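/- Graphs are connected, locally finite multigraphs (loops and parallel edges allowed). For a Polish space $\mathbb X$, let $\mathcal G_\bullet^{\mathbb X}$ (resp. $\mathcal G_{\bullet\bullet}^{\mathbb X}$) be the space of isomorphism classes of rooted (resp. doubly rooted) graphs whose vertices and edges carry marks in $\mathbb X$, with the local topology (two marked graphs are close if large balls around their roots are isomorphic, preserving the roots, by an isomorphism under which corresponding marks are close) and its Borel $\sigma$-algebra; write $\mathcal G_\bullet$ for the unmarked case. A random rooted marked graph $(G,\rho,m)$ is *unimodular* if $\mathbb E\sum_{v} f(G,\rho,v,m)=\mathbb E\sum_{v} f(G,v,\rho,m)$ for every Borel $f:\mathcal G_{\bullet\bullet}^{\mathbb X}\to[0,\infty]$. It is *sofic* if it is the limit in distribution, for the local topology, of a sequence of (possibly random) finite marked graphs rooted at a conditionally uniform vertex. An *$\mathbb X$-marking* of a unimodular random rooted graph $(G,\rho)$ is a random assignment $m$ of marks in $\mathbb X$ to the vertices and edges of $G$ such that $(G,\rho,m)$ is unimodular; $(G,\rho)$ is *strongly sofic* if $(G,\rho,m)$ is sofic for every Polish space $\mathbb X$ and every $\mathbb X$-marking $m$. A *percolation*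 on $(G,\rho)$ is a $\{0,1\}$-marking $\omega$ such that both endpoints of every open edge ($\omega(e)=1$) are open ($\omega(v)=1$); it is identified with the subgraph of open vertices and edges, and it is *connected* if almost surely the open vertices form exactly one cluster (in particular there is at least one open vertex). A *unimodular coupling* of unimodular random rooted graphs $(G_1,\rho_1)$ and $(G_2,\rho_2)$ is a unimodular random rooted $\{0,1\}^2$-marked graph $(G,\rho,\omega_1,\omega_2)$ such that, for $i=1,2$, $\omega_i$ is a connected percolation and the law of $(\omega_i,\rho)$ conditioned on $\omega_i(\rho)=1$ is the law of $(G_i,\rho_i)$; the two graphs are *coupling equivalent* if they admit a unimodular coupling. **Theorem.** 1. Let $(G_1,\rho_1)$ and $(G_2,\rho_2)$ be coupling equivalent unimodular random rooted graphs. Then $(G_1,\rho_1)$ is strongly sofic if and only if $(G_2,\rho_2)$ is strongly sofic. 2. Let $(G,\rho)$ be a unimodular random rooted graph, let $\omega$ be a connected percolation on $(G,\rho)$, and let $(H,\rho')$ be the random rooted graph whose law is that of $(\omega,\rho)$ conditioned on $\omega(\rho)=1$. Then $(G,\rho)$ is strongly sofic if and only if $(H,\rho')$ is strongly sofic. -/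

import Mathlib

open MeasureTheory Filter Topology
open scoped ENNReal

noncomputable section

namespace UnimodularGraph

/-! ### Locally finite connected marked multigraphs -/

/-- An isomorphism of multigraphs: a bijection of the vertices and a bijection of the edges that
respect incidence (loops and parallel edges are allowed). -/
structure GraphIso (G H : Graph ℕ ℕ) where
  toVert : G.vertexSet ≃ H.vertexSet
  toEdge : G.edgeSet ≃ H.edgeSet
  isLink_iff : ∀ (e : G.edgeSet) (x y : G.vertexSet),
    H.IsLink (toEdge e) (toVert x) (toVert y) ↔ G.IsLink e x y

/-- The vertices at graph distance at most `R` from `ρ`. -/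
def ballSet (G : Graph ℕ ℕ) (ρ : ℕ) : ℕ → Set ℕ
  | 0 => {ρ}
  | R + 1 => ballSet G ρ R ∪ {y | ∃ x ∈ ballSet G ρ R, G.Adj x y}

theorem mem_ballSet (G : Graph ℕ ℕ) (ρ : ℕ) : ∀ R, ρ ∈ ballSet G ρ R
  | 0 => rfl
  | R + 1 => Or.inl (mem_ballSet G ρ R)

/-- The ball `B_R(G, ρ)`, as the subgraph induced by the vertices at distance at most `R`. -/
def ball (G : Graph ℕ ℕ) (ρ R : ℕ) : Graph ℕ ℕ := G.induce (ballSet G ρ R)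

/-- A connected, locally finite (multi)graph with a mark in `X` on each vertex and each edge.
Connected locally finite graphs are countable, so vertices and edges may be labelled by natural
numbers; the values of `vmark` and `emark` outside the vertex set and the edge set are irrelevant
(they are ignored by all isomorphisms below). -/
structure MarkedGraph (X : Type) where
  graph : Graph ℕ ℕ
  vmark : ℕ → X
  emark : ℕ → X
  locallyFinite : ∀ v ∈ graph.vertexSet, {e | graph.Inc e v}.Finite
  connected : ∀ v ∈ graph.vertexSet, ∀ w ∈ graph.vertexSet,
    Relation.ReflTransGen graph.Adj v w

/-- A marked graph with a root. -/
structure RootedGraph (X : Type) extends MarkedGraph X where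
  root : ℕ
  root_mem : root ∈ graph.vertexSet

/-- A marked graph with an ordered pair of (not necessarily distinct) roots. -/
structure BirootedGraph (X : Type) extends MarkedGraph X where
  root₁ : ℕ
  root₂ : ℕ
  root₁_mem : root₁ ∈ graph.vertexSet
  root₂_mem : root₂ ∈ graph.vertexSet

/-- The same marked graph with another root. -/
def RootedGraph.reroot {X : Type} (N : RootedGraph X) (v : N.graph.vertexSet) : RootedGraph X :=
  { toMarkedGraph := N.toMarkedGraph, root := v, root_mem := v.2 }

/-- The birooted graph `(G, u, v, m)`. -/
def MarkedGraph.biroot {X : Type} (N : MarkedGraph X) (u v : N.graph.vertexSet) :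
    BirootedGraph X :=
  { toMarkedGraph := N, root₁ := u, root₂ := v, root₁_mem := u.2, root₂_mem := v.2 }

/-- The isomorphism `φ` preserves all marks. -/
def PreservesMarks {X : Type} (M N : MarkedGraph X) (φ : GraphIso M.graph N.graph) : Prop :=
  (∀ x : M.graph.vertexSet, N.vmark (φ.toVert x) = M.vmark x) ∧
    ∀ e : M.graph.edgeSet, N.emark (φ.toEdge e) = M.emark e

/-- Isomorphism of rooted marked graphs. -/
def RootedGraph.Equivalent {X : Type} (M N : RootedGraph X) : Prop :=
  ∃ φ : GraphIso M.graph N.graph, PreservesMarks M.toMarkedGraph N.toMarkedGraph φ ∧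
    φ.toVert ⟨M.root, M.root_mem⟩ = ⟨N.root, N.root_mem⟩

/-- Isomorphism of birooted marked graphs. -/
def BirootedGraph.Equivalent {X : Type} (M N : BirootedGraph X) : Prop :=
  ∃ φ : GraphIso M.graph N.graph, PreservesMarks M.toMarkedGraph N.toMarkedGraph φ ∧
    φ.toVert ⟨M.root₁, M.root₁_mem⟩ = ⟨N.root₁, N.root₁_mem⟩ ∧
    φ.toVert ⟨M.root₂, M.root₂_mem⟩ = ⟨N.root₂, N.root₂_mem⟩

def GraphIso.refl (G : Graph ℕ ℕ) : GraphIso G G := ⟨Equiv.refl _, Equiv.refl _, by simp⟩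

def GraphIso.symm {G H : Graph ℕ ℕ} (φ : GraphIso G H) : GraphIso H G :=
  ⟨φ.toVert.symm, φ.toEdge.symm, fun e x y => by
    simpa using (φ.isLink_iff (φ.toEdge.symm e) (φ.toVert.symm x) (φ.toVert.symm y)).symm⟩

def GraphIso.trans {G H K : Graph ℕ ℕ} (φ : GraphIso G H) (ψ : GraphIso H K) : GraphIso G K :=
  ⟨φ.toVert.trans ψ.toVert, φ.toEdge.trans ψ.toEdge, fun e x y =>
    (ψ.isLink_iff _ _ _).trans (φ.isLink_iff e x y)⟩

theorem PreservesMarks.refl {X : Type} (M : MarkedGraph X) :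
    PreservesMarks M M (GraphIso.refl M.graph) := ⟨fun _ => rfl, fun _ => rfl⟩

theorem PreservesMarks.symm {X : Type} {M N : MarkedGraph X} {φ : GraphIso M.graph N.graph}
    (h : PreservesMarks M N φ) : PreservesMarks N M φ.symm :=
  ⟨fun x => by simpa [GraphIso.symm] using (h.1 (φ.toVert.symm x)).symm,
    fun e => by simpa [GraphIso.symm] using (h.2 (φ.toEdge.symm e)).symm⟩

theorem PreservesMarks.trans {X : Type} {M N K : MarkedGraph X} {φ : GraphIso M.graph N.graph}
    {ψ : GraphIso N.graph K.graph} (h : PreservesMarks M N φ) (h' : PreservesMarks N K ψ) :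
    PreservesMarks M K (φ.trans ψ) :=
  ⟨fun x => (h'.1 _).trans (h.1 x), fun e => (h'.2 _).trans (h.2 e)⟩

instance rootedSetoid (X : Type) : Setoid (RootedGraph X) where
  r := RootedGraph.Equivalent
  iseqv :=
    { refl := fun _ => ⟨GraphIso.refl _, PreservesMarks.refl _, rfl⟩
      symm := fun ⟨φ, h, hr⟩ => ⟨φ.symm, h.symm, φ.toVert.symm_apply_eq.2 hr.symm⟩
      trans := fun ⟨φ, h, hr⟩ ⟨ψ, h', hr'⟩ =>
        ⟨φ.trans ψ, h.trans h', (congrArg ψ.toVert hr).trans hr'⟩ }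

instance birootedSetoid (X : Type) : Setoid (BirootedGraph X) where
  r := BirootedGraph.Equivalent
  iseqv :=
    { refl := fun _ => ⟨GraphIso.refl _, PreservesMarks.refl _, rfl, rfl⟩
      symm := fun ⟨φ, h, hr, hs⟩ => ⟨φ.symm, h.symm, φ.toVert.symm_apply_eq.2 hr.symm,
        φ.toVert.symm_apply_eq.2 hs.symm⟩
      trans := fun ⟨φ, h, hr, hs⟩ ⟨ψ, h', hr', hs'⟩ =>
        ⟨φ.trans ψ, h.trans h', (congrArg ψ.toVert hr).trans hr',
          (congrArg ψ.toVert hs).trans hs'⟩ }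

/-- The space of isomorphism classes of rooted graphs with marks in `X`. -/
def RootedSpace (X : Type) : Type := Quotient (rootedSetoid X)

/-- The space of isomorphism classes of doubly rooted graphs with marks in `X`. -/
def BirootedSpace (X : Type) : Type := Quotient (birootedSetoid X)

/-- Unmarked rooted graphs, as rooted graphs with the one-point mark space. -/
abbrev UnmarkedSpace : Type := RootedSpace Unit

def RootedGraph.cls {X : Type} (N : RootedGraph X) : RootedSpace X := Quotient.mk _ N

def BirootedGraph.cls {X : Type} (N : BirootedGraph X) : BirootedSpace X := Quotient.mk _ N

/-! ### The local topology -/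

/-- The marks of `N` at the image under `φ` of a vertex `x` (an edge `e`) of the ball of `M` lie in
`U x` (in `W e`). -/
def MarksWithin {X : Type} {B C : Graph ℕ ℕ} (N : MarkedGraph X) (φ : GraphIso B C)
    (U W : ℕ → Set X) : Prop :=
  (∀ x : B.vertexSet, N.vmark (φ.toVert x) ∈ U x) ∧
    ∀ e : B.edgeSet, N.emark (φ.toEdge e) ∈ W e

/-- The rooted marked graphs whose ball of radius `R` is isomorphic, as a rooted graph, to that of
`M`, the mark of the vertex (edge) corresponding to `x` being in `U x` (in `W x`). -/
def cylinder {X : Type} (M : RootedGraph X) (R : ℕ) (U W : ℕ → Set X) : Set (RootedSpace X) :=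
  {q | ∃ N : RootedGraph X, N.cls = q ∧
    ∃ φ : GraphIso (ball M.graph M.root R) (ball N.graph N.root R),
      MarksWithin N.toMarkedGraph φ U W ∧
      (φ.toVert ⟨M.root, mem_ballSet _ _ R⟩ : ℕ) = N.root}

/-- The analogue of `cylinder` for doubly rooted graphs: the ball is centred at the first root and
contains the second root. -/
def bicylinder {X : Type} (M : BirootedGraph X) (R : ℕ) (U W : ℕ → Set X) :
    Set (BirootedSpace X) :=
  {q | ∃ N : BirootedGraph X, N.cls = q ∧
    ∃ φ : GraphIso (ball M.graph M.root₁ R) (ball N.graph N.root₁ R),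
      MarksWithin N.toMarkedGraph φ U W ∧
      (φ.toVert ⟨M.root₁, mem_ballSet _ _ R⟩ : ℕ) = N.root₁ ∧
      ∃ h : M.root₂ ∈ ballSet M.graph M.root₁ R, (φ.toVert ⟨M.root₂, h⟩ : ℕ) = N.root₂}

/-- The local topology: two graphs are close if large balls around the roots are isomorphic by an
isomorphism under which the marks in the ball (finitely many) are close. -/
instance {X : Type} [TopologicalSpace X] : TopologicalSpace (RootedSpace X) :=
  TopologicalSpace.generateFrom
    {A | ∃ M R U W, (∀ n, IsOpen (U n)) ∧ (∀ n, IsOpen (W n)) ∧ A = cylinder M R U W}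

instance {X : Type} [TopologicalSpace X] : TopologicalSpace (BirootedSpace X) :=
  TopologicalSpace.generateFrom
    {A | ∃ M R U W, (∀ n, IsOpen (U n)) ∧ (∀ n, IsOpen (W n)) ∧ A = bicylinder M R U W}

instance {X : Type} [TopologicalSpace X] : MeasurableSpace (RootedSpace X) := borel _

instance {X : Type} [TopologicalSpace X] : BorelSpace (RootedSpace X) := ⟨rfl⟩

instance {X : Type} [TopologicalSpace X] : MeasurableSpace (BirootedSpace X) := borel _

instance {X : Type} [TopologicalSpace X] : BorelSpace (BirootedSpace X) := ⟨rfl⟩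

/-! ### Unimodularity -/

/-- `∑_v f(G, ρ, v, m)`: the mass sent by the root. -/
def massOut {X : Type} (f : BirootedSpace X → ℝ≥0∞) : RootedSpace X → ℝ≥0∞ :=
  Quotient.lift
    (fun N : RootedGraph X =>
      ∑' v : N.graph.vertexSet, f (N.biroot ⟨N.root, N.root_mem⟩ v).cls) <| by
    rintro M N ⟨φ, h, hr⟩
    refine Eq.trans (tsum_congr fun v => congrArg f ?_)
      (φ.toVert.tsum_eq fun v => f (N.biroot ⟨N.root, N.root_mem⟩ v).cls)
    exact Quotient.sound ⟨φ, h, hr, rfl⟩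

/-- `∑_u f(G, u, ρ, m)`: the mass received by the root. -/
def massIn {X : Type} (f : BirootedSpace X → ℝ≥0∞) : RootedSpace X → ℝ≥0∞ :=
  Quotient.lift
    (fun N : RootedGraph X =>
      ∑' u : N.graph.vertexSet, f (N.biroot u ⟨N.root, N.root_mem⟩).cls) <| by
    rintro M N ⟨φ, h, hr⟩
    refine Eq.trans (tsum_congr fun v => congrArg f ?_)
      (φ.toVert.tsum_eq fun v => f (N.biroot v ⟨N.root, N.root_mem⟩).cls)
    exact Quotient.sound ⟨φ, h, rfl, hr⟩

/-- The mass transport principle for the law `P` of a random rooted marked graph. -/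
def Unimodular {X : Type} [TopologicalSpace X] (P : ProbabilityMeasure (RootedSpace X)) : Prop :=
  ∀ f : BirootedSpace X → ℝ≥0∞, Measurable f →
    ∫⁻ q, massOut f q ∂(P : Measure (RootedSpace X)) =
      ∫⁻ q, massIn f q ∂(P : Measure (RootedSpace X))

/-! ### Soficity -/

/-- The graph is finite (a locally finite graph with finitely many vertices has finitely many
edges). -/
def IsFiniteGraph {X : Type} (q : RootedSpace X) : Prop :=
  ∃ N : RootedGraph X, N.cls = q ∧ N.graph.vertexSet.Finite

/-- For a finite graph `G` with `N` vertices: the probability `#{v : (G, v, m) ∈ A} / N` that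
`(G, v, m)` lies in `A` when `v` is a uniform vertex of `G`. -/
def rerootProb {X : Type} (A : Set (RootedSpace X)) : RootedSpace X → ℝ≥0∞ :=
  Quotient.lift
    (fun N : RootedGraph X =>
      (∑' v : N.graph.vertexSet, A.indicator 1 (N.reroot v).cls) /
        (ENat.card N.graph.vertexSet : ℝ≥0∞)) <| by
    rintro M N ⟨φ, h, hr⟩
    refine congrArg₂ (· / ·) ?_ (by rw [ENat.card_congr φ.toVert])
    refine Eq.trans (tsum_congr fun v => congrArg (A.indicator 1) ?_)
      (φ.toVert.tsum_eq fun v => A.indicator 1 (N.reroot v).cls)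
    exact Quotient.sound ⟨φ, h, rfl⟩

/-- `P` is the law of a (possibly random) finite marked graph with a conditionally uniform root:
the graph is almost surely finite and resampling the root uniformly does not change the law. -/
def IsUniformlyRootedFinite {X : Type} [TopologicalSpace X]
    (P : ProbabilityMeasure (RootedSpace X)) : Prop :=
  (∀ᵐ q ∂(P : Measure (RootedSpace X)), IsFiniteGraph q) ∧
    ∀ A : Set (RootedSpace X), MeasurableSet A →
      (P : Measure (RootedSpace X)) A = ∫⁻ q, rerootProb A q ∂(P : Measure (RootedSpace X))

/-- `P` is a Benjamini-Schramm limit: a limit in distribution, for the local topology, of finite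
marked graphs with uniform roots. -/
def Sofic {X : Type} [TopologicalSpace X] (P : ProbabilityMeasure (RootedSpace X)) : Prop :=
  ∃ F : ℕ → ProbabilityMeasure (RootedSpace X),
    (∀ n, IsUniformlyRootedFinite (F n)) ∧ Tendsto F atTop (𝓝 P)

/-- Apply a function to all marks. -/
def RootedGraph.mapMarks {X Y : Type} (g : X → Y) (N : RootedGraph X) : RootedGraph Y :=
  { graph := N.graph
    vmark := fun v => g (N.vmark v)
    emark := fun e => g (N.emark e)
    locallyFinite := N.locallyFinite
    connected := N.connected
    root := N.root
    root_mem := N.root_mem }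

def mapMarks {X Y : Type} (g : X → Y) : RootedSpace X → RootedSpace Y :=
  Quotient.map (RootedGraph.mapMarks g) <| by
    rintro M N ⟨φ, h, hr⟩
    exact ⟨φ, ⟨fun x => congrArg g (h.1 x), fun e => congrArg g (h.2 e)⟩, hr⟩

/-- Forget the marks. -/
def forget {X : Type} : RootedSpace X → UnmarkedSpace := mapMarks fun _ => ()

/-- `Q` is the law of `(G, ρ, m)` for some `X`-marking `m` of the random rooted graph `(G, ρ)` with
law `P`: the marked graph is unimodular and its underlying rooted graph has law `P`. -/
def IsMarkingOf {X : Type} [TopologicalSpace X] (Q : ProbabilityMeasure (RootedSpace X))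
    (P : ProbabilityMeasure UnmarkedSpace) : Prop :=
  Unimodular Q ∧ (Q : Measure (RootedSpace X)).map forget = (P : Measure UnmarkedSpace)

/-- Every marking by a Polish mark space is sofic. (Every Polish space is homeomorphic to one whose
underlying type lives in `Type`.) -/
def StronglySofic (P : ProbabilityMeasure UnmarkedSpace) : Prop :=
  ∀ (X : Type) [TopologicalSpace X] [PolishSpace X] (Q : ProbabilityMeasure (RootedSpace X)),
    IsMarkingOf Q P → Sofic Q

/-! ### Percolations and couplings -/

/-- The subgraph of open vertices and of open edges (an edge with a closed endpoint is never
counted as open). -/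
def openSubgraph (N : MarkedGraph Bool) : Graph ℕ ℕ :=
  (N.graph.restrict {e | N.emark e = true}).induce
    {v | v ∈ N.graph.vertexSet ∧ N.vmark v = true}

/-- `ω` is a percolation configuration (the endpoints of an open edge are open) whose open vertices
form exactly one cluster; in particular there is an open vertex. -/
def IsConnectedConfig (N : MarkedGraph Bool) : Prop :=
  (∀ e v, N.graph.Inc e v → N.emark e = true → N.vmark v = true) ∧
    (openSubgraph N).vertexSet.Nonempty ∧
    ∀ v ∈ (openSubgraph N).vertexSet, ∀ w ∈ (openSubgraph N).vertexSet,
      Relation.ReflTransGen (openSubgraph N).Adj v w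

/-- The percolation `ω` with law `Q` of `(G, ρ, ω)` is almost surely connected. -/
def AlmostSurelyConnected (Q : Measure (RootedSpace Bool)) : Prop :=
  ∀ᵐ q ∂Q, ∃ N : RootedGraph Bool, N.cls = q ∧ IsConnectedConfig N.toMarkedGraph

/-- The event `ω(ρ) = 1`. -/
def rootOpen : Set (RootedSpace Bool) :=
  {q | ∃ N : RootedGraph Bool, N.cls = q ∧ N.vmark N.root = true}

/-- The vertices of the open cluster of the root (only the root itself if it is closed). -/
def clusterSet (N : RootedGraph Bool) : Set ℕ :=
  {v | Relation.ReflTransGen (openSubgraph N.toMarkedGraph).Adj N.root v}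

theorem clusterSet_subset {N : RootedGraph Bool} {v : ℕ} (hv : v ∈ clusterSet N) :
    v ∈ N.graph.vertexSet := by
  cases hv with
  | refl => exact N.root_mem
  | tail _ hbc => exact hbc.choose_spec.2.2.1

/-- The open cluster of the root, rooted at the root. -/
def RootedGraph.cluster (N : RootedGraph Bool) : RootedGraph Unit where
  graph := (openSubgraph N.toMarkedGraph).induce (clusterSet N)
  vmark := fun _ => ()
  emark := fun _ => ()
  locallyFinite := fun v hv =>
    (N.locallyFinite v (clusterSet_subset hv)).subset fun _ ⟨w, hw⟩ => ⟨w, hw.1.1.2⟩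
  connected := by
    have key : ∀ v ∈ clusterSet N, Relation.ReflTransGen
        ((openSubgraph N.toMarkedGraph).induce (clusterSet N)).Adj N.root v := by
      intro v hv
      induction hv with
      | refl => exact .refl
      | tail hb hbc ih =>
        obtain ⟨e, he⟩ := hbc
        exact ih.tail ⟨e, he, hb, hb.tail ⟨e, he⟩⟩
    have : Std.Symm ((openSubgraph N.toMarkedGraph).induce (clusterSet N)).Adj :=
      ⟨fun _ _ h => h.symm⟩
    intro v hv w hw
    exact (Relation.ReflTransGen.stdSymm.symm _ _ (key v hv)).trans (key w hw)
  root := N.root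
  root_mem := Relation.ReflTransGen.refl

theorem openSubgraph_isLink_map {M N : MarkedGraph Bool} {φ : GraphIso M.graph N.graph}
    (h : PreservesMarks M N φ) {e : M.graph.edgeSet} {x y : M.graph.vertexSet}
    (hl : (openSubgraph M).IsLink e x y) :
    (openSubgraph N).IsLink (φ.toEdge e) (φ.toVert x) (φ.toVert y) :=
  ⟨⟨(h.2 e).trans hl.1.1, (φ.isLink_iff e x y).2 hl.1.2⟩,
    ⟨(φ.toVert x).2, (h.1 x).trans hl.2.1.2⟩, ⟨(φ.toVert y).2, (h.1 y).trans hl.2.2.2⟩⟩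

theorem clusterSet_map {M N : RootedGraph Bool} {φ : GraphIso M.graph N.graph}
    (h : PreservesMarks M.toMarkedGraph N.toMarkedGraph φ)
    (hr : φ.toVert ⟨M.root, M.root_mem⟩ = ⟨N.root, N.root_mem⟩) {v : ℕ} (hv : v ∈ clusterSet M) :
    (φ.toVert ⟨v, clusterSet_subset hv⟩ : ℕ) ∈ clusterSet N := by
  induction hv with
  | refl => rw [hr]; exact .refl
  | @tail b c hb hbc ih =>
    obtain ⟨e, he⟩ := hbc
    exact ih.tail ⟨_, openSubgraph_isLink_map h (e := ⟨e, he.1.2.edge_mem⟩)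
      (x := ⟨b, clusterSet_subset hb⟩) (y := ⟨c, he.2.2.1⟩) he⟩

theorem cluster_edge_mem {N : RootedGraph Bool} {e : ℕ} (he : e ∈ N.cluster.graph.edgeSet) :
    e ∈ N.graph.edgeSet := by
  obtain ⟨x, y, hl⟩ := he
  exact hl.1.1.2.edge_mem

theorem cluster_isLink_map {M N : RootedGraph Bool} {φ : GraphIso M.graph N.graph}
    (h : PreservesMarks M.toMarkedGraph N.toMarkedGraph φ)
    (hr : φ.toVert ⟨M.root, M.root_mem⟩ = ⟨N.root, N.root_mem⟩) {e : M.graph.edgeSet}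
    {x y : M.graph.vertexSet} (hl : M.cluster.graph.IsLink e x y) :
    N.cluster.graph.IsLink (φ.toEdge e) (φ.toVert x) (φ.toVert y) :=
  ⟨openSubgraph_isLink_map h hl.1, clusterSet_map h hr hl.2.1, clusterSet_map h hr hl.2.2⟩

theorem cluster_edge_map {M N : RootedGraph Bool} {φ : GraphIso M.graph N.graph}
    (h : PreservesMarks M.toMarkedGraph N.toMarkedGraph φ)
    (hr : φ.toVert ⟨M.root, M.root_mem⟩ = ⟨N.root, N.root_mem⟩) {e : ℕ}
    (he : e ∈ M.cluster.graph.edgeSet) :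
    (φ.toEdge ⟨e, cluster_edge_mem he⟩ : ℕ) ∈ N.cluster.graph.edgeSet := by
  obtain ⟨x, y, hl⟩ := id he
  exact ⟨_, _, cluster_isLink_map h hr (e := ⟨e, cluster_edge_mem he⟩)
    (x := ⟨x, clusterSet_subset hl.2.1⟩) (y := ⟨y, clusterSet_subset hl.2.2⟩) hl⟩

/-- The isomorphism of root clusters induced by an isomorphism of rooted percolations. -/
def clusterIso {M N : RootedGraph Bool} {φ : GraphIso M.graph N.graph}
    (h : PreservesMarks M.toMarkedGraph N.toMarkedGraph φ)
    (hr : φ.toVert ⟨M.root, M.root_mem⟩ = ⟨N.root, N.root_mem⟩) :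
    GraphIso M.cluster.graph N.cluster.graph where
  toVert :=
    { toFun := fun x => ⟨φ.toVert ⟨x, clusterSet_subset x.2⟩, clusterSet_map h hr x.2⟩
      invFun := fun x => ⟨φ.symm.toVert ⟨x, clusterSet_subset x.2⟩,
        clusterSet_map h.symm (φ.toVert.symm_apply_eq.2 hr.symm) x.2⟩
      left_inv := fun x => by simp [GraphIso.symm]
      right_inv := fun x => by simp [GraphIso.symm] }
  toEdge :=
    { toFun := fun e => ⟨φ.toEdge ⟨e, cluster_edge_mem e.2⟩, cluster_edge_map h hr e.2⟩
      invFun := fun e => ⟨φ.symm.toEdge ⟨e, cluster_edge_mem e.2⟩,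
        cluster_edge_map h.symm (φ.toVert.symm_apply_eq.2 hr.symm) e.2⟩
      left_inv := fun e => by simp [GraphIso.symm]
      right_inv := fun e => by simp [GraphIso.symm] }
  isLink_iff := fun e x y => by
    refine ⟨fun hl => ?_, fun hl => cluster_isLink_map h hr
      (e := ⟨e, cluster_edge_mem e.2⟩) (x := ⟨x, clusterSet_subset x.2⟩)
      (y := ⟨y, clusterSet_subset y.2⟩) hl⟩
    have := cluster_isLink_map h.symm (φ.toVert.symm_apply_eq.2 hr.symm)
      (e := φ.toEdge ⟨e, cluster_edge_mem e.2⟩) (x := φ.toVert ⟨x, clusterSet_subset x.2⟩)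
      (y := φ.toVert ⟨y, clusterSet_subset y.2⟩) hl
    simpa [GraphIso.symm] using this

def cluster : RootedSpace Bool → UnmarkedSpace :=
  Quotient.map RootedGraph.cluster <| by
    rintro M N ⟨φ, h, hr⟩
    exact ⟨clusterIso h hr, ⟨fun _ => rfl, fun _ => rfl⟩,
      Subtype.ext (have hv := congrArg Subtype.val hr; hv)⟩

/-- The law of the rooted graph `(ω, ρ)` conditioned on `ω(ρ) = 1`, when `(G, ρ, ω)` has law `Q`. -/
def percolationLaw (Q : Measure (RootedSpace Bool)) : Measure UnmarkedSpace :=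
  (ProbabilityTheory.cond Q rootOpen).map cluster

/-- `Q` is the law of `(G, ρ, ω)` for an almost surely connected percolation `ω` on the random
rooted graph `(G, ρ)` with law `P`. -/
def IsConnectedPercolationOn (Q : ProbabilityMeasure (RootedSpace Bool))
    (P : ProbabilityMeasure UnmarkedSpace) : Prop :=
  IsMarkingOf Q P ∧ AlmostSurelyConnected (Q : Measure (RootedSpace Bool))

/-- `Q` is the law of a unimodular coupling `(G, ρ, ω₁, ω₂)` of the random rooted graphs with laws
`P₁` and `P₂`. -/
def IsUnimodularCoupling (Q : ProbabilityMeasure (RootedSpace (Bool × Bool)))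
    (P₁ P₂ : ProbabilityMeasure UnmarkedSpace) : Prop :=
  Unimodular Q ∧
    AlmostSurelyConnected ((Q : Measure (RootedSpace (Bool × Bool))).map (mapMarks Prod.fst)) ∧
    AlmostSurelyConnected ((Q : Measure (RootedSpace (Bool × Bool))).map (mapMarks Prod.snd)) ∧
    percolationLaw ((Q : Measure (RootedSpace (Bool × Bool))).map (mapMarks Prod.fst)) =
      (P₁ : Measure UnmarkedSpace) ∧
    percolationLaw ((Q : Measure (RootedSpace (Bool × Bool))).map (mapMarks Prod.snd)) =
      (P₂ : Measure UnmarkedSpace)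

/-- The laws of two unimodular random rooted graphs are coupling equivalent. -/
def CouplingEquivalent (P₁ P₂ : ProbabilityMeasure UnmarkedSpace) : Prop :=
  ∃ Q : ProbabilityMeasure (RootedSpace (Bool × Bool)), IsUnimodularCoupling Q P₁ P₂

end UnimodularGraph

end

open MeasureTheory Filter Topology
open scoped ENNReal

noncomputable section

namespace UnimodularGraph

open Set ProbabilityTheory

set_option linter.unusedSectionVars false

section

/-! ### Isomorphisms given by functions on labels -/

/-! Part 1 is part 2 used twice. In a unimodular coupling, $\omega_1$ and $\omega_2$ are connected
percolations on one and the same unimodular graph $G$, so the strong soficity of each $G_i$ is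
equivalent to that of $G$. For part 2, let $H$ be the open cluster of $\omega$ in $G$. Two general
principles carry both directions.

Local transformations preserve soficity. The space of classes is separable and metrizable, so
soficity is a closed condition (`sofic_of_tendsto`), and a law of finite graphs is uniformly rooted
exactly when it satisfies mass transport (`isUniformlyRootedFinite_iff`). A construction that
replaces every vertex by a bounded number of descendants, equivariantly and continuously in the
local topology, can be applied to finite approximations; after normalisation the result is again
sofic (`Transform.sofic_tr`). The two instances are the open cluster of the root (`clusterT`) and a
truncated blow-up (`blowupT`).

Marks can be resampled. Independent atomless labels are almost surely distinct, so every vertex and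
edge acquires addresses as seen from the root, and a marking becomes a sequence with a regular
conditional law given the labelled graph (`exists_rootEquivariant_addLaw_eq`). Mass transport forces
this law not to depend on the root (`ae_map_enum_eq`). Hence any marking is, in the presence of
labels, given by a kernel that is equivariant under all isomorphisms
(`exists_equivariant_labelled`). Such a kernel may be used on any graph with the same labelled law,
whatever its other marks, and it preserves unimodularity (`Uni.addLaw`).

From $G$ to $H$: given a marking of $H$, its kernel is applied to the labelled open cluster inside
$G$, with constant marks elsewhere. This is a marking of $G$, hence sofic, and `clusterT` turns it
into the given marking of $H$.

From $H$ to $G$: given a marking of $G$, resampling puts it on one graph together with $\omega$ and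
the labels. Every vertex and edge of $G$ is assigned to the open vertex with least address. Each
open vertex records the marks of its objects and how its edges attach, naming the owners of their
ends by addresses inside the cluster. This is a marking of $H$ by the Polish space `Recipe X`, hence
sofic. The blow-up that reads the recipes with all indices less than $K$ rebuilds part of $G$ and
stays sofic. Letting owners send mass to their vertices (`lintegral_blowup_encodedCluster`), the
$K$-th blow-up law integrates a function at the piece of $G$ that contains the root, provided the
name of the root is less than $K$. As $K\to\infty$ these pieces exhaust $G$
(`tendsto_blowup_encode`), and dominated convergence exhibits the given marking as a limit of sofic
laws. -/

/-- `f` and `g` restrict to an isomorphism of multigraphs. -/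
structure IsIso (G H : Graph ℕ ℕ) (f g : ℕ → ℕ) : Prop where
  vert : BijOn f G.vertexSet H.vertexSet
  edge : BijOn g G.edgeSet H.edgeSet
  link : ∀ {e x y}, G.IsLink e x y → H.IsLink (g e) (f x) (f y)

/-- The ends of an edge are determined up to order, so a bijection of vertices and edges that
preserves links also reflects them. This is why `IsIso` asks for one direction only. -/
theorem IsIso.link_iff {G H : Graph ℕ ℕ} {f g : ℕ → ℕ} (h : IsIso G H f g) {e x y : ℕ}
    (he : e ∈ G.edgeSet) (hx : x ∈ G.vertexSet) (hy : y ∈ G.vertexSet) :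
    H.IsLink (g e) (f x) (f y) ↔ G.IsLink e x y := by
  refine ⟨fun hl => ?_, h.link⟩
  obtain ⟨a, b, hab⟩ := G.exists_isLink_of_mem_edgeSet he
  rcases (h.link hab).eq_and_eq_or_eq_and_eq hl with ⟨h1, h2⟩ | ⟨h1, h2⟩
  · rwa [← h.vert.injOn hab.left_mem hx h1, ← h.vert.injOn hab.right_mem hy h2]
  · rw [← h.vert.injOn hab.left_mem hy h1, ← h.vert.injOn hab.right_mem hx h2]
    exact hab.symm

theorem IsIso.id (G : Graph ℕ ℕ) : IsIso G G id id :=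
  ⟨bijOn_id _, bijOn_id _, fun h => h⟩

theorem IsIso.comp {G H K : Graph ℕ ℕ} {f g f' g' : ℕ → ℕ} (h' : IsIso H K f' g')
    (h : IsIso G H f g) : IsIso G K (f' ∘ f) (g' ∘ g) :=
  ⟨h'.vert.comp h.vert, h'.edge.comp h.edge, fun hl => h'.link (h.link hl)⟩

theorem IsIso.congr {G H : Graph ℕ ℕ} {f g f' g' : ℕ → ℕ} (h : IsIso G H f g)
    (hf : EqOn f f' G.vertexSet) (hg : EqOn g g' G.edgeSet) : IsIso G H f' g' :=
  ⟨h.vert.congr hf, h.edge.congr hg, fun hl => by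
    rw [← hf hl.left_mem, ← hf hl.right_mem, ← hg hl.edge_mem]; exact h.link hl⟩

/-- A right inverse on labels of an isomorphism. -/
theorem IsIso.symm {G H : Graph ℕ ℕ} {f g : ℕ → ℕ} (h : IsIso G H f g) :
    IsIso H G (Function.invFunOn f G.vertexSet) (Function.invFunOn g G.edgeSet) := by
  have hv := h.vert.invOn_invFunOn
  have he := h.edge.invOn_invFunOn
  have hv' := BijOn.symm hv.symm h.vert
  have he' := BijOn.symm he.symm h.edge
  refine ⟨hv', he', fun {e x y} hl => ?_⟩
  rw [← h.link_iff (he'.mapsTo hl.edge_mem) (hv'.mapsTo hl.left_mem) (hv'.mapsTo hl.right_mem),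
    hv.2 hl.left_mem, hv.2 hl.right_mem, he.2 hl.edge_mem]
  exact hl

theorem IsIso.exists_link {G H : Graph ℕ ℕ} {f g : ℕ → ℕ} (h : IsIso G H f g) {e' x' y' : ℕ}
    (hl : H.IsLink e' x' y') :
    ∃ e x y, G.IsLink e x y ∧ g e = e' ∧ f x = x' ∧ f y = y' := by
  obtain ⟨e, he, rfl⟩ := h.edge.surjOn hl.edge_mem
  obtain ⟨x, hx, rfl⟩ := h.vert.surjOn hl.left_mem
  obtain ⟨y, hy, rfl⟩ := h.vert.surjOn hl.right_mem
  exact ⟨e, x, y, (h.link_iff he hx hy).1 hl, rfl, rfl, rfl⟩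

theorem IsIso.adj {G H : Graph ℕ ℕ} {f g : ℕ → ℕ} (h : IsIso G H f g) {x y : ℕ}
    (hl : G.Adj x y) : H.Adj (f x) (f y) := by
  obtain ⟨e, he⟩ := hl
  exact ⟨_, h.link he⟩

theorem IsIso.inc_iff {G H : Graph ℕ ℕ} {f g : ℕ → ℕ} (h : IsIso G H f g) {e x : ℕ}
    (he : e ∈ G.edgeSet) (hx : x ∈ G.vertexSet) : H.Inc (g e) (f x) ↔ G.Inc e x := by
  constructor
  · rintro ⟨y', hy'⟩
    obtain ⟨y, hy, rfl⟩ := h.vert.surjOn hy'.right_mem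
    exact ⟨y, (h.link_iff he hx hy).1 hy'⟩
  · rintro ⟨y, hy⟩
    exact ⟨_, h.link hy⟩

/-- The function on labels underlying an isomorphism. -/
theorem GraphIso.exists_isIso {G H : Graph ℕ ℕ} (φ : GraphIso G H) :
    ∃ f g, IsIso G H f g ∧ (∀ x : G.vertexSet, f x = (φ.toVert x : ℕ)) ∧
      ∀ e : G.edgeSet, g e = (φ.toEdge e : ℕ) := by
  classical
  have hf : ∀ x : G.vertexSet, (fun x => if h : x ∈ G.vertexSet then (φ.toVert ⟨x, h⟩ : ℕ) else 0)
      x = φ.toVert x := fun x => by simp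
  have hg : ∀ x : G.edgeSet, (fun x => if h : x ∈ G.edgeSet then (φ.toEdge ⟨x, h⟩ : ℕ) else 0)
      x = φ.toEdge x := fun x => by simp
  refine ⟨(fun x => if h : x ∈ G.vertexSet then (φ.toVert ⟨x, h⟩ : ℕ) else 0),
    (fun x => if h : x ∈ G.edgeSet then (φ.toEdge ⟨x, h⟩ : ℕ) else 0),
    ⟨⟨fun x hx => ?_, fun x hx y hy hxy => ?_, fun y hy => ?_⟩,
    ⟨fun x hx => ?_, fun x hx y hy hxy => ?_, fun y hy => ?_⟩, fun {e x y} hl => ?_⟩, hf, hg⟩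
  · rw [hf ⟨x, hx⟩]; exact (φ.toVert ⟨x, hx⟩).2
  · rw [hf ⟨x, hx⟩, hf ⟨y, hy⟩] at hxy
    simpa using φ.toVert.injective (Subtype.ext hxy)
  · obtain ⟨x, hx⟩ := φ.toVert.surjective ⟨y, hy⟩
    exact ⟨x, x.2, by rw [hf x, hx]⟩
  · rw [hg ⟨x, hx⟩]; exact (φ.toEdge ⟨x, hx⟩).2
  · rw [hg ⟨x, hx⟩, hg ⟨y, hy⟩] at hxy
    simpa using φ.toEdge.injective (Subtype.ext hxy)
  · obtain ⟨x, hx⟩ := φ.toEdge.surjective ⟨y, hy⟩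
    exact ⟨x, x.2, by rw [hg x, hx]⟩
  · simp only [hl.left_mem, hl.right_mem, hl.edge_mem, dif_pos]
    exact (φ.isLink_iff _ _ _).2 hl

theorem IsIso.exists_graphIso {G H : Graph ℕ ℕ} {f g : ℕ → ℕ} (h : IsIso G H f g) :
    ∃ φ : GraphIso G H, (∀ x : G.vertexSet, (φ.toVert x : ℕ) = f x) ∧
      ∀ e : G.edgeSet, (φ.toEdge e : ℕ) = g e :=
  ⟨⟨h.vert.equiv f, h.edge.equiv g, fun e x y => h.link_iff e.2 x.2 y.2⟩,
    fun _ => rfl, fun _ => rfl⟩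

/-! ### Balls -/

variable {G H : Graph ℕ ℕ} {f g : ℕ → ℕ} {ρ R x y e : ℕ}

@[simp] theorem ball_vertexSet : (ball G ρ R).vertexSet = ballSet G ρ R := rfl

@[simp] theorem ball_isLink :
    (ball G ρ R).IsLink e x y ↔ G.IsLink e x y ∧ x ∈ ballSet G ρ R ∧ y ∈ ballSet G ρ R := Iff.rfl

theorem mem_ballSet_succ : x ∈ ballSet G ρ (R + 1) ↔
    x ∈ ballSet G ρ R ∨ ∃ y ∈ ballSet G ρ R, G.Adj y x := Iff.rfl

theorem ballSet_mono (G : Graph ℕ ℕ) (ρ : ℕ) : Monotone (ballSet G ρ) :=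
  monotone_nat_of_le_succ fun _ _ h => Or.inl h

theorem ballSet_subset (hρ : ρ ∈ G.vertexSet) : ∀ R, ballSet G ρ R ⊆ G.vertexSet
  | 0 => by simpa [ballSet] using hρ
  | R + 1 => by
    rintro x (hx | ⟨y, -, hy⟩)
    · exact ballSet_subset hρ R hx
    · exact hy.right_mem

theorem exists_mem_ballSet_iff :
    (∃ R, x ∈ ballSet G ρ R) ↔ Relation.ReflTransGen G.Adj ρ x := by
  constructor
  · rintro ⟨R, hR⟩
    induction R generalizing x with
    | zero => rw [show x = ρ from hR]
    | succ R ih =>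
      rcases hR with h | ⟨y, hy, h⟩
      · exact ih h
      · exact (ih hy).tail h
  · intro h
    induction h with
    | refl => exact ⟨0, rfl⟩
    | tail _ h ih =>
      obtain ⟨R, hR⟩ := ih
      exact ⟨R + 1, Or.inr ⟨_, hR, h⟩⟩

theorem ballSet_finite (hG : ∀ v ∈ G.vertexSet, {e | G.Inc e v}.Finite) (hρ : ρ ∈ G.vertexSet) :
    ∀ R, (ballSet G ρ R).Finite
  | 0 => finite_singleton _
  | R + 1 => by
    refine (ballSet_finite hG hρ R).union ?_
    have : {y | ∃ x ∈ ballSet G ρ R, G.Adj x y} ⊆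
        ⋃ x ∈ ballSet G ρ R, ⋃ e ∈ {e | G.Inc e x}, {y | G.IsLink e x y} := by
      rintro y ⟨x, hx, e, he⟩
      simp only [mem_iUnion]
      exact ⟨x, hx, e, ⟨y, he⟩, he⟩
    refine Finite.subset ((ballSet_finite hG hρ R).biUnion fun x hx =>
      (hG x (ballSet_subset hρ R hx)).biUnion fun e _ => ?_) this
    exact Subsingleton.finite fun a ha b hb => ha.right_unique hb

theorem ball_edgeSet_finite (hG : ∀ v ∈ G.vertexSet, {e | G.Inc e v}.Finite)
    (hρ : ρ ∈ G.vertexSet) (R : ℕ) : (ball G ρ R).edgeSet.Finite := by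
  refine Finite.subset ((ballSet_finite hG hρ R).biUnion fun x hx =>
      (hG x (ballSet_subset hρ R hx))) ?_
  rintro e ⟨x, y, hl, hx, hy⟩
  simp only [mem_iUnion]
  exact ⟨x, hx, y, hl⟩

theorem IsIso.image_ballSet (h : IsIso G H f g) (hρ : ρ ∈ G.vertexSet) :
    ∀ R, f '' ballSet G ρ R = ballSet H (f ρ) R
  | 0 => by simp [ballSet]
  | R + 1 => by
    have ih := h.image_ballSet hρ R
    ext y
    constructor
    · rintro ⟨x, hx | ⟨z, hz, ha⟩, rfl⟩
      · exact Or.inl (ih ▸ mem_image_of_mem f hx)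
      · exact Or.inr ⟨f z, ih ▸ mem_image_of_mem f hz, h.adj ha⟩
    · rintro (hy | ⟨z, hz, e, hl⟩)
      · rw [← ih] at hy
        obtain ⟨x, hx, rfl⟩ := hy
        exact ⟨x, Or.inl hx, rfl⟩
      · rw [← ih] at hz
        obtain ⟨z, hz, rfl⟩ := hz
        obtain ⟨y, hy, rfl⟩ := h.vert.surjOn hl.right_mem
        obtain ⟨e, he, rfl⟩ := h.edge.surjOn hl.edge_mem
        exact ⟨y, Or.inr ⟨z, hz, e, (h.link_iff he (ballSet_subset hρ R hz) hy).1 hl⟩, rfl⟩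

theorem IsIso.mem_ballSet_iff (h : IsIso G H f g) (hρ : ρ ∈ G.vertexSet) (hx : x ∈ G.vertexSet) :
    f x ∈ ballSet H (f ρ) R ↔ x ∈ ballSet G ρ R := by
  rw [← h.image_ballSet hρ R]
  exact h.vert.injOn.mem_image_iff (ballSet_subset hρ R) hx

theorem IsIso.ball (h : IsIso G H f g) (hρ : ρ ∈ G.vertexSet) (R : ℕ) :
    IsIso (ball G ρ R) (ball H (f ρ) R) f g := by
  refine ⟨?_, ⟨?_, ?_, ?_⟩, ?_⟩
  · simp only [ball_vertexSet, ← h.image_ballSet hρ R]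
    exact (h.vert.injOn.mono (ballSet_subset hρ R)).bijOn_image
  · rintro e ⟨x, y, hl, hx, hy⟩
    exact ⟨f x, f y, h.link hl, h.image_ballSet hρ R ▸ mem_image_of_mem f hx,
      h.image_ballSet hρ R ▸ mem_image_of_mem f hy⟩
  · refine h.edge.injOn.mono ?_
    rintro e ⟨x, y, hl, hx, hy⟩
    exact hl.edge_mem
  · rintro e ⟨x, y, hl, hx, hy⟩
    obtain ⟨e, x, y, hl', rfl, rfl, rfl⟩ := h.exists_link hl
    rw [h.mem_ballSet_iff hρ hl'.left_mem] at hx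
    rw [h.mem_ballSet_iff hρ hl'.right_mem] at hy
    exact ⟨e, ⟨x, y, hl', hx, hy⟩, rfl⟩
  · rintro e x y ⟨hl, hx, hy⟩
    exact ⟨h.link hl, h.image_ballSet hρ R ▸ mem_image_of_mem f hx,
      h.image_ballSet hρ R ▸ mem_image_of_mem f hy⟩

/-- A path of length at most `S` from `ρ` never leaves the ball of radius `R ≥ S`, so these
distances are intrinsic to the ball. -/
theorem ballSet_ball {S : ℕ} (h : S ≤ R) : ballSet (ball G ρ R) ρ S = ballSet G ρ S := by
  induction S with
  | zero => rfl
  | succ S ih =>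
    have ih := ih (by omega)
    have hs : ballSet G ρ S ⊆ ballSet G ρ R := ballSet_mono G ρ (by omega)
    ext y
    rw [mem_ballSet_succ, mem_ballSet_succ, ih]
    refine or_congr_right ⟨?_, ?_⟩
    · rintro ⟨x, hx, e, hl⟩
      exact ⟨x, hx, e, hl.1⟩
    · rintro ⟨x, hx, e, hl⟩
      exact ⟨x, hx, e, hl, hs hx, ballSet_mono G ρ h (Or.inr ⟨x, hx, e, hl⟩)⟩

theorem graph_ext {G H : Graph ℕ ℕ} (hv : G.vertexSet = H.vertexSet)
    (hl : ∀ e x y, G.IsLink e x y ↔ H.IsLink e x y) : G = H := Graph.ext hv hl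

theorem ball_ball {S : ℕ} (h : S ≤ R) : ball (ball G ρ R) ρ S = ball G ρ S := by
  refine graph_ext (ballSet_ball h) fun e x y => ?_
  simp only [ball_isLink, ballSet_ball h]
  have hs : ballSet G ρ S ⊆ ballSet G ρ R := ballSet_mono G ρ h
  exact ⟨fun h => ⟨h.1.1, h.2⟩, fun h => ⟨⟨h.1, hs h.2.1, hs h.2.2⟩, h.2⟩⟩

/-! ### Marked isomorphisms -/

variable {X Y : Type}

/-- `f` and `g` restrict to a mark-preserving isomorphism. -/
structure MIso (M N : MarkedGraph X) (f g : ℕ → ℕ) : Prop extends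
    IsIso M.graph N.graph f g where
  vmark : ∀ v ∈ M.graph.vertexSet, N.vmark (f v) = M.vmark v
  emark : ∀ e ∈ M.graph.edgeSet, N.emark (g e) = M.emark e

theorem MIso.id (M : MarkedGraph X) : MIso M M id id :=
  ⟨IsIso.id _, fun _ _ => rfl, fun _ _ => rfl⟩

theorem MIso.symm {M N : MarkedGraph X} (h : MIso M N f g) :
    MIso N M (Function.invFunOn f M.graph.vertexSet) (Function.invFunOn g M.graph.edgeSet) := by
  refine ⟨h.toIsIso.symm, fun v hv => ?_, fun e he => ?_⟩
  · rw [← h.vmark _ (h.toIsIso.symm.vert.mapsTo hv), h.vert.invOn_invFunOn.2 hv]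
  · rw [← h.emark _ (h.toIsIso.symm.edge.mapsTo he), h.edge.invOn_invFunOn.2 he]

theorem MIso.comp {M N K : MarkedGraph X} {f' g' : ℕ → ℕ} (h' : MIso N K f' g')
    (h : MIso M N f g) : MIso M K (f' ∘ f) (g' ∘ g) :=
  ⟨h'.toIsIso.comp h.toIsIso,
    fun v hv => (h'.vmark _ (h.vert.mapsTo hv)).trans (h.vmark v hv),
    fun v hv => (h'.emark _ (h.edge.mapsTo hv)).trans (h.emark v hv)⟩

/-- Mediates between bijections of subtypes, as in the definitions, and functions on labels, as in
the proof. The values of `f` outside the vertex set are arbitrary, so `P` may depend only on those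
inside. -/
theorem exists_mIso_iff {M N : MarkedGraph X} {P : (ℕ → ℕ) → Prop}
    (hP : ∀ f f', EqOn f f' M.graph.vertexSet → P f → P f') :
    (∃ f g, MIso M N f g ∧ P f) ↔ ∃ φ : GraphIso M.graph N.graph, PreservesMarks M N φ ∧
      ∃ f : ℕ → ℕ, (∀ x : M.graph.vertexSet, f x = (φ.toVert x : ℕ)) ∧ P f := by
  constructor
  · rintro ⟨f, g, h, hf⟩
    obtain ⟨φ, h1, h2⟩ := h.toIsIso.exists_graphIso
    refine ⟨φ, ⟨fun x => ?_, fun e => ?_⟩, f, fun x => (h1 x).symm, hf⟩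
    · rw [h1, h.vmark x x.2]
    · rw [h2, h.emark e e.2]
  · rintro ⟨φ, hm, f, hf, hP'⟩
    obtain ⟨f', g, h, h1, h2⟩ := φ.exists_isIso
    refine ⟨f', g, ⟨h, fun v hv => ?_, fun e he => ?_⟩, hP f f' (fun x hx => ?_) hP'⟩
    · rw [h1 ⟨v, hv⟩, hm.1 ⟨v, hv⟩]
    · rw [h2 ⟨e, he⟩, hm.2 ⟨e, he⟩]
    · rw [h1 ⟨x, hx⟩, hf ⟨x, hx⟩]

theorem RootedGraph.cls_eq_iff {M N : RootedGraph X} :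
    M.cls = N.cls ↔ ∃ f g, MIso M.toMarkedGraph N.toMarkedGraph f g ∧ f M.root = N.root := by
  rw [exists_mIso_iff fun f f' h hf => by rw [← h M.root_mem]; exact hf]
  constructor
  · intro h
    obtain ⟨φ, hm, hr⟩ := Quotient.exact h
    obtain ⟨f, g, -, h1, -⟩ := φ.exists_isIso
    exact ⟨φ, hm, f, h1, by rw [h1 ⟨_, M.root_mem⟩, hr]⟩
  · rintro ⟨φ, hm, f, h1, hr⟩
    exact Quotient.sound ⟨φ, hm, Subtype.ext ((h1 ⟨_, M.root_mem⟩).symm.trans hr)⟩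

theorem BirootedGraph.cls_eq_iff {M N : BirootedGraph X} :
    M.cls = N.cls ↔ ∃ f g, MIso M.toMarkedGraph N.toMarkedGraph f g ∧
      f M.root₁ = N.root₁ ∧ f M.root₂ = N.root₂ := by
  rw [exists_mIso_iff fun f f' h hf => by
    rw [← h M.root₁_mem, ← h M.root₂_mem]; exact hf]
  constructor
  · intro h
    obtain ⟨φ, hm, hr, hs⟩ := Quotient.exact h
    obtain ⟨f, g, -, h1, -⟩ := φ.exists_isIso
    exact ⟨φ, hm, f, h1, by rw [h1 ⟨_, M.root₁_mem⟩, hr], by rw [h1 ⟨_, M.root₂_mem⟩, hs]⟩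
  · rintro ⟨φ, hm, f, h1, hr, hs⟩
    exact Quotient.sound ⟨φ, hm, Subtype.ext ((h1 ⟨_, M.root₁_mem⟩).symm.trans hr),
      Subtype.ext ((h1 ⟨_, M.root₂_mem⟩).symm.trans hs)⟩

theorem RootedGraph.exists_cls_eq (q : RootedSpace X) : ∃ N : RootedGraph X, N.cls = q :=
  Quotient.exists_rep q

theorem BirootedGraph.exists_cls_eq (q : BirootedSpace X) : ∃ N : BirootedGraph X, N.cls = q :=
  Quotient.exists_rep q

end

section

variable {X Y : Type}

/-! ### Relabelling -/

/-- The permutations of the natural numbers act highly transitively. Extending finite partial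
isomorphisms to permutations of labels lets isomorphic balls be replaced by literally equal ones. -/
theorem exists_perm_eqOn {s : Set ℕ} (hs : s.Finite) {f : ℕ → ℕ} (hf : InjOn f s) :
    ∃ σ : Equiv.Perm ℕ, EqOn σ f s := by
  have := hs.to_subtype
  obtain ⟨n, ⟨e⟩⟩ := Finite.exists_equiv_fin s
  have ht := Equiv.Perm.isMultiplyPretransitive ℕ n
  obtain ⟨σ, hσ⟩ := ht.exists_smul_eq
    (⟨fun i => (e.symm i : ℕ), Subtype.val_injective.comp e.symm.injective⟩ : Fin n ↪ ℕ)
    (⟨fun i => f (e.symm i), fun i j h => e.symm.injective (Subtype.ext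
      (hf (e.symm i).2 (e.symm j).2 h))⟩ : Fin n ↪ ℕ)
  refine ⟨σ, fun x hx => ?_⟩
  have := DFunLike.congr_fun hσ (e ⟨x, hx⟩)
  change σ • ((e.symm (e ⟨x, hx⟩) : s) : ℕ) = f ((e.symm (e ⟨x, hx⟩) : s) : ℕ) at this
  simpa using this

/-- Rename vertices and edges. -/
def RootedGraph.relabel (N : RootedGraph X) (σ τ : Equiv.Perm ℕ) : RootedGraph X where
  graph :=
    { vertexSet := {x | σ.symm x ∈ N.graph.vertexSet}
      IsLink := fun e x y => N.graph.IsLink (τ.symm e) (σ.symm x) (σ.symm y)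
      isLink_symm := fun _ _ => ⟨fun _ _ h => h.symm⟩
      eq_or_eq_of_isLink_of_isLink := fun e x y v w h h' => by
        simpa using h.left_eq_or_eq h'
      left_mem_of_isLink := fun e x y h => h.left_mem }
  vmark := fun x => N.vmark (σ.symm x)
  emark := fun x => N.emark (τ.symm x)
  locallyFinite := fun v hv => by
    refine ((N.locallyFinite _ hv).image τ).subset ?_
    rintro e ⟨y, hy⟩
    exact ⟨τ.symm e, ⟨_, hy⟩, by simp⟩
  connected := fun v hv w hw => by
    have := (N.connected _ hv _ hw).lift (p := fun x y => ∃ e,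
      N.graph.IsLink (τ.symm e) (σ.symm x) (σ.symm y)) σ
      (by rintro a b ⟨e, he⟩; exact ⟨τ e, by simpa using he⟩)
    simp only [Function.onFun, Equiv.apply_symm_apply] at this
    exact this
  root := σ N.root
  root_mem := by simpa using N.root_mem

theorem RootedGraph.relabel_mIso (N : RootedGraph X) (σ τ : Equiv.Perm ℕ) :
    MIso N.toMarkedGraph (N.relabel σ τ).toMarkedGraph σ τ := by
  refine ⟨⟨⟨fun x hx => ?_, σ.injective.injOn, fun y hy => ⟨σ.symm y, hy, by simp⟩⟩,
    ⟨fun e he => ?_, τ.injective.injOn, fun e he => ⟨τ.symm e, ?_, by simp⟩⟩,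
    fun {e x y} hl => ?_⟩, fun v hv => ?_, fun e he => ?_⟩
  · simpa [relabel] using hx
  · obtain ⟨x, y, hl⟩ := N.graph.exists_isLink_of_mem_edgeSet he
    exact ⟨σ x, σ y, by simpa using hl⟩
  · obtain ⟨x, y, hl⟩ := he
    exact hl.edge_mem
  · simpa [relabel] using hl
  · simp [relabel]
  · simp [relabel]

theorem RootedGraph.relabel_cls (N : RootedGraph X) (σ τ : Equiv.Perm ℕ) :
    (N.relabel σ τ).cls = N.cls :=
  (RootedGraph.cls_eq_iff.2 ⟨σ, τ, N.relabel_mIso σ τ, rfl⟩).symm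

/-! ### Cylinders and literal agreement -/

theorem RootedGraph.ballSet_finite (N : RootedGraph X) (R : ℕ) :
    (ballSet N.graph N.root R).Finite :=
  UnimodularGraph.ballSet_finite N.locallyFinite N.root_mem R

theorem RootedGraph.ball_edgeSet_finite (N : RootedGraph X) (R : ℕ) :
    (ball N.graph N.root R).edgeSet.Finite :=
  UnimodularGraph.ball_edgeSet_finite N.locallyFinite N.root_mem R

/-- `N` has literally the same ball of radius `R` as `M`, with marks in the prescribed sets. -/
structure Near (M : RootedGraph X) (R : ℕ) (U W : ℕ → Set X) (N : RootedGraph X) : Prop where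
  root : N.root = M.root
  ball : ball N.graph N.root R = ball M.graph M.root R
  vmark : ∀ x ∈ ballSet M.graph M.root R, N.vmark x ∈ U x
  emark : ∀ e ∈ (UnimodularGraph.ball M.graph M.root R).edgeSet, N.emark e ∈ W e

/-- The balls are finite, so the isomorphism extends to permutations of all labels; renaming by
their inverses turns the ball of `N` into that of `M` without changing the class. -/
theorem exists_near_of_isIso {M N : RootedGraph X} {R : ℕ} {U W : ℕ → Set X} {f g : ℕ → ℕ}
    (h : IsIso (ball M.graph M.root R) (ball N.graph N.root R) f g) (hr : f M.root = N.root)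
    (hU : ∀ x ∈ ballSet M.graph M.root R, N.vmark (f x) ∈ U x)
    (hW : ∀ e ∈ (ball M.graph M.root R).edgeSet, N.emark (g e) ∈ W e) :
    ∃ N', N'.cls = N.cls ∧ Near M R U W N' := by
  obtain ⟨σ, hσ⟩ := exists_perm_eqOn (M.ballSet_finite R) h.vert.injOn
  obtain ⟨τ, hτ⟩ := exists_perm_eqOn (M.ball_edgeSet_finite R) h.edge.injOn
  refine ⟨N.relabel σ.symm τ.symm, N.relabel_cls _ _, ?_⟩
  have hroot : (N.relabel σ.symm τ.symm).root = M.root := by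
    change σ.symm N.root = M.root
    rw [← hr, ← hσ (mem_ballSet _ _ R)]; simp
  have hi := (N.relabel_mIso σ.symm τ.symm).toIsIso.ball N.root_mem R
  have hc := hi.comp (h.congr hσ.symm hτ.symm)
  -- The composite is the identity on labels, so the balls coincide as graphs and not merely up to
  -- isomorphism.
  have hc' := hc.congr (f' := id) (g' := id) (fun x _ => by simp) (fun x _ => by simp)
  refine ⟨hroot, ?_, fun x hx => ?_, fun e he => ?_⟩
  · refine graph_ext ?_ fun e x y => ⟨fun hl => ?_, fun hl => hc'.link hl⟩
    · have := hc'.vert.image_eq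
      rw [image_id] at this
      exact this.symm
    · obtain ⟨e', x', y', hl', rfl, rfl, rfl⟩ := hc'.exists_link hl
      exact hl'
  · change N.vmark (σ.symm.symm x) ∈ U x
    rw [Equiv.symm_symm, hσ hx]; exact hU x hx
  · change N.emark (τ.symm.symm e) ∈ W e
    rw [Equiv.symm_symm, hτ he]; exact hW e he

theorem mem_cylinder_iff {M : RootedGraph X} {R : ℕ} {U W : ℕ → Set X} {q : RootedSpace X} :
    q ∈ cylinder M R U W ↔ ∃ N, N.cls = q ∧ Near M R U W N := by
  constructor
  · rintro ⟨N, rfl, φ, hm, hr⟩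
    obtain ⟨f, g, h, h1, h2⟩ := φ.exists_isIso
    refine exists_near_of_isIso h ?_ (fun x hx => ?_) fun e he => ?_
    · rw [← hr]; exact h1 ⟨M.root, mem_ballSet _ _ R⟩
    · rw [h1 ⟨x, hx⟩]; exact hm.1 ⟨x, hx⟩
    · rw [h2 ⟨e, he⟩]; exact hm.2 ⟨e, he⟩
  · rintro ⟨N, rfl, h⟩
    have hi : IsIso (ball M.graph M.root R) (ball N.graph N.root R) id id := by
      rw [h.ball]; exact IsIso.id _
    obtain ⟨φ, h1, h2⟩ := hi.exists_graphIso
    refine ⟨N, rfl, φ, ⟨fun x => ?_, fun e => ?_⟩, ?_⟩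
    · rw [h1]; exact h.vmark x x.2
    · rw [h2]; exact h.emark e e.2
    · rw [h1]; exact h.root.symm

theorem Near.trans_iso {M N N' : RootedGraph X} {R : ℕ} {U W : ℕ → Set X}
    (h : Near M R U W N) (hN : N.cls = N'.cls) :
    ∃ f g, IsIso (UnimodularGraph.ball M.graph M.root R)
      (UnimodularGraph.ball N'.graph N'.root R) f g ∧ f M.root = N'.root ∧
      (∀ x ∈ ballSet M.graph M.root R, N'.vmark (f x) ∈ U x) ∧
      (∀ e ∈ (UnimodularGraph.ball M.graph M.root R).edgeSet, N'.emark (g e) ∈ W e) := by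
  obtain ⟨f, g, hi, hr⟩ := RootedGraph.cls_eq_iff.1 hN
  have hb := hi.toIsIso.ball N.root_mem R
  rw [h.ball, hr] at hb
  have hroot := h.root
  refine ⟨f, g, hb, by rw [← hroot, hr], fun x hx => ?_, fun e he => ?_⟩
  · have hx' : x ∈ N.graph.vertexSet := by
      have : x ∈ (UnimodularGraph.ball N.graph N.root R).vertexSet := by rw [h.ball]; exact hx
      exact ballSet_subset N.root_mem R this
    rw [hi.vmark x hx']; exact h.vmark x hx
  · have he' : e ∈ N.graph.edgeSet := by
      have : e ∈ (UnimodularGraph.ball N.graph N.root R).edgeSet := by rw [h.ball]; exact he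
      obtain ⟨a, b, hl, -⟩ := this
      exact hl.edge_mem
    rw [hi.emark e he']; exact h.emark e he

/-- Membership in a cylinder can be tested on any representative, since the witness composes with an
isomorphism. -/
theorem cls_mem_cylinder_iff {M N : RootedGraph X} {R : ℕ} {U W : ℕ → Set X} :
    N.cls ∈ cylinder M R U W ↔ ∃ f g, IsIso (ball M.graph M.root R)
      (ball N.graph N.root R) f g ∧ f M.root = N.root ∧
      (∀ x ∈ ballSet M.graph M.root R, N.vmark (f x) ∈ U x) ∧
      (∀ e ∈ (ball M.graph M.root R).edgeSet, N.emark (g e) ∈ W e) := by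
  rw [mem_cylinder_iff]
  constructor
  · rintro ⟨N', hN, h⟩
    exact h.trans_iso hN
  · rintro ⟨f, g, h, hr, hU, hW⟩
    exact exists_near_of_isIso h hr hU hW

theorem Near.mono {M N : RootedGraph X} {R S : ℕ} {U W U' W' : ℕ → Set X} (h : Near M R U W N)
    (hS : S ≤ R) (hU : ∀ x ∈ ballSet M.graph M.root S, U x ⊆ U' x)
    (hW : ∀ x ∈ (UnimodularGraph.ball M.graph M.root S).edgeSet, W x ⊆ W' x) :
    Near M S U' W' N := by
  have hb : UnimodularGraph.ball N.graph N.root S = UnimodularGraph.ball M.graph M.root S := by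
    rw [← ball_ball hS, ← ball_ball (G := M.graph) hS, h.ball, h.root]
  refine ⟨h.root, hb, fun x hx => hU x hx (h.vmark x (ballSet_mono _ _ hS hx)), fun e he =>
    hW e he (h.emark e ?_)⟩
  obtain ⟨a, b, hl, ha, hb⟩ := he
  exact ⟨a, b, hl, ballSet_mono _ _ hS ha, ballSet_mono _ _ hS hb⟩

theorem Near.refl {M : RootedGraph X} {R : ℕ} {U W : ℕ → Set X} (hU : ∀ x, M.vmark x ∈ U x)
    (hW : ∀ x, M.emark x ∈ W x) : Near M R U W M := ⟨rfl, rfl, fun x _ => hU x, fun x _ => hW x⟩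

variable [TopologicalSpace X] [TopologicalSpace Y]

theorem isOpen_cylinder {M : RootedGraph X} {R : ℕ} {U W : ℕ → Set X} (hU : ∀ x, IsOpen (U x))
    (hW : ∀ x, IsOpen (W x)) : IsOpen (cylinder M R U W) :=
  TopologicalSpace.isOpen_generateFrom_of_mem ⟨M, R, U, W, hU, hW, rfl⟩

/-- The generating cylinders may be centred at other graphs. One that contains `N.cls` also contains
a cylinder centred at `N`, with the mark constraints moved along the isomorphism of balls; finite
intersections are handled by the larger radius. -/
theorem mem_nhds_cls_iff {N : RootedGraph X} {O : Set (RootedSpace X)} :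
    O ∈ 𝓝 N.cls ↔ ∃ R U W, (∀ x, IsOpen (U x)) ∧ (∀ x, IsOpen (W x)) ∧ (∀ x, N.vmark x ∈ U x) ∧
      (∀ x, N.emark x ∈ W x) ∧ ∀ N', Near N R U W N' → N'.cls ∈ O := by
  constructor
  · intro hO
    obtain ⟨O', hO', hop, hmem⟩ := mem_nhds_iff.1 hO
    suffices H : ∃ R U W, (∀ x, IsOpen (U x)) ∧ (∀ x, IsOpen (W x)) ∧ (∀ x, N.vmark x ∈ U x) ∧
      (∀ x, N.emark x ∈ W x) ∧ ∀ N', Near N R U W N' → N'.cls ∈ O' by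
      obtain ⟨R, U, W, h1, h2, h3, h4, h5⟩ := H
      exact ⟨R, U, W, h1, h2, h3, h4, fun N' h => hO' (h5 N' h)⟩
    clear hO hO' O
    induction hop with
    | basic A hA =>
      obtain ⟨M, R, U, W, hU, hW, rfl⟩ := hA
      obtain ⟨f, g, hi, hr, hfU, hgW⟩ := cls_mem_cylinder_iff.1 hmem
      classical
      have hfin := hi.vert.invOn_invFunOn
      have hgin := hi.edge.invOn_invFunOn
      have hsy := hi.symm
      set f' := Function.invFunOn f (ball M.graph M.root R).vertexSet
      set g' := Function.invFunOn g (ball M.graph M.root R).edgeSet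
      -- The constraint at an object of the ball of `N` is the one at its preimage in the ball of
      -- `M`; labels outside the ball are unconstrained.
      refine ⟨R, fun x => if x ∈ ballSet N.graph N.root R then U (f' x) else univ,
        fun e => if e ∈ (ball N.graph N.root R).edgeSet then W (g' e) else univ,
        fun x => ?_, fun x => ?_, fun x => ?_, fun x => ?_, fun N' h => ?_⟩
      · dsimp only; split_ifs
        exacts [hU _, isOpen_univ]
      · dsimp only; split_ifs
        exacts [hW _, isOpen_univ]
      · dsimp only; split_ifs with hx
        · have := hfU _ (hsy.vert.mapsTo hx)
          rwa [hfin.2 hx] at this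
        · trivial
      · dsimp only; split_ifs with hx
        · have := hgW _ (hsy.edge.mapsTo hx)
          rwa [hgin.2 hx] at this
        · trivial
      · refine cls_mem_cylinder_iff.2 ⟨f, g, by rw [h.ball]; exact hi, by rw [hr, h.root],
          fun x hx => ?_, fun e he => ?_⟩
        · have hm : f x ∈ ballSet N.graph N.root R := hi.vert.mapsTo hx
          have := h.vmark _ hm
          rwa [if_pos hm, hfin.1 hx] at this
        · have := h.emark _ (hi.edge.mapsTo he)
          rwa [if_pos (hi.edge.mapsTo he), hgin.1 he] at this
    | univ =>
      exact ⟨0, fun _ => univ, fun _ => univ, by simp, by simp, by simp, by simp, by simp⟩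
    | inter A B _ _ ihA ihB =>
      obtain ⟨R, U, W, h1, h2, h3, h4, h5⟩ := ihA hmem.1
      obtain ⟨R', U', W', h1', h2', h3', h4', h5'⟩ := ihB hmem.2
      refine ⟨max R R', fun x => U x ∩ U' x, fun x => W x ∩ W' x, fun x => (h1 x).inter (h1' x),
        fun x => (h2 x).inter (h2' x), fun x => ⟨h3 x, h3' x⟩, fun x => ⟨h4 x, h4' x⟩,
        fun N' h => ⟨h5 N' ?_, h5' N' ?_⟩⟩
      · exact h.mono (le_max_left _ _) (fun _ _ => inter_subset_left) fun _ _ => inter_subset_left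
      · exact h.mono (le_max_right _ _) (fun _ _ => inter_subset_right)
          fun _ _ => inter_subset_right
    | sUnion S _ ih =>
      obtain ⟨A, hA, hm⟩ := hmem
      obtain ⟨R, U, W, h1, h2, h3, h4, h5⟩ := ih A hA hm
      exact ⟨R, U, W, h1, h2, h3, h4, fun N' h => ⟨A, hA, h5 N' h⟩⟩
  · rintro ⟨R, U, W, h1, h2, h3, h4, h5⟩
    refine mem_nhds_iff.2 ⟨cylinder N R U W, fun q hq => ?_, isOpen_cylinder h1 h2,
      mem_cylinder_iff.2 ⟨N, rfl, Near.refl h3 h4⟩⟩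
    obtain ⟨N', rfl, h⟩ := mem_cylinder_iff.1 hq
    exact h5 N' h

end

section

variable {X Y : Type}

/-! ### Separation and countability of the local topology -/

section Topology

variable [TopologicalSpace X]

/-- A cylinder depends only on the root label, the radius, the finite ball and the mark constraints
on it. Taking the constraints from a countable base leaves countably many cylinders. -/
instance secondCountable_rootedSpace [SecondCountableTopology X] :
    SecondCountableTopology (RootedSpace X) := by
  classical
  obtain ⟨b, hb⟩ := ((TopologicalSpace.countable_countableBasis X).insert univ).exists_eq_range
    ⟨univ, mem_insert _ _⟩
  have hbo : ∀ n, IsOpen (b n) := fun n => by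
    have : b n ∈ insert univ (TopologicalSpace.countableBasis X) := hb ▸ mem_range_self n
    rcases this with h | h
    · rw [h]; exact isOpen_univ
    · exact TopologicalSpace.isOpen_of_mem_countableBasis h
  have hbn : ∀ (x : X) (U : Set X), IsOpen U → x ∈ U → ∃ n, x ∈ b n ∧ b n ⊆ U := fun x U hU hx => by
    obtain ⟨v, hv, hxv, hvU⟩ :=
      (TopologicalSpace.isBasis_countableBasis X).exists_subset_of_mem_open hx hU
    have : v ∈ range b := hb ▸ mem_insert_of_mem _ hv
    obtain ⟨n, rfl⟩ := this
    exact ⟨n, hxv, hvU⟩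
  let U (s : Finset ℕ) (u : ℕ →₀ ℕ) (x : ℕ) : Set X := if x ∈ s then b (u x) else univ
  have hU : ∀ s u x, IsOpen (U s u x) := fun s u x => by
    dsimp only [U]; split_ifs
    exacts [hbo _, isOpen_univ]
  -- The index records the vertices, links and edges of the ball, the root, the radius and the
  -- numbers of the basic open sets. All `M` admitted for one index have the same ball; the union
  -- avoids choosing one, and is empty for indices that no graph realises.
  let C : (Finset ℕ × Finset (ℕ × ℕ × ℕ) × Finset ℕ) × (ℕ × ℕ) × ((ℕ →₀ ℕ) × (ℕ →₀ ℕ)) →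
      Set (RootedSpace X) := fun p => ⋃ (M : RootedGraph X)
    (_ : M.root = p.2.1.1 ∧ (ballSet M.graph M.root p.2.1.2 = p.1.1) ∧
      ({t : ℕ × ℕ × ℕ | (ball M.graph M.root p.2.1.2).IsLink t.1 t.2.1 t.2.2} = p.1.2.1)),
    cylinder M p.2.1.2 (U p.1.1 p.2.2.1) (U p.1.2.2 p.2.2.2)
  have hC : ∀ p, IsOpen (C p) := fun p =>
    isOpen_iUnion fun M => isOpen_iUnion fun _ => isOpen_cylinder (hU _ _) (hU _ _)
  refine (TopologicalSpace.isTopologicalBasis_of_isOpen_of_nhds (s := range C) ?_ ?_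
    ).secondCountableTopology (countable_range C)
  · rintro _ ⟨p, rfl⟩; exact hC p
  · intro q O hq hO
    obtain ⟨N, rfl⟩ := RootedGraph.exists_cls_eq q
    obtain ⟨R, A, B, hA, hB, hNA, hNB, h5⟩ := mem_nhds_cls_iff.1 (hO.mem_nhds hq)
    choose u hu huA using fun x => hbn _ _ (hA x) (hNA x)
    choose w hw hwB using fun x => hbn _ _ (hB x) (hNB x)
    have hlf : {t : ℕ × ℕ × ℕ | (ball N.graph N.root R).IsLink t.1 t.2.1 t.2.2}.Finite := by
      refine ((N.ball_edgeSet_finite R).prod ((N.ballSet_finite R).prod (N.ballSet_finite R))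
        ).subset ?_
      rintro ⟨e, x, y⟩ hl
      exact ⟨hl.edge_mem, hl.2.1, hl.2.2⟩
    let s := (N.ballSet_finite R).toFinset
    let t := (N.ball_edgeSet_finite R).toFinset
    let u' : ℕ →₀ ℕ := Finsupp.onFinset s (fun x => if x ∈ s then u x else 0) (by
      intro a; by_contra! h; simp [h.2] at h)
    let w' : ℕ →₀ ℕ := Finsupp.onFinset t (fun x => if x ∈ t then w x else 0) (by
      intro a; by_contra! h; simp [h.2] at h)
    have e1 : ∀ x ∈ s, U s u' x = b (u x) := fun x hx => by simp [U, u', hx]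
    have e2 : ∀ x ∈ t, U t w' x = b (w x) := fun x hx => by simp [U, w', hx]
    refine ⟨_, ⟨⟨(s, hlf.toFinset, t), (N.root, R), (u', w')⟩, rfl⟩, ?_, ?_⟩
    · simp only [C, mem_iUnion]
      refine ⟨N, ⟨rfl, by simp [s], by simp⟩, mem_cylinder_iff.2 ⟨N, rfl, rfl, rfl, ?_, ?_⟩⟩
      · intro x hx
        rw [e1 x (by simpa [s] using hx)]; exact hu x
      · intro x hx
        rw [e2 x (by simpa [t] using hx)]; exact hw x
    · intro q hq
      simp only [C, mem_iUnion] at hq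
      obtain ⟨M, ⟨hr, hv, hl⟩, hq⟩ := hq
      obtain ⟨N', rfl, hN'⟩ := mem_cylinder_iff.1 hq
      have hb : ball M.graph M.root R = ball N.graph N.root R := by
        refine graph_ext ?_ fun e x y => ?_
        · simp only [ball_vertexSet]; rw [hv]; simp [s]
        · have := Set.ext_iff.1 hl (e, x, y)
          simpa using this
      refine h5 N' ⟨hN'.root.trans hr, hN'.ball.trans hb, fun x hx => ?_, fun e he => ?_⟩
      · have hx' : x ∈ ballSet M.graph M.root R := by rw [hv]; simpa [s] using hx
        have := hN'.vmark x hx'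
        rw [e1 x (by simpa [s] using hx)] at this
        exact huA x this
      · have he' : e ∈ (ball M.graph M.root R).edgeSet := by rw [hb]; exact he
        have := hN'.emark e he'
        rw [e2 e (by simpa [t] using he)] at this
        exact hwB e this

/-- Around a class outside the cylinder, fix the ball and ask every mark to avoid those of the
finitely many closed sets that it already avoids. An isomorphism admissible for a nearby graph would
then be admissible for the original one. -/
theorem isClosed_cylinder {M : RootedGraph X} {R : ℕ} {C D : ℕ → Set X} (hC : ∀ x, IsClosed (C x))
    (hD : ∀ x, IsClosed (D x)) : IsClosed (cylinder M R C D) := by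
  classical
  rw [← isOpen_compl_iff, isOpen_iff_mem_nhds]
  intro q hq
  obtain ⟨N, rfl⟩ := RootedGraph.exists_cls_eq q
  refine mem_nhds_cls_iff.2 ⟨R,
    fun x => ⋂ y ∈ {y ∈ ballSet M.graph M.root R | N.vmark x ∉ C y}, (C y)ᶜ,
    fun x => ⋂ y ∈ {y ∈ (ball M.graph M.root R).edgeSet | N.emark x ∉ D y}, (D y)ᶜ,
    fun x => ((M.ballSet_finite R).subset (sep_subset _ _)).isOpen_biInter
      fun y _ => (hC y).isOpen_compl,
    fun x => ((M.ball_edgeSet_finite R).subset (sep_subset _ _)).isOpen_biInter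
      fun y _ => (hD y).isOpen_compl, fun x => by simp, fun x => by simp, fun N' hN' h => hq ?_⟩
  obtain ⟨f, g, hi, hr, hfC, hgD⟩ := cls_mem_cylinder_iff.1 h
  refine cls_mem_cylinder_iff.2 ⟨f, g, hN'.ball ▸ hi, hr.trans hN'.root, fun x hx => ?_,
    fun e he => ?_⟩
  · by_contra hn
    have h1 : f x ∈ ballSet N.graph N.root R := by
      have := hi.vert.mapsTo hx
      rwa [hN'.ball] at this
    have := hN'.vmark (f x) h1
    simp only [mem_ofPred_eq, mem_iInter] at this
    exact this x ⟨hx, hn⟩ (hfC x hx)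
  · by_contra hn
    have h1 : g e ∈ (ball N.graph N.root R).edgeSet := by
      have := hi.edge.mapsTo he
      rwa [hN'.ball] at this
    have := hN'.emark (g e) h1
    simp only [mem_ofPred_eq, mem_iInter] at this
    exact this e ⟨he, hn⟩ (hgD e he)

/-- Closed mark neighbourhoods inside the open constraints give a closed cylinder inside the given
neighbourhood. -/
instance regularSpace_rootedSpace [RegularSpace X] : RegularSpace (RootedSpace X) := by
  refine RegularSpace.of_exists_mem_nhds_isClosed_subset fun q O hO => ?_
  obtain ⟨N, rfl⟩ := RootedGraph.exists_cls_eq q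
  obtain ⟨R, A, B, hA, hB, hNA, hNB, h5⟩ := mem_nhds_cls_iff.1 hO
  choose C hC hCc hCA using fun x => exists_mem_nhds_isClosed_subset ((hA x).mem_nhds (hNA x))
  choose D hD hDc hDB using fun x => exists_mem_nhds_isClosed_subset ((hB x).mem_nhds (hNB x))
  refine ⟨cylinder N R C D, mem_nhds_cls_iff.2 ⟨R, fun x => interior (C x),
    fun x => interior (D x), fun _ => isOpen_interior, fun _ => isOpen_interior,
    fun x => mem_interior_iff_mem_nhds.2 (hC x), fun x => mem_interior_iff_mem_nhds.2 (hD x),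
    fun N' h => mem_cylinder_iff.2 ⟨N', rfl, h.mono le_rfl (fun _ _ => interior_subset)
      fun _ _ => interior_subset⟩⟩, isClosed_cylinder hCc hDc, fun q hq => ?_⟩
  obtain ⟨N', rfl, h⟩ := mem_cylinder_iff.1 hq
  exact h5 N' (h.mono le_rfl (fun _ _ => hCA _) fun _ _ => hDB _)

theorem exists_eventually_eq_of_finite {ι α : Type*} (𝒰 : Ultrafilter ι) {h : ι → α} {t : Set α}
    (ht : t.Finite) (hh : ∀ᶠ i in 𝒰, h i ∈ t) : ∃ a ∈ t, ∀ᶠ i in 𝒰, h i = a := by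
  obtain ⟨a, ha, hp⟩ := (𝒰.map h).eq_pure_of_finite_mem ht hh
  refine ⟨a, ha, ?_⟩
  have : ({a} : Set α) ∈ 𝒰.map h := by rw [hp]; rfl
  exact this

omit [TopologicalSpace X] in
/-- Compactness: rooted graphs with isomorphic balls of every radius are isomorphic. -/
theorem cls_eq_of_forall_ball {M N : RootedGraph X}
    (H : ∀ R, ∃ f g, IsIso (ball M.graph M.root R) (ball N.graph N.root R) f g ∧
      f M.root = N.root ∧ (∀ x ∈ ballSet M.graph M.root R, N.vmark (f x) = M.vmark x) ∧
      (∀ e ∈ (ball M.graph M.root R).edgeSet, N.emark (g e) = M.emark e)) : M.cls = N.cls := by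
  choose f g hi hr hv he using H
  -- A limit along an ultrafilter replaces diagonal extraction: a vertex or an edge has finitely
  -- many possible images, so its image stabilises.
  let 𝒰 : Ultrafilter ℕ := hyperfilter ℕ
  have hge : ∀ s, ∀ᶠ R in (𝒰 : Filter ℕ), s ≤ R := fun s => Nat.hyperfilter_le_atTop (eventually_ge_atTop s)
  have himg : ∀ {s R}, s ≤ R → f R '' ballSet M.graph M.root s = ballSet N.graph N.root s := by
    intro s R h
    have := (hi R).image_ballSet (ρ := M.root) (mem_ballSet _ _ R) s
    rwa [ballSet_ball h, hr, ballSet_ball h] at this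
  have hmV : ∀ x ∈ M.graph.vertexSet, ∃ s, x ∈ ballSet M.graph M.root s := fun x hx =>
    exists_mem_ballSet_iff.2 (M.connected _ M.root_mem _ hx)
  have hmV' : ∀ x ∈ N.graph.vertexSet, ∃ s, x ∈ ballSet N.graph N.root s := fun x hx =>
    exists_mem_ballSet_iff.2 (N.connected _ N.root_mem _ hx)
  have hmE : ∀ e ∈ M.graph.edgeSet, ∃ s, e ∈ (ball M.graph M.root s).edgeSet := fun e he => by
    obtain ⟨x, y, hl⟩ := M.graph.exists_isLink_of_mem_edgeSet he
    obtain ⟨s, hs⟩ := hmV x hl.left_mem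
    obtain ⟨t, ht⟩ := hmV y hl.right_mem
    exact ⟨max s t, x, y, hl, ballSet_mono _ _ (le_max_left _ _) hs,
      ballSet_mono _ _ (le_max_right _ _) ht⟩
  have hmE' : ∀ e ∈ N.graph.edgeSet, ∃ s, e ∈ (ball N.graph N.root s).edgeSet := fun e he => by
    obtain ⟨x, y, hl⟩ := N.graph.exists_isLink_of_mem_edgeSet he
    obtain ⟨s, hs⟩ := hmV' x hl.left_mem
    obtain ⟨t, ht⟩ := hmV' y hl.right_mem
    exact ⟨max s t, x, y, hl, ballSet_mono _ _ (le_max_left _ _) hs,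
      ballSet_mono _ _ (le_max_right _ _) ht⟩
  have hbm : ∀ {K : Graph ℕ ℕ} {ρ s R : ℕ}, s ≤ R → (ball K ρ s).edgeSet ⊆ (ball K ρ R).edgeSet := by
    rintro K ρ s R h e ⟨x, y, hl, hx, hy⟩
    exact ⟨x, y, hl, ballSet_mono _ _ h hx, ballSet_mono _ _ h hy⟩
  have himE : ∀ {s R}, s ≤ R → BijOn (g R) (ball M.graph M.root s).edgeSet
      (ball N.graph N.root s).edgeSet := by
    intro s R h
    have := ((hi R).ball (ρ := M.root) (mem_ballSet _ _ R) s).edge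
    rwa [ball_ball h, hr, ball_ball h] at this
  have F : ∀ x, ∃ v, x ∈ M.graph.vertexSet → ∀ᶠ R in 𝒰, f R x = v := fun x => by
    by_cases hx : x ∈ M.graph.vertexSet
    · obtain ⟨s, hs⟩ := hmV x hx
      obtain ⟨a, -, ha⟩ := exists_eventually_eq_of_finite 𝒰 (h := fun R => f R x)
        (N.ballSet_finite s) ((hge s).mono fun R hR => himg hR ▸ mem_image_of_mem _ hs)
      exact ⟨a, fun _ => ha⟩
    · exact ⟨0, fun h => absurd h hx⟩
  have Gx : ∀ e, ∃ v, e ∈ M.graph.edgeSet → ∀ᶠ R in 𝒰, g R e = v := fun e => by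
    by_cases hx : e ∈ M.graph.edgeSet
    · obtain ⟨s, hs⟩ := hmE e hx
      obtain ⟨a, -, ha⟩ := exists_eventually_eq_of_finite 𝒰 (h := fun R => g R e)
        (N.ball_edgeSet_finite s) ((hge s).mono fun R hR => (himE hR).mapsTo hs)
      exact ⟨a, fun _ => ha⟩
    · exact ⟨0, fun h => absurd h hx⟩
  choose F hF using F
  choose G hG using Gx
  have hlink : ∀ {e x y}, M.graph.IsLink e x y → N.graph.IsLink (G e) (F x) (F y) := by
    intro e x y hl
    obtain ⟨s, hs⟩ := hmV x hl.left_mem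
    obtain ⟨t, ht⟩ := hmV y hl.right_mem
    obtain ⟨R, h1, h2, h3, h4, h5⟩ := ((hF x hl.left_mem).and ((hF y hl.right_mem).and
      ((hG e hl.edge_mem).and ((hge s).and (hge t))))).exists
    rw [← h1, ← h2, ← h3]
    exact ((hi R).link ⟨hl, ballSet_mono _ _ h4 hs, ballSet_mono _ _ h5 ht⟩).1
  refine RootedGraph.cls_eq_iff.2 ⟨F, G, ⟨⟨⟨fun x hx => ?_, fun x hx y hy h => ?_, fun y hy => ?_⟩,
    ⟨fun e h => ?_, fun x hx y hy h => ?_, fun y hy => ?_⟩, hlink⟩, fun x hx => ?_,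
    fun e h => ?_⟩, ?_⟩
  · obtain ⟨s, hs⟩ := hmV x hx
    obtain ⟨R, h1, h2⟩ := ((hF x hx).and (hge s)).exists
    rw [← h1]
    exact ballSet_subset N.root_mem s (himg h2 ▸ mem_image_of_mem _ hs)
  · obtain ⟨s, hs⟩ := hmV x hx
    obtain ⟨t, ht⟩ := hmV y hy
    obtain ⟨R, h1, h2, h3, h4⟩ := ((hF x hx).and ((hF y hy).and ((hge s).and (hge t)))).exists
    exact (hi R).vert.injOn (ballSet_mono _ _ h3 hs) (ballSet_mono _ _ h4 ht)
      (by rw [h1, h2, h])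
  · obtain ⟨s, hs⟩ := hmV' y hy
    -- A preimage of `y` exists at every large radius and ranges over a finite ball, so it
    -- stabilises as well.
    have : ∀ R, ∃ x, s ≤ R → x ∈ ballSet M.graph M.root s ∧ f R x = y := fun R => by
      by_cases h : s ≤ R
      · rw [← himg h] at hs
        obtain ⟨x, hx, rfl⟩ := hs
        exact ⟨x, fun _ => ⟨hx, rfl⟩⟩
      · exact ⟨0, fun h' => absurd h' h⟩
    choose x hx using this
    obtain ⟨a, ha, ha'⟩ := exists_eventually_eq_of_finite 𝒰 (h := x)
        (M.ballSet_finite s) ((hge s).mono fun R hR => (hx R hR).1)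
    have haV := ballSet_subset M.root_mem s ha
    refine ⟨a, haV, ?_⟩
    obtain ⟨R, h1, h2, h3⟩ := ((hF a haV).and (ha'.and (hge s))).exists
    rw [← h1, ← h2]
    exact (hx R h3).2
  · obtain ⟨x, y, hl⟩ := M.graph.exists_isLink_of_mem_edgeSet h
    exact (hlink hl).edge_mem
  · obtain ⟨s, hs⟩ := hmE x hx
    obtain ⟨t, ht⟩ := hmE y hy
    obtain ⟨R, h1, h2, h3, h4⟩ := ((hG x hx).and ((hG y hy).and ((hge s).and (hge t)))).exists
    exact (hi R).edge.injOn (hbm h3 hs) (hbm h4 ht) (by rw [h1, h2, h])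
  · obtain ⟨s, hs⟩ := hmE' y hy
    have : ∀ R, ∃ x, s ≤ R → x ∈ (ball M.graph M.root s).edgeSet ∧ g R x = y := fun R => by
      by_cases h : s ≤ R
      · obtain ⟨x, hx, h'⟩ := (himE h).surjOn hs
        exact ⟨x, fun _ => ⟨hx, h'⟩⟩
      · exact ⟨0, fun h' => absurd h' h⟩
    choose x hx using this
    obtain ⟨a, ha, ha'⟩ := exists_eventually_eq_of_finite 𝒰 (h := x)
        (M.ball_edgeSet_finite s) ((hge s).mono fun R hR => (hx R hR).1)
    have haV : a ∈ M.graph.edgeSet := by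
      obtain ⟨_, _, hl, -⟩ := ha
      exact hl.edge_mem
    refine ⟨a, haV, ?_⟩
    obtain ⟨R, h1, h2, h3⟩ := ((hG a haV).and (ha'.and (hge s))).exists
    rw [← h1, ← h2]
    exact (hx R h3).2
  · obtain ⟨s, hs⟩ := hmV x hx
    obtain ⟨R, h1, h2⟩ := ((hF x hx).and (hge s)).exists
    rw [← h1]
    exact hv R x (ballSet_mono _ _ h2 hs)
  · obtain ⟨s, hs⟩ := hmE e h
    obtain ⟨R, h1, h2⟩ := ((hG e h).and (hge s)).exists
    rw [← h1]
    exact he R e (hbm h2 hs)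
  · obtain ⟨R, h1⟩ := (hF M.root M.root_mem).exists
    rw [← h1, hr]

/-- If two classes are inseparable, the cylinder around `M` whose constraints exclude the finitely
many differing marks of `N` contains `N`, for every radius. So all balls are isomorphic with equal
marks, and `cls_eq_of_forall_ball` applies. -/
instance t0Space_rootedSpace [T1Space X] : T0Space (RootedSpace X) := by
  refine ⟨fun p q h => ?_⟩
  obtain ⟨M, rfl⟩ := RootedGraph.exists_cls_eq p
  obtain ⟨N, rfl⟩ := RootedGraph.exists_cls_eq q
  refine cls_eq_of_forall_ball fun R => ?_
  have hU : ∀ x, IsOpen (⋂ y ∈ {y ∈ ballSet N.graph N.root R | N.vmark y ≠ M.vmark x},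
      {N.vmark y}ᶜ) := fun x => ((N.ballSet_finite R).subset (sep_subset _ _)).isOpen_biInter
      fun y _ => isOpen_compl_singleton
  have hW : ∀ x, IsOpen (⋂ y ∈ {y ∈ (ball N.graph N.root R).edgeSet | N.emark y ≠ M.emark x},
      {N.emark y}ᶜ) := fun x => ((N.ball_edgeSet_finite R).subset (sep_subset _ _)).isOpen_biInter
      fun y _ => isOpen_compl_singleton
  have hN := (h.mem_open_iff (isOpen_cylinder (M := M) (R := R) hU hW)).1
    (mem_cylinder_iff.2 ⟨M, rfl, Near.refl
      (fun x => by simp only [mem_iInter]; exact fun y hy => Ne.symm hy.2)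
      (fun x => by simp only [mem_iInter]; exact fun y hy => Ne.symm hy.2)⟩)
  obtain ⟨f, g, hi, hr, hfU, hgW⟩ := cls_mem_cylinder_iff.1 hN
  refine ⟨f, g, hi, hr, fun x hx => ?_, fun e he => ?_⟩
  · by_contra hne
    have := hfU x hx
    simp only [mem_iInter] at this
    exact this (f x) ⟨hi.vert.mapsTo hx, hne⟩ rfl
  · by_contra hne
    have := hgW e he
    simp only [mem_iInter] at this
    exact this (g e) ⟨hi.edge.mapsTo he, hne⟩ rfl

end Topology

end

section

variable {X Y : Type}

/-! ### Birooted graphs as rooted graphs with one marked vertex -/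

/-- Mark the second root. -/
def BirootedGraph.markSecond (N : BirootedGraph X) : RootedGraph (X × Bool) where
  graph := N.graph
  vmark := fun v => (N.vmark v, decide (v = N.root₂))
  emark := fun e => (N.emark e, false)
  locallyFinite := N.locallyFinite
  connected := N.connected
  root := N.root₁
  root_mem := N.root₁_mem

theorem BirootedGraph.markSecond_cls_iff {M N : BirootedGraph X} :
    M.markSecond.cls = N.markSecond.cls ↔ M.cls = N.cls := by
  rw [RootedGraph.cls_eq_iff, BirootedGraph.cls_eq_iff]
  constructor
  · rintro ⟨f, g, h, hr⟩
    have hv : ∀ v ∈ M.graph.vertexSet, (N.vmark (f v), decide (f v = N.root₂)) =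
      (M.vmark v, decide (v = M.root₂)) := h.vmark
    have he : ∀ v ∈ M.graph.edgeSet, (N.emark (g v), false) = (M.emark v, false) := h.emark
    refine ⟨f, g, ⟨h.toIsIso, fun v hv' => congrArg Prod.fst (hv v hv'),
      fun e he' => congrArg Prod.fst (he e he')⟩, hr, ?_⟩
    simpa using congrArg Prod.snd (hv M.root₂ M.root₂_mem)
  · rintro ⟨f, g, h, hr, hs⟩
    refine ⟨f, g, ⟨h.toIsIso, fun v hv' => ?_, fun e he' => ?_⟩, hr⟩
    · change (N.vmark (f v), decide (f v = N.root₂)) = (M.vmark v, decide (v = M.root₂))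
      rw [h.vmark v hv', ← hs]
      congr 2
      exact propext ⟨fun h' => h.vert.injOn hv' M.root₂_mem h', fun h' => h' ▸ rfl⟩
    · change (N.emark (g e), false) = (M.emark e, false)
      rw [h.emark e he']

def markSecond : BirootedSpace X → RootedSpace (X × Bool) :=
  Quotient.lift (fun N => N.markSecond.cls) fun _ _ h =>
    BirootedGraph.markSecond_cls_iff.2 (Quotient.sound h)

theorem markSecond_cls (N : BirootedGraph X) : markSecond N.cls = N.markSecond.cls := rfl

theorem markSecond_injective : Function.Injective (markSecond (X := X)) := by
  intro p q h
  obtain ⟨M, rfl⟩ := BirootedGraph.exists_cls_eq p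
  obtain ⟨N, rfl⟩ := BirootedGraph.exists_cls_eq q
  exact BirootedGraph.markSecond_cls_iff.1 h

theorem cls_mem_bicylinder_iff {M N : BirootedGraph X} {R : ℕ} {U W : ℕ → Set X} :
    N.cls ∈ bicylinder M R U W ↔ ∃ f g, IsIso (ball M.graph M.root₁ R)
      (ball N.graph N.root₁ R) f g ∧ f M.root₁ = N.root₁ ∧
      (∀ x ∈ ballSet M.graph M.root₁ R, N.vmark (f x) ∈ U x) ∧
      (∀ e ∈ (ball M.graph M.root₁ R).edgeSet, N.emark (g e) ∈ W e) ∧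
      M.root₂ ∈ ballSet M.graph M.root₁ R ∧ f M.root₂ = N.root₂ := by
  constructor
  · rintro ⟨N', hN, φ, hm, hr, hm2, hr2⟩
    obtain ⟨f, g, h, h1, h2⟩ := φ.exists_isIso
    obtain ⟨f', g', hi, hr1', hr2'⟩ := BirootedGraph.cls_eq_iff.1 hN
    have hb := hi.toIsIso.ball N'.root₁_mem R
    rw [hr1'] at hb
    refine ⟨f' ∘ f, g' ∘ g, hb.comp h, ?_, fun x hx => ?_, fun e he => ?_, hm2, ?_⟩
    · rw [← hr1', ← hr, Function.comp, h1 ⟨_, mem_ballSet _ _ R⟩]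
    · have := hm.1 ⟨x, hx⟩
      rw [← h1 ⟨x, hx⟩] at this
      rw [Function.comp, hi.vmark _ (ballSet_subset N'.root₁_mem R (h.vert.mapsTo hx))]
      exact this
    · have := hm.2 ⟨e, he⟩
      rw [← h2 ⟨e, he⟩] at this
      rw [Function.comp, hi.emark _ ?_]
      · exact this
      · obtain ⟨_, _, hl, -⟩ := h.edge.mapsTo he
        exact hl.edge_mem
    · rw [← hr2', ← hr2, Function.comp, h1 ⟨_, hm2⟩]
  · rintro ⟨f, g, h, hr, hU, hW, hm2, hr2⟩
    obtain ⟨φ, h1, h2⟩ := h.exists_graphIso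
    refine ⟨N, rfl, φ, ⟨fun x => ?_, fun e => ?_⟩, ?_, hm2, ?_⟩
    · rw [h1]; exact hU x x.2
    · rw [h2]; exact hW e e.2
    · rw [h1]; exact hr
    · rw [h1]; exact hr2

section Topology

variable [TopologicalSpace X]

/-- A large ball around the first root contains the second one, and an isomorphism of such balls
that respects the Boolean mark respects the second root. Topological facts about rooted graphs
thereby pass to doubly rooted ones. -/
theorem isInducing_markSecond : IsInducing (markSecond (X := X)) := by
  refine ⟨le_antisymm ?_ ?_⟩
  · refine continuous_iff_le_induced.1 (continuous_generateFrom_iff.2 ?_)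
    rintro _ ⟨M, R, U, W, hU, hW, rfl⟩
    rw [isOpen_iff_mem_nhds]
    intro q hq
    obtain ⟨N, rfl⟩ := BirootedGraph.exists_cls_eq q
    obtain ⟨R', A, B, hA, hB, hNA, hNB, h5⟩ :=
      mem_nhds_cls_iff.1 ((isOpen_cylinder hU hW).mem_nhds hq)
    obtain ⟨S, hS⟩ := exists_mem_ballSet_iff.2 (N.connected _ N.root₁_mem _ N.root₂_mem)
    -- The radius is enlarged to reach the second root; otherwise the bicylinder would be empty.
    have hop : IsOpen (bicylinder N (max R' S)
        (fun x => (fun a => (a, decide (x = N.root₂))) ⁻¹' A x)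
        (fun x => (fun a => (a, false)) ⁻¹' B x)) :=
      TopologicalSpace.isOpen_generateFrom_of_mem ⟨_, _, _, _,
        fun x => (hA x).preimage (by fun_prop), fun x => (hB x).preimage (by fun_prop), rfl⟩
    refine mem_nhds_iff.2 ⟨_, ?_, hop, cls_mem_bicylinder_iff.2 ⟨id, id, IsIso.id _, rfl,
      fun x _ => hNA x, fun x _ => hNB x, ballSet_mono _ _ (le_max_right _ _) hS, rfl⟩⟩
    intro q hq
    obtain ⟨K, rfl⟩ := BirootedGraph.exists_cls_eq q
    obtain ⟨f, g, hi, hr, hfU, hgW, h2, hr2⟩ := cls_mem_bicylinder_iff.1 hq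
    have hvm : ∀ x ∈ ballSet N.graph N.root₁ (max R' S), K.markSecond.vmark (f x) ∈ A x := by
      intro x hx
      have := hfU x hx
      have he : decide (f x = K.root₂) = decide (x = N.root₂) := by
        rw [← hr2]
        exact decide_eq_decide.2 ⟨fun h' => hi.vert.injOn hx h2 h', fun h' => h' ▸ rfl⟩
      change (K.vmark (f x), decide (f x = K.root₂)) ∈ A x
      rw [he]; exact this
    obtain ⟨N', hN', hnear⟩ := exists_near_of_isIso (M := N.markSecond) (N := K.markSecond)
      (U := A) (W := B) (R := max R' S) hi hr hvm (fun x hx => hgW x hx)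
    have := h5 N' (hnear.mono (le_max_left _ _) (fun _ _ => Subset.rfl) fun _ _ => Subset.rfl)
    rw [mem_preimage, markSecond_cls, ← hN']
    exact this
  · refine le_generateFrom ?_
    rintro _ ⟨M, R, U, W, hU, hW, rfl⟩
    by_cases h2 : M.root₂ ∈ ballSet M.graph M.root₁ R
    · refine ⟨cylinder M.markSecond R (fun x => U x ×ˢ {decide (x = M.root₂)})
        (fun x => W x ×ˢ univ), isOpen_cylinder (fun x => (hU x).prod (isOpen_discrete _))
          (fun x => (hW x).prod isOpen_univ), ?_⟩
      ext q
      obtain ⟨N, rfl⟩ := BirootedGraph.exists_cls_eq q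
      rw [mem_preimage, markSecond_cls, cls_mem_cylinder_iff, cls_mem_bicylinder_iff]
      constructor
      · rintro ⟨f, g, hi, hr, hfU, hgW⟩
        refine ⟨f, g, hi, hr, fun x hx => (hfU x hx).1, fun e he => (hgW e he).1, h2, ?_⟩
        have := (hfU M.root₂ h2).2
        simpa [BirootedGraph.markSecond] using this
      · rintro ⟨f, g, hi, hr, hfU, hgW, -, hr2⟩
        refine ⟨f, g, hi, hr, fun x hx => ⟨hfU x hx, ?_⟩, fun e he => ⟨hgW e he, trivial⟩⟩
        change decide (f x = N.root₂) = decide (x = M.root₂)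
        rw [← hr2]
        exact decide_eq_decide.2 ⟨fun h' => hi.vert.injOn hx h2 h', fun h' => h' ▸ rfl⟩
    · convert @isOpen_empty _ (TopologicalSpace.induced markSecond inferInstance)
      refine eq_empty_of_forall_notMem fun q hq => ?_
      obtain ⟨N, rfl⟩ := BirootedGraph.exists_cls_eq q
      obtain ⟨f, g, hi, hr, hfU, hgW, h2', hr2⟩ := cls_mem_bicylinder_iff.1 hq
      exact h2 h2'

instance secondCountable_birootedSpace [SecondCountableTopology X] :
    SecondCountableTopology (BirootedSpace X) :=
  isInducing_markSecond.secondCountableTopology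

instance t0Space_birootedSpace [T1Space X] : T0Space (BirootedSpace X) := by
  have : T0Space (RootedSpace (X × Bool)) := inferInstance
  exact IsEmbedding.t0Space ⟨isInducing_markSecond, markSecond_injective⟩

end Topology

/-! ### Measurable structure on labelled graphs -/

/-- A Borel set is closed for some Polish topology with the same Borel sets. The topology that it
induces along `f` makes `f` a closed embedding. -/
theorem standardBorelSpace_comap {α β : Type*} [mβ : MeasurableSpace β] [StandardBorelSpace β]
    {f : α → β} (hf : Function.Injective f) (hr : MeasurableSet (range f)) :
    @StandardBorelSpace α (mβ.comap f) := by
  obtain ⟨τ, hb, hp, hc, -⟩ := hr.isClopenable'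
  let := mβ.comap f
  let := τ.induced f
  have he : IsClosedEmbedding f := ⟨⟨⟨rfl⟩, hf⟩, hc⟩
  have := he.polishSpace
  have : BorelSpace α := ⟨by rw [borel_comap, ← hb.measurable_eq]⟩
  infer_instance

section Measurable

variable [MeasurableSpace X] [MeasurableSpace Y]

/-- The coordinates of a marked graph. -/
def MarkedGraph.coords (N : MarkedGraph X) :
    ((ℕ → Prop) × (ℕ → ℕ → ℕ → Prop)) × ((ℕ → X) × (ℕ → X)) :=
  ((fun v => v ∈ N.graph.vertexSet, fun e x y => N.graph.IsLink e x y), (N.vmark, N.emark))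

instance : MeasurableSpace (MarkedGraph X) := MeasurableSpace.comap MarkedGraph.coords inferInstance

instance : MeasurableSpace (RootedGraph X) :=
  MeasurableSpace.comap (fun N => (N.toMarkedGraph, N.root)) inferInstance

instance : MeasurableSpace (BirootedGraph X) :=
  MeasurableSpace.comap (fun N => (N.toMarkedGraph, N.root₁, N.root₂)) inferInstance

omit [MeasurableSpace X] in
theorem MarkedGraph.coords_injective : Function.Injective (MarkedGraph.coords (X := X)) := by
  rintro ⟨G, vm, em, _, _⟩ ⟨G', vm', em', _, _⟩ h
  simp only [coords, Prod.mk.injEq] at h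
  obtain ⟨⟨h1, h2⟩, rfl, rfl⟩ := h
  have : G = G' := graph_ext (Set.ext fun x => iff_of_eq (congrFun h1 x)) fun e x y =>
    iff_of_eq (congrFun (congrFun (congrFun h2 e) x) y)
  subst this
  rfl

variable {Ω : Type*} [MeasurableSpace Ω]

theorem measurable_pair_iff {α β : Type*} [MeasurableSpace α] [MeasurableSpace β] {f : Ω → α}
    {g : Ω → β} : (Measurable fun a => (f a, g a)) ↔ Measurable f ∧ Measurable g :=
  ⟨fun h => ⟨h.fst, h.snd⟩, fun h => h.1.prodMk h.2⟩

theorem measurable_markedGraph_iff {F : Ω → MarkedGraph X} : Measurable F ↔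
    (∀ v, Measurable fun a => v ∈ (F a).graph.vertexSet) ∧
    (∀ e x y, Measurable fun a => (F a).graph.IsLink e x y) ∧
    (∀ v, Measurable fun a => (F a).vmark v) ∧ (∀ e, Measurable fun a => (F a).emark e) := by
  rw [measurable_comap_iff]
  simp only [Function.comp_def, MarkedGraph.coords, measurable_pair_iff]
  constructor
  · rintro ⟨⟨h1, h2⟩, h3, h4⟩
    refine ⟨fun v => measurable_pi_iff.1 h1 v, fun e x y => ?_, fun v => measurable_pi_iff.1 h3 v,
      fun v => measurable_pi_iff.1 h4 v⟩
    exact measurable_pi_iff.1 (measurable_pi_iff.1 (measurable_pi_iff.1 h2 e) x) y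
  · rintro ⟨h1, h2, h3, h4⟩
    exact ⟨⟨measurable_pi_iff.2 h1, measurable_pi_iff.2 fun e => measurable_pi_iff.2 fun x =>
      measurable_pi_iff.2 fun y => h2 e x y⟩, measurable_pi_iff.2 h3, measurable_pi_iff.2 h4⟩

theorem measurable_rootedGraph_iff {F : Ω → RootedGraph X} : Measurable F ↔
    (Measurable fun a => (F a).toMarkedGraph) ∧ Measurable fun a => (F a).root := by
  rw [measurable_comap_iff, Function.comp_def, measurable_pair_iff]

theorem measurable_birootedGraph_iff {F : Ω → BirootedGraph X} : Measurable F ↔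
    (Measurable fun a => (F a).toMarkedGraph) ∧ (Measurable fun a => (F a).root₁) ∧
      Measurable fun a => (F a).root₂ := by
  rw [measurable_comap_iff, Function.comp_def, measurable_pair_iff, measurable_pair_iff]

@[fun_prop]
theorem RootedGraph.measurable_toMarkedGraph :
    Measurable (RootedGraph.toMarkedGraph (X := X)) := (measurable_rootedGraph_iff.1 measurable_id).1

@[fun_prop]
theorem RootedGraph.measurable_root :
    Measurable (RootedGraph.root (X := X)) := (measurable_rootedGraph_iff.1 measurable_id).2

@[fun_prop]
theorem BirootedGraph.measurable_toMarkedGraph :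
    Measurable (BirootedGraph.toMarkedGraph (X := X)) :=
  (measurable_birootedGraph_iff.1 measurable_id).1

@[fun_prop]
theorem BirootedGraph.measurable_root₁ :
    Measurable (BirootedGraph.root₁ (X := X)) := (measurable_birootedGraph_iff.1 measurable_id).2.1

@[fun_prop]
theorem BirootedGraph.measurable_root₂ :
    Measurable (BirootedGraph.root₂ (X := X)) := (measurable_birootedGraph_iff.1 measurable_id).2.2

variable {F : Ω → MarkedGraph X}

/-- Evaluation of a measurable family at a measurable index in a countable type. -/
theorem measurable_apply_countable {ι α : Type*} [Countable ι] [MeasurableSpace ι]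
    [MeasurableSingletonClass ι] [MeasurableSpace α] {F : Ω → ι → α} {i : Ω → ι}
    (hF : ∀ j, Measurable fun a => F a j) (hi : Measurable i) : Measurable fun a => F a (i a) := by
  have : Measurable fun p : Ω × ι => F p.1 p.2 :=
    measurable_from_prod_countable_left fun j => hF j
  exact this.comp (measurable_id.prodMk hi)

@[fun_prop]
theorem measurable_mem_vertexSet (hF : Measurable F) {v : Ω → ℕ} (hv : Measurable v) :
    Measurable fun a => v a ∈ (F a).graph.vertexSet :=
  measurable_apply_countable (measurable_markedGraph_iff.1 hF).1 hv

@[fun_prop]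
theorem measurable_isLink (hF : Measurable F) {e x y : Ω → ℕ} (he : Measurable e)
    (hx : Measurable x) (hy : Measurable y) :
    Measurable fun a => (F a).graph.IsLink (e a) (x a) (y a) :=
  measurable_apply_countable (F := fun a (p : ℕ × ℕ × ℕ) => (F a).graph.IsLink p.1 p.2.1 p.2.2)
    (i := fun a => (e a, x a, y a))
    (fun p => (measurable_markedGraph_iff.1 hF).2.1 p.1 p.2.1 p.2.2) (by fun_prop)

@[fun_prop]
theorem measurable_vmark (hF : Measurable F) {v : Ω → ℕ} (hv : Measurable v) :
    Measurable fun a => (F a).vmark (v a) :=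
  measurable_apply_countable (measurable_markedGraph_iff.1 hF).2.2.1 hv

@[fun_prop]
theorem measurable_emark (hF : Measurable F) {v : Ω → ℕ} (hv : Measurable v) :
    Measurable fun a => (F a).emark (v a) :=
  measurable_apply_countable (measurable_markedGraph_iff.1 hF).2.2.2 hv

@[fun_prop]
theorem measurable_inc (hF : Measurable F) {e x : Ω → ℕ} (he : Measurable e)
    (hx : Measurable x) : Measurable fun a => (F a).graph.Inc (e a) (x a) := by
  unfold Graph.Inc; fun_prop

@[fun_prop]
theorem measurable_adj (hF : Measurable F) {e x : Ω → ℕ} (he : Measurable e)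
    (hx : Measurable x) : Measurable fun a => (F a).graph.Adj (e a) (x a) := by
  unfold Graph.Adj; fun_prop

@[fun_prop]
theorem measurable_mem_edgeSet (hF : Measurable F) {e : Ω → ℕ} (he : Measurable e) :
    Measurable fun a => e a ∈ (F a).graph.edgeSet := by
  simp only [Graph.edge_mem_iff_exists_isLink]; fun_prop

/-- Balls of a measurable family of graphs. -/
theorem measurable_mem_ballSet_of_adj {Γ : Ω → Graph ℕ ℕ}
    (h : ∀ x y, Measurable fun a => (Γ a).Adj x y) {u x : Ω → ℕ} (hu : Measurable u)
    (hx : Measurable x) (R : ℕ) : Measurable fun a => x a ∈ ballSet (Γ a) (u a) R := by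
  have key : ∀ R x u, Measurable fun a => x ∈ ballSet (Γ a) u R := by
    intro R
    induction R with
    | zero => exact fun x u => measurable_const
    | succ R ih =>
      intro x u
      simp only [mem_ballSet_succ]
      fun_prop
  exact measurable_apply_countable (F := fun a (p : ℕ × ℕ) => p.2 ∈ ballSet (Γ a) p.1 R)
    (i := fun a => (u a, x a)) (fun p => key R p.2 p.1) (by fun_prop)

@[fun_prop]
theorem measurable_mem_ballSet (hF : Measurable F) {u x R : Ω → ℕ} (hu : Measurable u)
    (hx : Measurable x) (hR : Measurable R) :
    Measurable fun a => x a ∈ ballSet (F a).graph (u a) (R a) :=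
  measurable_apply_countable (F := fun a S => x a ∈ ballSet (F a).graph (u a) S)
    (fun S => measurable_mem_ballSet_of_adj (fun _ _ => by fun_prop) hu hx S) hR

/-- The coordinates map injectively onto a Borel set. Local finiteness is a bound on the labels of
incident edges and connectedness is membership in some ball, so only countable quantifiers occur. -/
instance [StandardBorelSpace X] : StandardBorelSpace (MarkedGraph X) := by
  let T := ((ℕ → Prop) × (ℕ → ℕ → ℕ → Prop)) × ((ℕ → X) × (ℕ → X))
  let L : T → ℕ → ℕ → ℕ → Prop := fun t => t.1.2
  let V : T → ℕ → Prop := fun t => t.1.1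
  have hL : ∀ e x y, Measurable fun t => L t e x y := fun e x y => by
    dsimp only [L]; fun_prop
  have hV : ∀ x, Measurable fun t => V t x := fun x => by
    dsimp only [V]; fun_prop
  let B : T → ℕ → ℕ → ℕ → Prop := fun t v R => Nat.rec (fun w => w = v)
    (fun _ P w => P w ∨ ∃ x, P x ∧ ∃ e, L t e x w) R
  have hB : ∀ R v w, Measurable fun t => B t v R w := by
    intro R
    induction R with
    | zero => exact fun _ _ => measurable_const
    | succ R ih =>
      intro v w
      change Measurable fun t => B t v R w ∨ ∃ x, B t v R x ∧ ∃ e, L t e x w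
      fun_prop
  let S : Set T := {t | (∀ e x y, L t e x y → L t e y x) ∧
    (∀ e x y v w, L t e x y → L t e v w → x = v ∨ x = w) ∧
    (∀ e x y, L t e x y → V t x) ∧
    (∀ v, V t v → ∃ n, ∀ e, (∃ y, L t e v y) → e ≤ n) ∧
    (∀ v, V t v → ∀ w, V t w → ∃ R, B t v R w)}
  have hS : MeasurableSet S := measurableSet_setOfPred.2 (by fun_prop)
  have hr : range (MarkedGraph.coords (X := X)) = S := by
    ext t
    have hBB : ∀ (G : Graph ℕ ℕ), (∀ e x y, G.IsLink e x y ↔ L t e x y) →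
        ∀ R v w, w ∈ ballSet G v R ↔ B t v R w := by
      intro G hG R
      induction R with
      | zero => exact fun v w => Iff.rfl
      | succ R ih =>
        intro v w
        rw [mem_ballSet_succ]
        change _ ↔ B t v R w ∨ ∃ x, B t v R x ∧ ∃ e, L t e x w
        simp only [ih, Graph.Adj, hG]
    constructor
    · rintro ⟨N, rfl⟩
      refine ⟨fun e x y h => h.symm, fun e x y v w h h' => h.left_eq_or_eq h',
        fun e x y h => h.left_mem, fun v hv => ?_, fun v hv w hw => ?_⟩
      · obtain ⟨n, hn⟩ := (N.locallyFinite v hv).bddAbove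
        exact ⟨n, fun e he => hn he⟩
      · obtain ⟨R, hR⟩ := exists_mem_ballSet_iff.2 (N.connected v hv w hw)
        exact ⟨R, (hBB N.graph (fun _ _ _ => Iff.rfl) R v w).1 hR⟩
    · rintro ⟨h1, h2, h3, h4, h5⟩
      let G : Graph ℕ ℕ :=
        { vertexSet := {x | V t x}
          IsLink := L t
          isLink_symm := fun e _ => ⟨fun x y => h1 e x y⟩
          eq_or_eq_of_isLink_of_isLink := fun e x y v w => h2 e x y v w
          left_mem_of_isLink := fun e x y h => h3 e x y h }
      refine ⟨⟨G, t.2.1, t.2.2, fun v hv => ?_, fun v hv w hw => ?_⟩, rfl⟩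
      · obtain ⟨n, hn⟩ := h4 v hv
        exact (finite_Iic n).subset fun e he => hn e he
      · obtain ⟨R, hR⟩ := h5 v hv w hw
        exact exists_mem_ballSet_iff.1 ⟨R, (hBB G (fun _ _ _ => Iff.rfl) R v w).2 hR⟩
  exact standardBorelSpace_comap MarkedGraph.coords_injective (hr ▸ hS)

instance [StandardBorelSpace X] : StandardBorelSpace (RootedGraph X) := by
  refine standardBorelSpace_comap (f := fun N : RootedGraph X => (N.toMarkedGraph, N.root))
    (fun M N h => ?_) ?_
  · cases M; cases N; simp_all
  · have : range (fun N : RootedGraph X => (N.toMarkedGraph, N.root)) =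
        {p | p.2 ∈ p.1.graph.vertexSet} := by
      ext ⟨M, v⟩
      exact ⟨fun ⟨N, hN⟩ => by cases hN; exact N.root_mem, fun h => ⟨⟨M, v, h⟩, rfl⟩⟩
    rw [this]
    exact measurableSet_setOfPred.2 (by fun_prop)

instance [StandardBorelSpace X] : StandardBorelSpace (BirootedGraph X) := by
  refine standardBorelSpace_comap
    (f := fun N : BirootedGraph X => (N.toMarkedGraph, N.root₁, N.root₂)) (fun M N h => ?_) ?_
  · cases M; cases N; simp_all
  · have : range (fun N : BirootedGraph X => (N.toMarkedGraph, N.root₁, N.root₂)) =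
        {p | p.2.1 ∈ p.1.graph.vertexSet ∧ p.2.2 ∈ p.1.graph.vertexSet} := by
      ext ⟨M, v, w⟩
      exact ⟨fun ⟨N, hN⟩ => by cases hN; exact ⟨N.root₁_mem, N.root₂_mem⟩,
        fun h => ⟨⟨M, v, w, h.1, h.2⟩, rfl⟩⟩
    rw [this]
    exact measurableSet_setOfPred.2 (by fun_prop)

end Measurable

end

section

variable {X Y Z : Type}

/-! ### Measurability on the spaces of isomorphism classes -/

section Descent

variable [TopologicalSpace X] [MeasurableSpace X] [BorelSpace X]

/-- The preimage of a cylinder is a countable union, over pairs of maps from the finite ball of `M`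
to labels, of events given by countably many coordinates. -/
theorem RootedGraph.measurable_cls [SecondCountableTopology X] :
    Measurable (RootedGraph.cls (X := X)) := by
  suffices H : @Measurable _ _ _ (MeasurableSpace.generateFrom
      {A : Set (RootedSpace X) | ∃ M R U W, (∀ n, IsOpen (U n)) ∧ (∀ n, IsOpen (W n)) ∧
        A = cylinder M R U W}) (RootedGraph.cls (X := X)) by
    intro t ht
    have ht' : MeasurableSet[borel (RootedSpace X)] t := ht
    rw [borel_eq_generateFrom_of_subbasis rfl] at ht'
    exact H ht'
  refine measurable_generateFrom ?_
  rintro _ ⟨M, R, U, W, hU, hW, rfl⟩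
  have hfV := M.ballSet_finite R
  have hfE := M.ball_edgeSet_finite R
  have := hfV.to_subtype
  have := hfE.to_subtype
  let B := ball M.graph M.root R
  have hUm := fun x => (hU x).measurableSet
  have hWm := fun x => (hW x).measurableSet
  have key : RootedGraph.cls ⁻¹' cylinder M R U W =
      ⋃ (f : ballSet M.graph M.root R → ℕ) (g : B.edgeSet → ℕ),
      {N | (f ⟨M.root, mem_ballSet _ _ R⟩ = N.root) ∧
        (∀ x y, f x = f y → x = y) ∧ (∀ y, y ∈ ballSet N.graph N.root R ↔ ∃ x, f x = y) ∧
        (∀ x y, g x = g y → x = y) ∧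
        (∀ e, (∃ x y, N.graph.IsLink e x y ∧ x ∈ ballSet N.graph N.root R ∧
          y ∈ ballSet N.graph N.root R) ↔ ∃ d, g d = e) ∧
        (∀ (e : B.edgeSet) (x y : ballSet M.graph M.root R), B.IsLink e x y →
          N.graph.IsLink (g e) (f x) (f y)) ∧
        (∀ x : ballSet M.graph M.root R, N.vmark (f x) ∈ U x) ∧
        ∀ e : B.edgeSet, N.emark (g e) ∈ W e} := by
    ext N
    simp only [mem_preimage, cls_mem_cylinder_iff, mem_iUnion, mem_ofPred_eq]
    constructor
    · rintro ⟨f, g, hi, hr, hfU, hgW⟩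
      refine ⟨fun x => f x, fun e => g e, hr, fun x y h => Subtype.ext (hi.vert.injOn x.2 y.2 h),
        fun y => ⟨fun hy => ?_, ?_⟩, fun x y h => Subtype.ext (hi.edge.injOn x.2 y.2 h),
        fun e => ⟨fun he => ?_, ?_⟩, fun e x y hl => (hi.link hl).1, fun x => hfU x x.2,
        fun e => hgW e e.2⟩
      · obtain ⟨x, hx, h⟩ := hi.vert.surjOn hy
        exact ⟨⟨x, hx⟩, h⟩
      · rintro ⟨x, rfl⟩
        exact hi.vert.mapsTo x.2
      · obtain ⟨x, hx, h⟩ := hi.edge.surjOn he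
        exact ⟨⟨x, hx⟩, h⟩
      · rintro ⟨x, rfl⟩
        exact hi.edge.mapsTo x.2
    · rintro ⟨f, g, hr, h1, h2, h3, h4, h5, h6, h7⟩
      classical
      let f' : ℕ → ℕ := fun x => if h : x ∈ ballSet M.graph M.root R then f ⟨x, h⟩ else 0
      let g' : ℕ → ℕ := fun x => if h : x ∈ B.edgeSet then g ⟨x, h⟩ else 0
      have hf' : ∀ x (h : x ∈ ballSet M.graph M.root R), f' x = f ⟨x, h⟩ := fun x h => dif_pos h
      have hg' : ∀ x (h : x ∈ B.edgeSet), g' x = g ⟨x, h⟩ := fun x h => dif_pos h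
      refine ⟨f', g', ⟨⟨fun x hx => ?_, fun x hx y hy h => ?_, fun y hy => ?_⟩,
        ⟨fun x hx => ?_, fun x hx y hy h => ?_, fun y hy => ?_⟩, fun {e x y} hl => ?_⟩, ?_,
        fun x hx => ?_, fun e he => ?_⟩
      · exact (h2 _).2 ⟨_, (hf' x hx).symm⟩
      · rw [hf' x hx, hf' y hy] at h
        exact congrArg Subtype.val (h1 _ _ h)
      · obtain ⟨x, rfl⟩ := (h2 y).1 hy
        exact ⟨x, x.2, hf' x x.2⟩
      · exact (h4 _).2 ⟨_, (hg' x hx).symm⟩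
      · rw [hg' x hx, hg' y hy] at h
        exact congrArg Subtype.val (h3 _ _ h)
      · obtain ⟨x, rfl⟩ := (h4 y).1 hy
        exact ⟨x, x.2, hg' x x.2⟩
      · rw [hf' x hl.2.1, hf' y hl.2.2, hg' e hl.edge_mem]
        exact ⟨h5 ⟨e, hl.edge_mem⟩ ⟨x, hl.2.1⟩ ⟨y, hl.2.2⟩ hl, (h2 _).2 ⟨_, rfl⟩, (h2 _).2 ⟨_, rfl⟩⟩
      · rw [← hr]; exact hf' _ _
      · rw [hf' x hx]; exact h6 ⟨x, hx⟩
      · rw [hg' e he]; exact h7 ⟨e, he⟩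
  rw [key]
  refine MeasurableSet.iUnion fun f => MeasurableSet.iUnion fun g => measurableSet_setOfPred.2 ?_
  have hm1 : ∀ x : ballSet M.graph M.root R, Measurable fun N : RootedGraph X =>
      N.vmark (f x) ∈ U x := fun x =>
    measurableSet_setOfPred.1 ((hUm x).preimage
      (measurable_vmark RootedGraph.measurable_toMarkedGraph measurable_const))
  have hm2 : ∀ x : B.edgeSet, Measurable fun N : RootedGraph X =>
      N.emark (g x) ∈ W x := fun x =>
    measurableSet_setOfPred.1 ((hWm x).preimage
      (measurable_emark RootedGraph.measurable_toMarkedGraph measurable_const))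
  have hm3 : ∀ n : ℕ, Measurable fun N : RootedGraph X => n = N.root := fun n =>
    measurableSet_setOfPred.1 (measurableSet_eq_fun measurable_const (by fun_prop))
  have hm4 : ∀ y, Measurable fun N : RootedGraph X => y ∈ ballSet N.graph N.root R := fun y =>
    measurable_mem_ballSet RootedGraph.measurable_toMarkedGraph (by fun_prop) (by fun_prop)
      (by fun_prop)
  have hm5 : ∀ e x y, Measurable fun N : RootedGraph X => N.graph.IsLink e x y := fun e x y =>
    measurable_isLink RootedGraph.measurable_toMarkedGraph (by fun_prop) (by fun_prop)
      (by fun_prop)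
  fun_prop

omit [TopologicalSpace X] [BorelSpace X] in
theorem BirootedGraph.measurable_markSecond :
    Measurable (BirootedGraph.markSecond (X := X)) := by
  rw [measurable_rootedGraph_iff, measurable_markedGraph_iff]
  have h := BirootedGraph.measurable_toMarkedGraph (X := X)
  refine ⟨⟨fun v => measurable_mem_vertexSet h measurable_const, fun e x y =>
    measurable_isLink h measurable_const measurable_const measurable_const, fun v =>
    (measurable_vmark h measurable_const).prodMk ?_, fun e =>
    (measurable_emark h measurable_const).prodMk measurable_const⟩, BirootedGraph.measurable_root₁⟩
  have : Measurable fun n : ℕ => decide (v = n) := measurable_from_top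
  exact this.comp BirootedGraph.measurable_root₂

theorem BirootedGraph.measurable_cls [SecondCountableTopology X] :
    Measurable (BirootedGraph.cls (X := X)) := by
  have hb : borel (BirootedSpace X) =
      MeasurableSpace.comap UnimodularGraph.markSecond (borel (RootedSpace (X × Bool))) := by
    rw [isInducing_markSecond.eq_induced]
    exact borel_comap
  intro t ht
  have ht' : MeasurableSet[borel (BirootedSpace X)] t := ht
  rw [hb] at ht'
  obtain ⟨s, hs, rfl⟩ := ht'
  exact (RootedGraph.measurable_cls.comp BirootedGraph.measurable_markSecond) hs

variable [PolishSpace X] {β : Type*} [MeasurableSpace β]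

/-- The class map is a measurable surjection from a standard Borel space onto a countably separated
one, so separation of analytic sets lets measurability be checked on representatives. No measurable
choice of representatives is needed. -/
theorem measurable_of_comp_cls {h : RootedSpace X → β} (hh : Measurable fun N => h (RootedGraph.cls N)) :
    Measurable h :=
  (RootedGraph.measurable_cls.measurable_comp_iff_of_surjective RootedGraph.exists_cls_eq).1 hh

theorem measurable_of_comp_bicls {h : BirootedSpace X → β}
    (hh : Measurable fun N => h (BirootedGraph.cls N)) : Measurable h :=
  (BirootedGraph.measurable_cls.measurable_comp_iff_of_surjective BirootedGraph.exists_cls_eq).1 hh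

end Descent

/-! ### Rerooting and sums over vertices -/

open scoped Classical in
/-- Reroot at a vertex; nothing happens if the label is not a vertex. -/
def RootedGraph.at' (N : RootedGraph X) (v : ℕ) : RootedGraph X :=
  if h : v ∈ N.graph.vertexSet then N.reroot ⟨v, h⟩ else N

theorem RootedGraph.at'_eq {N : RootedGraph X} {v : ℕ} (h : v ∈ N.graph.vertexSet) :
    N.at' v = N.reroot ⟨v, h⟩ := dif_pos h

theorem RootedGraph.at'_toMarkedGraph (N : RootedGraph X) (v : ℕ) :
    (N.at' v).toMarkedGraph = N.toMarkedGraph := by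
  unfold RootedGraph.at'; split_ifs <;> rfl

theorem RootedGraph.at'_root {N : RootedGraph X} {v : ℕ} (h : v ∈ N.graph.vertexSet) :
    (N.at' v).root = v := by rw [at'_eq h]; rfl

open scoped Classical in
/-- Choose two roots; the default is used if one of the labels is not a vertex. -/
def RootedGraph.bi (N : RootedGraph X) (u v : ℕ) : BirootedGraph X :=
  if h : u ∈ N.graph.vertexSet ∧ v ∈ N.graph.vertexSet then N.biroot ⟨u, h.1⟩ ⟨v, h.2⟩
  else N.biroot ⟨N.root, N.root_mem⟩ ⟨N.root, N.root_mem⟩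

theorem RootedGraph.bi_eq {N : RootedGraph X} {u v : ℕ} (hu : u ∈ N.graph.vertexSet)
    (hv : v ∈ N.graph.vertexSet) : N.bi u v = N.biroot ⟨u, hu⟩ ⟨v, hv⟩ := dif_pos ⟨hu, hv⟩

theorem RootedGraph.bi_toMarkedGraph (N : RootedGraph X) (u v : ℕ) :
    (N.bi u v).toMarkedGraph = N.toMarkedGraph := by
  unfold RootedGraph.bi; split_ifs <;> rfl

theorem RootedGraph.bi_root₁ {N : RootedGraph X} {u v : ℕ} (hu : u ∈ N.graph.vertexSet)
    (hv : v ∈ N.graph.vertexSet) : (N.bi u v).root₁ = u := by rw [bi_eq hu hv]; rfl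

theorem RootedGraph.bi_root₂ {N : RootedGraph X} {u v : ℕ} (hu : u ∈ N.graph.vertexSet)
    (hv : v ∈ N.graph.vertexSet) : (N.bi u v).root₂ = v := by rw [bi_eq hu hv]; rfl

/-- Forget the second root. -/
def BirootedGraph.first (N : BirootedGraph X) : RootedGraph X :=
  { toMarkedGraph := N.toMarkedGraph, root := N.root₁, root_mem := N.root₁_mem }

/-- Forget the first root. -/
def BirootedGraph.second (N : BirootedGraph X) : RootedGraph X :=
  { toMarkedGraph := N.toMarkedGraph, root := N.root₂, root_mem := N.root₂_mem }

theorem RootedGraph.first_bi {N : RootedGraph X} {u v : ℕ} (hu : u ∈ N.graph.vertexSet)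
    (hv : v ∈ N.graph.vertexSet) : (N.bi u v).first = N.at' u := by
  rw [bi_eq hu hv, at'_eq hu]; rfl

theorem RootedGraph.second_bi {N : RootedGraph X} {u v : ℕ} (hu : u ∈ N.graph.vertexSet)
    (hv : v ∈ N.graph.vertexSet) : (N.bi u v).second = N.at' v := by
  rw [bi_eq hu hv, at'_eq hv]; rfl

theorem RootedGraph.at'_self (N : RootedGraph X) : N.at' N.root = N := by
  rw [at'_eq N.root_mem]; rfl

def secondCls : BirootedSpace X → RootedSpace X :=
  Quotient.map BirootedGraph.second fun _ _ ⟨φ, h, _, hs⟩ => ⟨φ, h, hs⟩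

theorem secondCls_cls (N : BirootedGraph X) : secondCls N.cls = N.second.cls := rfl

/-- A sum over vertices as a sum over labels. -/
def vsum (N : MarkedGraph X) (h : ℕ → ℝ≥0∞) : ℝ≥0∞ :=
  ∑' v : ℕ, N.graph.vertexSet.indicator h v

theorem vsum_congr {N : MarkedGraph X} {h h' : ℕ → ℝ≥0∞} (H : ∀ v ∈ N.graph.vertexSet, h v = h' v) :
    vsum N h = vsum N h' := by
  unfold vsum
  rw [indicator_congr H]

theorem tsum_vertex_eq_vsum (N : MarkedGraph X) (h : ℕ → ℝ≥0∞) :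
    ∑' v : N.graph.vertexSet, h v = vsum N h := tsum_subtype _ _

theorem massOut_cls (f : BirootedSpace X → ℝ≥0∞) (N : RootedGraph X) :
    massOut f N.cls = vsum N.toMarkedGraph fun v => f (N.bi N.root v).cls := by
  rw [← tsum_vertex_eq_vsum]
  exact tsum_congr fun v => by rw [RootedGraph.bi_eq N.root_mem v.2]

theorem massIn_cls (f : BirootedSpace X → ℝ≥0∞) (N : RootedGraph X) :
    massIn f N.cls = vsum N.toMarkedGraph fun v => f (N.bi v N.root).cls := by
  rw [← tsum_vertex_eq_vsum]
  exact tsum_congr fun v => by rw [RootedGraph.bi_eq v.2 N.root_mem]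

section Measurable

variable [MeasurableSpace X] {Ω : Type*} [MeasurableSpace Ω]

theorem measurable_at' {F : Ω → RootedGraph X} (hF : Measurable F) {v : Ω → ℕ}
    (hv : Measurable v) : Measurable fun a => (F a).at' (v a) := by
  classical
  rw [measurable_rootedGraph_iff]
  simp only [RootedGraph.at'_toMarkedGraph]
  have hm : Measurable fun a => (F a).toMarkedGraph := RootedGraph.measurable_toMarkedGraph.comp hF
  refine ⟨hm, ?_⟩
  have : (fun a => ((F a).at' (v a)).root) = fun a =>
      if v a ∈ (F a).graph.vertexSet then v a else (F a).root := by
    ext a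
    unfold RootedGraph.at'; split_ifs <;> rfl
  rw [this]
  exact Measurable.ite (measurableSet_setOfPred.2 (measurable_mem_vertexSet hm hv)) hv
    (RootedGraph.measurable_root.comp hF)

theorem measurable_bi {F : Ω → RootedGraph X} (hF : Measurable F) {u v : Ω → ℕ}
    (hu : Measurable u) (hv : Measurable v) : Measurable fun a => (F a).bi (u a) (v a) := by
  classical
  rw [measurable_birootedGraph_iff]
  simp only [RootedGraph.bi_toMarkedGraph]
  have hm : Measurable fun a => (F a).toMarkedGraph := RootedGraph.measurable_toMarkedGraph.comp hF
  have hs : MeasurableSet {a | u a ∈ (F a).graph.vertexSet ∧ v a ∈ (F a).graph.vertexSet} :=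
    measurableSet_setOfPred.2 ((measurable_mem_vertexSet hm hu).and (measurable_mem_vertexSet hm hv))
  have h1 : (fun a => ((F a).bi (u a) (v a)).root₁) = fun a =>
      if u a ∈ (F a).graph.vertexSet ∧ v a ∈ (F a).graph.vertexSet then u a else (F a).root := by
    ext a
    unfold RootedGraph.bi; split_ifs <;> rfl
  have h2 : (fun a => ((F a).bi (u a) (v a)).root₂) = fun a =>
      if u a ∈ (F a).graph.vertexSet ∧ v a ∈ (F a).graph.vertexSet then v a else (F a).root := by
    ext a
    unfold RootedGraph.bi; split_ifs <;> rfl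
  rw [h1, h2]
  exact ⟨hm, Measurable.ite hs hu (RootedGraph.measurable_root.comp hF),
    Measurable.ite hs hv (RootedGraph.measurable_root.comp hF)⟩

theorem BirootedGraph.measurable_first : Measurable (BirootedGraph.first (X := X)) :=
  measurable_rootedGraph_iff.2 ⟨measurable_toMarkedGraph, measurable_root₁⟩

theorem BirootedGraph.measurable_second : Measurable (BirootedGraph.second (X := X)) :=
  measurable_rootedGraph_iff.2 ⟨measurable_toMarkedGraph, measurable_root₂⟩

theorem measurable_vsum {F : Ω → MarkedGraph X} (hF : Measurable F) {h : Ω → ℕ → ℝ≥0∞}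
    (hh : ∀ v, Measurable fun a => h a v) : Measurable fun a => vsum (F a) (h a) := by
  unfold vsum
  refine Measurable.tsum fun v => ?_
  classical
  simp only [indicator_apply]
  exact Measurable.ite (measurableSet_setOfPred.2 (measurable_mem_vertexSet hF measurable_const))
    (hh v) measurable_const

end Measurable

section Mass

variable [TopologicalSpace X] [PolishSpace X] [MeasurableSpace X] [BorelSpace X]

theorem measurable_secondCls : Measurable (secondCls (X := X)) :=
  measurable_of_comp_bicls (RootedGraph.measurable_cls.comp BirootedGraph.measurable_second)

theorem measurable_massOut {f : BirootedSpace X → ℝ≥0∞} (hf : Measurable f) :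
    Measurable (massOut f) := by
  refine measurable_of_comp_cls ?_
  simp only [massOut_cls]
  exact measurable_vsum RootedGraph.measurable_toMarkedGraph fun v =>
    hf.comp (BirootedGraph.measurable_cls.comp
      (measurable_bi measurable_id RootedGraph.measurable_root measurable_const))

theorem measurable_massIn {f : BirootedSpace X → ℝ≥0∞} (hf : Measurable f) :
    Measurable (massIn f) := by
  refine measurable_of_comp_cls ?_
  simp only [massIn_cls]
  exact measurable_vsum RootedGraph.measurable_toMarkedGraph fun v =>
    hf.comp (BirootedGraph.measurable_cls.comp
      (measurable_bi measurable_id measurable_const RootedGraph.measurable_root))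

end Mass

/-- The mass transport principle for measures. -/
def Uni [TopologicalSpace X] (P : Measure (RootedSpace X)) : Prop :=
  ∀ f : BirootedSpace X → ℝ≥0∞, Measurable f → ∫⁻ q, massOut f q ∂P = ∫⁻ q, massIn f q ∂P

section Mass

variable [TopologicalSpace X] [PolishSpace X] [MeasurableSpace X] [BorelSpace X]

end Mass

/-! ### Functoriality in the marks -/

theorem mapMarks_cls (g : X → Y) (N : RootedGraph X) :
    mapMarks g N.cls = (N.mapMarks g).cls := rfl

/-- Apply a function to all marks of a birooted graph. -/
def BirootedGraph.mapMarks (g : X → Y) (N : BirootedGraph X) : BirootedGraph Y :=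
  (N.first.mapMarks g).bi N.root₁ N.root₂

theorem MIso.mapMarks {M N : RootedGraph X} {f g : ℕ → ℕ}
    (h : MIso M.toMarkedGraph N.toMarkedGraph f g) (k : X → Y) :
    MIso (M.mapMarks k).toMarkedGraph (N.mapMarks k).toMarkedGraph f g :=
  ⟨h.toIsIso, fun v hv => congrArg k (h.vmark v hv), fun v hv => congrArg k (h.emark v hv)⟩

theorem BirootedGraph.mapMarks_cls_eq {M N : BirootedGraph X} (h : M.cls = N.cls) (g : X → Y) :
    (M.mapMarks g).cls = (N.mapMarks g).cls := by
  obtain ⟨f, g', hi, hr, hs⟩ := BirootedGraph.cls_eq_iff.1 h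
  refine BirootedGraph.cls_eq_iff.2 ⟨f, g', ?_, ?_, ?_⟩
  · have := MIso.mapMarks (M := M.first) (N := N.first) hi g
    simpa only [mapMarks, RootedGraph.bi_toMarkedGraph] using this
  · unfold mapMarks
    rw [RootedGraph.bi_root₁, RootedGraph.bi_root₁, hr]
    exacts [N.root₁_mem, N.root₂_mem, M.root₁_mem, M.root₂_mem]
  · unfold mapMarks
    rw [RootedGraph.bi_root₂, RootedGraph.bi_root₂, hs]
    exacts [N.root₁_mem, N.root₂_mem, M.root₁_mem, M.root₂_mem]

def bimapMarks (g : X → Y) : BirootedSpace X → BirootedSpace Y :=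
  Quotient.lift (fun N => (N.mapMarks g).cls) fun _ _ h =>
    BirootedGraph.mapMarks_cls_eq (Quotient.sound h) g

theorem bimapMarks_cls (g : X → Y) (N : BirootedGraph X) :
    bimapMarks g N.cls = (N.mapMarks g).cls := rfl

theorem RootedGraph.bi_mapMarks (g : X → Y) (N : RootedGraph X) {u v : ℕ}
    (hu : u ∈ N.graph.vertexSet) (hv : v ∈ N.graph.vertexSet) :
    (N.bi u v).mapMarks g = (N.mapMarks g).bi u v := by
  rw [bi_eq hu hv, bi_eq (N := N.mapMarks g) hu hv]
  exact bi_eq (N := (N.biroot ⟨u, hu⟩ ⟨v, hv⟩).first.mapMarks g) hu hv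

theorem RootedGraph.measurable_mapMarks [MeasurableSpace X] [MeasurableSpace Y] {g : X → Y}
    (hg : Measurable g) : Measurable (RootedGraph.mapMarks g) := by
  rw [measurable_rootedGraph_iff, measurable_markedGraph_iff]
  have h := RootedGraph.measurable_toMarkedGraph (X := X)
  exact ⟨⟨fun v => measurable_mem_vertexSet h measurable_const, fun e x y =>
    measurable_isLink h measurable_const measurable_const measurable_const, fun v =>
    hg.comp (measurable_vmark h measurable_const), fun e =>
    hg.comp (measurable_emark h measurable_const)⟩, RootedGraph.measurable_root⟩

section

variable [TopologicalSpace X] [PolishSpace X] [MeasurableSpace X] [BorelSpace X]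
  [TopologicalSpace Y] [PolishSpace Y] [MeasurableSpace Y] [BorelSpace Y]

theorem measurable_mapMarks {g : X → Y} (hg : Measurable g) : Measurable (mapMarks g) :=
  measurable_of_comp_cls (RootedGraph.measurable_cls.comp (RootedGraph.measurable_mapMarks hg))

theorem measurable_bimapMarks {g : X → Y} (hg : Measurable g) : Measurable (bimapMarks g) :=
  measurable_of_comp_bicls (BirootedGraph.measurable_cls.comp (measurable_bi
    ((RootedGraph.measurable_mapMarks hg).comp BirootedGraph.measurable_first)
    BirootedGraph.measurable_root₁ BirootedGraph.measurable_root₂))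

theorem Uni.map_mapMarks {P : Measure (RootedSpace X)} (hP : Uni P) {g : X → Y}
    (hg : Measurable g) : Uni (P.map (mapMarks g)) := by
  intro f hf
  rw [lintegral_map (measurable_massOut hf) (measurable_mapMarks hg),
    lintegral_map (measurable_massIn hf) (measurable_mapMarks hg)]
  convert hP (f ∘ bimapMarks g) (hf.comp (measurable_bimapMarks hg)) using 2 with q
  · ext q
    obtain ⟨N, rfl⟩ := RootedGraph.exists_cls_eq q
    rw [mapMarks_cls, massOut_cls, massOut_cls]
    refine vsum_congr (N := N.toMarkedGraph) fun v hv => ?_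
    rw [Function.comp, bimapMarks_cls, RootedGraph.bi_mapMarks g N N.root_mem hv]
    rfl
  · ext q
    obtain ⟨N, rfl⟩ := RootedGraph.exists_cls_eq q
    rw [mapMarks_cls, massIn_cls, massIn_cls]
    refine vsum_congr (N := N.toMarkedGraph) fun v hv => ?_
    rw [Function.comp, bimapMarks_cls, RootedGraph.bi_mapMarks g N hv N.root_mem]
    rfl

end

end

section

variable {X Y Z : Type}

/-! ### Finite graphs with a uniform root -/

theorem vsum_comm (N : MarkedGraph X) (h : ℕ → ℕ → ℝ≥0∞) :
    vsum N (fun v => vsum N fun w => h v w) = vsum N fun w => vsum N fun v => h v w := by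
  simp only [← tsum_vertex_eq_vsum]
  exact ENNReal.tsum_comm

theorem vsum_mul_right (N : MarkedGraph X) (h : ℕ → ℝ≥0∞) (c : ℝ≥0∞) :
    vsum N (fun v => h v * c) = vsum N h * c := by
  simp only [← tsum_vertex_eq_vsum]
  exact ENNReal.tsum_mul_right

theorem vsum_add (N : MarkedGraph X) (h h' : ℕ → ℝ≥0∞) :
    vsum N (fun v => h v + h' v) = vsum N h + vsum N h' := by
  simp only [← tsum_vertex_eq_vsum]
  exact ENNReal.tsum_add

theorem vsum_iSup {h : ℕ → ℕ → ℝ≥0∞} (N : MarkedGraph X) (hm : Monotone h) :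
    vsum N (fun v => ⨆ n, h n v) = ⨆ n, vsum N (h n) := by
  simp only [← tsum_vertex_eq_vsum]
  simp only [← lintegral_count]
  exact lintegral_iSup (fun n => .of_discrete) fun a b hab v => hm hab v

/-- The number of vertices. -/
def vcard : RootedSpace X → ℝ≥0∞ := massOut fun _ => 1

theorem vcard_cls (N : RootedGraph X) : vcard N.cls = ENat.card N.graph.vertexSet := by
  rw [vcard, massOut_cls, ← tsum_vertex_eq_vsum]
  simp

theorem vcard_at' (N : RootedGraph X) (v : ℕ) : vcard (N.at' v).cls = vcard N.cls := by
  simp only [vcard, massOut_cls, RootedGraph.at'_toMarkedGraph]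

theorem vcard_ne_zero (q : RootedSpace X) : vcard q ≠ 0 := by
  obtain ⟨N, rfl⟩ := RootedGraph.exists_cls_eq q
  rw [vcard_cls]
  simpa using Set.nonempty_iff_ne_empty.1 ⟨_, N.root_mem⟩

theorem isFiniteGraph_cls_iff (N : RootedGraph X) :
    IsFiniteGraph N.cls ↔ N.graph.vertexSet.Finite := by
  constructor
  · rintro ⟨M, hM, hf⟩
    obtain ⟨f, g, h, -⟩ := RootedGraph.cls_eq_iff.1 hM
    exact h.vert.image_eq ▸ hf.image f
  · exact fun h => ⟨N, rfl, h⟩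

theorem vcard_ne_top_iff (q : RootedSpace X) : vcard q ≠ ⊤ ↔ IsFiniteGraph q := by
  obtain ⟨N, rfl⟩ := RootedGraph.exists_cls_eq q
  rw [vcard_cls, isFiniteGraph_cls_iff]
  simp

/-- The average of `g` over all choices of the root. -/
def rootAvg (g : RootedSpace X → ℝ≥0∞) (q : RootedSpace X) : ℝ≥0∞ :=
  massOut (fun b => g (secondCls b)) q / vcard q

theorem rootAvg_cls (g : RootedSpace X → ℝ≥0∞) (N : RootedGraph X) :
    rootAvg g N.cls = vsum N.toMarkedGraph (fun v => g (N.at' v).cls) / vcard N.cls := by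
  rw [rootAvg, massOut_cls, vsum_congr fun v hv => ?_]
  rw [secondCls_cls, RootedGraph.second_bi N.root_mem hv]

theorem rerootProb_eq_rootAvg (A : Set (RootedSpace X)) : rerootProb A = rootAvg (A.indicator 1) := by
  ext q
  obtain ⟨N, rfl⟩ := RootedGraph.exists_cls_eq q
  rw [rootAvg_cls, vcard_cls, ← tsum_vertex_eq_vsum]
  change (∑' v : N.graph.vertexSet, A.indicator 1 (N.reroot v).cls) /
        (ENat.card N.graph.vertexSet : ℝ≥0∞) = _
  congr 1
  exact tsum_congr fun v => by rw [RootedGraph.at'_eq v.2]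

theorem massOut_at'_eq (f : BirootedSpace X → ℝ≥0∞) {N : RootedGraph X} {v : ℕ}
    (hv : v ∈ N.graph.vertexSet) :
    massOut f (N.at' v).cls = vsum N.toMarkedGraph fun w => f (N.bi v w).cls := by
  rw [massOut_cls, RootedGraph.at'_toMarkedGraph]
  refine vsum_congr fun w hw => ?_
  rw [RootedGraph.at'_root hv, RootedGraph.bi_eq hv hw, RootedGraph.at'_eq hv]
  rw [RootedGraph.bi_eq (N := N.reroot ⟨v, hv⟩) hv hw]
  rfl

theorem massIn_at'_eq (f : BirootedSpace X → ℝ≥0∞) {N : RootedGraph X} {v : ℕ}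
    (hv : v ∈ N.graph.vertexSet) :
    massIn f (N.at' v).cls = vsum N.toMarkedGraph fun w => f (N.bi w v).cls := by
  rw [massIn_cls, RootedGraph.at'_toMarkedGraph]
  refine vsum_congr fun w hw => ?_
  rw [RootedGraph.at'_root hv, RootedGraph.bi_eq hw hv, RootedGraph.at'_eq hv]
  rw [RootedGraph.bi_eq (N := N.reroot ⟨v, hv⟩) hw hv]
  rfl

section

variable [TopologicalSpace X] [PolishSpace X] [MeasurableSpace X] [BorelSpace X]

theorem measurable_vcard : Measurable (vcard (X := X)) := measurable_massOut measurable_const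

theorem measurable_rootAvg {g : RootedSpace X → ℝ≥0∞} (hg : Measurable g) :
    Measurable (rootAvg g) :=
  (measurable_massOut (hg.comp measurable_secondCls)).div measurable_vcard

omit [TopologicalSpace X] [PolishSpace X] [MeasurableSpace X] [BorelSpace X] in
theorem rootAvg_add (g h : RootedSpace X → ℝ≥0∞) : rootAvg (g + h) = rootAvg g + rootAvg h := by
  ext q
  obtain ⟨N, rfl⟩ := RootedGraph.exists_cls_eq q
  simp only [rootAvg_cls, Pi.add_apply, vsum_add, ENNReal.add_div]

omit [TopologicalSpace X] [PolishSpace X] [MeasurableSpace X] [BorelSpace X] in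
theorem rootAvg_iSup {g : ℕ → RootedSpace X → ℝ≥0∞} (hg : Monotone g) :
    rootAvg (fun q => ⨆ n, g n q) = fun q => ⨆ n, rootAvg (g n) q := by
  ext q
  obtain ⟨N, rfl⟩ := RootedGraph.exists_cls_eq q
  simp only [rootAvg_cls, div_eq_mul_inv]
  rw [vsum_iSup N.toMarkedGraph (h := fun n v => g n (N.at' v).cls)
    (fun a b hab v => hg hab _), ENNReal.iSup_mul]

/-- The hypothesis is the case of indicators; simple functions and monotone limits follow. -/
theorem lintegral_rootAvg {P : Measure (RootedSpace X)}
    (hP : ∀ A, MeasurableSet A → P A = ∫⁻ q, rootAvg (A.indicator 1) q ∂P)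
    {g : RootedSpace X → ℝ≥0∞} (hg : Measurable g) :
    ∫⁻ q, rootAvg g q ∂P = ∫⁻ q, g q ∂P := by
  refine Measurable.ennreal_induction (motive := fun g => ∫⁻ q, rootAvg g q ∂P = ∫⁻ q, g q ∂P)
    ?_ ?_ ?_ hg
  · intro c s hs
    have : rootAvg (s.indicator fun _ => c) = fun q => rootAvg (s.indicator 1) q * c := by
      ext q
      obtain ⟨N, rfl⟩ := RootedGraph.exists_cls_eq q
      simp only [rootAvg_cls, div_eq_mul_inv]
      rw [mul_right_comm, ← vsum_mul_right (h := fun v => s.indicator 1 (N.at' v).cls)]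
      congr 1
      refine vsum_congr fun v _ => ?_
      by_cases h : (N.at' v).cls ∈ s <;> simp [h]
    rw [this, lintegral_mul_const _ (measurable_rootAvg (measurable_one.indicator hs)), ← hP s hs,
      lintegral_indicator_const hs, mul_comm]
  · intro f g _ hf hg h1 h2
    rw [rootAvg_add]
    simp only [Pi.add_apply]
    rw [lintegral_add_left (measurable_rootAvg hf), lintegral_add_left hf, h1, h2]
  · intro f hf hm ih
    rw [rootAvg_iSup hm, lintegral_iSup (fun n => measurable_rootAvg (hf n)), lintegral_iSup hf hm]
    · simp only [ih]
    · intro a b hab q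
      obtain ⟨N, rfl⟩ := RootedGraph.exists_cls_eq q
      simp only [rootAvg_cls]
      gcongr
      simp only [← tsum_vertex_eq_vsum]
      exact ENNReal.tsum_le_tsum fun v => hm hab _

/-- Averaged over all roots of a finite graph, mass sent equals mass received, by exchanging two
sums; so resampling the root implies mass transport. Conversely, in a graph with `n` vertices let
every vertex send `1/n` to each vertex `v` such that the graph rerooted at `v` lies in `A`: the root
sends the proportion of such vertices and receives the indicator of `A`. -/
theorem isUniformlyRootedFinite_iff (P : ProbabilityMeasure (RootedSpace X)) :
    IsUniformlyRootedFinite P ↔ (∀ᵐ q ∂(P : Measure (RootedSpace X)), IsFiniteGraph q) ∧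
      Uni (P : Measure (RootedSpace X)) := by
  unfold IsUniformlyRootedFinite
  refine and_congr_right fun hfin => ?_
  simp only [rerootProb_eq_rootAvg]
  constructor
  · intro h f hf
    rw [← lintegral_rootAvg h (measurable_massOut hf), ← lintegral_rootAvg h (measurable_massIn hf)]
    refine lintegral_congr fun q => ?_
    obtain ⟨N, rfl⟩ := RootedGraph.exists_cls_eq q
    rw [rootAvg_cls, rootAvg_cls, vsum_congr fun v hv => massOut_at'_eq f hv,
      vsum_congr fun v hv => massIn_at'_eq f hv, vsum_comm]
  · intro h A hA
    have hf : Measurable fun b : BirootedSpace X =>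
        A.indicator 1 (secondCls b) * (vcard (secondCls b))⁻¹ :=
      ((measurable_one.indicator hA).comp measurable_secondCls).mul
        (measurable_vcard.comp measurable_secondCls).inv
    have := h _ hf
    rw [lintegral_congr (g := rootAvg (A.indicator 1)) fun q => ?_] at this
    · rw [this, ← lintegral_indicator_one hA]
      refine lintegral_congr_ae ?_
      filter_upwards [hfin] with q hq
      have hq' := (vcard_ne_top_iff q).2 hq
      have hq0 := vcard_ne_zero q
      obtain ⟨N, rfl⟩ := RootedGraph.exists_cls_eq q
      rw [massIn_cls, vsum_congr (h' := fun _ => A.indicator 1 N.cls * (vcard N.cls)⁻¹)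
        fun v hv => by
          rw [secondCls_cls, RootedGraph.second_bi hv N.root_mem, RootedGraph.at'_self]]
      have : vsum N.toMarkedGraph (fun _ => 1 * (A.indicator 1 N.cls * (vcard N.cls)⁻¹)) =
        vcard N.cls * (A.indicator 1 N.cls * (vcard N.cls)⁻¹) := by
        rw [vsum_mul_right, vcard, massOut_cls]
      simp only [one_mul] at this
      rw [this, mul_left_comm, ENNReal.mul_inv_cancel hq0 hq', mul_one]
    · obtain ⟨N, rfl⟩ := RootedGraph.exists_cls_eq q
      rw [rootAvg_cls, massOut_cls, div_eq_mul_inv, ← vsum_mul_right]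
      refine vsum_congr fun v hv => ?_
      rw [secondCls_cls, RootedGraph.second_bi N.root_mem hv, vcard_at']

end

section

variable [TopologicalSpace X] [PolishSpace X]

instance : TopologicalSpace.MetrizableSpace (RootedSpace X) := by
  have : T3Space (RootedSpace X) := {}
  exact TopologicalSpace.metrizableSpace_of_t3_secondCountable _

/-- The weak topology on laws over a separable metrizable space is metrizable, so points of a
closure are limits of sequences. -/
theorem sofic_iff_mem_closure (P : ProbabilityMeasure (RootedSpace X)) :
    Sofic P ↔ P ∈ closure {F | IsUniformlyRootedFinite F} := by
  rw [mem_closure_iff_seq_limit]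
  exact Iff.rfl

theorem sofic_of_tendsto {ι : Type*} {l : Filter ι} [l.NeBot]
    {F : ι → ProbabilityMeasure (RootedSpace X)} {P : ProbabilityMeasure (RootedSpace X)}
    (hF : ∀ᶠ n in l, Sofic (F n)) (h : Tendsto F l (𝓝 P)) : Sofic P := by
  rw [sofic_iff_mem_closure, ← closure_closure]
  exact mem_closure_of_tendsto h (hF.mono fun n hn => (sofic_iff_mem_closure _).1 hn)

end

end

section

variable {X Y Z : Type}

/-! ### The filter of literal neighbourhoods -/

section

variable [TopologicalSpace X]

/-- The filter of rooted graphs that literally agree with `N` on a large ball, up to small changes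
of the marks. -/
def near (N : RootedGraph X) : Filter (RootedGraph X) where
  sets := {A | ∃ R U W, (∀ x, IsOpen (U x)) ∧ (∀ x, IsOpen (W x)) ∧ (∀ x, N.vmark x ∈ U x) ∧
      (∀ x, N.emark x ∈ W x) ∧ ∀ N', Near N R U W N' → N' ∈ A}
  univ_sets := ⟨0, fun _ => univ, fun _ => univ, by simp, by simp, by simp, by simp, by simp⟩
  sets_of_superset := by
    rintro A B ⟨R, U, W, h1, h2, h3, h4, h5⟩ h
    exact ⟨R, U, W, h1, h2, h3, h4, fun N' hN' => h (h5 N' hN')⟩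
  inter_sets := by
    rintro A B ⟨R, U, W, h1, h2, h3, h4, h5⟩ ⟨R', U', W', h1', h2', h3', h4', h5'⟩
    exact ⟨max R R', fun x => U x ∩ U' x, fun x => W x ∩ W' x, fun x => (h1 x).inter (h1' x),
        fun x => (h2 x).inter (h2' x), fun x => ⟨h3 x, h3' x⟩, fun x => ⟨h4 x, h4' x⟩,
        fun N' h => ⟨h5 N' (h.mono (le_max_left _ _) (fun _ _ => inter_subset_left)
            fun _ _ => inter_subset_left),
          h5' N' (h.mono (le_max_right _ _) (fun _ _ => inter_subset_right)
            fun _ _ => inter_subset_right)⟩⟩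

theorem nhds_cls (N : RootedGraph X) : 𝓝 N.cls = map RootedGraph.cls (near N) :=
  Filter.ext fun _ => mem_nhds_cls_iff

theorem eventually_near {N : RootedGraph X} {p : RootedGraph X → Prop} : (∀ᶠ N' in near N, p N') ↔
    ∃ R U W, (∀ x, IsOpen (U x)) ∧ (∀ x, IsOpen (W x)) ∧ (∀ x, N.vmark x ∈ U x) ∧
      (∀ x, N.emark x ∈ W x) ∧ ∀ N', Near N R U W N' → p N' := Iff.rfl

theorem eventually_near_ball (N : RootedGraph X) (R : ℕ) :
    ∀ᶠ N' in near N, N'.root = N.root ∧ ball N'.graph N.root R = ball N.graph N.root R :=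
  eventually_near.2 ⟨R, fun _ => univ, fun _ => univ, by simp, by simp, by simp, by simp,
    fun N' h => ⟨h.root, by rw [← h.root, h.ball, h.root]⟩⟩

theorem eventually_near_vmark {N : RootedGraph X} {v : ℕ} (hv : v ∈ N.graph.vertexSet)
    {U : Set X} (hU : U ∈ 𝓝 (N.vmark v)) : ∀ᶠ N' in near N, N'.vmark v ∈ U := by
  classical
  obtain ⟨R, hR⟩ := exists_mem_ballSet_iff.2 (N.connected _ N.root_mem _ hv)
  refine eventually_near.2 ⟨R, fun x => if x = v then interior U else univ, fun _ => univ,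
    fun x => ?_, by simp, fun x => ?_, by simp, fun N' h => ?_⟩
  · dsimp only; split_ifs
    exacts [isOpen_interior, isOpen_univ]
  · dsimp only; split_ifs with h
    · subst h; exact mem_interior_iff_mem_nhds.2 hU
    · trivial
  · have := h.vmark v hR
    rw [if_pos rfl] at this
    exact interior_subset this

theorem exists_mem_ball_edgeSet {N : RootedGraph X} {e : ℕ} (he : e ∈ N.graph.edgeSet) :
    ∃ R, e ∈ (ball N.graph N.root R).edgeSet := by
  obtain ⟨x, y, hl⟩ := N.graph.exists_isLink_of_mem_edgeSet he
  obtain ⟨s, hs⟩ := exists_mem_ballSet_iff.2 (N.connected _ N.root_mem _ hl.left_mem)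
  obtain ⟨t, ht⟩ := exists_mem_ballSet_iff.2 (N.connected _ N.root_mem _ hl.right_mem)
  exact ⟨max s t, x, y, hl, ballSet_mono _ _ (le_max_left _ _) hs,
    ballSet_mono _ _ (le_max_right _ _) ht⟩

theorem eventually_near_emark {N : RootedGraph X} {e : ℕ} (he : e ∈ N.graph.edgeSet)
    {U : Set X} (hU : U ∈ 𝓝 (N.emark e)) : ∀ᶠ N' in near N, N'.emark e ∈ U := by
  classical
  obtain ⟨R, hR⟩ := exists_mem_ball_edgeSet he
  refine eventually_near.2 ⟨R, fun _ => univ, fun x => if x = e then interior U else univ,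
    by simp, fun x => ?_, by simp, fun x => ?_, fun N' h => ?_⟩
  · dsimp only; split_ifs
    exacts [isOpen_interior, isOpen_univ]
  · dsimp only; split_ifs with h
    · subst h; exact mem_interior_iff_mem_nhds.2 hU
    · trivial
  · have := h.emark e hR
    rw [if_pos rfl] at this
    exact interior_subset this

/-- A ball carries finitely many marks, so stabilisation of balls together with pointwise
convergence of marks is enough. -/
theorem tendsto_near {α : Type*} {l : Filter α} {F : α → RootedGraph X} {N : RootedGraph X}
    (h1 : ∀ R, ∀ᶠ a in l, (F a).root = N.root ∧
      ball (F a).graph N.root R = ball N.graph N.root R)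
    (h2 : ∀ v ∈ N.graph.vertexSet, Tendsto (fun a => (F a).vmark v) l (𝓝 (N.vmark v)))
    (h3 : ∀ e ∈ N.graph.edgeSet, Tendsto (fun a => (F a).emark e) l (𝓝 (N.emark e))) :
    Tendsto F l (near N) := by
  rintro A ⟨R, U, W, hU, hW, hNU, hNW, hA⟩
  have e1 : ∀ᶠ a in l, ∀ x ∈ ballSet N.graph N.root R, (F a).vmark x ∈ U x :=
    (eventually_all_finite (N.ballSet_finite R)).2 fun x hx =>
      h2 x (ballSet_subset N.root_mem R hx) ((hU x).mem_nhds (hNU x))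
  have e2 : ∀ᶠ a in l, ∀ x ∈ (ball N.graph N.root R).edgeSet, (F a).emark x ∈ W x :=
    (eventually_all_finite (N.ball_edgeSet_finite R)).2 fun x hx =>
      h3 x (by obtain ⟨_, _, hl, -⟩ := hx; exact hl.edge_mem) ((hW x).mem_nhds (hNW x))
  refine ((h1 R).and (e1.and e2)).mono fun a ⟨ha, ha1, ha2⟩ => ?_
  exact hA _ ⟨ha.1, by rw [ha.1, ha.2], ha1, ha2⟩

end

/-! ### Components of a locally finite graph -/

/-- A locally finite marked graph that need not be connected. -/
structure PreGraph (X : Type) where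
  graph : Graph ℕ ℕ
  vmark : ℕ → X
  emark : ℕ → X
  locallyFinite : ∀ v ∈ graph.vertexSet, {e | graph.Inc e v}.Finite

/-- The vertices connected to `x` (only `x` itself if it is not a vertex). -/
def reach (G : Graph ℕ ℕ) (x : ℕ) : Set ℕ := {y | Relation.ReflTransGen G.Adj x y}

theorem reach_symm {G : Graph ℕ ℕ} {x y : ℕ} (h : y ∈ reach G x) : x ∈ reach G y :=
  Relation.ReflTransGen.stdSymm.symm _ _ h

theorem reach_eq {G : Graph ℕ ℕ} {x y : ℕ} (h : y ∈ reach G x) : reach G y = reach G x :=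
  Set.ext fun _ => ⟨fun hz => Relation.ReflTransGen.trans h hz,
    fun hz => Relation.ReflTransGen.trans (reach_symm h) hz⟩

theorem reach_subset {G : Graph ℕ ℕ} {x : ℕ} (hx : x ∈ G.vertexSet) : reach G x ⊆ G.vertexSet := by
  intro y hy
  cases hy with
  | refl => exact hx
  | tail _ h => exact h.right_mem

theorem mem_reach_iff {G : Graph ℕ ℕ} {x y : ℕ} : y ∈ reach G x ↔ ∃ R, y ∈ ballSet G x R :=
  exists_mem_ballSet_iff.symm

theorem ballSet_subset_reach {G : Graph ℕ ℕ} {x R : ℕ} : ballSet G x R ⊆ reach G x :=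
  fun _ h => mem_reach_iff.2 ⟨R, h⟩

theorem ballSet_induce_reach (G : Graph ℕ ℕ) (x : ℕ) : ∀ R,
    ballSet (G.induce (reach G x)) x R = ballSet G x R
  | 0 => rfl
  | R + 1 => by
    have ih := ballSet_induce_reach G x R
    ext y
    rw [mem_ballSet_succ, mem_ballSet_succ, ih]
    refine or_congr_right ⟨?_, ?_⟩
    · rintro ⟨z, hz, e, hl⟩
      exact ⟨z, hz, e, hl.1⟩
    · rintro ⟨z, hz, e, hl⟩
      have hz' := ballSet_subset_reach hz
      exact ⟨z, hz, e, hl, hz', Relation.ReflTransGen.tail hz' ⟨e, hl⟩⟩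

theorem ball_induce_reach (G : Graph ℕ ℕ) (x R : ℕ) :
    ball (G.induce (reach G x)) x R = ball G x R := by
  refine graph_ext (ballSet_induce_reach G x R) fun e y z => ?_
  simp only [ball_isLink, ballSet_induce_reach]
  exact ⟨fun h => ⟨h.1.1, h.2⟩, fun h => ⟨⟨h.1, ballSet_subset_reach h.2.1,
    ballSet_subset_reach h.2.2⟩, h.2⟩⟩

/-- The component of `x`, rooted at `x`. -/
def PreGraph.comp (Γ : PreGraph X) (x : ℕ) : RootedGraph X where
  graph := Γ.graph.induce (reach Γ.graph x)
  vmark := Γ.vmark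
  emark := Γ.emark
  locallyFinite := fun v _ => by
    by_cases hv : v ∈ Γ.graph.vertexSet
    · exact (Γ.locallyFinite v hv).subset fun e ⟨y, hy⟩ => ⟨y, hy.1⟩
    · convert Set.finite_empty (α := ℕ)
      exact eq_empty_of_forall_notMem fun e ⟨y, hy⟩ => hv hy.1.left_mem
  connected := fun v hv w hw => by
    have key : ∀ y ∈ reach Γ.graph x,
        Relation.ReflTransGen (Γ.graph.induce (reach Γ.graph x)).Adj x y := fun y hy => by
      obtain ⟨R, hR⟩ := mem_reach_iff.1 hy
      rw [← ballSet_induce_reach] at hR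
      exact exists_mem_ballSet_iff.1 ⟨R, hR⟩
    exact (Relation.ReflTransGen.stdSymm.symm _ _ (key v hv)).trans (key w hw)
  root := x
  root_mem := Relation.ReflTransGen.refl

theorem PreGraph.comp_toMarkedGraph_eq {Γ : PreGraph X} {x y : ℕ} (h : y ∈ reach Γ.graph x) :
    (Γ.comp y).toMarkedGraph = (Γ.comp x).toMarkedGraph := by
  unfold comp
  simp only [reach_eq h]

/-- A mark-preserving isomorphism of locally finite graphs. -/
structure PreIso (Γ Δ : PreGraph X) (f g : ℕ → ℕ) : Prop extends
    IsIso Γ.graph Δ.graph f g where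
  vmark : ∀ v ∈ Γ.graph.vertexSet, Δ.vmark (f v) = Γ.vmark v
  emark : ∀ e ∈ Γ.graph.edgeSet, Δ.emark (g e) = Γ.emark e

theorem IsIso.mem_reach_iff {G H : Graph ℕ ℕ} {f g : ℕ → ℕ} (h : IsIso G H f g) {x y : ℕ}
    (hx : x ∈ G.vertexSet) (hy : y ∈ G.vertexSet) : f y ∈ reach H (f x) ↔ y ∈ reach G x := by
  simp only [UnimodularGraph.mem_reach_iff, h.mem_ballSet_iff hx hy]

theorem PreIso.comp {Γ Δ : PreGraph X} {f g : ℕ → ℕ} (h : PreIso Γ Δ f g) {x : ℕ}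
    (hx : x ∈ Γ.graph.vertexSet) :
    MIso (Γ.comp x).toMarkedGraph (Δ.comp (f x)).toMarkedGraph f g := by
  have hr := reach_subset hx
  refine ⟨⟨⟨fun y hy => (h.mem_reach_iff hx (hr hy)).2 hy, h.vert.injOn.mono hr, fun y hy => ?_⟩,
    ⟨?_, h.edge.injOn.mono ?_, ?_⟩, ?_⟩, fun v hv => h.vmark v (hr hv), ?_⟩
  · obtain ⟨z, hz, rfl⟩ := h.vert.surjOn (reach_subset (h.vert.mapsTo hx) hy)
    exact ⟨z, (h.mem_reach_iff hx hz).1 hy, rfl⟩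
  · rintro e ⟨y, z, hl, hy, hz⟩
    exact ⟨f y, f z, h.link hl, (h.mem_reach_iff hx (hr hy)).2 hy,
      (h.mem_reach_iff hx (hr hz)).2 hz⟩
  · rintro e ⟨y, z, hl, hy, hz⟩
    exact hl.edge_mem
  · rintro e ⟨y, z, hl, hy, hz⟩
    obtain ⟨e, y, z, hl', rfl, rfl, rfl⟩ := h.exists_link hl
    exact ⟨e, ⟨y, z, hl', (h.mem_reach_iff hx hl'.left_mem).1 hy,
      (h.mem_reach_iff hx hl'.right_mem).1 hz⟩, rfl⟩
  · rintro e y z ⟨hl, hy, hz⟩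
    exact ⟨h.link hl, (h.mem_reach_iff hx (hr hy)).2 hy, (h.mem_reach_iff hx (hr hz)).2 hz⟩
  · rintro e ⟨y, z, hl, hy, hz⟩
    exact h.emark e hl.edge_mem

section

variable [MeasurableSpace X] {Ω : Type*} [MeasurableSpace Ω]

theorem measurable_mem_reach {Γ : Ω → Graph ℕ ℕ} (h : ∀ e x y, Measurable fun a => (Γ a).IsLink e x y)
    {x y : Ω → ℕ} (hx : Measurable x) (hy : Measurable y) :
    Measurable fun a => y a ∈ reach (Γ a) (x a) := by
  simp only [mem_reach_iff]
  refine Measurable.exists fun R => measurable_mem_ballSet_of_adj (fun x y => ?_) hx hy R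
  unfold Graph.Adj
  exact Measurable.exists fun e => h e x y

theorem measurable_comp {Γ : Ω → PreGraph X}
    (hl : ∀ e x y, Measurable fun a => (Γ a).graph.IsLink e x y)
    (hv : ∀ v, Measurable fun a => (Γ a).vmark v) (he : ∀ v, Measurable fun a => (Γ a).emark v)
    {x : Ω → ℕ} (hx : Measurable x) : Measurable fun a => (Γ a).comp (x a) := by
  rw [measurable_rootedGraph_iff, measurable_markedGraph_iff]
  exact ⟨⟨fun v => measurable_mem_reach hl hx measurable_const, fun e y z =>
    (hl e y z).and ((measurable_mem_reach hl hx measurable_const).and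
      (measurable_mem_reach hl hx measurable_const)), hv, he⟩, hx⟩

end

/-! ### Local transformations -/

/-- A local transformation: the vertex `v` is replaced by the vertices `nm v i` with `pres v i`,
and the edges are built equivariantly from local information. -/
structure Transform (Y Z : Type) [TopologicalSpace Y] [MeasurableSpace Y] [TopologicalSpace Z]
    [MeasurableSpace Z] where
  gr : MarkedGraph Y → PreGraph Z
  K : ℕ
  nm : ℕ → Fin K → ℕ
  pres : MarkedGraph Y → ℕ → Fin K → Prop
  nm_inj : ∀ {v i w j}, nm v i = nm w j → v = w ∧ i = j
  vert : ∀ N x, x ∈ (gr N).graph.vertexSet ↔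
    ∃ v i, v ∈ N.graph.vertexSet ∧ pres N v i ∧ nm v i = x
  pres_iff : ∀ {M N f g}, MIso M N f g → ∀ v ∈ M.graph.vertexSet, ∀ i,
    (pres N (f v) i ↔ pres M v i)
  equiv : ∀ {M N f g}, MIso M N f g → ∃ f' g', PreIso (gr M) (gr N) f' g' ∧
    ∀ v ∈ M.graph.vertexSet, ∀ i, f' (nm v i) = nm (f v) i
  measurable_isLink : ∀ e x y, Measurable fun N => (gr N).graph.IsLink e x y
  measurable_vmark : ∀ v, Measurable fun N => (gr N).vmark v
  measurable_emark : ∀ e, Measurable fun N => (gr N).emark e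
  measurable_pres : ∀ v i, Measurable fun N => pres N v i
  local_pres : ∀ (N : RootedGraph Y) i, ∀ᶠ N' in near N,
    (pres N'.toMarkedGraph N'.root i ↔ pres N.toMarkedGraph N.root i)
  local_gr : ∀ (N : RootedGraph Y) i, pres N.toMarkedGraph N.root i →
    Tendsto (fun N' : RootedGraph Y => (gr N'.toMarkedGraph).comp (nm N'.root i)) (near N)
      (near ((gr N.toMarkedGraph).comp (nm N.root i)))

namespace Transform

variable [TopologicalSpace Y] [PolishSpace Y] [MeasurableSpace Y] [BorelSpace Y]
  [TopologicalSpace Z] [PolishSpace Z] [MeasurableSpace Z] [BorelSpace Z] (T : Transform Y Z)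

/-- The transformed graph, rooted at the `i`-th descendant of the root. -/
def rg (N : RootedGraph Y) (i : Fin T.K) : RootedGraph Z :=
  (T.gr N.toMarkedGraph).comp (T.nm N.root i)

theorem nm_mem {N : MarkedGraph Y} {v : ℕ} {i : Fin T.K} (hv : v ∈ N.graph.vertexSet)
    (h : T.pres N v i) : T.nm v i ∈ (T.gr N).graph.vertexSet := (T.vert N _).2 ⟨v, i, hv, h, rfl⟩

theorem rg_congr {M N : RootedGraph Y} (h : M.cls = N.cls) (i : Fin T.K) :
    (T.pres M.toMarkedGraph M.root i ↔ T.pres N.toMarkedGraph N.root i) ∧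
      (T.pres M.toMarkedGraph M.root i → (T.rg M i).cls = (T.rg N i).cls) := by
  obtain ⟨f, g', hi, hr⟩ := RootedGraph.cls_eq_iff.1 h
  obtain ⟨f', g'', hi', hf'⟩ := T.equiv hi
  have := T.pres_iff hi M.root M.root_mem i
  rw [hr] at this
  refine ⟨this.symm, fun hp => RootedGraph.cls_eq_iff.2 ⟨f', g'', ?_, ?_⟩⟩
  · have := hi'.comp (T.nm_mem M.root_mem hp)
    rwa [hf' _ M.root_mem, hr] at this
  · exact (hf' _ M.root_mem i).trans (by rw [hr]; rfl)

open scoped Classical in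
/-- The random measure `∑ δ` over the descendants of the root. -/
def kern : RootedSpace Y → Measure (RootedSpace Z) :=
  Quotient.lift (fun N => ∑ i, if T.pres N.toMarkedGraph N.root i then
      Measure.dirac (T.rg N i).cls else 0) <| by
    intro M N h
    refine Finset.sum_congr rfl fun i _ => ?_
    have := T.rg_congr (Quotient.sound h) i
    split_ifs with h1 h2 h2
    · rw [this.2 h1]
    · exact absurd (this.1.1 h1) h2
    · exact absurd (this.1.2 h2) h1
    · rfl

open scoped Classical in
theorem kern_cls (N : RootedGraph Y) : T.kern N.cls =
    ∑ i, if T.pres N.toMarkedGraph N.root i then Measure.dirac (T.rg N i).cls else 0 := rfl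

/-- The sum of `g` over the descendants of the root. -/
def push (g : RootedSpace Z → ℝ≥0∞) (q : RootedSpace Y) : ℝ≥0∞ := ∫⁻ p, g p ∂T.kern q

open scoped Classical in
theorem push_cls {g : RootedSpace Z → ℝ≥0∞} (hg : Measurable g) (N : RootedGraph Y) :
    T.push g N.cls = ∑ i, if T.pres N.toMarkedGraph N.root i then g (T.rg N i).cls else 0 := by
  rw [push, kern_cls, lintegral_finsetSum_measure]
  refine Finset.sum_congr rfl fun i _ => ?_
  split_ifs
  · rw [lintegral_dirac' _ hg]
  · simp

theorem measurable_rg (i : Fin T.K) : Measurable fun N => T.rg N i := by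
  refine measurable_comp (fun e x y => (T.measurable_isLink e x y).comp
    RootedGraph.measurable_toMarkedGraph) (fun v => (T.measurable_vmark v).comp
    RootedGraph.measurable_toMarkedGraph) (fun v => (T.measurable_emark v).comp
    RootedGraph.measurable_toMarkedGraph) ?_
  exact (measurable_from_top (f := fun v => T.nm v i)).comp RootedGraph.measurable_root

theorem measurable_pres' {Ω : Type*} [MeasurableSpace Ω] {F : Ω → MarkedGraph Y}
    (hF : Measurable F) {v : Ω → ℕ} (hv : Measurable v) (i : Fin T.K) :
    Measurable fun a => T.pres (F a) (v a) i :=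
  measurable_apply_countable (F := fun a v => T.pres (F a) v i)
    (fun v => (T.measurable_pres v i).comp hF) hv

theorem measurable_push {g : RootedSpace Z → ℝ≥0∞} (hg : Measurable g) :
    Measurable (T.push g) := by
  classical
  refine measurable_of_comp_cls ?_
  simp only [T.push_cls hg]
  refine Finset.measurable_sum _ fun i _ => Measurable.ite (measurableSet_setOfPred.2
    (T.measurable_pres' RootedGraph.measurable_toMarkedGraph RootedGraph.measurable_root i)) ?_
    measurable_const
  exact hg.comp (RootedGraph.measurable_cls.comp (T.measurable_rg i))

theorem measurable_kern : Measurable T.kern := by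
  refine Measure.measurable_of_measurable_coe _ fun A hA => ?_
  simp only [← lintegral_indicator_one hA]
  exact T.measurable_push (measurable_one.indicator hA)

/-- The law of the transformed graph: total mass over the descendants of the root. -/
def tr (Q : Measure (RootedSpace Y)) : Measure (RootedSpace Z) := Q.bind T.kern

theorem lintegral_tr (Q : Measure (RootedSpace Y)) {g : RootedSpace Z → ℝ≥0∞}
    (hg : Measurable g) : ∫⁻ p, g p ∂T.tr Q = ∫⁻ q, T.push g q ∂Q := by
  rw [tr, Measure.lintegral_bind T.measurable_kern.aemeasurable hg.aemeasurable]
  rfl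

end Transform

end

/-! ### Local transformations: mass transport, finiteness, continuity and soficity -/

section

variable {X Y Z : Type}

theorem RootedGraph.bi_congr {M N : RootedGraph X} (h : M.toMarkedGraph = N.toMarkedGraph) {u v : ℕ}
    (hu : u ∈ M.graph.vertexSet) (hv : v ∈ M.graph.vertexSet) : M.bi u v = N.bi u v := by
  obtain ⟨M, r, hr⟩ := M
  obtain ⟨N, r', hr'⟩ := N
  obtain rfl : M = N := h
  exact (bi_eq hu hv).trans (bi_eq (N := ⟨M, r', hr'⟩) hu hv).symm

namespace Transform

variable [TopologicalSpace Y] [PolishSpace Y] [MeasurableSpace Y] [BorelSpace Y]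
  [TopologicalSpace Z] [PolishSpace Z] [MeasurableSpace Z] [BorelSpace Z] (T : Transform Y Z)

-- By `vert` and `nm_inj`, each vertex of the component is `nm v j` for exactly one pair `(v, j)`,
-- which turns the sum over its vertices into a double sum.
open scoped Classical in
theorem vsum_comp {N : MarkedGraph Y} {x : ℕ} (hx : x ∈ (T.gr N).graph.vertexSet) (h : ℕ → ℝ≥0∞) :
    vsum ((T.gr N).comp x).toMarkedGraph h = vsum N fun v => ∑ j,
      if T.pres N v j ∧ T.nm v j ∈ reach (T.gr N).graph x then h (T.nm v j) else 0 := by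
  have hinj : Function.Injective fun p : ℕ × Fin T.K => T.nm p.1 p.2 := fun p q hpq =>
    Prod.ext (T.nm_inj hpq).1 (T.nm_inj hpq).2
  have hsupp : Function.support ((reach (T.gr N).graph x).indicator h) ⊆
      range fun p : ℕ × Fin T.K => T.nm p.1 p.2 := by
    intro y hy
    obtain ⟨v, i, -, -, rfl⟩ := (T.vert N y).1 (reach_subset hx (mem_of_indicator_ne_zero hy))
    exact ⟨(v, i), rfl⟩
  change ∑' y, (reach (T.gr N).graph x).indicator h y = _
  rw [← hinj.tsum_eq hsupp,
    ENNReal.tsum_prod (f := fun v i => (reach (T.gr N).graph x).indicator h (T.nm v i))]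
  refine tsum_congr fun v => ?_
  rw [tsum_fintype]
  by_cases hv : v ∈ N.graph.vertexSet
  · rw [indicator_of_mem hv]
    refine Finset.sum_congr rfl fun i _ => ?_
    by_cases hr : T.nm v i ∈ reach (T.gr N).graph x
    · obtain ⟨w, j, -, hp, hw⟩ := (T.vert N _).1 (reach_subset hx hr)
      obtain ⟨rfl, rfl⟩ := T.nm_inj hw
      rw [if_pos ⟨hp, hr⟩, indicator_of_mem hr]
    · rw [if_neg (fun h => hr h.2), indicator_of_notMem hr]
  · rw [indicator_of_notMem hv]
    refine Finset.sum_eq_zero fun i _ => indicator_of_notMem (fun hr => hv ?_) _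
    obtain ⟨w, j, hw', -, hw⟩ := (T.vert N _).1 (reach_subset hx hr)
    exact (T.nm_inj hw).1 ▸ hw'

open scoped Classical in
/-- A transport on the transformed graph as a transport on the original graph. -/
def pullTransportAux (f : BirootedSpace Z → ℝ≥0∞) (B : BirootedGraph Y) : ℝ≥0∞ :=
  ∑ i, ∑ j, if T.pres B.toMarkedGraph B.root₁ i ∧ T.pres B.toMarkedGraph B.root₂ j ∧
    T.nm B.root₂ j ∈ reach (T.gr B.toMarkedGraph).graph (T.nm B.root₁ i) then
    f (((T.gr B.toMarkedGraph).comp (T.nm B.root₁ i)).bi (T.nm B.root₁ i) (T.nm B.root₂ j)).cls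
    else 0

theorem pullTransportAux_congr (f : BirootedSpace Z → ℝ≥0∞) {B C : BirootedGraph Y}
    (h : B.cls = C.cls) : T.pullTransportAux f B = T.pullTransportAux f C := by
  obtain ⟨φ, ψ, hi, hr, hs⟩ := BirootedGraph.cls_eq_iff.1 h
  obtain ⟨φ', ψ', hi', hf'⟩ := T.equiv hi
  refine Finset.sum_congr rfl fun i _ => Finset.sum_congr rfl fun j _ => ?_
  rw [← hr, ← hs, T.pres_iff hi _ B.root₁_mem, T.pres_iff hi _ B.root₂_mem, ← hf' _ B.root₁_mem,
    ← hf' _ B.root₂_mem]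
  by_cases h1 : T.pres B.toMarkedGraph B.root₁ i
  · by_cases h2 : T.pres B.toMarkedGraph B.root₂ j
    · have m1 := T.nm_mem B.root₁_mem h1
      have m2 := T.nm_mem B.root₂_mem h2
      rw [hi'.mem_reach_iff m1 m2]
      split_ifs with h3
      · refine congrArg f (BirootedGraph.cls_eq_iff.2 ⟨φ', ψ', ?_, ?_, ?_⟩)
        · simp only [RootedGraph.bi_toMarkedGraph]
          exact hi'.comp m1
        · rw [RootedGraph.bi_root₁ (mem_reach_iff.2 ⟨0, rfl⟩) h3.2.2, RootedGraph.bi_root₁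
            (mem_reach_iff.2 ⟨0, rfl⟩) ((hi'.mem_reach_iff m1 m2).2 h3.2.2)]
        · rw [RootedGraph.bi_root₂ (mem_reach_iff.2 ⟨0, rfl⟩) h3.2.2, RootedGraph.bi_root₂
            (mem_reach_iff.2 ⟨0, rfl⟩) ((hi'.mem_reach_iff m1 m2).2 h3.2.2)]
      · rfl
    · simp [h2]
  · simp [h1]

/-- A transport on the transformed graph as a transport on the original graph. -/
def pullTransport (f : BirootedSpace Z → ℝ≥0∞) : BirootedSpace Y → ℝ≥0∞ :=
  Quotient.lift (T.pullTransportAux f) fun _ _ h => T.pullTransportAux_congr f (Quotient.sound h)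

theorem measurable_pullTransport {f : BirootedSpace Z → ℝ≥0∞} (hf : Measurable f) :
    Measurable (T.pullTransport f) := by
  classical
  refine measurable_of_comp_bicls (h := T.pullTransport f) ?_
  change Measurable (T.pullTransportAux f)
  have hM : Measurable fun B : BirootedGraph Y => B.toMarkedGraph :=
    BirootedGraph.measurable_toMarkedGraph
  have h1 : ∀ i, Measurable fun B : BirootedGraph Y => T.nm B.root₁ i := fun i =>
    (measurable_from_top (f := fun v => T.nm v i)).comp BirootedGraph.measurable_root₁
  have h2 : ∀ i, Measurable fun B : BirootedGraph Y => T.nm B.root₂ i := fun i =>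
    (measurable_from_top (f := fun v => T.nm v i)).comp BirootedGraph.measurable_root₂
  refine Finset.measurable_sum _ fun i _ => Finset.measurable_sum _ fun j _ =>
    Measurable.ite (measurableSet_setOfPred.2 ?_) ?_ measurable_const
  · exact (T.measurable_pres' hM BirootedGraph.measurable_root₁ i).and
      ((T.measurable_pres' hM BirootedGraph.measurable_root₂ j).and (measurable_mem_reach
        (fun e x y => (T.measurable_isLink e x y).comp hM) (h1 i) (h2 j)))
  · exact hf.comp (BirootedGraph.measurable_cls.comp (measurable_bi (measurable_comp
      (fun e x y => (T.measurable_isLink e x y).comp hM) (fun v => (T.measurable_vmark v).comp hM)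
      (fun v => (T.measurable_emark v).comp hM) (h1 i)) (h1 i) (h2 j)))

/-- Summing the pulled-back transport over the second root gives the mass sent by all descendants of
the root, each inside its own component. -/
theorem massOut_pullTransport {f : BirootedSpace Z → ℝ≥0∞} (hf : Measurable f)
    (q : RootedSpace Y) : massOut (T.pullTransport f) q = T.push (massOut f) q := by
  classical
  obtain ⟨N, rfl⟩ := RootedGraph.exists_cls_eq q
  rw [massOut_cls, T.push_cls (measurable_massOut hf)]
  have : ∀ v ∈ N.graph.vertexSet, T.pullTransport f (N.bi N.root v).cls =
      T.pullTransportAux f (N.bi N.root v) := fun _ _ => rfl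
  rw [vsum_congr this]
  simp only [← tsum_vertex_eq_vsum]
  rw [tsum_congr fun v : N.graph.vertexSet => by
    rw [pullTransportAux, RootedGraph.bi_root₁ N.root_mem v.2, RootedGraph.bi_root₂ N.root_mem v.2,
      RootedGraph.bi_toMarkedGraph], Summable.tsum_finsetSum fun _ _ => ENNReal.summable]
  refine Finset.sum_congr rfl fun i _ => ?_
  split_ifs with h
  · rw [massOut_cls]
    refine Eq.trans ?_ (T.vsum_comp (T.nm_mem N.root_mem h) _).symm
    simp only [h, true_and]
    rw [← tsum_vertex_eq_vsum]
    rfl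
  · simp [h]

/-- The pulled-back transport is evaluated in the component rooted at the sender. Reachability is
symmetric, so this is the same marked graph as the component of the receiver. -/
theorem massIn_pullTransport {f : BirootedSpace Z → ℝ≥0∞} (hf : Measurable f)
    (q : RootedSpace Y) : massIn (T.pullTransport f) q = T.push (massIn f) q := by
  classical
  obtain ⟨N, rfl⟩ := RootedGraph.exists_cls_eq q
  rw [massIn_cls, T.push_cls (measurable_massIn hf)]
  have : ∀ v ∈ N.graph.vertexSet, T.pullTransport f (N.bi v N.root).cls =
      T.pullTransportAux f (N.bi v N.root) := fun _ _ => rfl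
  rw [vsum_congr this]
  simp only [← tsum_vertex_eq_vsum]
  rw [tsum_congr fun v : N.graph.vertexSet => by
    rw [pullTransportAux, RootedGraph.bi_root₁ v.2 N.root_mem, RootedGraph.bi_root₂ v.2 N.root_mem,
      RootedGraph.bi_toMarkedGraph, Finset.sum_comm],
    Summable.tsum_finsetSum fun _ _ => ENNReal.summable]
  refine Finset.sum_congr rfl fun i _ => ?_
  split_ifs with h
  · rw [massIn_cls]
    refine Eq.trans ?_ (T.vsum_comp (T.nm_mem N.root_mem h) _).symm
    rw [← tsum_vertex_eq_vsum]
    refine tsum_congr fun v => Finset.sum_congr rfl fun j _ => ?_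
    simp only [h, true_and]
    by_cases hr : T.nm N.root i ∈ reach (T.gr N.toMarkedGraph).graph (T.nm v j)
    · have hr' := reach_symm hr
      simp only [hr, hr', and_true]
      congr 3
      refine RootedGraph.bi_congr (PreGraph.comp_toMarkedGraph_eq hr') (mem_reach_iff.2 ⟨0, rfl⟩) hr
    · have hr' : T.nm v j ∉ reach (T.gr N.toMarkedGraph).graph (T.nm N.root i) := fun h =>
        hr (reach_symm h)
      simp [hr, hr']
  · simp [h]

/-- Mass transport for `f` under the transformed law is mass transport for `pullTransport f` under
`Q`. -/
theorem uni_tr {Q : Measure (RootedSpace Y)} (hQ : Uni Q) : Uni (T.tr Q) := by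
  intro f hf
  rw [T.lintegral_tr Q (measurable_massOut hf), T.lintegral_tr Q (measurable_massIn hf)]
  simp only [← T.massOut_pullTransport hf, ← T.massIn_pullTransport hf]
  exact hQ _ (T.measurable_pullTransport hf)

/-- Each vertex has at most `K` descendants, so a finite graph is transformed into a finite one. -/
theorem ae_isFiniteGraph_tr {Q : Measure (RootedSpace Y)} (hQ : ∀ᵐ q ∂Q, IsFiniteGraph q) :
    ∀ᵐ p ∂T.tr Q, IsFiniteGraph p := by
  have hm : MeasurableSet {p : RootedSpace Z | IsFiniteGraph p}ᶜ := by
    simp only [← vcard_ne_top_iff]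
    exact (measurableSet_eq_fun measurable_vcard measurable_const).compl.compl
  rw [ae_iff, ← compl_ofPred, ← lintegral_indicator_one hm,
    T.lintegral_tr Q (measurable_one.indicator hm), lintegral_eq_zero_iff (T.measurable_push
      (measurable_one.indicator hm))]
  filter_upwards [hQ] with q hq
  obtain ⟨N, rfl⟩ := RootedGraph.exists_cls_eq q
  rw [isFiniteGraph_cls_iff] at hq
  rw [T.push_cls (measurable_one.indicator hm)]
  refine Finset.sum_eq_zero fun i _ => ?_
  split_ifs with h
  · refine indicator_of_notMem (notMem_compl_iff.2 ?_) _
    rw [mem_ofPred_eq, isFiniteGraph_cls_iff]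
    refine Set.Finite.subset ?_ (reach_subset (T.nm_mem N.root_mem h))
    refine Set.Finite.subset ((hq.prod (finite_univ (α := Fin T.K))).image
      fun p => T.nm p.1 p.2) fun x hx => ?_
    obtain ⟨v, j, hv, -, rfl⟩ := (T.vert _ _).1 hx
    exact ⟨(v, j), ⟨hv, mem_univ _⟩, rfl⟩
  · rfl

theorem tendsto_cls (N : RootedGraph Z) : Tendsto RootedGraph.cls (near N) (𝓝 N.cls) :=
  (nhds_cls N).ge

/-- Near a given graph the set of present descendants of the root is constant, and the component of
each of them varies continuously. -/
theorem continuous_push {g : RootedSpace Z → ℝ≥0∞} (hg : Continuous g) :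
    Continuous (T.push g) := by
  classical
  rw [continuous_iff_continuousAt]
  intro q
  obtain ⟨N, rfl⟩ := RootedGraph.exists_cls_eq q
  rw [ContinuousAt, nhds_cls, tendsto_map'_iff]
  simp only [Function.comp_def, T.push_cls hg.measurable]
  refine tendsto_finsetSum _ fun i _ => ?_
  by_cases h : T.pres N.toMarkedGraph N.root i
  · rw [if_pos h]
    refine Tendsto.congr' (f₁ := fun N' => g (T.rg N' i).cls) ?_
      ((hg.tendsto _).comp ((tendsto_cls _).comp (T.local_gr N i h)))
    filter_upwards [T.local_pres N i] with N' hN'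
    rw [if_pos (hN'.2 h)]
  · rw [if_neg h]
    refine tendsto_const_nhds.congr' ?_
    filter_upwards [T.local_pres N i] with N' hN'
    rw [if_neg (fun h' => h (hN'.1 h'))]

theorem kern_univ_le (q : RootedSpace Y) : T.kern q univ ≤ T.K := by
  classical
  obtain ⟨N, rfl⟩ := RootedGraph.exists_cls_eq q
  rw [kern_cls, Measure.finsetSum_apply]
  refine (Finset.sum_le_card_nsmul _ _ 1 fun i _ => ?_).trans (by simp)
  split_ifs <;> simp

instance (Q : Measure (RootedSpace Y)) [IsFiniteMeasure Q] : IsFiniteMeasure (T.tr Q) := by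
  refine ⟨?_⟩
  rw [tr, Measure.bind_apply .univ T.measurable_kern.aemeasurable]
  refine (lintegral_mono T.kern_univ_le).trans_lt ?_
  rw [lintegral_const]
  exact ENNReal.mul_lt_top (ENNReal.natCast_lt_top _) (measure_lt_top _ _)

/-- The transformed law as a finite measure. -/
def trF (Q : ProbabilityMeasure (RootedSpace Y)) : FiniteMeasure (RootedSpace Z) :=
  ⟨T.tr (Q : Measure (RootedSpace Y)), inferInstance⟩

theorem tendsto_trF {ι : Type*} {l : Filter ι} {F : ι → ProbabilityMeasure (RootedSpace Y)}
    {Q : ProbabilityMeasure (RootedSpace Y)} (h : Tendsto F l (𝓝 Q)) :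
    Tendsto (fun n => T.trF (F n)) l (𝓝 (T.trF Q)) := by
  rw [FiniteMeasure.tendsto_iff_forall_lintegral_tendsto]
  intro f
  have hf : Continuous fun p => (f p : ℝ≥0∞) := ENNReal.continuous_coe.comp f.continuous
  -- The root has at most `K` descendants, so `push` preserves boundedness as well as continuity,
  -- and test functions can be moved to the original space.
  have hle : ∀ q, T.push (fun p => (f p : ℝ≥0∞)) q ≤ (nndist f 0 * T.K : NNReal) := by
    intro q
    refine (lintegral_mono (g := fun _ => (nndist f 0 : ℝ≥0∞)) fun p => ?_).trans ?_
    · exact ENNReal.coe_le_coe.2 (BoundedContinuousFunction.NNReal.upper_bound f p)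
    · rw [lintegral_const, ENNReal.coe_mul]
      exact mul_le_mul_right (by simpa using T.kern_univ_le q) _
  let g : BoundedContinuousFunction (RootedSpace Y) NNReal :=
    BoundedContinuousFunction.mkOfBound
      ⟨fun q => (T.push (fun p => (f p : ℝ≥0∞)) q).toNNReal,
        continuous_iff_continuousAt.2 fun q => (ENNReal.tendsto_toNNReal
          ((hle q).trans_lt ENNReal.coe_lt_top).ne).comp (T.continuous_push hf).continuousAt⟩
      (nndist f 0 * T.K : NNReal) fun q q' => by
        have key : ∀ q, (T.push (fun p => (f p : ℝ≥0∞)) q).toNNReal ≤ nndist f 0 * T.K :=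
          fun q => (ENNReal.toNNReal_mono ENNReal.coe_ne_top (hle q)).trans_eq (ENNReal.toNNReal_coe _)
        have h1 := key q
        have h2 := key q'
        rw [NNReal.dist_eq, abs_le]
        have h1' := NNReal.coe_le_coe.2 h1
        have h2' := NNReal.coe_le_coe.2 h2
        have h3 := NNReal.coe_nonneg ((T.push (fun p => (f p : ℝ≥0∞)) q).toNNReal)
        have h4 := NNReal.coe_nonneg ((T.push (fun p => (f p : ℝ≥0∞)) q').toNNReal)
        constructor <;> simp only [ContinuousMap.coe_mk] at * <;> linarith
  have hg : ∀ q, (g q : ℝ≥0∞) = T.push (fun p => (f p : ℝ≥0∞)) q := fun q =>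
    ENNReal.coe_toNNReal ((hle q).trans_lt ENNReal.coe_lt_top).ne
  have := ProbabilityMeasure.tendsto_iff_forall_lintegral_tendsto.1 h g
  simp only [hg] at this
  simp only [trF, FiniteMeasure.toMeasure_mk, T.lintegral_tr _ hf.measurable]
  exact this

/-- Transform the finite approximations of `Q` and normalise. The transformed laws are still finite
and satisfy mass transport, hence are uniformly rooted, and the normalisations converge because the
limit has positive mass. -/
theorem sofic_tr {Q : ProbabilityMeasure (RootedSpace Y)} (hQ : Sofic Q)
    {P : ProbabilityMeasure (RootedSpace Z)}
    (h : (P : Measure (RootedSpace Z)) = (T.tr (Q : Measure (RootedSpace Y)) univ)⁻¹ •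
      T.tr (Q : Measure (RootedSpace Y))) : Sofic P := by
  obtain ⟨F, hF, hFQ⟩ := hQ
  have : Nonempty (RootedSpace Z) := P.nonempty
  have norm_eq : ∀ Q' : ProbabilityMeasure (RootedSpace Y), T.trF Q' ≠ 0 →
      ((T.trF Q').normalize : Measure (RootedSpace Z)) =
      (T.tr (Q' : Measure (RootedSpace Y)) univ)⁻¹ • T.tr (Q' : Measure (RootedSpace Y)) := by
    intro Q' h0
    rw [FiniteMeasure.toMeasure_normalize_eq_of_nonzero _ h0]
    have hm : (T.trF Q').mass ≠ 0 := (T.trF Q').mass_nonzero_iff.2 h0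
    change (((T.trF Q').mass⁻¹ : NNReal) : ℝ≥0∞) • (T.trF Q' : Measure (RootedSpace Z)) = _
    rw [ENNReal.coe_inv hm, FiniteMeasure.ennreal_mass]
    rfl
  -- With total mass zero, the right side of `h` would be the zero measure and not a probability.
  have h0 : T.trF Q ≠ 0 := by
    intro h0
    have h0' : T.tr (Q : Measure (RootedSpace Y)) = 0 := congrArg FiniteMeasure.toMeasure h0
    have h1 := congrArg (fun μ : Measure _ => μ univ) h
    simp [h0'] at h1
  have hP : (T.trF Q).normalize = P := Subtype.ext ((norm_eq Q h0).trans h.symm)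
  have ht := T.tendsto_trF hFQ
  refine sofic_of_tendsto (l := atTop) ?_ (hP ▸ FiniteMeasure.tendsto_normalize_of_tendsto ht h0)
  -- The normalisation of the zero measure is a default value that need not be uniformly rooted; it
  -- occurs for finitely many `n` only.
  have : ∀ᶠ n in atTop, T.trF (F n) ≠ 0 := ht.eventually_ne h0
  filter_upwards [this] with n hn
  rw [sofic_iff_mem_closure]
  refine subset_closure ?_
  obtain ⟨h1, h2⟩ := (isUniformlyRootedFinite_iff _).1 (hF n)
  refine (isUniformlyRootedFinite_iff _).2 ?_
  rw [norm_eq _ hn]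
  refine ⟨(Measure.ae_smul_measure_le _) (T.ae_isFiniteGraph_tr h1), fun f hf => ?_⟩
  rw [lintegral_smul_measure, lintegral_smul_measure, T.uni_tr h2 f hf]

end Transform

end

section

variable {X Y Z : Type}

/-! ### Convergence of components -/

/-- An edge at a vertex at distance `r` may end at distance `r + 1`, so the larger radius is needed
to see every edge at `v`. -/
theorem isLink_iff_of_ball_eq {G H : Graph ℕ ℕ} {ρ r : ℕ} (h : ball G ρ (r + 1) = ball H ρ (r + 1))
    {v : ℕ} (hv : v ∈ ballSet H ρ r) (e y : ℕ) : G.IsLink e v y ↔ H.IsLink e v y := by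
  have h1 : ∀ s ≤ r + 1, ballSet G ρ s = ballSet H ρ s := fun s hs => by
    rw [← ballSet_ball hs, h, ballSet_ball hs]
  have hv' : v ∈ ballSet G ρ r := (h1 r (by omega)).symm ▸ hv
  constructor
  · intro hl
    have : (ball G ρ (r + 1)).IsLink e v y := ⟨hl, Or.inl hv', Or.inr ⟨v, hv', e, hl⟩⟩
    rw [h] at this
    exact this.1
  · intro hl
    have : (ball H ρ (r + 1)).IsLink e v y := ⟨hl, Or.inl hv, Or.inr ⟨v, hv, e, hl⟩⟩
    rw [← h] at this
    exact this.1

theorem finite_inc (N : MarkedGraph Y) (v : ℕ) : {e | N.graph.Inc e v}.Finite := by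
  by_cases hv : v ∈ N.graph.vertexSet
  · exact N.locallyFinite v hv
  · convert Set.finite_empty (α := ℕ)
    exact eq_empty_of_forall_notMem fun e ⟨y, hy⟩ => hv hy.left_mem

theorem finite_adj (N : MarkedGraph Y) (v : ℕ) : {y | N.graph.Adj v y}.Finite := by
  refine ((finite_inc N v).biUnion (t := fun e => {y | N.graph.IsLink e v y}) fun _ _ =>
    Set.Subsingleton.finite fun y hy z hz => hy.right_unique hz).subset ?_
  rintro y ⟨e, he⟩
  exact mem_biUnion (show e ∈ {e | N.graph.Inc e v} from ⟨y, he⟩) he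

theorem ball_eq_of_forall_isLink {G H : Graph ℕ ℕ} {x R : ℕ}
    (h : ∀ y ∈ ballSet H x R, ∀ e z, G.IsLink e y z ↔ H.IsLink e y z) :
    ball G x R = ball H x R := by
  have hb : ∀ r ≤ R, ballSet G x r = ballSet H x r := by
    intro r hr
    induction r with
    | zero => rfl
    | succ r ih =>
      have ih := ih (by omega)
      ext y
      rw [mem_ballSet_succ, mem_ballSet_succ, ih]
      refine or_congr_right (exists_congr fun z => and_congr_right fun hz => ?_)
      exact exists_congr fun e => h z (ballSet_mono _ _ (by omega) hz) e y
  refine graph_ext (hb R le_rfl) fun e y z => ?_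
  simp only [ball_isLink, hb R le_rfl]
  exact and_congr_left fun hy => h y hy.1 e z

section

variable [TopologicalSpace Y] [TopologicalSpace Z]

theorem eventually_near_isLink {N : RootedGraph Y} {v : ℕ} (hv : v ∈ N.graph.vertexSet) :
    ∀ᶠ N' in near N, ∀ e y, N'.graph.IsLink e v y ↔ N.graph.IsLink e v y := by
  obtain ⟨r, hr⟩ := exists_mem_ballSet_iff.2 (N.connected _ N.root_mem _ hv)
  filter_upwards [eventually_near_ball N (r + 1)] with N' h
  exact isLink_iff_of_ball_eq h.2 hr

theorem eventually_near_root (N : RootedGraph Y) : ∀ᶠ N' in near N, N'.root = N.root :=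
  (eventually_near_ball N 0).mono fun _ h => h.1

theorem eventually_near_mem {N : RootedGraph Y} {v : ℕ} (hv : v ∈ N.graph.vertexSet) :
    ∀ᶠ N' in near N, v ∈ N'.graph.vertexSet := by
  obtain ⟨r, hr⟩ := exists_mem_ballSet_iff.2 (N.connected _ N.root_mem _ hv)
  filter_upwards [eventually_near_ball N r] with N' h
  have : v ∈ ballSet N'.graph N.root r := by
    have := congrArg Graph.vertexSet h.2
    simp only [ball_vertexSet] at this
    rwa [this]
  exact ballSet_subset (h.1 ▸ N'.root_mem) r this

/-- A ball of the component has finitely many vertices; once the links at each of them have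
stabilised, so has the ball. -/
theorem PreGraph.tendsto_comp {α : Type*} {l : Filter α} {F : α → PreGraph Z} {Γ : PreGraph Z}
    {x : ℕ} (h1 : ∀ y ∈ reach Γ.graph x, ∀ᶠ a in l, ∀ e z, (F a).graph.IsLink e y z ↔ Γ.graph.IsLink e y z)
    (h2 : ∀ y ∈ reach Γ.graph x, Tendsto (fun a => (F a).vmark y) l (𝓝 (Γ.vmark y)))
    (h3 : ∀ e ∈ (Γ.comp x).graph.edgeSet,
      Tendsto (fun a => (F a).emark e) l (𝓝 (Γ.emark e))) :
    Tendsto (fun a => (F a).comp x) l (near (Γ.comp x)) := by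
  refine tendsto_near (fun R => ?_) h2 h3
  have := (eventually_all_finite ((Γ.comp x).ballSet_finite R)).2 fun y hy =>
    h1 y (ballSet_subset (Γ.comp x).root_mem R hy)
  filter_upwards [this] with a ha
  refine ⟨rfl, ?_⟩
  change ball ((F a).graph.induce (reach (F a).graph x)) x R =
    ball (Γ.graph.induce (reach Γ.graph x)) x R
  rw [ball_induce_reach, ball_induce_reach]
  refine ball_eq_of_forall_isLink fun y hy => ha y ?_
  exact (ballSet_induce_reach Γ.graph x R).symm ▸ hy

end

/-! ### Clusters -/

/-- The open subgraph of a marked graph whose marks tell whether they are open. -/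
def openGraph (op : Y → Bool) (N : MarkedGraph Y) : Graph ℕ ℕ :=
  (N.graph.restrict {e | op (N.emark e) = true}).induce
    {v | v ∈ N.graph.vertexSet ∧ op (N.vmark v) = true}

theorem openGraph_isLink {op : Y → Bool} {N : MarkedGraph Y} {e x y : ℕ} :
    (openGraph op N).IsLink e x y ↔ N.graph.IsLink e x y ∧ op (N.emark e) = true ∧
      op (N.vmark x) = true ∧ op (N.vmark y) = true :=
  ⟨fun ⟨⟨h1, h2⟩, ⟨_, h3⟩, _, h4⟩ => ⟨h2, h1, h3, h4⟩,
    fun ⟨h1, h2, h3, h4⟩ => ⟨⟨h2, h1⟩, ⟨h1.left_mem, h3⟩, h1.right_mem, h4⟩⟩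

theorem mem_openGraph {op : Y → Bool} {N : MarkedGraph Y} {x : ℕ} :
    x ∈ (openGraph op N).vertexSet ↔ x ∈ N.graph.vertexSet ∧ op (N.vmark x) = true := Iff.rfl

/-- The open subgraph, with marks given by `d`. -/
def openPre (op : Y → Bool) (d : Y → Z) (N : MarkedGraph Y) : PreGraph Z where
  graph := openGraph op N
  vmark := fun v => d (N.vmark v)
  emark := fun e => d (N.emark e)
  locallyFinite := fun v hv => (N.locallyFinite v hv.1).subset fun _ ⟨y, hy⟩ => ⟨y, hy.1.2⟩

theorem preIso_openPre {op : Y → Bool} {d : Y → Z} {M N : MarkedGraph Y} {f g : ℕ → ℕ}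
    (h : MIso M N f g) : PreIso (openPre op d M) (openPre op d N) f g := by
  refine ⟨⟨?_, ?_, ?_⟩, ?_, ?_⟩
  · refine ⟨fun v hv => ⟨h.vert.mapsTo hv.1, by rw [h.vmark v hv.1]; exact hv.2⟩,
      h.vert.injOn.mono fun v hv => hv.1, fun v hv => ?_⟩
    obtain ⟨w, hw, rfl⟩ := h.vert.surjOn hv.1
    exact ⟨w, ⟨hw, by rw [← h.vmark w hw]; exact hv.2⟩, rfl⟩
  · refine ⟨?_, h.edge.injOn.mono ?_, ?_⟩
    · rintro e ⟨x, y, hl⟩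
      replace hl := openGraph_isLink.1 hl
      refine ⟨f x, f y, openGraph_isLink.2 ?_⟩
      rw [h.vmark _ hl.1.left_mem, h.vmark _ hl.1.right_mem, h.emark _ hl.1.edge_mem]
      exact ⟨h.link hl.1, hl.2⟩
    · rintro e ⟨x, y, hl⟩
      exact (openGraph_isLink.1 hl).1.edge_mem
    · rintro e ⟨x, y, hl⟩
      replace hl := openGraph_isLink.1 hl
      obtain ⟨hl, h2⟩ := hl
      obtain ⟨e, x, y, hl', rfl, rfl, rfl⟩ := h.exists_link hl
      rw [h.vmark _ hl'.left_mem, h.vmark _ hl'.right_mem, h.emark _ hl'.edge_mem] at h2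
      exact ⟨e, ⟨x, y, openGraph_isLink.2 ⟨hl', h2⟩⟩, rfl⟩
  · intro e x y hl
    replace hl := openGraph_isLink.1 hl
    refine openGraph_isLink.2 ?_
    rw [h.vmark _ hl.1.left_mem, h.vmark _ hl.1.right_mem, h.emark _ hl.1.edge_mem]
    exact ⟨h.link hl.1, hl.2⟩
  · exact fun v hv => congrArg d (h.vmark v hv.1)
  · rintro e ⟨x, y, hl⟩
    exact congrArg d (h.emark e (openGraph_isLink.1 hl).1.edge_mem)

section

variable [TopologicalSpace Y] {op : Y → Bool} (hop : Continuous op)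

include hop

theorem eventually_near_op_vmark {N : RootedGraph Y} {v : ℕ} (hv : v ∈ N.graph.vertexSet) :
    ∀ᶠ N' in near N, op (N'.vmark v) = op (N.vmark v) :=
  eventually_near_vmark hv (hop.continuousAt.preimage_mem_nhds
    ((isOpen_discrete {op (N.vmark v)}).mem_nhds rfl))

theorem eventually_near_op_emark {N : RootedGraph Y} {e : ℕ} (he : e ∈ N.graph.edgeSet) :
    ∀ᶠ N' in near N, op (N'.emark e) = op (N.emark e) :=
  eventually_near_emark he (hop.continuousAt.preimage_mem_nhds
    ((isOpen_discrete {op (N.emark e)}).mem_nhds rfl))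

/-- Openness of a link at `v` depends on `v`, its finitely many edges and its finitely many
neighbours. Each is locally constant, since `op` is continuous into a discrete space. -/
theorem eventually_near_openGraph_isLink {N : RootedGraph Y} {v : ℕ} (hv : v ∈ N.graph.vertexSet) :
    ∀ᶠ N' in near N, ∀ e y, (openGraph op N'.toMarkedGraph).IsLink e v y ↔
      (openGraph op N.toMarkedGraph).IsLink e v y := by
  have hE := (eventually_all_finite (finite_inc N.toMarkedGraph v)).2 fun e he =>
    eventually_near_op_emark hop (N := N) (e := e) he.edge_mem
  have hV : ∀ᶠ N' in near N, ∀ y, N.graph.Adj v y → op (N'.vmark y) = op (N.vmark y) :=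
    (eventually_all_finite (finite_adj N.toMarkedGraph v)).2 fun y hy =>
      eventually_near_op_vmark hop hy.right_mem
  filter_upwards [eventually_near_isLink hv, eventually_near_op_vmark hop hv, hE, hV]
    with N' h1 h2 h3 h4 e y
  rw [openGraph_isLink, openGraph_isLink, h1, h2]
  refine and_congr_right fun hl => ?_
  rw [h3 e ⟨y, hl⟩, h4 y ⟨e, hl⟩]

theorem tendsto_openPre_comp [TopologicalSpace Z] {d : Y → Z} (hd : Continuous d)
    {N : RootedGraph Y} (h : op (N.vmark N.root) = true) :
    Tendsto (fun N' : RootedGraph Y => (openPre op d N'.toMarkedGraph).comp N.root) (near N)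
      (near ((openPre op d N.toMarkedGraph).comp N.root)) := by
  have hr : reach (openGraph op N.toMarkedGraph) N.root ⊆ N.graph.vertexSet := fun y hy =>
    (reach_subset (G := openGraph op N.toMarkedGraph) ⟨N.root_mem, h⟩ hy).1
  refine PreGraph.tendsto_comp (fun y hy => eventually_near_openGraph_isLink hop (hr hy))
    (fun y hy => ?_) fun e he => ?_
  · exact (hd.tendsto _).comp fun U hU => eventually_near_vmark (hr hy) hU
  · obtain ⟨x, y, hl, -⟩ := he
    exact (hd.tendsto _).comp fun U hU =>
      eventually_near_emark (openGraph_isLink.1 hl).1.edge_mem hU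

end

section

variable [TopologicalSpace Y] [MeasurableSpace Y] [BorelSpace Y] [TopologicalSpace Z]
  [MeasurableSpace Z] [BorelSpace Z]

/-- The open cluster of the root, with marks given by `d`. -/
def clusterT (op : Y → Bool) (hop : Continuous op) (d : Y → Z) (hd : Continuous d) :
    Transform Y Z where
  gr := openPre op d
  K := 1
  nm v _ := v
  pres N v _ := op (N.vmark v) = true
  nm_inj h := ⟨h, Subsingleton.elim _ _⟩
  vert N x := ⟨fun h => ⟨x, 0, h.1, h.2, rfl⟩, by rintro ⟨v, i, h1, h2, rfl⟩; exact ⟨h1, h2⟩⟩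
  pres_iff h v hv _ := by rw [h.vmark v hv]
  equiv {M N f g} h := ⟨f, g, preIso_openPre h, fun _ _ _ => rfl⟩
  measurable_isLink e x y := by
    simp only [openPre, openGraph_isLink]
    have := hop.measurable
    have h : ∀ {F : MarkedGraph Y → Y}, Measurable F → Measurable fun N => op (F N) = true :=
      fun hF => measurableSet_setOfPred.1 ((hop.measurable.comp hF) (measurableSet_singleton true))
    exact (measurable_isLink measurable_id measurable_const measurable_const measurable_const).and
      ((h (measurable_emark measurable_id measurable_const)).and
      ((h (measurable_vmark measurable_id measurable_const)).and
      (h (measurable_vmark measurable_id measurable_const))))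
  measurable_vmark v := hd.measurable.comp (measurable_vmark measurable_id measurable_const)
  measurable_emark e := hd.measurable.comp (measurable_emark measurable_id measurable_const)
  measurable_pres v _ := measurableSet_setOfPred.1 ((hop.measurable.comp
    (measurable_vmark measurable_id measurable_const)) (measurableSet_singleton true))
  local_pres N _ := by
    filter_upwards [eventually_near_root N, eventually_near_op_vmark hop N.root_mem] with N' h1 h2
    rw [h1, h2]
  local_gr N _ hp := (tendsto_openPre_comp hop hd hp).congr' <| by
    filter_upwards [eventually_near_root N] with N' h
    rw [h]

end

end

section

variable {X Y Z : Type}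

/-! ### The law of the root cluster -/

theorem cls_mem_rootOpen_iff (N : RootedGraph Bool) :
    N.cls ∈ rootOpen ↔ N.vmark N.root = true := by
  constructor
  · rintro ⟨M, hM, hr⟩
    obtain ⟨f, g, h, hfr⟩ := RootedGraph.cls_eq_iff.1 hM
    rw [← hfr, h.vmark _ M.root_mem, hr]
  · exact fun h => ⟨N, rfl, h⟩

theorem measurableSet_rootOpen : MeasurableSet rootOpen := by
  refine measurableSet_setOfPred.2 (measurable_of_comp_cls (h := fun q => q ∈ rootOpen) ?_)
  simp only [cls_mem_rootOpen_iff]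
  exact measurableSet_setOfPred.1 ((measurable_vmark RootedGraph.measurable_toMarkedGraph
    RootedGraph.measurable_root) (measurableSet_singleton true))

/-- On representatives, `cluster` is the transformation `clusterT` with trivial marks, whose
measurability is known. -/
theorem measurable_cluster : Measurable cluster := by
  refine measurable_of_comp_cls ?_
  exact RootedGraph.measurable_cls.comp
    ((clusterT id continuous_id (fun _ => ()) continuous_const).measurable_rg (0 : Fin 1))

section

variable [TopologicalSpace Y] [PolishSpace Y] [MeasurableSpace Y] [BorelSpace Y]
  [TopologicalSpace Z] [PolishSpace Z] [MeasurableSpace Z] [BorelSpace Z]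
  {op : Y → Bool} (hop : Continuous op) {d : Y → Z} (hd : Continuous d)

theorem push_clusterT {g : RootedSpace Z → ℝ≥0∞} (hg : Measurable g) (N : RootedGraph Y) :
    (clusterT op hop d hd).push g N.cls =
      if op (N.vmark N.root) = true then
        g ((openPre op d N.toMarkedGraph).comp N.root).cls else 0 := by
  rw [Transform.push_cls _ hg]
  refine (Fin.sum_univ_one fun _ => @ite _ (op (N.vmark N.root) = true) (Classical.propDecidable _)
    (g ((openPre op d N.toMarkedGraph).comp N.root).cls) 0).trans ?_
  congr

theorem tr_clusterT_univ (Q : Measure (RootedSpace Y)) :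
    (clusterT op hop d hd).tr Q univ = (Q.map (mapMarks op)) rootOpen := by
  rw [← lintegral_one, Transform.lintegral_tr _ _ measurable_const,
    Measure.map_apply (measurable_mapMarks hop.measurable) measurableSet_rootOpen,
    ← lintegral_indicator_one (measurable_mapMarks hop.measurable measurableSet_rootOpen)]
  refine lintegral_congr fun q => ?_
  obtain ⟨N, rfl⟩ := RootedGraph.exists_cls_eq q
  rw [push_clusterT hop hd measurable_const]
  have : N.cls ∈ mapMarks op ⁻¹' rootOpen ↔ op (N.vmark N.root) = true := by
    rw [mem_preimage, mapMarks_cls, cls_mem_rootOpen_iff]; rfl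
  by_cases h : op (N.vmark N.root) = true
  · rw [if_pos h, indicator_of_mem (this.2 h)]; rfl
  · rw [if_neg h, indicator_of_notMem (fun h' => h (this.1 h'))]

theorem forget_comp_openPre (N : RootedGraph Y) :
    forget ((openPre op d N.toMarkedGraph).comp N.root).cls =
      cluster (mapMarks op N.cls) := rfl

/-- `clusterT` restricts to the event that the root is open, whose probability is its total mass, so
normalising amounts to conditioning. The marks given by `d` disappear under `forget`. -/
theorem percolationLaw_map (Q : Measure (RootedSpace Y)) :
    percolationLaw (Q.map (mapMarks op)) =
      ((clusterT op hop d hd).tr Q univ)⁻¹ • ((clusterT op hop d hd).tr Q).map forget := by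
  have hf : Measurable (forget (X := Z)) := measurable_mapMarks measurable_const
  have hm := measurable_mapMarks hop.measurable
  ext A hA
  have hB : MeasurableSet (rootOpen ∩ cluster ⁻¹' A) :=
    measurableSet_rootOpen.inter (measurable_cluster hA)
  rw [percolationLaw, Measure.map_apply measurable_cluster hA,
    ProbabilityTheory.cond_apply measurableSet_rootOpen, Measure.smul_apply, tr_clusterT_univ,
    smul_eq_mul, Measure.map_apply hf hA, Measure.map_apply hm hB]
  congr 1
  rw [← lintegral_indicator_one (hf hA), Transform.lintegral_tr _ _ (measurable_one.indicator
    (hf hA)), ← lintegral_indicator_one (hm hB)]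
  refine lintegral_congr fun q => ?_
  obtain ⟨N, rfl⟩ := RootedGraph.exists_cls_eq q
  rw [push_clusterT hop hd (measurable_one.indicator (hf hA))]
  have h1 : mapMarks op N.cls ∈ rootOpen ↔ op (N.vmark N.root) = true := by
    rw [mapMarks_cls, cls_mem_rootOpen_iff]; rfl
  have h2 := forget_comp_openPre (op := op) (d := d) N
  classical
  simp only [indicator_apply, mem_preimage, mem_inter_iff, h1, h2]
  split_ifs <;> simp_all

end

/-! ### Connected configurations -/

/-- The open vertices form exactly one cluster. -/
def OpenConnected (op : Y → Bool) (N : MarkedGraph Y) : Prop :=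
  (openGraph op N).vertexSet.Nonempty ∧ ∀ v ∈ (openGraph op N).vertexSet,
    ∀ w ∈ (openGraph op N).vertexSet, w ∈ reach (openGraph op N) v

theorem OpenConnected.congr {op : Y → Bool} {M N : MarkedGraph Y} {f g : ℕ → ℕ}
    (h : MIso M N f g) (hM : OpenConnected op M) : OpenConnected op N := by
  have hi : IsIso (openGraph op M) (openGraph op N) f g :=
    (preIso_openPre (d := fun _ => ()) h).toIsIso
  refine ⟨?_, fun v hv w hw => ?_⟩
  · obtain ⟨v, hv⟩ := hM.1
    exact ⟨f v, hi.vert.mapsTo hv⟩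
  · obtain ⟨v, hv', rfl⟩ := hi.vert.surjOn hv
    obtain ⟨w, hw', rfl⟩ := hi.vert.surjOn hw
    exact (hi.mem_reach_iff hv' hw').2 (hM.2 v hv' w hw')

/-- Connectedness of the open part is invariant under isomorphism, so one good representative makes
all of them good. -/
theorem ae_openConnected [TopologicalSpace Y] [PolishSpace Y] [MeasurableSpace Y] [BorelSpace Y]
    {Q : Measure (RootedSpace Y)} {op : Y → Bool} (hop : Continuous op)
    (h : AlmostSurelyConnected (Q.map (mapMarks op))) :
    ∀ᵐ q ∂Q, ∀ N : RootedGraph Y, N.cls = q → OpenConnected op N.toMarkedGraph := by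
  have h' := ae_of_ae_map (measurable_mapMarks hop.measurable).aemeasurable h
  filter_upwards [h'] with q hq N hN
  obtain ⟨M, hM, hc⟩ := hq
  rw [← hN, mapMarks_cls] at hM
  obtain ⟨f, g, hi, -⟩ := RootedGraph.cls_eq_iff.1 hM
  have h1 : OpenConnected id M.toMarkedGraph := hc.2
  have h2 : OpenConnected id (N.mapMarks op).toMarkedGraph := h1.congr hi
  exact h2

theorem measurable_openConnected [TopologicalSpace Y] [MeasurableSpace Y] [BorelSpace Y]
    {op : Y → Bool} (hop : Continuous op) :
    Measurable fun N : MarkedGraph Y => OpenConnected op N := by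
  have h1 : ∀ {F : MarkedGraph Y → Y}, Measurable F → Measurable fun N => op (F N) = true :=
    fun hF => measurableSet_setOfPred.1 ((hop.measurable.comp hF) (measurableSet_singleton true))
  have hv : ∀ v, Measurable fun N : MarkedGraph Y => v ∈ (openGraph op N).vertexSet := fun v =>
    (measurable_mem_vertexSet measurable_id measurable_const).and
      (h1 (measurable_vmark measurable_id measurable_const))
  have hl : ∀ e x y, Measurable fun N : MarkedGraph Y => (openGraph op N).IsLink e x y :=
    (clusterT op hop (fun _ => ()) continuous_const).measurable_isLink
  unfold OpenConnected Set.Nonempty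
  refine (Measurable.exists hv).and (Measurable.forall fun v => (hv v).imp
    (Measurable.forall fun w => (hv w).imp ?_))
  exact measurable_mem_reach hl measurable_const measurable_const

end

section

variable {A A' B B' : Type}

/-! ### Adding random marks -/

/-- Marks for all vertex labels and all edge labels. -/
abbrev Marks (B : Type) : Type := ℕ ⊕ ℕ → B

/-- Add marks to a marked graph. -/
def MarkedGraph.addMarks (N : MarkedGraph A) (m : Marks B) : MarkedGraph (A × B) where
  graph := N.graph
  vmark v := (N.vmark v, m (.inl v))
  emark e := (N.emark e, m (.inr e))
  locallyFinite := N.locallyFinite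
  connected := N.connected

def RootedGraph.addMarks (N : RootedGraph A) (m : Marks B) : RootedGraph (A × B) :=
  { toMarkedGraph := N.toMarkedGraph.addMarks m, root := N.root, root_mem := N.root_mem }

/-- The vertices and the edges. -/
def objs (G : Graph ℕ ℕ) : Set (ℕ ⊕ ℕ) := Sum.elim G.vertexSet G.edgeSet

theorem IsIso.mapsTo_objs {G H : Graph ℕ ℕ} {f g : ℕ → ℕ} (h : IsIso G H f g) :
    MapsTo (Sum.map f g) (objs G) (objs H) := by
  rintro (v | e) ho
  · exact h.vert.mapsTo ho
  · exact h.edge.mapsTo ho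

theorem IsIso.injOn_objs {G H : Graph ℕ ℕ} {f g : ℕ → ℕ} (h : IsIso G H f g) :
    InjOn (Sum.map f g) (objs G) := by
  rintro (v | e) ho (w | e') ho' heq
  · exact congrArg _ (h.vert.injOn ho ho' (Sum.inl_injective heq))
  · cases heq
  · cases heq
  · exact congrArg _ (h.edge.injOn ho ho' (Sum.inr_injective heq))

theorem IsIso.surjOn_objs {G H : Graph ℕ ℕ} {f g : ℕ → ℕ} (h : IsIso G H f g) :
    SurjOn (Sum.map f g) (objs G) (objs H) := by
  rintro (v | e) ho
  · obtain ⟨w, hw, rfl⟩ := h.vert.surjOn ho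
    exact ⟨.inl w, hw, rfl⟩
  · obtain ⟨w, hw, rfl⟩ := h.edge.surjOn ho
    exact ⟨.inr w, hw, rfl⟩

open scoped Classical in
/-- Transport marks along a map of objects defined on `S`. -/
def pull (b : B) (S : Set (ℕ ⊕ ℕ)) (F : ℕ ⊕ ℕ → ℕ ⊕ ℕ) (m : Marks B) : Marks B := fun o =>
  if o ∈ S then m (F o) else b

theorem pull_of_mem {b : B} {S : Set (ℕ ⊕ ℕ)} {F : ℕ ⊕ ℕ → ℕ ⊕ ℕ} {m : Marks B} {o : ℕ ⊕ ℕ}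
    (h : o ∈ S) : pull b S F m o = m (F o) := if_pos h

theorem measurable_pull [MeasurableSpace B] (b : B) (S : Set (ℕ ⊕ ℕ)) (F : ℕ ⊕ ℕ → ℕ ⊕ ℕ) :
    Measurable (pull b S F) := by
  refine measurable_pi_lambda _ fun o => ?_
  unfold pull
  split_ifs
  · exact measurable_pi_apply _
  · exact measurable_const

/-- A mark-preserving isomorphism stays one after adding marks that correspond. -/
theorem MIso.addMarks {M N : MarkedGraph A} {f g : ℕ → ℕ} (h : MIso M N f g) {m m' : Marks B}
    (hm : ∀ o ∈ objs M.graph, m' (Sum.map f g o) = m o) : MIso (M.addMarks m) (N.addMarks m') f g :=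
  ⟨h.toIsIso, fun v hv => Prod.ext (h.vmark v hv) (hm (.inl v) hv),
    fun e he => Prod.ext (h.emark e he) (hm (.inr e) he)⟩

theorem addMarks_cls_congr {M N : RootedGraph A} {f g : ℕ → ℕ}
    (h : MIso M.toMarkedGraph N.toMarkedGraph f g) (hr : f M.root = N.root) {m m' : Marks B}
    (hm : ∀ o ∈ objs M.graph, m' (Sum.map f g o) = m o) :
    (M.addMarks m).cls = (N.addMarks m').cls :=
  RootedGraph.cls_eq_iff.2 ⟨f, g, h.addMarks hm, hr⟩

def BirootedGraph.addMarks (C : BirootedGraph A) (m : Marks B) : BirootedGraph (A × B) :=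
  { toMarkedGraph := C.toMarkedGraph.addMarks m, root₁ := C.root₁, root₂ := C.root₂,
    root₁_mem := C.root₁_mem, root₂_mem := C.root₂_mem }

theorem RootedGraph.bi_addMarks (N : RootedGraph A) (m : Marks B) (u v : ℕ) :
    (N.addMarks m).bi u v = (N.bi u v).addMarks m := by
  by_cases h : u ∈ N.graph.vertexSet ∧ v ∈ N.graph.vertexSet
  · rw [bi_eq h.1 h.2, bi_eq (N := N.addMarks m) h.1 h.2]
    rfl
  · have h' : ¬ (u ∈ (N.addMarks m).graph.vertexSet ∧ v ∈ (N.addMarks m).graph.vertexSet) := h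
    rw [bi, bi, dif_neg h, dif_neg h']
    rfl

theorem bi_addMarks_cls_congr {C D : BirootedGraph A} {f g : ℕ → ℕ}
    (h : MIso C.toMarkedGraph D.toMarkedGraph f g) (h₁ : f C.root₁ = D.root₁)
    (h₂ : f C.root₂ = D.root₂) {m m' : Marks B}
    (hm : ∀ o ∈ objs C.graph, m' (Sum.map f g o) = m o) :
    (C.addMarks m).cls = (D.addMarks m').cls :=
  BirootedGraph.cls_eq_iff.2 ⟨f, g, h.addMarks hm, h₁, h₂⟩

section

variable [MeasurableSpace A] [MeasurableSpace B] {Ω : Type*} [MeasurableSpace Ω]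

theorem measurable_addMarks {F : Ω → RootedGraph A} {m : Ω → Marks B} (hF : Measurable F)
    (hm : Measurable m) : Measurable fun a => (F a).addMarks (m a) := by
  have hG : Measurable fun a => (F a).toMarkedGraph := RootedGraph.measurable_toMarkedGraph.comp hF
  rw [measurable_rootedGraph_iff, measurable_markedGraph_iff]
  have h := measurable_markedGraph_iff.1 hG
  have hm' := measurable_pi_iff.1 hm
  exact ⟨⟨h.1, h.2.1, fun v => (h.2.2.1 v).prodMk (hm' _), fun v => (h.2.2.2 v).prodMk (hm' _)⟩,
    (RootedGraph.measurable_root (X := A)).comp hF⟩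

theorem measurable_bi_addMarks {F : Ω → BirootedGraph A} {m : Ω → Marks B} (hF : Measurable F)
    (hm : Measurable m) : Measurable fun a => (F a).addMarks (m a) := by
  have hG : Measurable fun a => (F a).toMarkedGraph :=
    BirootedGraph.measurable_toMarkedGraph.comp hF
  rw [measurable_birootedGraph_iff, measurable_markedGraph_iff]
  have h := measurable_markedGraph_iff.1 hG
  have hm' := measurable_pi_iff.1 hm
  exact ⟨⟨h.1, h.2.1, fun v => (h.2.2.1 v).prodMk (hm' _), fun v => (h.2.2.2 v).prodMk (hm' _)⟩,
    (BirootedGraph.measurable_root₁ (X := A)).comp hF,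
    (BirootedGraph.measurable_root₂ (X := A)).comp hF⟩

/-- The random marks given by `K` are equivariant under all isomorphisms, which need not preserve
the root. -/
def Equivariant (K : Kernel (RootedGraph A) (Marks B)) : Prop :=
  ∀ (b : B) (M N : RootedGraph A) (f g : ℕ → ℕ), MIso M.toMarkedGraph N.toMarkedGraph f g →
    (K N).map (pull b (objs M.graph) (Sum.map f g)) = (K M).map (pull b (objs M.graph) id)

/-- The random marks given by `K` are equivariant under root-preserving isomorphisms. -/
def RootEquivariant (K : Kernel (RootedGraph A) (Marks B)) : Prop :=
  ∀ (b : B) (M N : RootedGraph A) (f g : ℕ → ℕ), MIso M.toMarkedGraph N.toMarkedGraph f g →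
    f M.root = N.root →
    (K N).map (pull b (objs M.graph) (Sum.map f g)) = (K M).map (pull b (objs M.graph) id)

theorem Equivariant.rootEquivariant {K : Kernel (RootedGraph A) (Marks B)} (hK : Equivariant K) :
    RootEquivariant K := fun b M N f g h _ => hK b M N f g h

/-- By `hc`, `φ` depends only on the marks of objects of `M`. The default values introduced by
`pull` are therefore harmless, and both integrals are integrals of `φ` against the same pulled-back
law. -/
theorem lintegral_congr_of_map_pull [Nonempty B] {μ ν : Measure (Marks B)} {M N : MarkedGraph A}
    {f g : ℕ → ℕ} (h : MIso M N f g)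
    (hμ : ∀ b, ν.map (pull b (objs M.graph) (Sum.map f g)) = μ.map (pull b (objs M.graph) id))
    {φ φ' : Marks B → ℝ≥0∞} (hφ : Measurable φ)
    (hc : ∀ m m' : Marks B, (∀ o ∈ objs M.graph, m' (Sum.map f g o) = m o) → φ m = φ' m') :
    ∫⁻ m, φ m ∂μ = ∫⁻ m, φ' m ∂ν := by
  obtain ⟨b⟩ := ‹Nonempty B›
  -- Both sides are compared through marks on `N` that extend the transported ones, arbitrarily
  -- outside the image.
  have key : ∀ m m' : Marks B, (∀ o ∈ objs M.graph, m' o = m o) → φ m = φ m' := by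
    classical
    intro m m' hm
    let m'' : Marks B := fun o => if ho : ∃ o' ∈ objs M.graph, Sum.map f g o' = o then m ho.choose
      else b
    have hm'' : ∀ o ∈ objs M.graph, m'' (Sum.map f g o) = m o := by
      intro o ho
      have hex : ∃ o' ∈ objs M.graph, Sum.map f g o' = Sum.map f g o := ⟨o, ho, rfl⟩
      change dite _ _ _ = _
      rw [dif_pos hex, h.injOn_objs hex.choose_spec.1 ho hex.choose_spec.2]
    rw [hc m m'' hm'', hc m' m'' fun o ho => (hm'' o ho).trans (hm o ho).symm]
  have h1 : ∫⁻ m, φ m ∂μ = ∫⁻ m, φ m ∂μ.map (pull b (objs M.graph) id) := by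
    rw [lintegral_map hφ (measurable_pull _ _ _)]
    exact MeasureTheory.lintegral_congr fun m => key _ _ fun o ho => pull_of_mem ho
  have h2 : ∫⁻ m, φ' m ∂ν = ∫⁻ m, φ m ∂ν.map (pull b (objs M.graph) (Sum.map f g)) := by
    rw [lintegral_map hφ (measurable_pull _ _ _)]
    exact MeasureTheory.lintegral_congr fun m => (hc _ _ fun o ho => (pull_of_mem ho).symm).symm
  rw [h1, h2, hμ b]

theorem RootEquivariant.lintegral_congr [Nonempty B] {K : Kernel (RootedGraph A) (Marks B)}
    (hK : RootEquivariant K) {M N : RootedGraph A} {f g : ℕ → ℕ}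
    (h : MIso M.toMarkedGraph N.toMarkedGraph f g) (hr : f M.root = N.root)
    {φ φ' : Marks B → ℝ≥0∞} (hφ : Measurable φ)
    (hc : ∀ m m' : Marks B, (∀ o ∈ objs M.graph, m' (Sum.map f g o) = m o) → φ m = φ' m') :
    ∫⁻ m, φ m ∂K M = ∫⁻ m, φ' m ∂K N :=
  lintegral_congr_of_map_pull h (fun b => hK b M N f g h hr) hφ hc

theorem Equivariant.lintegral_congr [Nonempty B] {K : Kernel (RootedGraph A) (Marks B)}
    (hK : Equivariant K) {M N : RootedGraph A} {f g : ℕ → ℕ}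
    (h : MIso M.toMarkedGraph N.toMarkedGraph f g)
    {φ φ' : Marks B → ℝ≥0∞} (hφ : Measurable φ)
    (hc : ∀ m m' : Marks B, (∀ o ∈ objs M.graph, m' (Sum.map f g o) = m o) → φ m = φ' m') :
    ∫⁻ m, φ m ∂K M = ∫⁻ m, φ' m ∂K N :=
  lintegral_congr_of_map_pull h (fun b => hK b M N f g h) hφ hc

end

section

variable [TopologicalSpace A] [PolishSpace A] [MeasurableSpace A] [BorelSpace A]
  [TopologicalSpace B] [PolishSpace B] [MeasurableSpace B] [BorelSpace B]

theorem measurable_addMarks_cls : Measurable fun p : RootedGraph A × Marks B =>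
    (p.1.addMarks p.2).cls :=
  RootedGraph.measurable_cls.comp (measurable_addMarks measurable_fst measurable_snd)

theorem measurable_addMarks_cls_right (N : RootedGraph A) :
    Measurable fun m : Marks B => (N.addMarks m).cls :=
  measurable_addMarks_cls.comp (measurable_const.prodMk measurable_id)

variable [Nonempty B] {K : Kernel (RootedGraph A) (Marks B)} [IsMarkovKernel K]

/-- The law of the graph with random marks added. -/
def addKernel (hK : RootEquivariant K) : Kernel (RootedSpace A) (RootedSpace (A × B)) where
  toFun := Quotient.lift (fun N => (K N).map fun m => (N.addMarks m).cls) <| by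
    intro M N hMN
    obtain ⟨f, g, h, hr⟩ := RootedGraph.cls_eq_iff.1 (Quotient.sound hMN)
    have hm := measurable_addMarks_cls_right (A := A) (B := B)
    refine Measure.ext fun S hS => ?_
    rw [← lintegral_indicator_one hS, ← lintegral_indicator_one hS,
      lintegral_map (measurable_one.indicator hS) (hm M),
      lintegral_map (measurable_one.indicator hS) (hm N)]
    exact hK.lintegral_congr h hr ((measurable_one.indicator hS).comp (hm M)) fun m m' hmm =>
      congrArg _ (addMarks_cls_congr h hr hmm)
  measurable' := by
    refine measurable_of_comp_cls ?_
    refine Measure.measurable_of_measurable_coe _ fun S hS => ?_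
    have hm := measurable_addMarks_cls_right (A := A) (B := B)
    change Measurable fun N : RootedGraph A => ((K N).map fun m => (N.addMarks m).cls) S
    simp only [Measure.map_apply (hm _) hS]
    exact Kernel.measurable_kernel_prodMk_left (measurable_addMarks_cls hS)

theorem addKernel_cls (hK : RootEquivariant K) (N : RootedGraph A) :
    addKernel hK N.cls = (K N).map fun m => (N.addMarks m).cls := rfl

/-- The law of `(G, ρ, m)` with random marks added. -/
def addLaw (hK : RootEquivariant K) (Q : Measure (RootedSpace A)) : Measure (RootedSpace (A × B)) :=
  Q.bind (addKernel hK)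

theorem lintegral_addKernel_cls (hK : RootEquivariant K) {φ : RootedSpace (A × B) → ℝ≥0∞}
    (hφ : Measurable φ) (N : RootedGraph A) :
    ∫⁻ p, φ p ∂addKernel hK N.cls = ∫⁻ m, φ (N.addMarks m).cls ∂K N := by
  rw [addKernel_cls, lintegral_map hφ (measurable_addMarks_cls_right N)]

theorem lintegral_addLaw (hK : RootEquivariant K) (Q : Measure (RootedSpace A))
    {φ : RootedSpace (A × B) → ℝ≥0∞} (hφ : Measurable φ) :
    ∫⁻ p, φ p ∂addLaw hK Q = ∫⁻ q, ∫⁻ p, φ p ∂addKernel hK q ∂Q :=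
  Measure.lintegral_bind (addKernel hK).measurable.aemeasurable hφ.aemeasurable

instance (hK : RootEquivariant K) : IsMarkovKernel (addKernel hK) := by
  refine ⟨fun q => ?_⟩
  obtain ⟨N, rfl⟩ := RootedGraph.exists_cls_eq q
  rw [addKernel_cls]
  exact Measure.isProbabilityMeasure_map (measurable_addMarks_cls_right N).aemeasurable

instance (hK : RootEquivariant K) (Q : Measure (RootedSpace A)) [IsProbabilityMeasure Q] :
    IsProbabilityMeasure (addLaw hK Q) := by
  unfold addLaw; infer_instance

theorem measurable_bi_addMarks_cls : Measurable fun p : BirootedGraph A × Marks B =>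
    (p.1.addMarks p.2).cls :=
  BirootedGraph.measurable_cls.comp (measurable_bi_addMarks measurable_fst measurable_snd)

theorem measurable_bi_addMarks_cls_right {f : BirootedSpace (A × B) → ℝ≥0∞} (hf : Measurable f)
    (C : BirootedGraph A) : Measurable fun m : Marks B => f (C.addMarks m).cls :=
  hf.comp (measurable_bi_addMarks_cls.comp (measurable_const.prodMk measurable_id))

/-- The transport on unmarked graphs obtained by averaging over the marks given by `K` at a root
chosen by `e`. -/
def avgAux (K : Kernel (RootedGraph A) (Marks B)) (e : BirootedGraph A → RootedGraph A)
    (f : BirootedSpace (A × B) → ℝ≥0∞) (C : BirootedGraph A) : ℝ≥0∞ :=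
  ∫⁻ m, f (C.addMarks m).cls ∂K (e C)

theorem avgAux_congr (hK : RootEquivariant K) {e : BirootedGraph A → RootedGraph A}
    (he : ∀ C D f g, MIso C.toMarkedGraph D.toMarkedGraph f g → f C.root₁ = D.root₁ →
      f C.root₂ = D.root₂ → MIso (e C).toMarkedGraph (e D).toMarkedGraph f g ∧
        f (e C).root = (e D).root) (he' : ∀ C, (e C).graph = C.graph)
    {f : BirootedSpace (A × B) → ℝ≥0∞} (hf : Measurable f)
    {C D : BirootedGraph A} (h : C.cls = D.cls) : avgAux K e f C = avgAux K e f D := by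
  obtain ⟨φ, ψ, hi, hr, hs⟩ := BirootedGraph.cls_eq_iff.1 h
  obtain ⟨h1, h2⟩ := he C D φ ψ hi hr hs
  refine hK.lintegral_congr h1 h2 (measurable_bi_addMarks_cls_right hf _) fun m m' hm => ?_
  rw [he'] at hm
  rw [bi_addMarks_cls_congr hi hr hs hm]

theorem measurable_avgAux {e : BirootedGraph A → RootedGraph A} (he : Measurable e)
    {f : BirootedSpace (A × B) → ℝ≥0∞} (hf : Measurable f) : Measurable (avgAux K e f) :=
  Measurable.lintegral_kernel_prod_right (κ := K.comap _ he)
    (f := fun (C : BirootedGraph A) m => f (C.addMarks m).cls)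
    (hf.comp measurable_bi_addMarks_cls)

/-- Average a transport over the marks given by `K` at the first root. -/
def avgFirst (hK : RootEquivariant K) {f : BirootedSpace (A × B) → ℝ≥0∞} (hf : Measurable f) :
    BirootedSpace A → ℝ≥0∞ :=
  Quotient.lift (avgAux K BirootedGraph.first f) fun _ _ h =>
    avgAux_congr hK (fun _ _ _ _ h1 h2 _ => ⟨h1, h2⟩) (fun _ => rfl) hf (Quotient.sound h)

/-- Average a transport over the marks given by `K` at the second root. -/
def avgSecond (hK : RootEquivariant K) {f : BirootedSpace (A × B) → ℝ≥0∞} (hf : Measurable f) :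
    BirootedSpace A → ℝ≥0∞ :=
  Quotient.lift (avgAux K BirootedGraph.second f) fun _ _ h =>
    avgAux_congr hK (fun _ _ _ _ h1 _ h2 => ⟨h1, h2⟩) (fun _ => rfl) hf (Quotient.sound h)

variable (hK : RootEquivariant K) {f : BirootedSpace (A × B) → ℝ≥0∞} (hf : Measurable f)

theorem avgFirst_cls (C : BirootedGraph A) :
    avgFirst hK hf C.cls = ∫⁻ m, f (C.addMarks m).cls ∂K C.first := rfl

theorem avgSecond_cls (C : BirootedGraph A) :
    avgSecond hK hf C.cls = ∫⁻ m, f (C.addMarks m).cls ∂K C.second := rfl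

theorem measurable_avgFirst : Measurable (avgFirst hK hf) :=
  measurable_of_comp_bicls (h := avgFirst hK hf)
    (measurable_avgAux BirootedGraph.measurable_first hf)

theorem measurable_avgSecond : Measurable (avgSecond hK hf) :=
  measurable_of_comp_bicls (h := avgSecond hK hf)
    (measurable_avgAux BirootedGraph.measurable_second hf)

/-- This is Tonelli's theorem. The marks are sampled at the root, which is the sender here and the
receiver in `lintegral_massIn_addKernel`; hence two different averages. -/
theorem lintegral_massOut_addKernel (q : RootedSpace A) :
    ∫⁻ p, massOut f p ∂addKernel hK q = massOut (avgFirst hK hf) q := by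
  obtain ⟨N, rfl⟩ := RootedGraph.exists_cls_eq q
  rw [lintegral_addKernel_cls hK (measurable_massOut hf), massOut_cls,
    vsum_congr (h' := fun v => ∫⁻ m, f ((N.bi N.root v).addMarks m).cls ∂K N) fun v hv => by
      rw [avgFirst_cls, RootedGraph.first_bi N.root_mem hv, RootedGraph.at'_self],
    ← tsum_vertex_eq_vsum, ← lintegral_tsum fun v => (measurable_bi_addMarks_cls_right hf _).aemeasurable]
  refine MeasureTheory.lintegral_congr fun m => ?_
  rw [massOut_cls, ← tsum_vertex_eq_vsum]
  simp only [RootedGraph.bi_addMarks]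
  rfl

theorem lintegral_massIn_addKernel (q : RootedSpace A) :
    ∫⁻ p, massIn f p ∂addKernel hK q = massIn (avgSecond hK hf) q := by
  obtain ⟨N, rfl⟩ := RootedGraph.exists_cls_eq q
  rw [lintegral_addKernel_cls hK (measurable_massIn hf), massIn_cls,
    vsum_congr (h' := fun v => ∫⁻ m, f ((N.bi v N.root).addMarks m).cls ∂K N) fun v hv => by
      rw [avgSecond_cls, RootedGraph.second_bi hv N.root_mem, RootedGraph.at'_self],
    ← tsum_vertex_eq_vsum, ← lintegral_tsum fun v => (measurable_bi_addMarks_cls_right hf _).aemeasurable]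
  refine MeasureTheory.lintegral_congr fun m => ?_
  rw [massIn_cls, ← tsum_vertex_eq_vsum]
  simp only [RootedGraph.bi_addMarks]
  rfl

/-- Equivariance under isomorphisms that may move the root makes `avgFirst` and `avgSecond` equal.
Mass transport under `Q` for this common average is mass transport for the marked law. -/
theorem Uni.addLaw (hK : Equivariant K) {Q : Measure (RootedSpace A)} (hQ : Uni Q) :
    Uni (addLaw hK.rootEquivariant Q) := by
  intro f hf
  rw [lintegral_addLaw _ Q (measurable_massOut hf), lintegral_addLaw _ Q (measurable_massIn hf)]
  simp only [lintegral_massOut_addKernel _ hf, lintegral_massIn_addKernel _ hf]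
  have : avgSecond hK.rootEquivariant hf = avgFirst hK.rootEquivariant hf := by
    ext c
    obtain ⟨C, rfl⟩ := BirootedGraph.exists_cls_eq c
    rw [avgFirst_cls, avgSecond_cls]
    refine hK.lintegral_congr (M := C.second) (N := C.first) (MIso.id _) 
      (measurable_bi_addMarks_cls_right hf _) fun m m' hm => ?_
    rw [bi_addMarks_cls_congr (MIso.id C.toMarkedGraph) rfl rfl hm]
  rw [this]
  exact hQ _ (measurable_avgFirst hK.rootEquivariant hf)

end

end

section

variable {A A' B B' : Type}

section

variable [TopologicalSpace A] [PolishSpace A] [MeasurableSpace A] [BorelSpace A]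
  [TopologicalSpace A'] [PolishSpace A'] [MeasurableSpace A'] [BorelSpace A']
  [TopologicalSpace B] [PolishSpace B] [MeasurableSpace B] [BorelSpace B] [Nonempty B]

theorem map_fst_addLaw {K : Kernel (RootedGraph A) (Marks B)} [IsMarkovKernel K]
    (hK : RootEquivariant K) (Q : Measure (RootedSpace A)) :
    (addLaw hK Q).map (mapMarks Prod.fst) = Q := by
  refine Measure.ext_of_lintegral _ fun φ hφ => ?_
  have hm : Measurable (mapMarks (Prod.fst (α := A) (β := B))) := measurable_mapMarks measurable_fst
  rw [lintegral_map hφ hm, lintegral_addLaw hK Q (φ := fun p => φ (mapMarks Prod.fst p)) (hφ.comp hm)]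
  refine lintegral_congr fun q => ?_
  obtain ⟨N, rfl⟩ := RootedGraph.exists_cls_eq q
  rw [lintegral_addKernel_cls hK (φ := fun p => φ (mapMarks Prod.fst p)) (hφ.comp hm)]
  change ∫⁻ _, φ N.cls ∂_ = _
  simp

/-- A kernel on graphs with more marks, obtained by forgetting some of them. -/
def comapMarks (K : Kernel (RootedGraph A') (Marks B)) {c : A → A'} (hc : Measurable c) :
    Kernel (RootedGraph A) (Marks B) := K.comap _ (RootedGraph.measurable_mapMarks hc)

instance (K : Kernel (RootedGraph A') (Marks B)) [IsMarkovKernel K] {c : A → A'}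
    (hc : Measurable c) : IsMarkovKernel (comapMarks K hc) := by
  unfold comapMarks; infer_instance

theorem RootEquivariant.comapMarks {K : Kernel (RootedGraph A') (Marks B)}
    (hK : RootEquivariant K) {c : A → A'} (hc : Measurable c) : RootEquivariant (comapMarks K hc) :=
  fun b M N f g h => hK b (M.mapMarks c) (N.mapMarks c) f g (h.mapMarks c)

theorem Equivariant.comapMarks {K : Kernel (RootedGraph A') (Marks B)} (hK : Equivariant K)
    {c : A → A'} (hc : Measurable c) : Equivariant (comapMarks K hc) :=
  fun b M N f g h => hK b (M.mapMarks c) (N.mapMarks c) f g (h.mapMarks c)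

/-- A kernel that reads the old marks only through `c` gives the same new marks before and after `c`
is applied. This transfers a kernel to graphs with additional marks. -/
theorem map_addLaw_comapMarks {K : Kernel (RootedGraph A') (Marks B)} [IsMarkovKernel K]
    (hK : RootEquivariant K) {c : A → A'} (hc : Measurable c) (Q : Measure (RootedSpace A)) :
    (addLaw (hK.comapMarks hc) Q).map (mapMarks (Prod.map c id)) =
      addLaw hK (Q.map (mapMarks c)) := by
  refine Measure.ext_of_lintegral _ fun φ hφ => ?_
  have hm : Measurable (mapMarks (Prod.map c (id : B → B))) :=
    measurable_mapMarks (hc.prodMap measurable_id)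
  rw [lintegral_map hφ hm, lintegral_addLaw _ Q (φ := fun p => φ (mapMarks (Prod.map c id) p)) (hφ.comp hm),
    lintegral_addLaw hK _ hφ,
    lintegral_map (Measurable.lintegral_kernel hφ) (measurable_mapMarks hc)]
  refine lintegral_congr fun q => ?_
  obtain ⟨N, rfl⟩ := RootedGraph.exists_cls_eq q
  rw [lintegral_addKernel_cls _ (φ := fun p => φ (mapMarks (Prod.map c id) p)) (hφ.comp hm),
    mapMarks_cls, lintegral_addKernel_cls hK hφ]
  rfl

/-! ### Deterministic marks -/

/-- Marks that are a measurable function of the graph. -/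
def detKernel {d : RootedGraph A → Marks B} (hd : Measurable d) :
    Kernel (RootedGraph A) (Marks B) := Kernel.deterministic d hd

instance {d : RootedGraph A → Marks B} (hd : Measurable d) : IsMarkovKernel (detKernel hd) := by
  unfold detKernel; infer_instance

theorem equivariant_detKernel {d : RootedGraph A → Marks B} (hd : Measurable d)
    (h : ∀ (M N : RootedGraph A) (f g : ℕ → ℕ), MIso M.toMarkedGraph N.toMarkedGraph f g →
      ∀ o ∈ objs M.graph, d N (Sum.map f g o) = d M o) : Equivariant (detKernel hd) := by
  intro b M N f g hi
  rw [detKernel, Kernel.deterministic_apply, Kernel.deterministic_apply,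
    Measure.map_dirac' (measurable_pull _ _ _), Measure.map_dirac' (measurable_pull _ _ _)]
  congr 1
  funext o
  unfold pull
  split_ifs with ho
  · exact h M N f g hi o ho
  · rfl

theorem lintegral_addLaw_detKernel {d : RootedGraph A → Marks B} (hd : Measurable d)
    (hK : RootEquivariant (detKernel hd)) (Q : Measure (RootedSpace A))
    {φ : RootedSpace (A × B) → ℝ≥0∞} (hφ : Measurable φ) {ψ : RootedSpace A → ℝ≥0∞}
    (h : ∀ᵐ q ∂Q, ∀ N : RootedGraph A, N.cls = q → φ (N.addMarks (d N)).cls = ψ q) :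
    ∫⁻ p, φ p ∂addLaw hK Q = ∫⁻ q, ψ q ∂Q := by
  rw [lintegral_addLaw hK Q hφ]
  refine lintegral_congr_ae ?_
  filter_upwards [h] with q hq
  obtain ⟨N, rfl⟩ := RootedGraph.exists_cls_eq q
  rw [lintegral_addKernel_cls hK hφ, detKernel, Kernel.deterministic_apply,
    lintegral_dirac' _ (f := fun m => φ (N.addMarks m).cls)
      (hφ.comp (measurable_addMarks_cls_right N)), hq N rfl]

end

/-! ### Independent labels -/

/-- The space of labels. -/
abbrev Label : Type := ℕ → Bool

instance : PolishSpace Label :=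
  @instPolishSpaceOfSeparableSpaceOfIsCompletelyMetrizableSpace _ _ inferInstance inferInstance

theorem not_countable_label : ¬ Countable Label := by
  intro h
  have h1 := Cardinal.mk_le_aleph0_iff.2 h
  simp only [Cardinal.mk_pi, Cardinal.mk_bool, Cardinal.prod_const, Cardinal.lift_id,
    Cardinal.mk_nat] at h1
  exact absurd h1 (not_le.2 (Cardinal.cantor _))

theorem not_countable_unitInterval : ¬ Countable unitInterval := by
  intro h
  have h1 : (volume : Measure unitInterval) univ = 0 := (countable_univ_iff.2 h).measure_zero _
  simp at h1

/-- An atomless law on labels. -/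
def labelLaw : Measure Label := (volume : Measure unitInterval).map
  (PolishSpace.measurableEquivOfNotCountable not_countable_unitInterval not_countable_label)

instance : IsProbabilityMeasure labelLaw :=
  Measure.isProbabilityMeasure_map (MeasurableEquiv.measurable _).aemeasurable

instance : NullSingletonClass labelLaw := by
  refine ⟨fun x => ?_⟩
  rw [labelLaw, MeasurableEquiv.map_apply]
  have : (PolishSpace.measurableEquivOfNotCountable not_countable_unitInterval
      not_countable_label) ⁻¹' {x} = {(PolishSpace.measurableEquivOfNotCountable
      not_countable_unitInterval not_countable_label).symm x} := by
    ext y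
    simp [← MeasurableEquiv.eq_symm_apply]
  rw [this]
  exact measure_singleton _

/-- Independent labels on all objects. -/
def labelsLaw : Measure (Marks Label) := Measure.infinitePi fun _ => labelLaw

instance : IsProbabilityMeasure labelsLaw := by unfold labelsLaw; infer_instance

/-- The diagonal is null for the square of an atomless law, and there are countably many pairs of
objects. -/
theorem ae_labels_injective : ∀ᵐ m ∂labelsLaw, Function.Injective m := by
  have key : ∀ o o' : ℕ ⊕ ℕ, o ≠ o' → ∀ᵐ m ∂labelsLaw, m o ≠ m o' := by
    intro o o' h
    have hm := Measure.infinitePi_map_eval_prod (P := fun _ : ℕ ⊕ ℕ => labelLaw) h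
    have hd : MeasurableSet {p : Label × Label | p.1 = p.2} :=
      measurableSet_eq_fun measurable_fst measurable_snd
    have h0 : (labelLaw.prod labelLaw) {p : Label × Label | p.1 = p.2} = 0 := by
      rw [Measure.prod_apply hd]
      refine (lintegral_congr fun x => ?_).trans lintegral_zero
      have : Prod.mk x ⁻¹' {p : Label × Label | p.1 = p.2} = {x} := by
        ext y; simp [eq_comm]
      rw [this, measure_singleton]
    rw [← hm, Measure.map_apply (by fun_prop) hd] at h0
    rw [ae_iff]
    simpa [labelsLaw] using h0
  have : ∀ᵐ m ∂labelsLaw, ∀ o o' : ℕ ⊕ ℕ, o ≠ o' → m o ≠ m o' := by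
    simp only [ae_all_iff]
    exact key
  filter_upwards [this] with m hm o o' h
  by_contra hne
  exact hm o o' hne h

-- Coordinates selected by an injection are again independent with the same law, so the result
-- depends on `S` but not on `F`. This is what makes independent labels equivariant.
open scoped Classical in
theorem map_pull_labelsLaw (b : Label) {S : Set (ℕ ⊕ ℕ)} {F : ℕ ⊕ ℕ → ℕ ⊕ ℕ} (hF : InjOn F S) :
    labelsLaw.map (pull b S F) =
      Measure.infinitePi fun o => if o ∈ S then labelLaw else Measure.dirac b := by
  have hp : ∀ o, IsProbabilityMeasure (if o ∈ S then labelLaw else Measure.dirac b) := fun o => by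
    split_ifs <;> infer_instance
  refine Measure.eq_infinitePi _ fun s t ht => ?_
  have hms : MeasurableSet (Set.pi (s : Set (ℕ ⊕ ℕ)) t) :=
    MeasurableSet.pi s.countable_toSet fun i _ => ht i
  rw [Measure.map_apply (measurable_pull _ _ _) hms]
  by_cases hb : ∀ o ∈ s, o ∉ S → b ∈ t o
  -- The constraint at `o` becomes a constraint on the label of `F o`; injectivity of `F` on `S`
  -- makes this unambiguous.
  · let t' : ℕ ⊕ ℕ → Set Label := fun o => t (Function.invFunOn F S o)
    have hinv : ∀ o ∈ S, t' (F o) = t o := fun o ho => by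
      simp only [t', hF.leftInvOn_invFunOn ho]
    have hset : pull b S F ⁻¹' (Set.pi s t) =
        Set.pi ((s.filter (· ∈ S)).image F : Finset _) t' := by
      ext m
      simp only [mem_preimage, Set.mem_pi, Finset.mem_coe, Finset.mem_image, Finset.mem_filter,
        forall_exists_index, and_imp]
      constructor
      · rintro h _ o ho hoS rfl
        have := h o ho
        rwa [pull_of_mem hoS, ← hinv o hoS] at this
      · intro h o ho
        by_cases hoS : o ∈ S
        · rw [pull_of_mem hoS, ← hinv o hoS]
          exact h _ o ho hoS rfl
        · rw [pull, if_neg hoS]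
          exact hb o ho hoS
    rw [hset, labelsLaw, Measure.infinitePi_pi _ (fun i _ => ht _), Finset.prod_image
      (fun x hx y hy hxy => hF (Finset.mem_filter.1 hx).2 (Finset.mem_filter.1 hy).2 hxy),
      Finset.prod_filter]
    refine Finset.prod_congr rfl fun o ho => ?_
    split_ifs with hoS
    · exact congrArg labelLaw (hinv o hoS)
    · rw [Measure.dirac_apply' _ (ht o), indicator_of_mem (hb o ho hoS)]; rfl
  -- If the constant `b` violates a constraint outside `S`, both sides vanish.
  · push Not at hb
    obtain ⟨o, ho, hoS, hb⟩ := hb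
    rw [Finset.prod_eq_zero ho (by rw [if_neg hoS, Measure.dirac_apply' _ (ht o),
      indicator_of_notMem hb])]
    convert measure_empty (μ := labelsLaw)
    refine eq_empty_of_forall_notMem fun m hm => hb ?_
    have := hm o ho
    rwa [pull, if_neg hoS] at this

/-- The kernel of independent labels. -/
def labelKernel (A : Type) [MeasurableSpace A] : Kernel (RootedGraph A) (Marks Label) :=
  Kernel.const _ labelsLaw

instance [MeasurableSpace A] : IsMarkovKernel (labelKernel A) := by
  unfold labelKernel; infer_instance

theorem equivariant_labelKernel (A : Type) [MeasurableSpace A] : Equivariant (labelKernel A) := by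
  intro b M N f g h
  simp only [labelKernel, Kernel.const_apply]
  rw [map_pull_labelsLaw b h.injOn_objs, map_pull_labelsLaw b (injOn_id _)]

/-- The label of an object. -/
def objLabel (lab : A → Label) (N : MarkedGraph A) : ℕ ⊕ ℕ → Label :=
  Sum.elim (fun v => lab (N.vmark v)) fun e => lab (N.emark e)

/-- Different objects have different labels. -/
def DistinctLabels (lab : A → Label) (N : MarkedGraph A) : Prop :=
  InjOn (objLabel lab N) (objs N.graph)

theorem objLabel_map {lab : A → Label} {M N : MarkedGraph A} {f g : ℕ → ℕ} (h : MIso M N f g)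
    {o : ℕ ⊕ ℕ} (ho : o ∈ objs M.graph) : objLabel lab N (Sum.map f g o) = objLabel lab M o := by
  rcases o with v | e
  · exact congrArg lab (h.vmark v ho)
  · exact congrArg lab (h.emark e ho)

theorem DistinctLabels.congr {lab : A → Label} {M N : MarkedGraph A} {f g : ℕ → ℕ}
    (h : MIso M N f g) (hM : DistinctLabels lab M) : DistinctLabels lab N := by
  intro o ho o' ho' heq
  obtain ⟨o, ho₁, rfl⟩ := h.surjOn_objs ho
  obtain ⟨o', ho₂, rfl⟩ := h.surjOn_objs ho'
  rw [objLabel_map h ho₁, objLabel_map h ho₂] at heq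
  rw [hM ho₁ ho₂ heq]

section

variable [MeasurableSpace A]

theorem measurable_mem_objs {Ω : Type*} [MeasurableSpace Ω] {F : Ω → MarkedGraph A}
    (hF : Measurable F) (o : ℕ ⊕ ℕ) : Measurable fun a => o ∈ objs (F a).graph := by
  rcases o with v | e
  · exact measurable_mem_vertexSet hF measurable_const
  · exact measurable_mem_edgeSet hF measurable_const

theorem measurable_objLabel {Ω : Type*} [MeasurableSpace Ω] {F : Ω → MarkedGraph A}
    (hF : Measurable F) {lab : A → Label} (hlab : Measurable lab) (o : ℕ ⊕ ℕ) :
    Measurable fun a => objLabel lab (F a) o := by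
  rcases o with v | e
  · exact hlab.comp (measurable_vmark hF measurable_const)
  · exact hlab.comp (measurable_emark hF measurable_const)

theorem measurable_distinctLabels {lab : A → Label} (hlab : Measurable lab) :
    Measurable fun N : MarkedGraph A => DistinctLabels lab N := by
  unfold DistinctLabels InjOn
  refine Measurable.forall fun o => (measurable_mem_objs measurable_id o).imp
    (Measurable.forall fun o' => (measurable_mem_objs measurable_id o').imp
    (Measurable.imp ?_ measurable_const))
  exact measurableSet_setOfPred.1 (measurableSet_eq_fun (measurable_objLabel measurable_id hlab o)
    (measurable_objLabel measurable_id hlab o'))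

end

section

variable [TopologicalSpace A] [PolishSpace A] [MeasurableSpace A] [BorelSpace A]
  [TopologicalSpace A'] [PolishSpace A'] [MeasurableSpace A'] [BorelSpace A']

/-- The law of the graph with independent labels added. -/
def labelled (Q : Measure (RootedSpace A)) : Measure (RootedSpace (A × Label)) :=
  addLaw (equivariant_labelKernel A).rootEquivariant Q

theorem lintegral_labelled (Q : Measure (RootedSpace A))
    {φ : RootedSpace (A × Label) → ℝ≥0∞} (hφ : Measurable φ) {ψ : RootedSpace A → ℝ≥0∞}
    (h : ∀ N : RootedGraph A, ∫⁻ m, φ (N.addMarks m).cls ∂labelsLaw = ψ N.cls) :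
    ∫⁻ p, φ p ∂labelled Q = ∫⁻ q, ψ q ∂Q := by
  rw [labelled, lintegral_addLaw _ Q hφ]
  refine lintegral_congr fun q => ?_
  obtain ⟨N, rfl⟩ := RootedGraph.exists_cls_eq q
  rw [lintegral_addKernel_cls _ hφ]
  exact h N

theorem map_labelled (Q : Measure (RootedSpace A)) {c : A → A'} (hc : Measurable c) :
    (labelled Q).map (mapMarks (Prod.map c id)) = labelled (Q.map (mapMarks c)) :=
  map_addLaw_comapMarks (equivariant_labelKernel A').rootEquivariant hc Q

theorem ae_distinctLabels (Q : Measure (RootedSpace A)) :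
    ∀ᵐ q ∂labelled Q, ∀ N : RootedGraph (A × Label), N.cls = q →
      DistinctLabels Prod.snd N.toMarkedGraph := by
  let S : Set (RootedSpace (A × Label)) := {q | ∀ N : RootedGraph (A × Label), N.cls = q →
      DistinctLabels Prod.snd N.toMarkedGraph}
  have hS : ∀ N : RootedGraph (A × Label), N.cls ∈ S ↔ DistinctLabels Prod.snd N.toMarkedGraph := by
    refine fun N => ⟨fun h => h N rfl, fun h M hM => ?_⟩
    obtain ⟨f, g, hi, -⟩ := RootedGraph.cls_eq_iff.1 hM.symm
    exact h.congr hi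
  have hSm : MeasurableSet S := by
    refine measurableSet_setOfPred.2 (measurable_of_comp_cls (h := fun q => q ∈ S) ?_)
    simp only [hS]
    exact (measurable_distinctLabels measurable_snd).comp RootedGraph.measurable_toMarkedGraph
  change (labelled Q) Sᶜ = 0
  rw [← lintegral_indicator_one hSm.compl, lintegral_labelled Q
    (measurable_one.indicator hSm.compl) (ψ := fun _ => 0), lintegral_zero]
  intro N
  refine (lintegral_congr_ae ?_).trans lintegral_zero
  filter_upwards [ae_labels_injective] with m hm
  refine indicator_of_notMem (notMem_compl_iff.2 ((hS _).2 fun o _ o' _ heq => hm ?_)) _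
  rcases o with o | o <;> rcases o' with o' | o' <;> exact heq

end

end

section

variable {A A' B B' : Type}

/-! ### Addresses of vertices and edges -/

/-- Incidence of vertices and edges, as a symmetric relation. -/
def OAdj (G : Graph ℕ ℕ) : ℕ ⊕ ℕ → ℕ ⊕ ℕ → Prop
  | .inl v, .inr e => G.Inc e v
  | .inr e, .inl v => G.Inc e v
  | _, _ => False

theorem OAdj.symm {G : Graph ℕ ℕ} : ∀ {o o' : ℕ ⊕ ℕ}, OAdj G o o' → OAdj G o' o
  | .inl _, .inr _, h => h
  | .inr _, .inl _, h => h
  | .inl _, .inl _, h => h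
  | .inr _, .inr _, h => h

theorem OAdj.mem_left {G : Graph ℕ ℕ} : ∀ {o o' : ℕ ⊕ ℕ}, OAdj G o o' → o ∈ objs G
  | .inl _, .inr _, h => h.vertex_mem
  | .inr _, .inl _, h => h.edge_mem
  | .inl _, .inl _, h => h.elim
  | .inr _, .inr _, h => h.elim

theorem OAdj.mem_right {G : Graph ℕ ℕ} {o o' : ℕ ⊕ ℕ} (h : OAdj G o o') : o' ∈ objs G :=
  h.symm.mem_left

/-- The objects at distance at most `r` from `o` in the incidence graph. -/
def oball (G : Graph ℕ ℕ) (o : ℕ ⊕ ℕ) : ℕ → Set (ℕ ⊕ ℕ)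
  | 0 => {o}
  | r + 1 => oball G o r ∪ {y | ∃ x ∈ oball G o r, OAdj G x y}

theorem mem_oball_succ {G : Graph ℕ ℕ} {o y : ℕ ⊕ ℕ} {r : ℕ} :
    y ∈ oball G o (r + 1) ↔ y ∈ oball G o r ∨ ∃ x ∈ oball G o r, OAdj G x y := Iff.rfl

theorem oball_mono (G : Graph ℕ ℕ) (o : ℕ ⊕ ℕ) : Monotone (oball G o) :=
  monotone_nat_of_le_succ fun _ _ h => Or.inl h

theorem oball_subset {G : Graph ℕ ℕ} {o : ℕ ⊕ ℕ} (ho : o ∈ objs G) (r : ℕ) :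
    oball G o r ⊆ objs G := by
  induction r with
  | zero => rintro x rfl; exact ho
  | succ r ih =>
    rintro x (hx | ⟨y, -, hy⟩)
    · exact ih hx
    · exact hy.mem_right

theorem IsIso.oadj_iff {G H : Graph ℕ ℕ} {f g : ℕ → ℕ} (h : IsIso G H f g) :
    ∀ {o o' : ℕ ⊕ ℕ}, o ∈ objs G → o' ∈ objs G →
      (OAdj H (Sum.map f g o) (Sum.map f g o') ↔ OAdj G o o')
  | .inl _, .inr _, hv, he => h.inc_iff he hv
  | .inr _, .inl _, he, hv => h.inc_iff he hv
  | .inl _, .inl _, _, _ => Iff.rfl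
  | .inr _, .inr _, _, _ => Iff.rfl

theorem IsIso.mem_oball_iff {G H : Graph ℕ ℕ} {f g : ℕ → ℕ} (h : IsIso G H f g) {o o' : ℕ ⊕ ℕ}
    (ho : o ∈ objs G) (ho' : o' ∈ objs G) (r : ℕ) :
    Sum.map f g o' ∈ oball H (Sum.map f g o) r ↔ o' ∈ oball G o r := by
  induction r generalizing o' with
  | zero => exact ⟨fun heq => h.injOn_objs ho' ho heq, fun heq => congrArg _ heq⟩
  | succ r ih =>
    rw [mem_oball_succ, mem_oball_succ, ih ho']
    refine or_congr_right ⟨?_, ?_⟩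
    · rintro ⟨x, hx, hxo⟩
      obtain ⟨x, hx', rfl⟩ := h.surjOn_objs (oball_subset (h.mapsTo_objs ho) r hx)
      exact ⟨x, (ih hx').1 hx, (h.oadj_iff hx' ho').1 hxo⟩
    · rintro ⟨x, hx, hxo⟩
      have hx' := oball_subset ho r hx
      exact ⟨_, (ih hx').2 hx, (h.oadj_iff hx' ho').2 hxo⟩

theorem finite_oadj (N : MarkedGraph A) : ∀ o, {o' | OAdj N.graph o o'}.Finite
  | .inl v => ((finite_inc N v).image Sum.inr).subset fun o' h => by
      rcases o' with v' | e
      · exact h.elim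
      · exact ⟨e, h, rfl⟩
  | .inr e => by
      refine Set.Finite.subset (s := Sum.inl '' {v | N.graph.Inc e v}) (Set.Finite.image _ ?_) ?_
      · by_cases he : e ∈ N.graph.edgeSet
        · obtain ⟨x, y, hl⟩ := N.graph.exists_isLink_of_mem_edgeSet he
          refine (Set.toFinite {x, y}).subset fun v hv => ?_
          rcases hv.eq_or_eq_of_isLink hl with rfl | rfl <;> simp
        · convert Set.finite_empty (α := ℕ)
          exact eq_empty_of_forall_notMem fun v hv => he hv.edge_mem
      · intro o' h
        rcases o' with v' | e
        · exact ⟨v', h, rfl⟩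
        · exact h.elim

theorem finite_oball (N : MarkedGraph A) (o : ℕ ⊕ ℕ) : ∀ r, (oball N.graph o r).Finite
  | 0 => finite_singleton _
  | r + 1 => (finite_oball N o r).union
      (((finite_oball N o r).biUnion fun x _ => finite_oadj N x).subset
        fun _ ⟨_, hx, hxy⟩ => mem_biUnion hx hxy)

theorem exists_mem_oball_iff {G : Graph ℕ ℕ} {o o' : ℕ ⊕ ℕ} :
    (∃ r, o' ∈ oball G o r) ↔ Relation.ReflTransGen (OAdj G) o o' := by
  constructor
  · rintro ⟨r, hr⟩
    induction r generalizing o' with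
    | zero => rw [show o' = o from hr]
    | succ r ih =>
      rcases hr with h | ⟨x, hx, h⟩
      · exact ih h
      · exact (ih hx).tail h
  · intro h
    induction h with
    | refl => exact ⟨0, rfl⟩
    | tail _ h ih =>
      obtain ⟨r, hr⟩ := ih
      exact ⟨r + 1, Or.inr ⟨_, hr, h⟩⟩

/-- A step between adjacent vertices is two steps in the incidence graph, through the edge, and
every edge is next to its ends; so connectedness carries over. -/
theorem exists_mem_oball (N : MarkedGraph A) {o o' : ℕ ⊕ ℕ} (ho : o ∈ objs N.graph)
    (ho' : o' ∈ objs N.graph) : ∃ r, o' ∈ oball N.graph o r := by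
  rw [exists_mem_oball_iff]
  have hv : ∀ v ∈ N.graph.vertexSet, ∀ w ∈ N.graph.vertexSet,
      Relation.ReflTransGen (OAdj N.graph) (.inl v) (.inl w) := by
    intro v hv w hw
    induction N.connected v hv w hw with
    | refl => exact .refl
    | @tail b c _ h ih =>
      obtain ⟨e, he⟩ := h
      have h1 : OAdj N.graph (.inl b) (.inr e) := ⟨c, he⟩
      have h2 : OAdj N.graph (.inr e) (.inl c) := ⟨b, he.symm⟩
      exact ((ih he.left_mem).tail h1).tail h2
  have hx : ∀ o ∈ objs N.graph, ∃ v ∈ N.graph.vertexSet,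
      Relation.ReflTransGen (OAdj N.graph) o (.inl v) ∧
      Relation.ReflTransGen (OAdj N.graph) (.inl v) o := by
    rintro (v | e) ho
    · exact ⟨v, ho, .refl, .refl⟩
    · obtain ⟨x, y, hl⟩ := N.graph.exists_isLink_of_mem_edgeSet ho
      exact ⟨x, hl.left_mem, .single (show N.graph.Inc e x from ⟨y, hl⟩),
        .single (show N.graph.Inc e x from ⟨y, hl⟩)⟩
  obtain ⟨v, hvm, h1, -⟩ := hx o ho
  obtain ⟨w, hwm, -, h2⟩ := hx o' ho'
  exact h1.trans ((hv v hvm w hwm).trans h2)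

/-- The labels with a given finite prefix. -/
def prefixSet (n : ℕ) : Set Label :=
  {ℓ | ∀ i < n.unpair.1, ℓ i = n.unpair.2.testBit i}

/-- Finitely many labels other than `x` differ from it within a common finite prefix. The number `n`
codes the length of this prefix and its bits. -/
theorem exists_prefixSet {s : Set Label} (hs : s.Finite) (x : Label) :
    ∃ n, x ∈ prefixSet n ∧ ∀ y ∈ s, y ∈ prefixSet n → y = x := by
  have h1 : ∀ y : Label, ∃ k, y ≠ x → y k ≠ x k := fun y => by
    by_cases h : y = x
    · exact ⟨0, fun h' => absurd h h'⟩
    · obtain ⟨k, hk⟩ := Function.ne_iff.1 h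
      exact ⟨k, fun _ => hk⟩
  choose k hk using h1
  obtain ⟨m, hm⟩ := (hs.image k).bddAbove
  let c := Nat.ofBits fun i : Fin (m + 1) => x i
  have hc : ∀ i < m + 1, c.testBit i = x i := fun i hi => Nat.testBit_ofBits_lt _ _ hi
  refine ⟨Nat.pair (m + 1) c, fun i hi => ?_, fun y hy hyn => ?_⟩
  · rw [Nat.unpair_pair] at hi ⊢
    exact (hc i hi).symm
  · by_contra hne
    have hlt : k y < m + 1 := Nat.lt_succ_of_le (hm ⟨y, hy, rfl⟩)
    have := hyn (k y) (by rw [Nat.unpair_pair]; exact hlt)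
    rw [Nat.unpair_pair, hc _ hlt] at this
    exact hk y hne this

/-- Addresses use finite prefixes and not whole labels because a clopen condition is stable under
small changes of the labels. -/
theorem isClopen_prefixSet (n : ℕ) : IsClopen (prefixSet n) := by
  have : prefixSet n = ⋂ i ∈ Finset.range n.unpair.1, {ℓ : Label | ℓ i = n.unpair.2.testBit i} := by
    ext; simp [prefixSet]
  rw [this]
  refine isClopen_biInter_finset fun i _ => ?_
  exact (isClopen_discrete {n.unpair.2.testBit i}).preimage (continuous_apply i)

/-- `o'` is the unique object near `o` specified by the code `α`. -/
def IsAddr (lab : A → Label) (N : MarkedGraph A) (o : ℕ ⊕ ℕ) (α : ℕ) (o' : ℕ ⊕ ℕ) : Prop :=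
  o' ∈ oball N.graph o α.unpair.1 ∧ objLabel lab N o' ∈ prefixSet α.unpair.2 ∧
    ∀ x ∈ oball N.graph o α.unpair.1, objLabel lab N x ∈ prefixSet α.unpair.2 → x = o'

theorem IsAddr.unique {lab : A → Label} {N : MarkedGraph A} {o o₁ o₂ : ℕ ⊕ ℕ} {α : ℕ}
    (h₁ : IsAddr lab N o α o₁) (h₂ : IsAddr lab N o α o₂) : o₁ = o₂ :=
  h₂.2.2 _ h₁.1 h₁.2.1

theorem IsAddr.mem {lab : A → Label} {N : MarkedGraph A} {o o' : ℕ ⊕ ℕ} {α : ℕ}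
    (h : IsAddr lab N o α o') (ho : o ∈ objs N.graph) : o' ∈ objs N.graph := oball_subset ho _ h.1

/-- A ball that contains `o'` is finite and its labels are distinct, so a long enough prefix
isolates `o'` in it. -/
theorem DistinctLabels.exists_isAddr {lab : A → Label} {N : MarkedGraph A}
    (h : DistinctLabels lab N) {o o' : ℕ ⊕ ℕ} (ho : o ∈ objs N.graph) (ho' : o' ∈ objs N.graph) :
    ∃ α, IsAddr lab N o α o' := by
  obtain ⟨r, hr⟩ := exists_mem_oball N ho ho'
  obtain ⟨n, hn, hn'⟩ := exists_prefixSet ((finite_oball N o r).image (objLabel lab N))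
    (objLabel lab N o')
  refine ⟨Nat.pair r n, ?_⟩
  rw [IsAddr, Nat.unpair_pair]
  exact ⟨hr, hn, fun x hx hx' => h (oball_subset ho r hx) ho' (hn' _ ⟨x, hx, rfl⟩ hx')⟩

theorem MIso.isAddr_iff {lab : A → Label} {M N : MarkedGraph A} {f g : ℕ → ℕ} (h : MIso M N f g)
    {o o' : ℕ ⊕ ℕ} (ho : o ∈ objs M.graph) (ho' : o' ∈ objs M.graph) (α : ℕ) :
    IsAddr lab N (Sum.map f g o) α (Sum.map f g o') ↔ IsAddr lab M o α o' := by
  unfold IsAddr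
  rw [h.mem_oball_iff ho ho', objLabel_map h ho']
  refine and_congr_right fun _ => and_congr_right fun _ => ⟨fun H x hx hx' => ?_, fun H x hx hx' => ?_⟩
  · have hxm := oball_subset ho _ hx
    exact h.injOn_objs hxm ho' (H _ ((h.mem_oball_iff ho hxm _).2 hx) (by rwa [objLabel_map h hxm]))
  · obtain ⟨x, hxm, rfl⟩ := h.surjOn_objs (oball_subset (h.mapsTo_objs ho) _ hx)
    rw [objLabel_map h hxm] at hx'
    rw [H x ((h.mem_oball_iff ho hxm _).1 hx) hx']

/-- The least address of `o'` as seen from `o`. -/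
def addrOf (lab : A → Label) (N : MarkedGraph A) (o o' : ℕ ⊕ ℕ) : ℕ :=
  sInf {α | IsAddr lab N o α o'}

theorem DistinctLabels.isAddr_addrOf {lab : A → Label} {N : MarkedGraph A}
    (h : DistinctLabels lab N) {o o' : ℕ ⊕ ℕ} (ho : o ∈ objs N.graph) (ho' : o' ∈ objs N.graph) :
    IsAddr lab N o (addrOf lab N o o') o' := Nat.sInf_mem (h.exists_isAddr ho ho')

theorem MIso.addrOf_eq {lab : A → Label} {M N : MarkedGraph A} {f g : ℕ → ℕ} (h : MIso M N f g)
    {o o' : ℕ ⊕ ℕ} (ho : o ∈ objs M.graph) (ho' : o' ∈ objs M.graph) :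
    addrOf lab N (Sum.map f g o) (Sum.map f g o') = addrOf lab M o o' := by
  unfold addrOf
  congr 1
  ext α
  exact h.isAddr_iff ho ho' α

section Measurable

variable {Ω : Type*} [MeasurableSpace Ω]

theorem measurable_sInf_nat {S : Ω → Set ℕ} (hS : ∀ k, Measurable fun a => k ∈ S a) :
    Measurable fun a => sInf (S a) := by
  refine measurable_to_countable' fun k => measurableSet_setOfPred.2 ?_
  -- The infimum of the empty set is `0`, which gives the value `0` a second case.
  have : (fun a => sInf (S a) ∈ ({k} : Set ℕ)) =
      fun a => (k ∈ S a ∧ ∀ j, j < k → j ∉ S a) ∨ (k = 0 ∧ ∀ j, j ∉ S a) := by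
    ext a
    rw [mem_singleton_iff]
    constructor
    · rintro rfl
      rcases (S a).eq_empty_or_nonempty with h | h
      · right; simp [h]
      · exact Or.inl ⟨Nat.sInf_mem h, fun j hj => Nat.notMem_of_lt_sInf hj⟩
    · rintro (⟨h1, h2⟩ | ⟨rfl, h⟩)
      · refine le_antisymm (Nat.sInf_le h1) ?_
        by_contra hlt
        exact h2 _ (not_le.1 hlt) (Nat.sInf_mem ⟨k, h1⟩)
      · rw [Nat.sInf_eq_zero]; right; exact eq_empty_of_forall_notMem h
  change Measurable fun a => sInf (S a) ∈ ({k} : Set ℕ)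
  rw [this]
  fun_prop

/-- Serves functions defined by choosing an object. The cases are indexed by objects and may
overlap, since `f` follows every case that applies. -/
theorem measurable_of_cases {ι β : Type*} [Countable ι] [MeasurableSpace β] {S : ι → Ω → Prop}
    (hS : ∀ i, Measurable (S i)) {g : ι → Ω → β} (hg : ∀ i, Measurable (g i)) {c : β} {f : Ω → β}
    (h1 : ∀ i a, S i a → f a = g i a) (h2 : ∀ a, (∀ i, ¬ S i a) → f a = c) : Measurable f := by
  intro T hT
  have : f ⁻¹' T = {a | (∃ i, S i a ∧ g i a ∈ T) ∨ ((∀ i, ¬ S i a) ∧ c ∈ T)} := by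
    ext a
    simp only [mem_preimage, mem_ofPred_eq]
    by_cases h : ∃ i, S i a
    · obtain ⟨i, hi⟩ := h
      constructor
      · exact fun ha => Or.inl ⟨i, hi, h1 i a hi ▸ ha⟩
      · rintro (⟨j, hj, ha⟩ | ⟨h, -⟩)
        · rwa [h1 j a hj]
        · exact absurd hi (h i)
    · push Not at h
      rw [h2 a h]
      exact ⟨fun ha => Or.inr ⟨h, ha⟩, fun h' => h'.elim (fun ⟨i, hi, _⟩ => absurd hi (h i)) And.right⟩
  rw [this]
  refine measurableSet_setOfPred.2 ((Measurable.exists fun i => (hS i).and ?_).or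
    ((Measurable.forall fun i => (hS i).not).and measurable_const))
  exact measurableSet_setOfPred.1 (hg i hT)

variable [MeasurableSpace A] {F : Ω → MarkedGraph A} {lab : A → Label}

theorem measurable_mem_oball (hF : Measurable F) (o o' : ℕ ⊕ ℕ) (r : ℕ) :
    Measurable fun a => o' ∈ oball (F a).graph o r := by
  induction r generalizing o' with
  | zero => exact measurable_const
  | succ r ih =>
    simp only [mem_oball_succ]
    refine (ih o').or (Measurable.exists fun x => (ih x).and ?_)
    rcases x with v | e <;> rcases o' with w | e'
    · exact measurable_const
    · exact measurable_inc hF measurable_const measurable_const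
    · exact measurable_inc hF measurable_const measurable_const
    · exact measurable_const

theorem measurable_isAddr (hF : Measurable F) (hlab : Measurable lab) (o o' : ℕ ⊕ ℕ) (α : ℕ) :
    Measurable fun a => IsAddr lab (F a) o α o' := by
  have h : ∀ x n, Measurable fun a => objLabel lab (F a) x ∈ prefixSet n := fun x n =>
    measurableSet_setOfPred.1 (measurable_objLabel hF hlab x (isClopen_prefixSet n).isOpen.measurableSet)
  unfold IsAddr
  exact (measurable_mem_oball hF _ _ _).and ((h _ _).and (Measurable.forall fun x =>
    (measurable_mem_oball hF _ _ _).imp ((h _ _).imp measurable_const)))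

theorem measurable_addrOf (hF : Measurable F) (hlab : Measurable lab) (o o' : ℕ ⊕ ℕ) :
    Measurable fun a => addrOf lab (F a) o o' :=
  measurable_sInf_nat fun α => measurable_isAddr hF hlab o o' α

end Measurable

end

section

variable {A A' B B' X : Type}

theorem exists_countable_isPiSystem (α : Type*) [m : MeasurableSpace α]
    [MeasurableSpace.CountablyGenerated α] :
    ∃ 𝒞 : Set (Set α), 𝒞.Countable ∧ IsPiSystem 𝒞 ∧ m = MeasurableSpace.generateFrom 𝒞 := by
  obtain ⟨b, hb, hm⟩ := MeasurableSpace.CountablyGenerated.isCountablyGenerated (α := α)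
  refine ⟨generateSetAlgebra b, countable_generateSetAlgebra hb, fun s hs t ht _ =>
    isSetAlgebra_generateSetAlgebra.inter_mem hs ht, ?_⟩
  rw [generateFrom_generateSetAlgebra_eq, ← hm]

/-! ### Enumerating the marks by addresses -/

/-- The marks of the second kind. -/
def marksOf (M : MarkedGraph (A × B)) : Marks B :=
  Sum.elim (fun v => (M.vmark v).2) fun e => (M.emark e).2

theorem mapMarks_fst_addMarks (M : RootedGraph (A × B)) :
    (M.mapMarks Prod.fst).addMarks (marksOf M.toMarkedGraph) = M := rfl

open scoped Classical in
/-- The marks of the objects with given addresses as seen from the root. -/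
def enum (lab : A → Label) (b : B) (N : RootedGraph A) (m : Marks B) : ℕ → B := fun α =>
  if h : ∃ o, IsAddr lab N.toMarkedGraph (.inl N.root) α o then m h.choose else b

theorem enum_of_isAddr {lab : A → Label} {b : B} {N : RootedGraph A} {m : Marks B} {α : ℕ}
    {o : ℕ ⊕ ℕ} (h : IsAddr lab N.toMarkedGraph (.inl N.root) α o) : enum lab b N m α = m o := by
  have hex : ∃ o, IsAddr lab N.toMarkedGraph (.inl N.root) α o := ⟨o, h⟩
  rw [enum, dif_pos hex, hex.choose_spec.unique h]

theorem enum_of_not {lab : A → Label} {b : B} {N : RootedGraph A} {m : Marks B} {α : ℕ}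
    (h : ∀ o, ¬ IsAddr lab N.toMarkedGraph (.inl N.root) α o) : enum lab b N m α = b := by
  rw [enum, dif_neg (not_exists.2 h)]

/-- Addresses are preserved by root-preserving isomorphisms. The enumeration is thus a function of
the isomorphism class with values in a fixed space, which marks indexed by labels are not. -/
theorem enum_congr {lab : A → Label} {b : B} {M N : RootedGraph A} {f g : ℕ → ℕ}
    (h : MIso M.toMarkedGraph N.toMarkedGraph f g) (hr : f M.root = N.root) {m m' : Marks B}
    (hm : ∀ o ∈ objs M.graph, m' (Sum.map f g o) = m o) : enum lab b N m' = enum lab b M m := by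
  have hroot : Sum.map f g (.inl M.root) = .inl N.root := congrArg Sum.inl hr
  have hM : Sum.inl M.root ∈ objs M.graph := M.root_mem
  ext α
  by_cases hex : ∃ o, IsAddr lab M.toMarkedGraph (.inl M.root) α o
  · obtain ⟨o, ho⟩ := hex
    have ho' := ho.mem hM
    rw [enum_of_isAddr ho, enum_of_isAddr (o := Sum.map f g o) (by
      rw [← hroot]; exact (h.isAddr_iff hM ho' α).2 ho), hm o ho']
  · push Not at hex
    rw [enum_of_not hex, enum_of_not]
    intro o ho
    rw [← hroot] at ho
    obtain ⟨o, ho', rfl⟩ := h.surjOn_objs (ho.mem (h.mapsTo_objs hM))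
    exact hex o ((h.isAddr_iff hM ho' α).1 ho)

/-- Marks given by their enumeration. -/
def denum (lab : A → Label) (N : RootedGraph A) (y : ℕ → B) : Marks B := fun o =>
  y (addrOf lab N.toMarkedGraph (.inl N.root) o)

theorem denum_enum {lab : A → Label} {b : B} {N : RootedGraph A} {m : Marks B}
    (h : DistinctLabels lab N.toMarkedGraph) {o : ℕ ⊕ ℕ} (ho : o ∈ objs N.graph) :
    denum lab N (enum lab b N m) o = m o :=
  enum_of_isAddr (h.isAddr_addrOf N.root_mem ho)

theorem denum_map {lab : A → Label} {M N : RootedGraph A} {f g : ℕ → ℕ}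
    (h : MIso M.toMarkedGraph N.toMarkedGraph f g) (hr : f M.root = N.root) (y : ℕ → B)
    {o : ℕ ⊕ ℕ} (ho : o ∈ objs M.graph) : denum lab N y (Sum.map f g o) = denum lab M y o := by
  have hM : Sum.inl M.root ∈ objs M.graph := M.root_mem
  rw [denum, denum, ← hr]
  exact congrArg y (h.addrOf_eq hM ho)

section Measurable

variable [MeasurableSpace A] [MeasurableSpace B] {Ω : Type*} [MeasurableSpace Ω]
  {lab : A → Label}

theorem measurable_isAddr_root {F : Ω → RootedGraph A} (hF : Measurable F) (hlab : Measurable lab)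
    (α : ℕ) (o : ℕ ⊕ ℕ) :
    Measurable fun a => IsAddr lab (F a).toMarkedGraph (.inl (F a).root) α o :=
  measurable_apply_countable (F := fun a r => IsAddr lab (F a).toMarkedGraph (.inl r) α o)
    (fun _ => measurable_isAddr (RootedGraph.measurable_toMarkedGraph.comp hF) hlab _ _ _)
    (RootedGraph.measurable_root.comp hF)

theorem measurable_enum {F : Ω → RootedGraph A} (hF : Measurable F) (hlab : Measurable lab) (b : B)
    {m : Ω → Marks B} (hm : Measurable m) : Measurable fun a => enum lab b (F a) (m a) := by
  refine measurable_pi_lambda _ fun α => ?_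
  exact measurable_of_cases (S := fun o a => IsAddr lab (F a).toMarkedGraph (.inl (F a).root) α o)
    (fun o => measurable_isAddr_root hF hlab α o) (g := fun o a => m a o)
    (fun o => (measurable_pi_apply o).comp hm) (c := b) (fun o a h => enum_of_isAddr h)
    fun a h => enum_of_not h

theorem measurable_denum {F : Ω → RootedGraph A} (hF : Measurable F) (hlab : Measurable lab)
    {y : Ω → ℕ → B} (hy : Measurable y) : Measurable fun a => denum lab (F a) (y a) := by
  refine measurable_pi_lambda _ fun o => ?_
  refine measurable_apply_countable (F := fun a n => y a n) (fun n => (measurable_pi_apply n).comp hy) ?_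
  exact measurable_apply_countable (F := fun a r => addrOf lab (F a).toMarkedGraph (.inl r) o)
    (fun _ => measurable_addrOf (RootedGraph.measurable_toMarkedGraph.comp hF) hlab _ _)
    (RootedGraph.measurable_root.comp hF)

theorem measurable_marksOf : Measurable (marksOf (A := A) (B := B)) := by
  refine measurable_pi_lambda _ fun o => ?_
  rcases o with v | e
  · exact measurable_snd.comp (measurable_vmark measurable_id measurable_const)
  · exact measurable_snd.comp (measurable_emark measurable_id measurable_const)

end Measurable

section

variable [TopologicalSpace A] [PolishSpace A] [MeasurableSpace A] [BorelSpace A]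
  [TopologicalSpace X] [PolishSpace X] [MeasurableSpace X] [BorelSpace X] [Nonempty X]
  {lab : A → Label}

/-! ### Disintegration of marks -/

/-- The enumeration of the marks of an isomorphism class. -/
def enumC (lab : A → Label) (b : X) : RootedSpace (A × X) → ℕ → X :=
  Quotient.lift (fun M => enum lab b (M.mapMarks Prod.fst) (marksOf M.toMarkedGraph)) <| by
    intro M N h
    obtain ⟨f, g, hi, hr⟩ := RootedGraph.cls_eq_iff.1 (Quotient.sound h)
    refine (enum_congr (hi.mapMarks Prod.fst) hr ?_).symm
    rintro (v | e) ho
    · exact congrArg Prod.snd (hi.vmark v ho)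
    · exact congrArg Prod.snd (hi.emark e ho)

theorem measurable_enumC (hlab : Measurable lab) (b : X) : Measurable (enumC lab b) := by
  refine measurable_of_comp_cls ?_
  exact measurable_enum (RootedGraph.measurable_mapMarks measurable_fst) hlab b
    (measurable_marksOf.comp RootedGraph.measurable_toMarkedGraph)

/-- The kernel on marks given by a kernel on enumerations. -/
def denumKernel (hlab : Measurable lab) (κ : Kernel (RootedSpace A) (ℕ → X)) [IsMarkovKernel κ] :
    Kernel (RootedGraph A) (Marks X) where
  toFun N := (κ N.cls).map (denum lab N)
  measurable' := by
    refine Measure.measurable_of_measurable_coe _ fun S hS => ?_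
    have h : ∀ N : RootedGraph A, Measurable (denum (B := X) lab N) := fun N =>
      measurable_denum measurable_const hlab measurable_id
    simp only [Measure.map_apply (h _) hS]
    exact Kernel.measurable_kernel_prodMk_left (κ := κ.comap _ RootedGraph.measurable_cls)
      (measurable_denum (F := fun p : RootedGraph A × (ℕ → X) => p.1) measurable_fst hlab
        measurable_snd hS)

variable (hlab : Measurable lab) (κ : Kernel (RootedSpace A) (ℕ → X)) [IsMarkovKernel κ]

include hlab in
theorem measurable_denum_right (N : RootedGraph A) : Measurable (denum (B := X) lab N) :=
  measurable_denum measurable_const hlab measurable_id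

theorem denumKernel_apply (N : RootedGraph A) :
    denumKernel hlab κ N = (κ N.cls).map (denum lab N) := rfl

instance : IsMarkovKernel (denumKernel hlab κ) :=
  ⟨fun N => Measure.isProbabilityMeasure_map (measurable_denum_right hlab N).aemeasurable⟩

theorem rootEquivariant_denumKernel : RootEquivariant (denumKernel hlab κ) := by
  intro b M N f g h hr
  have hc : N.cls = M.cls := (RootedGraph.cls_eq_iff.2 ⟨f, g, h, hr⟩).symm
  rw [denumKernel_apply, denumKernel_apply, hc, Measure.map_map (measurable_pull _ _ _)
    (measurable_denum_right hlab N), Measure.map_map (measurable_pull _ _ _)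
    (measurable_denum_right hlab M)]
  congr 1
  funext y o
  simp only [Function.comp, pull]
  split_ifs with ho
  · exact denum_map h hr y ho
  · rfl

/-- Distinct labels make the enumeration lossless, so the marks can be resampled from its
conditional distribution given the class without them. Root-equivariance is automatic because this
distribution is a function of the class. -/
theorem exists_rootEquivariant_addLaw_eq (R : Measure (RootedSpace (A × X)))
    [IsProbabilityMeasure R] (hlab : Measurable lab)
    (hR : ∀ᵐ q ∂(R.map (mapMarks Prod.fst)), ∀ N : RootedGraph A, N.cls = q →
      DistinctLabels lab N.toMarkedGraph) :
    ∃ (K : Kernel (RootedGraph A) (Marks X)) (_ : IsMarkovKernel K) (hK : RootEquivariant K),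
      addLaw hK (R.map (mapMarks Prod.fst)) = R := by
  obtain ⟨b⟩ := ‹Nonempty X›
  have : Nonempty X := ⟨b⟩
  have hm : Measurable (mapMarks (Prod.fst (α := A) (β := X))) := measurable_mapMarks measurable_fst
  have he := measurable_enumC (X := X) hlab b
  let κ := condDistrib (enumC lab b) (mapMarks Prod.fst) R
  refine ⟨denumKernel hlab κ, inferInstance, rootEquivariant_denumKernel hlab κ, ?_⟩
  refine Measure.ext_of_lintegral _ fun φ hφ => ?_
  -- The integrand as a function of the class and an enumeration; it is independent of the
  -- representative because decoding commutes with root-preserving isomorphisms.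
  let Φ : RootedSpace A × (ℕ → X) → ℝ≥0∞ := fun p =>
    Quotient.lift (fun N : RootedGraph A => φ (N.addMarks (denum lab N p.2)).cls) (by
      intro M N h
      obtain ⟨f, g, hi, hr⟩ := RootedGraph.cls_eq_iff.1 (Quotient.sound h)
      exact congrArg φ (addMarks_cls_congr hi hr fun o ho => denum_map hi hr _ ho)) p.1
  have hΦ : Measurable Φ := by
    have hs : Function.Surjective (Prod.map RootedGraph.cls id :
        RootedGraph A × (ℕ → X) → RootedSpace A × (ℕ → X)) :=
      Function.Surjective.prodMap (fun q => RootedGraph.exists_cls_eq q) Function.surjective_id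
    have hmm : Measurable (Prod.map RootedGraph.cls id :
        RootedGraph A × (ℕ → X) → RootedSpace A × (ℕ → X)) :=
      RootedGraph.measurable_cls.prodMap measurable_id
    refine (hmm.measurable_comp_iff_of_surjective hs).1 ?_
    exact hφ.comp (measurable_addMarks_cls.comp (measurable_fst.prodMk
      (measurable_denum measurable_fst hlab measurable_snd)))
  rw [lintegral_addLaw _ _ hφ]
  have h1 : ∀ q, ∫⁻ p, φ p ∂addKernel (rootEquivariant_denumKernel hlab κ) q =
      ∫⁻ y, Φ (q, y) ∂κ q := by
    intro q
    obtain ⟨N, rfl⟩ := RootedGraph.exists_cls_eq q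
    rw [lintegral_addKernel_cls _ hφ, denumKernel_apply]
    exact lintegral_map (hφ.comp (measurable_addMarks_cls_right N)) (measurable_denum_right hlab N)
  simp only [h1]
  rw [← Measure.lintegral_compProd hΦ, compProd_map_condDistrib he.aemeasurable,
    lintegral_map hΦ (hm.prodMk he)]
  refine lintegral_congr_ae ?_
  filter_upwards [ae_of_ae_map hm.aemeasurable hR] with q hq
  obtain ⟨M, rfl⟩ := RootedGraph.exists_cls_eq q
  change φ ((M.mapMarks Prod.fst).addMarks _).cls = φ M.cls
  refine congrArg φ ?_
  rw [← mapMarks_fst_addMarks M]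
  refine addMarks_cls_congr (MIso.id _) rfl fun o ho => ?_
  rw [Sum.map_id_id, id]
  exact (denum_enum (hq _ rfl) ho).symm

end

end

section

variable {A A' B B' X : Type}

/-! ### Root-independent disintegration -/

section

variable [TopologicalSpace A] [PolishSpace A] [MeasurableSpace A] [BorelSpace A]
  [TopologicalSpace X] [PolishSpace X] [MeasurableSpace X] [BorelSpace X] [Nonempty X]
  {K : Kernel (RootedGraph A) (Marks X)} [IsMarkovKernel K]

/-- If adding marks preserves unimodularity, then mass transports do not depend on whether the
marks are sampled at the sender or at the receiver. -/
theorem ae_massIn_avgFirst_eq (hK : RootEquivariant K) {P : Measure (RootedSpace A)}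
    [IsProbabilityMeasure P] (hP : Uni P) (hadd : Uni (addLaw hK P))
    {f : BirootedSpace (A × X) → ℝ≥0∞} (hf : Measurable f) :
    massIn (avgFirst hK hf) =ᵐ[P] massIn (avgSecond hK hf) := by
  refine ae_eq_of_forall_setLIntegral_eq_of_sigmaFinite (measurable_massIn (measurable_avgFirst hK hf))
    (measurable_massIn (measurable_avgSecond hK hf)) fun s hs _ => ?_
  have hm : Measurable fun d : BirootedSpace (A × X) => mapMarks Prod.fst (secondCls d) :=
    (measurable_mapMarks measurable_fst).comp measurable_secondCls
  -- The transport is restricted to receivers whose class without the added marks lies in `s`;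
  -- varying `s` turns equality of integrals into almost sure equality.
  let f' : BirootedSpace (A × X) → ℝ≥0∞ := fun d =>
    s.indicator 1 (mapMarks Prod.fst (secondCls d)) * f d
  have hf' : Measurable f' := ((measurable_one.indicator hs).comp hm).mul hf
  have hF : ∀ C : BirootedGraph A, avgFirst hK hf' C.cls =
      s.indicator 1 C.second.cls * avgFirst hK hf C.cls := fun C => by
    rw [avgFirst_cls, avgFirst_cls, ← lintegral_const_mul _ (measurable_bi_addMarks_cls_right hf C)]
    rfl
  have hS : ∀ C : BirootedGraph A, avgSecond hK hf' C.cls =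
      s.indicator 1 C.second.cls * avgSecond hK hf C.cls := fun C => by
    rw [avgSecond_cls, avgSecond_cls, ← lintegral_const_mul _ (measurable_bi_addMarks_cls_right hf C)]
    rfl
  have key : ∀ {h h' : BirootedSpace A → ℝ≥0∞},
      (∀ C : BirootedGraph A, h' C.cls = s.indicator 1 C.second.cls * h C.cls) →
      ∀ q, massIn h' q = s.indicator (massIn h) q := by
    intro h h' hh q
    obtain ⟨N, rfl⟩ := RootedGraph.exists_cls_eq q
    have h1 : massIn h' N.cls = s.indicator 1 N.cls * massIn h N.cls := by
      rw [massIn_cls, massIn_cls, mul_comm, ← vsum_mul_right]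
      refine vsum_congr fun v hv => ?_
      rw [hh, RootedGraph.second_bi hv N.root_mem, RootedGraph.at'_self, mul_comm]
    rw [h1]
    by_cases hN : N.cls ∈ s <;> simp [hN]
  rw [← lintegral_indicator hs, ← lintegral_indicator hs]
  simp only [← key hF, ← key hS]
  -- Mass transport for `P` turns the left side into mass sent with marks sampled at the sender.
  -- This is mass sent in the marked graph, and mass transport for the marked law gives the right
  -- side.
  rw [← hP _ (measurable_avgFirst hK hf')]
  simp only [← lintegral_massIn_addKernel, ← lintegral_massOut_addKernel]
  rw [← lintegral_addLaw _ _ (measurable_massIn hf'), ← lintegral_addLaw _ _ (measurable_massOut hf')]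
  exact hadd _ hf'

/-! The transport of mass to the root from the vertex with a given address. -/

/-- The first root has address `α` as seen from the second root, and the enumeration of the marks
as seen from the second root lies in `S`. -/
def AddrEvent (lab : A → Label) (b : X) (α : ℕ) (S : Set (ℕ → X)) (D : BirootedGraph (A × X)) :
    Prop :=
  IsAddr lab (D.second.mapMarks Prod.fst).toMarkedGraph (.inl D.root₂) α (.inl D.root₁) ∧
    enum lab b (D.second.mapMarks Prod.fst) (marksOf D.toMarkedGraph) ∈ S

variable {lab : A → Label} {b : X} {α : ℕ} {S : Set (ℕ → X)}

theorem addrEvent_congr {C D : BirootedGraph (A × X)} (h : C.cls = D.cls) :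
    AddrEvent lab b α S C ↔ AddrEvent lab b α S D := by
  obtain ⟨f, g, hi, hr, hs⟩ := BirootedGraph.cls_eq_iff.1 h
  have hi' : MIso (C.second.mapMarks Prod.fst).toMarkedGraph
      (D.second.mapMarks Prod.fst).toMarkedGraph f g := hi.mapMarks Prod.fst
  have h1 := hi'.isAddr_iff (lab := lab) (o := .inl C.root₂) (o' := .inl C.root₁) C.root₂_mem
    C.root₁_mem α
  rw [Sum.map_inl, Sum.map_inl, hr, hs] at h1
  have h2 := enum_congr (lab := lab) (b := b) (m := marksOf C.toMarkedGraph)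
    (m' := marksOf D.toMarkedGraph) hi' hs <| by
      rintro (v | e) ho
      · exact congrArg Prod.snd (hi.vmark v ho)
      · exact congrArg Prod.snd (hi.emark e ho)
  rw [AddrEvent, AddrEvent, h1, h2]

open scoped Classical in
/-- The indicator of `AddrEvent` as a mass transport. -/
def addrTransport (lab : A → Label) (b : X) (α : ℕ) (S : Set (ℕ → X)) :
    BirootedSpace (A × X) → ℝ≥0∞ :=
  Quotient.lift (fun D => if AddrEvent lab b α S D then 1 else 0) fun C D h => by
    simp only [addrEvent_congr (Quotient.sound h : C.cls = D.cls)]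

theorem measurable_addrTransport (hlab : Measurable lab) (hS : MeasurableSet S) :
    Measurable (addrTransport lab b α S) := by
  classical
  refine measurable_of_comp_bicls (Measurable.ite (measurableSet_setOfPred.2 ?_) measurable_const
    measurable_const)
  have hm := (RootedGraph.measurable_mapMarks (X := A × X) (Y := A) measurable_fst).comp
    (BirootedGraph.measurable_second (X := A × X))
  have hmm : Measurable fun D : BirootedGraph (A × X) => marksOf D.toMarkedGraph :=
    measurable_marksOf.comp BirootedGraph.measurable_toMarkedGraph
  refine Measurable.and ?_ (measurableSet_setOfPred.1 (measurable_enum hm hlab b hmm hS))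
  exact measurable_apply_countable (F := fun (D : BirootedGraph (A × X)) r => IsAddr lab
    (D.second.mapMarks Prod.fst).toMarkedGraph (.inl D.root₂) α (.inl r))
    (fun _ => measurable_isAddr_root hm hlab α _) BirootedGraph.measurable_root₁

theorem addrEvent_addMarks (C : BirootedGraph A) (m : Marks X) :
    AddrEvent lab b α S (C.addMarks m) ↔
      IsAddr lab C.toMarkedGraph (.inl C.root₂) α (.inl C.root₁) ∧ enum lab b C.second m ∈ S := by
  have : marksOf (C.addMarks m).toMarkedGraph = m := by
    funext o; rcases o with v | e <;> rfl
  rw [AddrEvent, this]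
  rfl

theorem lintegral_addrTransport (μ : Measure (Marks X)) (hlab : Measurable lab)
    (hS : MeasurableSet S) {N : RootedGraph A} {u v : ℕ} (hv : v ∈ N.graph.vertexSet)
    (hu : IsAddr lab N.toMarkedGraph (.inl N.root) α (.inl u)) :
    ∫⁻ m, addrTransport lab b α S ((N.bi v N.root).addMarks m).cls ∂μ =
      ({u} : Set ℕ).indicator (fun _ => μ.map (enum lab b N) S) v := by
  classical
  have h : ∀ m, addrTransport lab b α S ((N.bi v N.root).addMarks m).cls =
      if v = u then (enum lab b N ⁻¹' S).indicator 1 m else 0 := by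
    intro m
    have h1 : AddrEvent lab b α S ((N.bi v N.root).addMarks m) ↔ v = u ∧ enum lab b N m ∈ S := by
      rw [addrEvent_addMarks, RootedGraph.bi_toMarkedGraph, RootedGraph.bi_root₁ hv N.root_mem,
        RootedGraph.bi_root₂ hv N.root_mem, RootedGraph.second_bi hv N.root_mem,
        RootedGraph.at'_self]
      refine and_congr_left fun _ => ⟨fun h => ?_, fun h => h ▸ hu⟩
      exact Sum.inl_injective (h.unique hu)
    change ite _ _ _ = _
    simp only [h1]
    by_cases hvu : v = u <;> simp [hvu, indicator_apply]
  have hm : Measurable (enum lab b N) := measurable_enum measurable_const hlab b measurable_id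
  simp only [h]
  by_cases hvu : v = u
  · simp [hvu, Measure.map_apply hm hS, lintegral_indicator_one (hm hS)]
  · simp [hvu]

/-- Under `addrTransport` the root receives mass only from the vertex with address `α`. By
`ae_massIn_avgFirst_eq`, sampling there or at the root gives the same probability that the
enumeration lies in `S`. Countably many `α` and `S` suffice, as addresses are natural numbers and a
law is determined on a countable π-system. -/
theorem ae_map_enum_eq (hK : RootEquivariant K) {P : Measure (RootedSpace A)}
    [IsProbabilityMeasure P] (hP : Uni P) (hadd : Uni (addLaw hK P)) (hlab : Measurable lab)
    (hd : ∀ᵐ q ∂P, ∀ N : RootedGraph A, N.cls = q → DistinctLabels lab N.toMarkedGraph) (b : X) :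
    ∀ᵐ q ∂P, ∀ N : RootedGraph A, N.cls = q → ∀ u ∈ N.graph.vertexSet,
      (K (N.at' u)).map (enum lab b N) = (K N).map (enum lab b N) := by
  obtain ⟨𝒞, hc, hpi, hgen⟩ := exists_countable_isPiSystem (ℕ → X)
  have hCm : ∀ S ∈ 𝒞, MeasurableSet S := fun S hS => by
    rw [hgen]; exact MeasurableSpace.measurableSet_generateFrom hS
  have hall : ∀ᵐ q ∂P, ∀ α : ℕ, ∀ S, ∀ hS : S ∈ 𝒞,
      massIn (avgFirst hK (measurable_addrTransport (b := b) (α := α) hlab (hCm S hS))) q =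
      massIn (avgSecond hK (measurable_addrTransport (b := b) (α := α) hlab (hCm S hS))) q := by
    refine ae_all_iff.2 fun α => (ae_ball_iff hc).2 fun S hS => ?_
    exact ae_massIn_avgFirst_eq hK hP hadd _
  filter_upwards [hall, hd] with q hq hdq N hN u hu
  have hm : Measurable (enum lab b N) := measurable_enum measurable_const hlab b measurable_id
  have := Measure.isProbabilityMeasure_map (μ := K (N.at' u)) hm.aemeasurable
  have := Measure.isProbabilityMeasure_map (μ := K N) hm.aemeasurable
  refine ext_of_generate_finite 𝒞 hgen hpi (fun S hS => ?_) (by simp)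
  obtain ⟨α, hα⟩ := (hdq N hN).exists_isAddr (o := .inl N.root) (o' := .inl u) N.root_mem hu
  have h := hq α S hS
  rw [← hN, massIn_cls, massIn_cls, vsum_congr
      (h := fun v => avgFirst hK (measurable_addrTransport hlab (hCm S hS)) (N.bi v N.root).cls)
      (h' := ({u} : Set ℕ).indicator fun v => (K (N.at' v)).map (enum lab b N) S)
      fun v hv => by
        rw [avgFirst_cls, RootedGraph.first_bi hv N.root_mem,
          lintegral_addrTransport _ hlab (hCm S hS) hv hα]
        by_cases hvu : v = u <;> simp [hvu],
    vsum_congr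
      (h := fun v => avgSecond hK (measurable_addrTransport hlab (hCm S hS)) (N.bi v N.root).cls)
      (h' := ({u} : Set ℕ).indicator fun v => (K N).map (enum lab b N) S)
      fun v hv => by
        rw [avgSecond_cls, RootedGraph.second_bi hv N.root_mem, RootedGraph.at'_self,
          lintegral_addrTransport _ hlab (hCm S hS) hv hα]] at h
  have hv : ∀ F : ℕ → ℝ≥0∞, vsum N.toMarkedGraph (({u} : Set ℕ).indicator F) = F u := fun F => by
    rw [vsum, tsum_eq_single u fun v hv => ?_]
    · simp [hu]
    · simp [hv]
  rwa [hv, hv] at h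

/-! The modified kernel. -/

/-- Discarding the marks outside `S` beforehand is harmless when only marks in `S` are read. -/
theorem pull_pull (b b' : X) {T S : Set (ℕ ⊕ ℕ)} {F : ℕ ⊕ ℕ → ℕ ⊕ ℕ} (h : MapsTo F T S) :
    pull b T F ∘ pull b' S id = pull b T F := by
  funext m o
  by_cases ho : o ∈ T
  · rw [Function.comp, pull_of_mem ho, pull_of_mem (h ho), pull_of_mem ho, id]
  · simp [pull, ho]

theorem map_pull_of_map_pull (b b' : X) {T S : Set (ℕ ⊕ ℕ)} {F : ℕ ⊕ ℕ → ℕ ⊕ ℕ}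
    (h : MapsTo F T S) {μ ν : Measure (Marks X)}
    (hμ : μ.map (pull b' S id) = ν.map (pull b' S id)) : μ.map (pull b T F) = ν.map (pull b T F) := by
  rw [← pull_pull b b' h, ← Measure.map_map (measurable_pull _ _ _) (measurable_pull _ _ _), hμ,
    Measure.map_map (measurable_pull _ _ _) (measurable_pull _ _ _)]

/-- The law of the marks of the vertices and edges given by `K` does not depend on the root. -/
def RootFree (K : Kernel (RootedGraph A) (Marks X)) (b : X) (N : RootedGraph A) : Prop :=
  ∀ u ∈ N.graph.vertexSet, (K (N.at' u)).map (pull b (objs N.graph) id) =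
    (K N).map (pull b (objs N.graph) id)

theorem measurable_pull_objs {Ω : Type*} [MeasurableSpace Ω] {F : Ω → MarkedGraph A} (hF : Measurable F)
    {m : Ω → Marks X} (hm : Measurable m) (b : X) :
    Measurable fun a => pull b (objs (F a).graph) id (m a) := by
  classical
  refine measurable_pi_lambda _ fun o => ?_
  exact Measurable.ite (measurableSet_setOfPred.2 (measurable_mem_objs hF o))
    ((measurable_pi_apply o).comp hm) measurable_const

/-- Equality of two laws is tested on a countable π-system, which leaves countably many measurable
conditions. -/
theorem measurableSet_rootFree (b : X) : MeasurableSet {N | RootFree K b N} := by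
  obtain ⟨𝒞, hc, hpi, hgen⟩ := exists_countable_isPiSystem (Marks X)
  have hCm : ∀ S ∈ 𝒞, MeasurableSet S := fun S hS => by
    rw [hgen]; exact MeasurableSpace.measurableSet_generateFrom hS
  have h : ∀ N, RootFree K b N ↔ ∀ u, u ∈ N.graph.vertexSet → ∀ S : 𝒞,
      (K (N.at' u)) (pull b (objs N.graph) id ⁻¹' S) = K N (pull b (objs N.graph) id ⁻¹' S) := by
    intro N
    refine forall₂_congr fun u _ => ⟨fun h S => ?_, fun h => ?_⟩
    · rw [← Measure.map_apply (measurable_pull _ _ _) (hCm S S.2), h,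
        Measure.map_apply (measurable_pull _ _ _) (hCm S S.2)]
    · have hm := measurable_pull b (objs N.graph) id
      have := Measure.isProbabilityMeasure_map (μ := K (N.at' u)) hm.aemeasurable
      have := Measure.isProbabilityMeasure_map (μ := K N) hm.aemeasurable
      refine ext_of_generate_finite 𝒞 hgen hpi (fun S hS => ?_) (by simp)
      rw [Measure.map_apply hm (hCm S hS), Measure.map_apply hm (hCm S hS)]
      exact h ⟨S, hS⟩
  simp only [h]
  have : Countable 𝒞 := hc.to_subtype
  refine measurableSet_setOfPred.2 (Measurable.forall fun u => (measurable_mem_vertexSet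
    RootedGraph.measurable_toMarkedGraph measurable_const).imp (Measurable.forall fun S => ?_))
  have hp : MeasurableSet {p : RootedGraph A × Marks X | pull b (objs p.1.graph) id p.2 ∈ (S : Set (Marks X))} :=
    measurable_pull_objs (RootedGraph.measurable_toMarkedGraph.comp measurable_fst) measurable_snd b
      (hCm S S.2)
  exact measurableSet_setOfPred.1 (measurableSet_eq_fun
    (Kernel.measurable_kernel_prodMk_left
      (κ := K.comap _ (measurable_at' measurable_id (measurable_const (a := u)))) hp)
    (Kernel.measurable_kernel_prodMk_left hp))

/-- Root-equivariance compares `M` rerooted at `u` with `N` rerooted at the image of `u`, where the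
law of the marks does not depend on the root. -/
theorem RootFree.map (hK : RootEquivariant K) {b : X} {M N : RootedGraph A} {f g : ℕ → ℕ}
    (h : MIso M.toMarkedGraph N.toMarkedGraph f g) (hN : RootFree K b N) : RootFree K b M := by
  have hroot : ∀ u ∈ M.graph.vertexSet, (K (M.at' u)).map (pull b (objs M.graph) id) =
      (K N).map (pull b (objs M.graph) (Sum.map f g)) := by
    intro u hu
    have h1 := hK b (M.at' u) (N.at' (f u)) f g (by
      rw [RootedGraph.at'_toMarkedGraph, RootedGraph.at'_toMarkedGraph]; exact h) (by
      rw [RootedGraph.at'_root hu, RootedGraph.at'_root (h.vert.mapsTo hu)])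
    rw [RootedGraph.at'_toMarkedGraph] at h1
    rw [← h1]
    exact map_pull_of_map_pull b b h.mapsTo_objs (hN _ (h.vert.mapsTo hu))
  intro u hu
  have h2 := hroot _ M.root_mem
  rw [RootedGraph.at'_self] at h2
  rw [hroot u hu, h2]

theorem RootFree.equivariant (hK : RootEquivariant K) {b b' : X} {M N : RootedGraph A} {f g : ℕ → ℕ}
    (h : MIso M.toMarkedGraph N.toMarkedGraph f g) (hN : RootFree K b N) :
    (K N).map (pull b' (objs M.graph) (Sum.map f g)) = (K M).map (pull b' (objs M.graph) id) := by
  have hv := h.vert.mapsTo M.root_mem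
  have h1 := hK b' M (N.at' (f M.root)) f g (by rw [RootedGraph.at'_toMarkedGraph]; exact h)
    (RootedGraph.at'_root hv).symm
  rw [← h1]
  exact (map_pull_of_map_pull b' b h.mapsTo_objs (hN _ hv)).symm

open scoped Classical in
/-- Replace the marks by constant marks where their law depends on the root. -/
def rootFreeKernel (K : Kernel (RootedGraph A) (Marks X)) [IsMarkovKernel K] (b : X) :
    Kernel (RootedGraph A) (Marks X) :=
  Kernel.piecewise (measurableSet_rootFree (K := K) b) K (Kernel.const _ (Measure.dirac fun _ => b))

instance (b : X) : IsMarkovKernel (rootFreeKernel K b) := by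
  unfold rootFreeKernel; infer_instance

/-- Root-freeness is invariant under isomorphism, so both graphs fall in the same case, and constant
marks are equivariant under everything. -/
theorem equivariant_rootFreeKernel (hK : RootEquivariant K) (b : X) :
    Equivariant (rootFreeKernel K b) := by
  classical
  intro b' M N f g h
  rw [rootFreeKernel, Kernel.piecewise_apply, Kernel.piecewise_apply]
  by_cases hN : RootFree K b N
  · rw [if_pos (show N ∈ {N | RootFree K b N} from hN),
      if_pos (show M ∈ {N | RootFree K b N} from hN.map hK h)]
    exact hN.equivariant hK h
  · have hM : ¬ RootFree K b M := fun hM => hN (hM.map hK h.symm)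
    rw [if_neg (show N ∉ {N | RootFree K b N} from hN),
      if_neg (show M ∉ {N | RootFree K b N} from hM), Kernel.const_apply, Kernel.const_apply,
      Measure.map_dirac' (measurable_pull _ _ _), Measure.map_dirac' (measurable_pull _ _ _)]
    rfl

/-- By `ae_map_enum_eq`, the law of the enumeration is almost surely the same from every root, and
decoding it recovers the marks. So almost every graph is root-free, where `rootFreeKernel` does not
change the kernel. -/
theorem exists_equivariant_addLaw_eq (hK : RootEquivariant K) {P : Measure (RootedSpace A)}
    [IsProbabilityMeasure P] (hP : Uni P) (hadd : Uni (addLaw hK P)) (hlab : Measurable lab)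
    (hd : ∀ᵐ q ∂P, ∀ N : RootedGraph A, N.cls = q → DistinctLabels lab N.toMarkedGraph) :
    ∃ (K' : Kernel (RootedGraph A) (Marks X)) (_ : IsMarkovKernel K') (hK' : Equivariant K'),
      addLaw hK'.rootEquivariant P = addLaw hK P := by
  classical
  obtain ⟨b⟩ := ‹Nonempty X›
  have : Nonempty X := ⟨b⟩
  refine ⟨rootFreeKernel K b, inferInstance, equivariant_rootFreeKernel hK b, ?_⟩
  refine Measure.ext_of_lintegral _ fun φ hφ => ?_
  rw [lintegral_addLaw _ _ hφ, lintegral_addLaw _ _ hφ]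
  refine lintegral_congr_ae ?_
  filter_upwards [ae_map_enum_eq hK hP hadd hlab hd b, hd] with q hq hdq
  obtain ⟨N, rfl⟩ := RootedGraph.exists_cls_eq q
  have hpull : pull b (objs N.graph) id ∘ denum lab N ∘ enum lab b N = pull b (objs N.graph) id := by
    funext m o
    by_cases ho : o ∈ objs N.graph
    · rw [Function.comp, pull_of_mem ho, pull_of_mem ho]
      exact denum_enum (hdq N rfl) ho
    · simp [pull, ho]
  have hN : RootFree K b N := by
    intro u hu
    have hm : Measurable (enum lab b N) := measurable_enum measurable_const hlab b measurable_id
    rw [← hpull, ← Function.comp_assoc, ← Measure.map_map ((measurable_pull _ _ _).comp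
      (measurable_denum_right hlab N)) hm, hq N rfl u hu, Measure.map_map
        ((measurable_pull _ _ _).comp (measurable_denum_right hlab N)) hm]
  rw [lintegral_addKernel_cls _ hφ, lintegral_addKernel_cls _ hφ, rootFreeKernel,
    Kernel.piecewise_apply, if_pos (show N ∈ {N | RootFree K b N} from hN)]

/-- Every marking is, in the presence of independent labels, given by an equivariant kernel. -/
theorem exists_equivariant_labelled {R : Measure (RootedSpace X)} [IsProbabilityMeasure R] (hR : Uni R) :
    ∃ (K : Kernel (RootedGraph Label) (Marks X)) (_ : IsMarkovKernel K) (hK : Equivariant K),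
      addLaw hK.rootEquivariant ((labelled R).map (mapMarks Prod.snd)) =
        (labelled R).map (mapMarks Prod.swap) := by
  have hsw : Measurable (mapMarks (Prod.swap (α := X) (β := Label))) := measurable_mapMarks measurable_swap
  have hsn : Measurable (mapMarks (Prod.snd (α := X) (β := Label))) := measurable_mapMarks measurable_snd
  have hfs : Measurable (mapMarks (Prod.fst (α := Label) (β := X))) := measurable_mapMarks measurable_fst
  have hU : Uni (labelled R) := hR.addLaw (equivariant_labelKernel X)
  have : IsProbabilityMeasure (labelled R) := by unfold labelled; infer_instance
  have := Measure.isProbabilityMeasure_map (μ := labelled R) hsw.aemeasurable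
  have := Measure.isProbabilityMeasure_map (μ := labelled R) hsn.aemeasurable
  have heq : ((labelled R).map (mapMarks Prod.swap)).map (mapMarks Prod.fst) =
      (labelled R).map (mapMarks Prod.snd) := by
    rw [Measure.map_map hfs hsw]
    congr 1
    funext q
    obtain ⟨N, rfl⟩ := RootedGraph.exists_cls_eq q
    rfl
  have hd : ∀ᵐ q ∂(labelled R).map (mapMarks Prod.snd), ∀ N : RootedGraph Label, N.cls = q →
      DistinctLabels id N.toMarkedGraph := by
    have hS : ∀ N : RootedGraph Label, (∀ M : RootedGraph Label, M.cls = N.cls →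
        DistinctLabels id M.toMarkedGraph) ↔ DistinctLabels id N.toMarkedGraph := by
      refine fun N => ⟨fun h => h N rfl, fun h M hM => ?_⟩
      obtain ⟨f, g, hi, -⟩ := RootedGraph.cls_eq_iff.1 hM.symm
      exact h.congr hi
    rw [ae_map_iff hsn.aemeasurable]
    · filter_upwards [ae_distinctLabels R] with q hq
      obtain ⟨M, rfl⟩ := RootedGraph.exists_cls_eq q
      rw [mapMarks_cls, hS]
      exact hq M rfl
    · refine measurableSet_setOfPred.2 (measurable_of_comp_cls
        (h := fun q => ∀ N : RootedGraph Label, N.cls = q → DistinctLabels id N.toMarkedGraph) ?_)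
      simp only [hS]
      exact (measurable_distinctLabels measurable_id).comp RootedGraph.measurable_toMarkedGraph
  -- The swap puts the labels first, as the marks that the kernel reads, and the marks of `R`
  -- second, as those to be disintegrated.
  obtain ⟨K, hKm, hK, hKR⟩ := exists_rootEquivariant_addLaw_eq (lab := id)
    ((labelled R).map (mapMarks Prod.swap)) measurable_id (by rwa [heq])
  rw [heq] at hKR
  have h := exists_equivariant_addLaw_eq (lab := id) hK (P := (labelled R).map (mapMarks Prod.snd))
    (hU.map_mapMarks measurable_snd) (by rw [hKR]; exact hU.map_mapMarks measurable_swap)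
    measurable_id hd
  rwa [hKR] at h

end

end

section

variable {A B X Y Z : Type}

/-! ### Laws with added marks -/

section

variable [TopologicalSpace A] [PolishSpace A] [MeasurableSpace A] [BorelSpace A]
  [TopologicalSpace B] [PolishSpace B] [MeasurableSpace B] [BorelSpace B]

theorem addLaw_smul [Nonempty B] {K : Kernel (RootedGraph A) (Marks B)} [IsMarkovKernel K]
    (hK : RootEquivariant K) (c : ℝ≥0∞) (Q : Measure (RootedSpace A)) :
    addLaw hK (c • Q) = c • addLaw hK Q := by
  refine Measure.ext_of_lintegral _ fun φ hφ => ?_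
  rw [lintegral_smul_measure, lintegral_addLaw _ _ hφ, lintegral_addLaw _ _ hφ,
    lintegral_smul_measure]

theorem Uni.labelled {Q : Measure (RootedSpace A)} (hQ : Uni Q) : Uni (labelled Q) :=
  hQ.addLaw (equivariant_labelKernel A)

instance (Q : Measure (RootedSpace A)) [IsProbabilityMeasure Q] :
    IsProbabilityMeasure (labelled Q) := by
  unfold UnimodularGraph.labelled; infer_instance

theorem map_fst_labelled (Q : Measure (RootedSpace A)) :
    (labelled Q).map (mapMarks Prod.fst) = Q := map_fst_addLaw _ Q

theorem map_mapMarks_mapMarks [TopologicalSpace X] [PolishSpace X] [MeasurableSpace X]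
    [BorelSpace X] (Q : Measure (RootedSpace A)) {c : A → B} (hc : Measurable c) {d : B → X}
    (hd : Measurable d) :
    (Q.map (mapMarks c)).map (mapMarks d) = Q.map (mapMarks (d ∘ c)) := by
  rw [Measure.map_map (measurable_mapMarks hd) (measurable_mapMarks hc)]
  congr 1
  funext q
  obtain ⟨N, rfl⟩ := RootedGraph.exists_cls_eq q
  rfl

/-- Labels are sampled without looking at the marks, so the labelled graph has a law determined by
the unmarked graph. A kernel on labelled graphs can therefore be moved between different markings of
one graph. -/
theorem map_snd_labelled (Q : Measure (RootedSpace A)) :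
    (labelled Q).map (mapMarks Prod.snd) =
      (labelled (Q.map forget)).map (mapMarks Prod.snd) := by
  have : Q.map forget = Q.map (mapMarks fun _ => ()) := rfl
  rw [this, ← map_labelled Q measurable_const,
    map_mapMarks_mapMarks _ (measurable_const.prodMap measurable_id) measurable_snd]
  rfl

theorem mapMarks_id : mapMarks (id : A → A) = id := by
  funext q
  obtain ⟨N, rfl⟩ := RootedGraph.exists_cls_eq q
  rfl

theorem addMarks_pull_cls (N : RootedGraph A) (b : B) (m : Marks B) :
    (N.addMarks (pull b (objs N.graph) id m)).cls = (N.addMarks m).cls :=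
  addMarks_cls_congr (MIso.id N.toMarkedGraph) rfl fun o ho => by
    rw [pull_of_mem ho, Sum.map_id_id]

end

/-! ### Marks of the open cluster -/

/-- The component of the open vertex with least index. -/
def openComp (op : A → Bool) (d : A → Y) (N : MarkedGraph A) : RootedGraph Y :=
  (openPre op d N).comp (sInf {v | v ∈ (openGraph op N).vertexSet})

theorem sInf_mem_openGraph {op : A → Bool} {N : MarkedGraph A} (h : OpenConnected op N) :
    sInf {v | v ∈ (openGraph op N).vertexSet} ∈ (openGraph op N).vertexSet := Nat.sInf_mem h.1

theorem openComp_toMarkedGraph {op : A → Bool} {d : A → Y} {N : MarkedGraph A}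
    (h : OpenConnected op N) {v : ℕ} (hv : v ∈ (openGraph op N).vertexSet) :
    ((openPre op d N).comp v).toMarkedGraph = (openComp op d N).toMarkedGraph :=
  PreGraph.comp_toMarkedGraph_eq (h.2 _ (sInf_mem_openGraph h) v hv)

theorem MIso.openComp {op : A → Bool} {d : A → Y} {M N : MarkedGraph A} {f g : ℕ → ℕ}
    (h : MIso M N f g) (hM : OpenConnected op M) :
    MIso (openComp op d M).toMarkedGraph (openComp op d N).toMarkedGraph f g := by
  have hp : PreIso (openPre op d M) (openPre op d N) f g := preIso_openPre h
  have h1 := hp.comp (sInf_mem_openGraph hM)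
  rwa [openComp_toMarkedGraph (hM.congr h) (hp.vert.mapsTo (sInf_mem_openGraph hM))] at h1

theorem objs_openComp_subset {op : A → Bool} {d : A → Y} {N : MarkedGraph A}
    (h : OpenConnected op N) : objs (openComp op d N).graph ⊆ objs N.graph := by
  rintro (v | e) ho
  · exact (reach_subset (sInf_mem_openGraph h) ho).1
  · obtain ⟨x, y, hl, -⟩ := ho
    exact (openGraph_isLink.1 hl).1.edge_mem

theorem measurable_openComp [TopologicalSpace A] [MeasurableSpace A] [BorelSpace A]
    [TopologicalSpace Y] [MeasurableSpace Y] [BorelSpace Y]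
    {op : A → Bool} (hop : Continuous op) {d : A → Y} (hd : Continuous d) :
    Measurable (openComp op d) := by
  have hl := (clusterT op hop d hd).measurable_isLink
  refine measurable_comp hl (clusterT op hop d hd).measurable_vmark
    (clusterT op hop d hd).measurable_emark (measurable_sInf_nat fun v => ?_)
  exact (measurable_mem_vertexSet measurable_id measurable_const).and
    (measurableSet_setOfPred.1 ((hop.measurable.comp (measurable_vmark measurable_id measurable_const))
      (measurableSet_singleton true)))

section

variable [TopologicalSpace A] [PolishSpace A] [MeasurableSpace A] [BorelSpace A]
  [TopologicalSpace Y] [PolishSpace Y] [MeasurableSpace Y] [BorelSpace Y]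
  [TopologicalSpace X] [PolishSpace X] [MeasurableSpace X] [BorelSpace X]
  (K : Kernel (RootedGraph Y) (Marks X)) [IsMarkovKernel K]
  [Nonempty X] {op : A → Bool} (hop : Continuous op) {d : A → Y} (hd : Continuous d) (b : X)

/-- Put the marks given by `K` on the open cluster. -/
def clusterKernelAux : Kernel (RootedGraph A) (Marks X) where
  toFun N := (K (openComp op d N.toMarkedGraph)).map
    (pull b (objs (openComp op d N.toMarkedGraph).graph) id)
  measurable' := by
    refine Measure.measurable_of_measurable_coe _ fun S hS => ?_
    simp only [Measure.map_apply (measurable_pull _ _ _) hS]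
    have hC : Measurable fun N : RootedGraph A => openComp op d N.toMarkedGraph :=
      (measurable_openComp hop hd).comp RootedGraph.measurable_toMarkedGraph
    exact Kernel.measurable_kernel_prodMk_left (κ := K.comap _ hC) (measurable_pull_objs
      (RootedGraph.measurable_toMarkedGraph.comp (hC.comp measurable_fst)) measurable_snd b hS)

instance : IsMarkovKernel (clusterKernelAux K hop hd b) :=
  ⟨fun _ => Measure.isProbabilityMeasure_map (measurable_pull _ _ _).aemeasurable⟩

open scoped Classical in
/-- Put the marks given by `K` on the open cluster, and constant marks elsewhere. -/
def clusterKernel : Kernel (RootedGraph A) (Marks X) :=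
  Kernel.piecewise (s := {N | OpenConnected op N.toMarkedGraph})
    (measurableSet_setOfPred.2 ((measurable_openConnected hop).comp
      RootedGraph.measurable_toMarkedGraph))
    (clusterKernelAux K hop hd b) (Kernel.const _ (Measure.dirac fun _ => b))

instance : IsMarkovKernel (clusterKernel K hop hd b) := by
  unfold clusterKernel; infer_instance

theorem clusterKernel_apply {N : RootedGraph A} (h : OpenConnected op N.toMarkedGraph) :
    clusterKernel K hop hd b N = (K (openComp op d N.toMarkedGraph)).map
      (pull b (objs (openComp op d N.toMarkedGraph).graph) id) := by
  classical
  rw [clusterKernel, Kernel.piecewise_apply, if_pos (show N ∈ {N : RootedGraph A | OpenConnected op N.toMarkedGraph} from h)]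
  rfl

variable {K}

/-- An isomorphism carries open cluster to open cluster but need not respect the root chosen in
`openComp`, the open vertex with least label; this is why `K` must be equivariant without any
condition on roots. -/
theorem equivariant_clusterKernel (hK : Equivariant K) :
    Equivariant (clusterKernel K hop hd b) := by
  classical
  intro b' M N f g h
  by_cases hM : OpenConnected op M.toMarkedGraph
  · have hN := hM.congr h
    have hC := h.openComp (d := d) hM
    rw [clusterKernel_apply K hop hd b hM, clusterKernel_apply K hop hd b hN,
      Measure.map_map (measurable_pull _ _ _) (measurable_pull _ _ _),
      Measure.map_map (measurable_pull _ _ _) (measurable_pull _ _ _)]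
    -- Since the isomorphism matches the two clusters, marks off the cluster can be discarded before
    -- or after transporting.
    have h1 : pull b' (objs M.graph) (Sum.map f g) ∘
        pull b (objs (openComp op d N.toMarkedGraph).graph) id =
        pull b' (objs M.graph) id ∘
          pull b (objs (openComp op d M.toMarkedGraph).graph) (Sum.map f g) := by
      funext m o
      by_cases ho : o ∈ objs M.graph
      · have hiff : Sum.map f g o ∈ objs (openComp op d N.toMarkedGraph).graph ↔
            o ∈ objs (openComp op d M.toMarkedGraph).graph := by
          refine ⟨fun h' => ?_, fun h' => hC.mapsTo_objs h'⟩
          obtain ⟨o', ho', heq⟩ := hC.surjOn_objs h'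
          rwa [← h.injOn_objs (objs_openComp_subset hM ho') ho heq]
        simp only [Function.comp, pull_of_mem ho]
        simp only [pull, hiff, id]
      · simp [pull, ho]
    rw [h1, ← Measure.map_map (measurable_pull _ _ _) (measurable_pull _ _ _),
      hK b _ _ f g hC, Measure.map_map (measurable_pull _ _ _) (measurable_pull _ _ _)]
  · have hN : ¬ OpenConnected op N.toMarkedGraph := fun hN => hM (hN.congr h.symm)
    rw [clusterKernel, Kernel.piecewise_apply, Kernel.piecewise_apply,
      if_neg (show N ∉ {N : RootedGraph A | OpenConnected op N.toMarkedGraph} from hN),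
      if_neg (show M ∉ {N : RootedGraph A | OpenConnected op N.toMarkedGraph} from hM),
      Kernel.const_apply, Kernel.const_apply,
      Measure.map_dirac' (measurable_pull _ _ _), Measure.map_dirac' (measurable_pull _ _ _)]
    rfl

/-- The open cluster of the graph with marks given by `clusterKernel K` is the open cluster with
marks given by `K`. -/
theorem tr_addLaw_clusterKernel (hK : Equivariant K) {Q : Measure (RootedSpace A)}
    (hQ : ∀ᵐ q ∂Q, ∀ N : RootedGraph A, N.cls = q → OpenConnected op N.toMarkedGraph) :
    (clusterT (op ∘ Prod.fst) (hop.comp continuous_fst) (Prod.map d id)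
      (hd.prodMap continuous_id)).tr
        (addLaw (equivariant_clusterKernel hop hd b hK).rootEquivariant Q) =
      addLaw hK.rootEquivariant ((clusterT op hop d hd).tr Q) := by
  refine Measure.ext_of_lintegral _ fun φ hφ => ?_
  rw [Transform.lintegral_tr _ _ hφ, lintegral_addLaw _ _ (Transform.measurable_push _ hφ),
    lintegral_addLaw _ _ hφ, Transform.lintegral_tr _ _ (Measurable.lintegral_kernel hφ)]
  refine lintegral_congr_ae ?_
  filter_upwards [hQ] with q hq
  obtain ⟨N, rfl⟩ := RootedGraph.exists_cls_eq q
  have hN := hq N rfl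
  rw [lintegral_addKernel_cls _ (Transform.measurable_push _ hφ),
    push_clusterT hop hd (Measurable.lintegral_kernel hφ)]
  simp only [push_clusterT _ _ hφ]
  by_cases hr : op (N.vmark N.root) = true
  · rw [if_pos hr, lintegral_addKernel_cls _ hφ]
    have h1 : ∀ m : Marks X, (if (op ∘ Prod.fst) ((N.addMarks m).vmark (N.addMarks m).root) = true
        then φ ((openPre (op ∘ Prod.fst) (Prod.map d id)
          (N.addMarks m).toMarkedGraph).comp (N.addMarks m).root).cls else 0) =
        φ (((openPre op d N.toMarkedGraph).comp N.root).addMarks m).cls := fun m => if_pos hr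
    simp only [h1]
    have hC : ((openPre op d N.toMarkedGraph).comp N.root).toMarkedGraph =
      (openComp op d N.toMarkedGraph).toMarkedGraph :=
        openComp_toMarkedGraph hN ⟨N.root_mem, hr⟩
    have hφ' : Measurable fun m : Marks X =>
        φ (((openPre op d N.toMarkedGraph).comp N.root).addMarks m).cls :=
      hφ.comp (measurable_addMarks_cls_right _)
    -- The cluster from which marks are sampled is rooted at the least open label, the transformed
    -- graph at `N.root`. They are one marked graph, and equivariance of `K` absorbs the change of
    -- root.
    rw [clusterKernel_apply K hop hd b hN, lintegral_map hφ' (measurable_pull _ _ _), ← hC]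
    simp only [addMarks_pull_cls]
    refine hK.lintegral_congr (f := id) (g := id) ?_ (hφ.comp (measurable_addMarks_cls_right _))
      fun m m' hm => ?_
    · rw [← hC]; exact MIso.id _
    · rw [← hC] at hm
      exact congrArg φ (addMarks_cls_congr (MIso.id _) rfl hm)
  · rw [if_neg hr]
    have h1 : ∀ m : Marks X, (if (op ∘ Prod.fst) ((N.addMarks m).vmark (N.addMarks m).root) = true
        then φ ((openPre (op ∘ Prod.fst) (Prod.map d id)
          (N.addMarks m).toMarkedGraph).comp (N.addMarks m).root).cls else 0) = 0 :=
      fun m => if_neg hr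
    simp only [h1, lintegral_zero]

/-- The open cluster of a labelled graph is a labelled open cluster. -/
theorem tr_labelled (Q : Measure (RootedSpace A)) :
    (clusterT (op ∘ Prod.fst) (hop.comp continuous_fst) (Prod.map d id)
      (hd.prodMap continuous_id)).tr (labelled Q) = labelled ((clusterT op hop d hd).tr Q) := by
  refine Measure.ext_of_lintegral _ fun φ hφ => ?_
  rw [Transform.lintegral_tr _ _ hφ, labelled, lintegral_addLaw _ _ (Transform.measurable_push _ hφ),
    labelled, lintegral_addLaw _ _ hφ, Transform.lintegral_tr _ _ (Measurable.lintegral_kernel hφ)]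
  refine lintegral_congr fun q => ?_
  obtain ⟨N, rfl⟩ := RootedGraph.exists_cls_eq q
  rw [lintegral_addKernel_cls _ (Transform.measurable_push _ hφ),
    push_clusterT hop hd (Measurable.lintegral_kernel hφ), lintegral_addKernel_cls _ hφ]
  simp only [push_clusterT _ _ hφ]
  by_cases hr : op (N.vmark N.root) = true
  · rw [if_pos hr]
    exact lintegral_congr fun m => if_pos hr
  · rw [if_neg hr]
    exact (lintegral_congr fun m => if_neg hr).trans lintegral_zero

end

end

/-! ### From the graph to the open cluster -/

section

variable {A B X Y Z : Type}

section

variable [TopologicalSpace A] [PolishSpace A] [MeasurableSpace A] [BorelSpace A]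
  [TopologicalSpace Y] [PolishSpace Y] [MeasurableSpace Y] [BorelSpace Y]
  [TopologicalSpace X] [PolishSpace X] [MeasurableSpace X] [BorelSpace X]

theorem tr_clusterT_comp {op : A → Bool} (hop : Continuous op) {d : A → Y} (hd : Continuous d)
    {e : Y → X} (he : Continuous e) (Q : Measure (RootedSpace A)) :
    (clusterT op hop (e ∘ d) (he.comp hd)).tr Q =
      ((clusterT op hop d hd).tr Q).map (mapMarks e) := by
  have hm : Measurable (mapMarks e) := measurable_mapMarks he.measurable
  refine Measure.ext_of_lintegral _ fun φ hφ => ?_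
  rw [lintegral_map hφ hm, Transform.lintegral_tr _ _ hφ,
    Transform.lintegral_tr _ _ (g := fun q => φ (mapMarks e q)) (hφ.comp hm)]
  refine lintegral_congr fun q => ?_
  obtain ⟨N, rfl⟩ := RootedGraph.exists_cls_eq q
  rw [push_clusterT hop _ hφ, push_clusterT hop hd (g := fun q => φ (mapMarks e q)) (hφ.comp hm)]
  rfl

theorem labelled_smul (c : ℝ≥0∞) (Q : Measure (RootedSpace A)) :
    labelled (c • Q) = c • labelled Q := addLaw_smul _ c Q

theorem map_forget_mapMarks (Q : Measure (RootedSpace A)) {c : A → Y} (hc : Measurable c) :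
    (Q.map (mapMarks c)).map forget = Q.map forget :=
  map_mapMarks_mapMarks Q hc measurable_const

end

theorem forget_unit : forget (X := Unit) = id := mapMarks_id

theorem ProbabilityMeasure.nonempty_marks [TopologicalSpace X]
    (Q : ProbabilityMeasure (RootedSpace X)) : Nonempty X := by
  obtain ⟨q⟩ := Q.nonempty
  obtain ⟨N, -⟩ := RootedGraph.exists_cls_eq q
  exact ⟨N.vmark 0⟩

/-- Strong soficity passes to the open cluster of a connected percolation. -/
theorem StronglySofic.percolation {P H : ProbabilityMeasure UnmarkedSpace}
    {Q : ProbabilityMeasure (RootedSpace Bool)} (hQ : IsConnectedPercolationOn Q P)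
    (hH : percolationLaw (Q : Measure (RootedSpace Bool)) = (H : Measure UnmarkedSpace))
    (hP : StronglySofic P) : StronglySofic H := by
  intro X _ _ R hR
  let _ : MeasurableSpace X := borel X
  have : BorelSpace X := ⟨rfl⟩
  have : Nonempty X := ProbabilityMeasure.nonempty_marks R
  obtain ⟨b⟩ := id this
  have hQU : Uni (Q : Measure (RootedSpace Bool)) := hQ.1.1
  obtain ⟨K, hKm, hK, hKR⟩ := exists_equivariant_labelled (R := (R : Measure (RootedSpace X))) hR.1
  -- The kernel reads labels only, so it can be applied to the labelled open cluster inside the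
  -- large graph.
  have hK₁ := hK.comapMarks (A := Unit × Label) measurable_snd
  have hop : Continuous ((id : Bool → Bool) ∘ Prod.fst (β := Label)) :=
    continuous_id.comp continuous_fst
  have hc : Continuous fun _ : Bool => () := continuous_const
  have hd : Continuous (Prod.map (fun _ : Bool => ()) (id : Label → Label)) := hc.prodMap continuous_id
  have hK' := equivariant_clusterKernel hop hd b hK₁
  -- A marking of the whole graph: the percolation, the labels, and the resampled marks on the open
  -- cluster.
  let J := addLaw hK'.rootEquivariant (labelled (Q : Measure (RootedSpace Bool)))
  have hJU : Uni J := hQU.labelled.addLaw hK'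
  have hJ1 : J.map (mapMarks Prod.fst) = labelled (Q : Measure (RootedSpace Bool)) :=
    map_fst_addLaw _ _
  have hJ2 : J.map (mapMarks (((id : Bool → Bool) ∘ Prod.fst (β := Label)) ∘ Prod.fst (β := X))) =
      (Q : Measure (RootedSpace Bool)) := by
    rw [← map_mapMarks_mapMarks J measurable_fst hop.measurable, hJ1]
    exact map_fst_labelled _
  have hJP : IsMarkingOf (⟨J, inferInstance⟩ : ProbabilityMeasure (RootedSpace ((Bool × Label) × X))) P := by
    refine ⟨hJU, ?_⟩
    rw [ProbabilityMeasure.coe_mk, ← hQ.1.2, ← map_forget_mapMarks J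
      (hop.comp continuous_fst).measurable, hJ2]
  let c := ((Q : Measure (RootedSpace Bool)) rootOpen)⁻¹
  have hT := percolationLaw_map continuous_id hc (Q : Measure (RootedSpace Bool))
  have htU := tr_clusterT_univ continuous_id hc (Q : Measure (RootedSpace Bool))
  simp only [mapMarks_id, Measure.map_id, forget_unit] at hT htU
  rw [htU, hH] at hT
  have hopen : ∀ᵐ q ∂labelled (Q : Measure (RootedSpace Bool)), ∀ N : RootedGraph (Bool × Label),
      N.cls = q → OpenConnected (id ∘ Prod.fst) N.toMarkedGraph := by
    refine ae_openConnected hop ?_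
    have h1 := map_fst_labelled (Q : Measure (RootedSpace Bool))
    change AlmostSurelyConnected ((labelled (Q : Measure (RootedSpace Bool))).map (mapMarks Prod.fst))
    rw [h1]
    exact hQ.2
  refine (clusterT (((id : Bool → Bool) ∘ Prod.fst (β := Label)) ∘ Prod.fst (β := X))
    (hop.comp continuous_fst) Prod.snd continuous_snd).sofic_tr (hP _ ⟨J, inferInstance⟩ hJP) ?_
  rw [tr_clusterT_univ, ProbabilityMeasure.coe_mk, hJ2]
  have h1 := tr_clusterT_comp (hop.comp (continuous_fst (Y := X)))
    (hd.prodMap (continuous_id (X := X))) continuous_snd J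
  -- Taking the open cluster commutes with adding labels and with adding marks by `K`. The result
  -- is, up to the factor `c`, the labelled `H` with marks sampled by `K`.
  rw [tr_addLaw_clusterKernel hop hd b hK₁ hopen, tr_labelled continuous_id hc] at h1
  refine Eq.trans ?_ (congrArg (fun μ => c • μ) h1).symm
  rw [← Measure.map_smul, ← addLaw_smul, ← labelled_smul, ← hT]
  -- `R` is a marking of `H`, so the labelled graphs of `R` and of `H` have the same law, and adding
  -- marks by `K` to labelled `H` reproduces `R` together with its labels.
  have h2 := map_addLaw_comapMarks hK.rootEquivariant (measurable_snd (α := Unit) (β := Label))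
    (labelled (H : Measure UnmarkedSpace))
  rw [← hR.2, ← map_snd_labelled, hKR, hR.2] at h2
  have h3 := congrArg (fun μ => μ.map (mapMarks Prod.snd)) h2
  simp only [map_mapMarks_mapMarks _ (measurable_snd.prodMap measurable_id) measurable_snd,
    map_mapMarks_mapMarks _ measurable_swap measurable_snd] at h3
  exact (map_fst_labelled (R : Measure (RootedSpace X))).symm.trans h3.symm

end

section

variable {A B X Y Z : Type}

/-! ### Graphs encoded in the marks of another graph -/

/-- A mark that tells the label of a vertex, the kinds of its descendants (`0` for none, `1` for a
vertex, `2 + c` for an edge whose ends are coded by `c`) and the marks of its descendants. -/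
abbrev Recipe (X : Type) : Type := Label × (ℕ → ℕ) × (ℕ → X)

/-- The kind of the descendant `x`, where `Nat.pair v a` stands for the `a`-th descendant of `v`. -/
def kindAt (N : MarkedGraph (Recipe X)) (x : ℕ) : ℕ := (N.vmark x.unpair.1).2.1 x.unpair.2

def markAt (N : MarkedGraph (Recipe X)) (x : ℕ) : X := (N.vmark x.unpair.1).2.2 x.unpair.2

/-- The descendant `x` is a vertex, and its code as seen from `v` is `s`. -/
def IsEnd (K : ℕ) (N : MarkedGraph (Recipe X)) (v s x : ℕ) : Prop :=
  s.unpair.1 < K ∧ x.unpair.2 < K ∧ x.unpair.2 = s.unpair.2 ∧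
    IsAddr Prod.fst N (.inl v) s.unpair.1 (.inl x.unpair.1) ∧ kindAt N x = 1

theorem unpair_ext {x y : ℕ} (h1 : x.unpair.1 = y.unpair.1) (h2 : x.unpair.2 = y.unpair.2) :
    x = y := by
  rw [← Nat.pair_unpair x, h1, h2, Nat.pair_unpair]

theorem IsEnd.unique {K : ℕ} {N : MarkedGraph (Recipe X)} {v s x y : ℕ} (hx : IsEnd K N v s x)
    (hy : IsEnd K N v s y) : x = y :=
  unpair_ext (Sum.inl_injective (hx.2.2.2.1.unique hy.2.2.2.1)) (hx.2.2.1.trans hy.2.2.1.symm)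

/-- The kind of `e` is `2` plus a code for a pair of ends; both orders are allowed because links are
symmetric. The bounds by `K`, here and in `IsEnd`, restrict the construction to a bounded
neighbourhood. -/
def BlowupLink (K : ℕ) (N : MarkedGraph (Recipe X)) (e x y : ℕ) : Prop :=
  e.unpair.1 ∈ N.graph.vertexSet ∧ e.unpair.2 < K ∧ 2 ≤ kindAt N e ∧
    ((IsEnd K N e.unpair.1 (kindAt N e - 2).unpair.1 x ∧
      IsEnd K N e.unpair.1 (kindAt N e - 2).unpair.2 y) ∨
    (IsEnd K N e.unpair.1 (kindAt N e - 2).unpair.1 y ∧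
      IsEnd K N e.unpair.1 (kindAt N e - 2).unpair.2 x))

theorem BlowupLink.exists_isEnd {K : ℕ} {N : MarkedGraph (Recipe X)} {e x y : ℕ}
    (h : BlowupLink K N e x y) : ∃ s, IsEnd K N e.unpair.1 s x := by
  rcases h.2.2.2 with h | h
  · exact ⟨_, h.1⟩
  · exact ⟨_, h.2⟩

theorem BlowupLink.symm {K : ℕ} {N : MarkedGraph (Recipe X)} {e x y : ℕ}
    (h : BlowupLink K N e x y) : BlowupLink K N e y x :=
  ⟨h.1, h.2.1, h.2.2.1, h.2.2.2.symm⟩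

/-- The graph of the descendants with index less than `K`. -/
def blowup (K : ℕ) (N : MarkedGraph (Recipe X)) : Graph ℕ ℕ where
  vertexSet := {x | x.unpair.1 ∈ N.graph.vertexSet ∧ x.unpair.2 < K ∧ kindAt N x = 1}
  IsLink := BlowupLink K N
  isLink_symm _ _ := ⟨fun _ _ h => h.symm⟩
  eq_or_eq_of_isLink_of_isLink := by
    rintro e x y v w ⟨-, -, -, h⟩ ⟨-, -, -, h'⟩
    rcases h with h | h <;> rcases h' with h' | h'
    · exact Or.inl (h.1.unique h'.1)
    · exact Or.inr (h.1.unique h'.1)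
    · exact Or.inr (h.2.unique h'.2)
    · exact Or.inl (h.2.unique h'.2)
  left_mem_of_isLink e x y h := by
    obtain ⟨s, hs⟩ := h.exists_isEnd
    exact ⟨hs.2.2.2.1.mem (show Sum.inl _ ∈ objs N.graph from h.1), hs.2.1, hs.2.2.2.2⟩

theorem oball_trans {G : Graph ℕ ℕ} {o x y : ℕ ⊕ ℕ} {r s : ℕ} (h : x ∈ oball G o r)
    (h' : y ∈ oball G x s) : y ∈ oball G o (r + s) := by
  induction s generalizing y with
  | zero => rwa [show y = x from h']
  | succ s ih =>
    rcases h' with h' | ⟨z, hz, hzy⟩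
    · exact Or.inl (ih h')
    · exact Or.inr ⟨z, ih hz, hzy⟩

theorem mem_oball_symm {G : Graph ℕ ℕ} {o x : ℕ ⊕ ℕ} {r : ℕ} (h : x ∈ oball G o r) :
    o ∈ oball G x r := by
  induction r generalizing x with
  | zero => exact (show x = o from h).symm
  | succ r ih =>
    rcases h with h | ⟨y, hy, hyx⟩
    · exact Or.inl (ih h)
    · have h1 : y ∈ oball G x 1 := Or.inr ⟨x, rfl, hyx.symm⟩
      rw [Nat.add_comm]
      exact oball_trans h1 (ih hy)

/-- An address begins with a radius, which is at most its code and so less than `K`. The bound on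
the distance gives local finiteness and locality of the blow-up. -/
theorem IsEnd.mem_oball {K : ℕ} {N : MarkedGraph (Recipe X)} {v s x : ℕ} (h : IsEnd K N v s x) :
    Sum.inl x.unpair.1 ∈ oball N.graph (.inl v) K :=
  oball_mono _ _ ((Nat.unpair_left_le _).trans h.1.le) h.2.2.2.1.1

/-- The graph of the descendants with index less than `K`, with its marks. -/
def blowupPre (K : ℕ) (N : MarkedGraph (Recipe X)) : PreGraph X where
  graph := blowup K N
  vmark := markAt N
  emark := markAt N
  locallyFinite x _ := by
    -- The owner of an edge at `x` lies within distance `K` of the owner of `x`, and each owner has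
    -- at most `K` descendants.
    refine (((finite_oball N (.inl x.unpair.1) K).preimage Sum.inl_injective.injOn).image2 Nat.pair
      (finite_Iio K)).subset ?_
    rintro e ⟨y, hl⟩
    obtain ⟨s, hs⟩ := BlowupLink.exists_isEnd hl
    exact ⟨_, mem_oball_symm hs.mem_oball, _, hl.2.1, Nat.pair_unpair e⟩

/-! Equivariance. -/

section

variable {M N : MarkedGraph (Recipe X)} {f g : ℕ → ℕ} (h : MIso M N f g) {K : ℕ}

/-- The map induced by `f` on descendants. -/
def mapDesc (f : ℕ → ℕ) (x : ℕ) : ℕ := Nat.pair (f x.unpair.1) x.unpair.2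

include h

theorem MIso.kindAt {x : ℕ} (hx : x.unpair.1 ∈ M.graph.vertexSet) :
    kindAt N (mapDesc f x) = kindAt M x := by
  rw [UnimodularGraph.kindAt, mapDesc, Nat.unpair_pair, h.vmark _ hx]
  rfl

theorem MIso.markAt {x : ℕ} (hx : x.unpair.1 ∈ M.graph.vertexSet) :
    markAt N (mapDesc f x) = markAt M x := by
  rw [UnimodularGraph.markAt, mapDesc, Nat.unpair_pair, h.vmark _ hx]
  rfl

theorem MIso.isEnd_iff {v s x : ℕ} (hv : v ∈ M.graph.vertexSet)
    (hx : x.unpair.1 ∈ M.graph.vertexSet) : IsEnd K N (f v) s (mapDesc f x) ↔ IsEnd K M v s x := by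
  have h1 := h.isAddr_iff (lab := Prod.fst) (o := .inl v) (o' := .inl x.unpair.1) hv hx s.unpair.1
  rw [IsEnd, IsEnd, h.kindAt hx, mapDesc, Nat.unpair_pair, ← h1]
  rfl

theorem MIso.blowupLink_iff {e x y : ℕ} (he : e.unpair.1 ∈ M.graph.vertexSet)
    (hx : x.unpair.1 ∈ M.graph.vertexSet) (hy : y.unpair.1 ∈ M.graph.vertexSet) :
    BlowupLink K N (mapDesc f e) (mapDesc f x) (mapDesc f y) ↔ BlowupLink K M e x y := by
  have h1 : (mapDesc f e).unpair = (f e.unpair.1, e.unpair.2) := Nat.unpair_pair _ _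
  rw [BlowupLink, BlowupLink, h.kindAt he, h1]
  simp only [h.isEnd_iff he hx, h.isEnd_iff he hy]
  exact and_congr_left fun _ => ⟨fun _ => he, fun _ => h.vert.mapsTo he⟩

theorem MIso.exists_mapDesc {x : ℕ} (hx : x.unpair.1 ∈ N.graph.vertexSet) :
    ∃ y, y.unpair.1 ∈ M.graph.vertexSet ∧ mapDesc f y = x := by
  obtain ⟨v, hv, hvx⟩ := h.vert.surjOn hx
  refine ⟨Nat.pair v x.unpair.2, by rwa [Nat.unpair_pair], ?_⟩
  rw [mapDesc, Nat.unpair_pair, hvx, Nat.pair_unpair]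

theorem MIso.injOn_mapDesc : InjOn (mapDesc f) {x | x.unpair.1 ∈ M.graph.vertexSet} := by
  intro x hx y hy hxy
  have := congrArg Nat.unpair hxy
  rw [mapDesc, mapDesc, Nat.unpair_pair, Nat.unpair_pair, Prod.mk.injEq] at this
  exact unpair_ext (h.vert.injOn hx hy this.1) this.2

theorem MIso.blowupPre : PreIso (blowupPre K M) (blowupPre K N) (mapDesc f) (mapDesc f) := by
  have hV : ∀ x, x.unpair.1 ∈ M.graph.vertexSet →
      (mapDesc f x ∈ (blowup K N).vertexSet ↔ x ∈ (blowup K M).vertexSet) := fun x hx => by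
    have h1 : (mapDesc f x).unpair = (f x.unpair.1, x.unpair.2) := Nat.unpair_pair _ _
    simp only [blowup, mem_ofPred_eq, h.kindAt hx, h1]
    exact and_congr_left fun _ => ⟨fun _ => hx, fun _ => h.vert.mapsTo hx⟩
  have hE : ∀ e, e ∈ (blowup K M).edgeSet → e.unpair.1 ∈ M.graph.vertexSet := by
    rintro e ⟨x, y, hl⟩
    exact hl.1
  refine ⟨⟨⟨fun x hx => (hV x hx.1).2 hx, h.injOn_mapDesc.mono fun x hx => hx.1, fun x hx => ?_⟩,
    ⟨?_, h.injOn_mapDesc.mono hE, ?_⟩, fun {e x y} hl => ?_⟩, fun x hx => h.markAt hx.1,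
    fun e he => h.markAt (hE e he)⟩
  · obtain ⟨y, hy, rfl⟩ := h.exists_mapDesc hx.1
    exact ⟨y, (hV y hy).1 hx, rfl⟩
  · rintro e ⟨x, y, hl⟩
    exact ⟨mapDesc f x, mapDesc f y, (h.blowupLink_iff hl.1
      ((blowup K M).left_mem_of_isLink hl).1 ((blowup K M).left_mem_of_isLink hl.symm).1).2 hl⟩
  · rintro e ⟨x, y, hl⟩
    obtain ⟨e, he, rfl⟩ := h.exists_mapDesc hl.1
    obtain ⟨x, hx, rfl⟩ := h.exists_mapDesc ((blowup K N).left_mem_of_isLink hl).1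
    obtain ⟨y, hy, rfl⟩ := h.exists_mapDesc ((blowup K N).left_mem_of_isLink hl.symm).1
    exact ⟨e, ⟨x, y, (h.blowupLink_iff he hx hy).1 hl⟩, rfl⟩
  · exact (h.blowupLink_iff hl.1 ((blowup K M).left_mem_of_isLink hl).1
      ((blowup K M).left_mem_of_isLink (BlowupLink.symm hl)).1).2 hl

end

/-! Measurability. -/

section

variable [MeasurableSpace X]

theorem measurable_kindAt (x : ℕ) : Measurable fun N : MarkedGraph (Recipe X) => kindAt N x :=
  (measurable_pi_apply _).comp (measurable_fst.comp (measurable_snd.comp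
    (measurable_vmark measurable_id measurable_const)))

theorem measurable_markAt (x : ℕ) : Measurable fun N : MarkedGraph (Recipe X) => markAt N x :=
  (measurable_pi_apply _).comp (measurable_snd.comp (measurable_snd.comp
    (measurable_vmark measurable_id measurable_const)))

theorem measurable_kindAt_prop (x : ℕ) (p : ℕ → Prop) :
    Measurable fun N : MarkedGraph (Recipe X) => p (kindAt N x) :=
  (measurable_from_top (f := p)).comp (measurable_kindAt x)

theorem measurable_isEnd (K v s x : ℕ) :
    Measurable fun N : MarkedGraph (Recipe X) => IsEnd K N v s x :=
  measurable_const.and (measurable_const.and (measurable_const.and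
    ((measurable_isAddr measurable_id measurable_fst _ _ _).and
      (measurable_kindAt_prop x fun k => k = 1))))

theorem measurable_blowupLink (K e x y : ℕ) :
    Measurable fun N : MarkedGraph (Recipe X) => BlowupLink K N e x y := by
  have h : ∀ (t : ℕ → ℕ) x, Measurable fun N : MarkedGraph (Recipe X) =>
      IsEnd K N e.unpair.1 (t (kindAt N e)) x := fun t x =>
    measurable_apply_countable (F := fun (N : MarkedGraph (Recipe X)) k => IsEnd K N e.unpair.1 (t k) x)
      (fun k => measurable_isEnd K _ _ _) (measurable_kindAt e)
  have h1 := h fun k => (k - 2).unpair.1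
  have h2 := h fun k => (k - 2).unpair.2
  exact (measurable_mem_vertexSet measurable_id measurable_const).and (measurable_const.and
    ((measurable_kindAt_prop e fun k => 2 ≤ k).and
      (((h1 x).and (h2 y)).or ((h1 y).and (h2 x)))))

end

/-! Locality. -/

section

variable [TopologicalSpace X]

theorem eventually_near_oadj [TopologicalSpace Y] {N : RootedGraph Y} :
    ∀ {o : ℕ ⊕ ℕ}, o ∈ objs N.graph →
      ∀ᶠ N' in near N, ∀ o', OAdj N'.graph o o' ↔ OAdj N.graph o o'
  | .inl v, hv => by
    filter_upwards [eventually_near_isLink (v := v) hv] with N' h o'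
    rcases o' with w | e
    · exact Iff.rfl
    · exact exists_congr fun y => h e y
  | .inr e, he => by
    obtain ⟨x, y, hl⟩ := N.graph.exists_isLink_of_mem_edgeSet he
    filter_upwards [eventually_near_isLink hl.left_mem] with N' h o'
    rcases o' with w | e'
    · have hl' := (h e y).2 hl
      constructor
      · rintro ⟨z, hz⟩
        rcases hz.symm.right_eq_or_eq hl' with rfl | rfl
        · exact ⟨y, hl⟩
        · exact ⟨x, hl.symm⟩
      · rintro ⟨z, hz⟩
        rcases hz.symm.right_eq_or_eq hl with rfl | rfl
        · exact ⟨y, hl'⟩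
        · exact ⟨x, hl'.symm⟩
    · exact Iff.rfl

theorem eventually_near_oball [TopologicalSpace Y] {N : RootedGraph Y} {o : ℕ ⊕ ℕ}
    (ho : o ∈ objs N.graph) (r : ℕ) :
    ∀ᶠ N' in near N, oball N'.graph o r = oball N.graph o r := by
  induction r with
  | zero => exact Eventually.of_forall fun _ => rfl
  | succ r ih =>
    have h := (eventually_all_finite (finite_oball N.toMarkedGraph o r)).2 fun x hx =>
      eventually_near_oadj (oball_subset ho r hx)
    filter_upwards [ih, h] with N' h1 h2
    ext y
    rw [mem_oball_succ, mem_oball_succ, h1]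
    exact or_congr_right (exists_congr fun x => and_congr_right fun hx => h2 x hx y)

theorem eventually_near_objLabel [TopologicalSpace Y] {N : RootedGraph Y} {lab : Y → Label}
    (hlab : Continuous lab) {S : Set Label} (hS : IsClopen S) {o : ℕ ⊕ ℕ} (ho : o ∈ objs N.graph) :
    ∀ᶠ N' in near N, (objLabel lab N'.toMarkedGraph o ∈ S ↔ objLabel lab N.toMarkedGraph o ∈ S) := by
  have key : ∀ y : Y, ∀ᶠ y' in 𝓝 y, (lab y' ∈ S ↔ lab y ∈ S) := fun y => by
    by_cases hy : lab y ∈ S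
    · filter_upwards [hlab.continuousAt.preimage_mem_nhds (hS.isOpen.mem_nhds hy)] with y' hy'
      exact ⟨fun _ => hy, fun _ => hy'⟩
    · filter_upwards [hlab.continuousAt.preimage_mem_nhds (hS.compl.isOpen.mem_nhds hy)] with y' hy'
      exact ⟨fun h => absurd h hy', fun h => absurd h hy⟩
  rcases o with v | e
  · exact eventually_near_vmark ho (key _)
  · exact eventually_near_emark ho (key _)

/-- An address involves the finitely many objects of a ball and a clopen condition on their labels,
so what it designates is locally constant. -/
theorem eventually_near_isAddr [TopologicalSpace Y] {N : RootedGraph Y} {lab : Y → Label}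
    (hlab : Continuous lab) {o : ℕ ⊕ ℕ} (ho : o ∈ objs N.graph) (α : ℕ) :
    ∀ᶠ N' in near N, ∀ o', IsAddr lab N'.toMarkedGraph o α o' ↔ IsAddr lab N.toMarkedGraph o α o' := by
  have h := (eventually_all_finite (finite_oball N.toMarkedGraph o α.unpair.1)).2 fun x hx =>
    eventually_near_objLabel hlab (isClopen_prefixSet α.unpair.2) (oball_subset ho _ hx)
  filter_upwards [eventually_near_oball ho α.unpair.1, h] with N' h1 h2 o'
  rw [IsAddr, IsAddr, h1]
  refine and_congr_right fun ho' => ?_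
  rw [h2 o' ho']
  refine and_congr_right fun _ => forall₂_congr fun x hx => ?_
  rw [h2 x hx]

/-- A kind is a natural number that depends continuously on a mark, hence it is locally constant. -/
theorem eventually_near_kindAt {N : RootedGraph (Recipe X)} {x : ℕ}
    (hx : x.unpair.1 ∈ N.graph.vertexSet) :
    ∀ᶠ N' in near N, kindAt N'.toMarkedGraph x = kindAt N.toMarkedGraph x := by
  have hc : Continuous fun y : Recipe X => y.2.1 x.unpair.2 :=
    (continuous_apply _).comp (continuous_fst.comp continuous_snd)
  exact eventually_near_vmark hx (hc.continuousAt.preimage_mem_nhds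
    ((isOpen_discrete {kindAt N.toMarkedGraph x}).mem_nhds rfl))

theorem tendsto_markAt {N : RootedGraph (Recipe X)} {x : ℕ} (hx : x.unpair.1 ∈ N.graph.vertexSet) :
    Tendsto (fun N' : RootedGraph (Recipe X) => markAt N'.toMarkedGraph x) (near N)
      (𝓝 (markAt N.toMarkedGraph x)) := by
  have hc : Continuous fun y : Recipe X => y.2.2 x.unpair.2 :=
    (continuous_apply _).comp (continuous_snd.comp continuous_snd)
  exact (hc.tendsto _).comp fun U hU => eventually_near_vmark hx hU

/-- Only addresses less than `K` matter, and possible ends have owners in a finite ball and indices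
less than `K`; so finitely many conditions have to stabilise for all `s` and `x` at once. -/
theorem eventually_near_isEnd {N : RootedGraph (Recipe X)} {v : ℕ} (hv : v ∈ N.graph.vertexSet)
    (K : ℕ) : ∀ᶠ N' in near N, ∀ s x, IsEnd K N'.toMarkedGraph v s x ↔
      IsEnd K N.toMarkedGraph v s x := by
  have hvo : Sum.inl v ∈ objs N.graph := hv
  have h1 := (eventually_all_finite (finite_Iio K)).2 fun α _ =>
    eventually_near_isAddr (lab := Prod.fst) continuous_fst hvo α
  have h2 := (eventually_all_finite (((finite_oball N.toMarkedGraph (.inl v) K).preimage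
    Sum.inl_injective.injOn).image2 Nat.pair (finite_Iio K))).2 fun x hx =>
      eventually_near_kindAt (N := N) (x := x) <| by
        obtain ⟨w, hw, a, -, rfl⟩ := hx
        rw [Nat.unpair_pair]
        exact oball_subset hvo K hw
  filter_upwards [h1, h2] with N' h1 h2 s x
  refine and_congr_right fun hs => and_congr_right fun hx => and_congr_right fun _ => ?_
  rw [h1 _ hs]
  refine and_congr_right fun ha => ?_
  rw [h2 x ⟨x.unpair.1, oball_mono _ _ ((Nat.unpair_left_le _).trans hs.le) ha.1, x.unpair.2, hx,
    Nat.pair_unpair x⟩]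

/-- A link at `x` has its owner within distance `K` of the owner of `x`, so finitely many candidates
for `e` have to be watched. -/
theorem eventually_near_blowupLink {N : RootedGraph (Recipe X)} {x : ℕ}
    (hx : x.unpair.1 ∈ N.graph.vertexSet) (K : ℕ) :
    ∀ᶠ N' in near N, ∀ e y, BlowupLink K N'.toMarkedGraph e x y ↔
      BlowupLink K N.toMarkedGraph e x y := by
  have hxo : Sum.inl x.unpair.1 ∈ objs N.graph := hx
  have hS : ∀ v, Sum.inl v ∈ oball N.graph (.inl x.unpair.1) K → v ∈ N.graph.vertexSet :=
    fun v hv => oball_subset hxo K hv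
  have hfin := (finite_oball N.toMarkedGraph (.inl x.unpair.1) K).preimage
    (Sum.inl_injective (α := ℕ) (β := ℕ)).injOn
  have h1 := (eventually_all_finite hfin).2 fun v hv => eventually_near_isEnd (hS v hv) K
  have h2 := (eventually_all_finite (hfin.image2 Nat.pair (finite_Iio K))).2 fun e he =>
      eventually_near_kindAt (N := N) (x := e) <| by
        obtain ⟨w, hw, a, -, rfl⟩ := he
        rw [Nat.unpair_pair]
        exact hS w hw
  have h3 := (eventually_all_finite hfin).2 fun v hv => eventually_near_mem (hS v hv)
  filter_upwards [h1, h2, h3, eventually_near_oball hxo K] with N' h1 h2 h3 h4 e y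
  by_cases he : Sum.inl e.unpair.1 ∈ oball N.graph (.inl x.unpair.1) K
  · rw [BlowupLink, BlowupLink]
    refine and_congr ⟨fun _ => hS _ he, fun _ => h3 _ he⟩ (and_congr_right fun hK => ?_)
    rw [h2 e ⟨e.unpair.1, he, e.unpair.2, hK, Nat.pair_unpair e⟩]
    simp only [h1 _ he]
  -- An owner outside the ball gives no link at `x` in either graph.
  · constructor <;> intro h <;> obtain ⟨s, hs⟩ := h.exists_isEnd
    · exact absurd (h4 ▸ mem_oball_symm hs.mem_oball) he
    · exact absurd (mem_oball_symm hs.mem_oball) he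

theorem tendsto_blowupPre_comp {N : RootedGraph (Recipe X)} {K x : ℕ}
    (hx : x ∈ (blowup K N.toMarkedGraph).vertexSet) :
    Tendsto (fun N' : RootedGraph (Recipe X) => (blowupPre K N'.toMarkedGraph).comp x) (near N)
      (near ((blowupPre K N.toMarkedGraph).comp x)) := by
  have hr := reach_subset hx
  refine PreGraph.tendsto_comp (fun y hy => eventually_near_blowupLink (hr hy).1 K)
    (fun y hy => tendsto_markAt (hr hy).1) ?_
  rintro e ⟨y, z, hl, -⟩
  exact tendsto_markAt hl.1

/-- The graph of the descendants with index less than `K`, as a local transformation. -/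
def blowupT [MeasurableSpace X] [BorelSpace X] (K : ℕ) : Transform (Recipe X) X where
  gr := blowupPre K
  K := K
  nm v i := Nat.pair v i
  pres N v i := kindAt N (Nat.pair v i) = 1
  nm_inj h := by
    obtain ⟨h1, h2⟩ := Nat.pair_eq_pair.1 h
    exact ⟨h1, Fin.ext h2⟩
  vert N x := by
    constructor
    · rintro ⟨h1, h2, h3⟩
      exact ⟨x.unpair.1, ⟨x.unpair.2, h2⟩, h1, (congrArg (kindAt N) (Nat.pair_unpair x)).trans h3,
        Nat.pair_unpair x⟩
    · rintro ⟨v, i, h1, h2, rfl⟩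
      exact ⟨by rwa [Nat.unpair_pair], by rw [Nat.unpair_pair]; exact i.2, h2⟩
  pres_iff {M N f g} h v hv i := by
    have := h.kindAt (x := Nat.pair v i) (by rwa [Nat.unpair_pair])
    rw [mapDesc, Nat.unpair_pair] at this
    rw [this]
  equiv {M N f g} h := ⟨mapDesc f, mapDesc f, h.blowupPre, fun v _ i => by
    rw [mapDesc, Nat.unpair_pair]⟩
  measurable_isLink e x y := measurable_blowupLink K e x y
  measurable_vmark := measurable_markAt
  measurable_emark := measurable_markAt
  measurable_pres v i := measurable_kindAt_prop (Nat.pair v i) fun k => k = 1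
  local_pres N i := by
    filter_upwards [eventually_near_root N, eventually_near_kindAt (N := N)
      (x := Nat.pair N.root i) (by rw [Nat.unpair_pair]; exact N.root_mem)] with N' h1 h2
    rw [h1, h2]
  local_gr N i hp := (tendsto_blowupPre_comp (N := N) (K := K) (x := Nat.pair N.root i)
    ⟨by rw [Nat.unpair_pair]; exact N.root_mem, by rw [Nat.unpair_pair]; exact i.2, hp⟩).congr' <| by
      filter_upwards [eventually_near_root N] with N' h
      rw [h]

end

end

section

variable {A B X Y Z : Type}

/-! ### Assigning all vertices and edges to open vertices -/

/-- The least address of an open vertex as seen from `o`. -/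
def ownerAddr (op : A → Bool) (lab : A → Label) (N : MarkedGraph A) (o : ℕ ⊕ ℕ) : ℕ :=
  sInf {α | ∃ v ∈ (openGraph op N).vertexSet, IsAddr lab N o α (.inl v)}

/-- `v` is the open vertex with least address as seen from `o`, and `a` is the least address of `o`
as seen from `v`. -/
def Named (op : A → Bool) (lab : A → Label) (N : MarkedGraph A) (v a : ℕ) (o : ℕ ⊕ ℕ) : Prop :=
  v ∈ (openGraph op N).vertexSet ∧ IsAddr lab N o (ownerAddr op lab N o) (.inl v) ∧
    IsAddr lab N (.inl v) a o ∧ addrOf lab N (.inl v) o = a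

section

variable {op : A → Bool} {lab : A → Label} {M N : MarkedGraph A} {f g : ℕ → ℕ}

theorem Named.mem {v a : ℕ} {o : ℕ ⊕ ℕ} (h : Named op lab N v a o) : o ∈ objs N.graph :=
  h.2.2.1.mem (show Sum.inl v ∈ objs N.graph from h.1.1)

theorem Named.unique {v a : ℕ} {o o' : ℕ ⊕ ℕ} (h : Named op lab N v a o)
    (h' : Named op lab N v a o') : o = o' := h.2.2.1.unique h'.2.2.1

theorem Named.owner_unique {v w a b : ℕ} {o : ℕ ⊕ ℕ} (h : Named op lab N v a o)
    (h' : Named op lab N w b o) : v = w := Sum.inl_injective (h.2.1.unique h'.2.1)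

theorem Named.name_unique {v w a b : ℕ} {o : ℕ ⊕ ℕ} (h : Named op lab N v a o)
    (h' : Named op lab N w b o) : a = b := by
  rw [← h.2.2.2, ← h'.2.2.2, h.owner_unique h']

/-- Some vertex is open and has an address as seen from `o`. The least address that designates an
open vertex gives the owner, and distinct labels give `o` an address as seen from it. -/
theorem exists_named (hc : OpenConnected op N) (hd : DistinctLabels lab N) {o : ℕ ⊕ ℕ}
    (ho : o ∈ objs N.graph) : ∃ v a, Named op lab N v a o := by
  have hne : {α | ∃ v ∈ (openGraph op N).vertexSet, IsAddr lab N o α (.inl v)}.Nonempty := by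
    obtain ⟨w, hw⟩ := hc.1
    obtain ⟨α, hα⟩ := hd.exists_isAddr ho (o' := .inl w) hw.1
    exact ⟨α, w, hw, hα⟩
  obtain ⟨v, hv, h⟩ := Nat.sInf_mem hne
  exact ⟨v, _, hv, h, hd.isAddr_addrOf hv.1 ho, rfl⟩

theorem MIso.mem_openGraph_iff (h : MIso M N f g) {v : ℕ} (hv : v ∈ M.graph.vertexSet) :
    f v ∈ (openGraph op N).vertexSet ↔ v ∈ (openGraph op M).vertexSet := by
  rw [mem_openGraph, mem_openGraph, h.vmark v hv]
  exact and_congr_left fun _ => ⟨fun _ => hv, fun _ => h.vert.mapsTo hv⟩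

theorem MIso.ownerAddr_eq (h : MIso M N f g) {o : ℕ ⊕ ℕ} (ho : o ∈ objs M.graph) :
    ownerAddr op lab N (Sum.map f g o) = ownerAddr op lab M o := by
  refine congrArg sInf (Set.ext fun α => ⟨?_, ?_⟩)
  · rintro ⟨v, hv, ha⟩
    obtain ⟨w, hw, rfl⟩ := h.vert.surjOn hv.1
    exact ⟨w, (h.mem_openGraph_iff hw).1 hv, (h.isAddr_iff (o' := .inl w) ho hw α).1 ha⟩
  · rintro ⟨w, hw, ha⟩
    exact ⟨f w, (h.mem_openGraph_iff hw.1).2 hw, (h.isAddr_iff (o' := .inl w) ho hw.1 α).2 ha⟩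

theorem MIso.named_iff (h : MIso M N f g) {v a : ℕ} (hv : v ∈ M.graph.vertexSet) {o : ℕ ⊕ ℕ}
    (ho : o ∈ objs M.graph) : Named op lab N (f v) a (Sum.map f g o) ↔ Named op lab M v a o := by
  have hvo : Sum.inl v ∈ objs M.graph := hv
  rw [Named, Named, h.mem_openGraph_iff hv, h.ownerAddr_eq ho]
  exact and_congr_right' (and_congr (h.isAddr_iff ho hvo _)
    (and_congr (h.isAddr_iff hvo ho _) (by rw [← h.addrOf_eq hvo ho]; rfl)))

/-- `c` codes the owners and the names of the ends of the edge `e`, where the owners are given by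
their addresses in the open subgraph as seen from `v`. -/
def EdgeCode (op : A → Bool) (lab : A → Label) (N : MarkedGraph A) (v e c : ℕ) : Prop :=
  ∃ x y u w, N.graph.IsLink e x y ∧ Named op lab N u c.unpair.1.unpair.2 (.inl x) ∧
    Named op lab N w c.unpair.2.unpair.2 (.inl y) ∧
    IsAddr id ((openPre op lab N).comp v).toMarkedGraph (.inl v) c.unpair.1.unpair.1 (.inl u) ∧
    IsAddr id ((openPre op lab N).comp v).toMarkedGraph (.inl v) c.unpair.2.unpair.1 (.inl w)

theorem EdgeCode.map (h : MIso M N f g) {v e c : ℕ} (hv : v ∈ (openGraph op M).vertexSet)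
    (hc : EdgeCode op lab M v e c) : EdgeCode op lab N (f v) (g e) c := by
  obtain ⟨x, y, u, w, hl, hu, hw, h1, h2⟩ := hc
  have hi := (preIso_openPre (op := op) (d := lab) h).comp (x := v) hv
  have hvm : Sum.inl v ∈ objs ((openPre op lab M).comp v).graph :=
    ((openPre op lab M).comp v).root_mem
  exact ⟨f x, f y, f u, f w, h.link hl, (h.named_iff hu.1.1 hu.mem).2 hu,
    (h.named_iff hw.1.1 hw.mem).2 hw, (hi.isAddr_iff hvm (h1.mem hvm) _).2 h1,
    (hi.isAddr_iff hvm (h2.mem hvm) _).2 h2⟩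

theorem DistinctLabels.comp_openPre (hd : DistinctLabels lab N) {v : ℕ}
    (hv : v ∈ (openGraph op N).vertexSet) :
    DistinctLabels id ((openPre op lab N).comp v).toMarkedGraph := by
  have hsub : objs ((openPre op lab N).comp v).graph ⊆ objs N.graph := by
    rintro (w | e) ho
    · exact (reach_subset hv ho).1
    · obtain ⟨x, y, hl, -⟩ := ho
      exact (openGraph_isLink.1 hl).1.edge_mem
  intro o ho o' ho' h
  exact hd (hsub ho) (hsub ho') h

/-- The owners of both ends lie in the open cluster of `v`, where they have addresses. Here it is
essential that the open vertices form a single cluster: owners of the ends of a closed edge must be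
found without leaving the open subgraph. -/
theorem exists_edgeCode (hc : OpenConnected op N) (hd : DistinctLabels lab N) {v e : ℕ}
    (hv : v ∈ (openGraph op N).vertexSet) (he : e ∈ N.graph.edgeSet) :
    ∃ c, EdgeCode op lab N v e c := by
  obtain ⟨x, y, hl⟩ := N.graph.exists_isLink_of_mem_edgeSet he
  obtain ⟨u, a, hu⟩ := exists_named hc hd (o := .inl x) hl.left_mem
  obtain ⟨w, b, hw⟩ := exists_named hc hd (o := .inl y) hl.right_mem
  have hvm : Sum.inl v ∈ objs ((openPre op lab N).comp v).graph :=
    ((openPre op lab N).comp v).root_mem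
  obtain ⟨α, hα⟩ := (hd.comp_openPre hv).exists_isAddr hvm
    (o' := .inl u) (hc.2 v hv u hu.1)
  obtain ⟨β, hβ⟩ := (hd.comp_openPre hv).exists_isAddr hvm
    (o' := .inl w) (hc.2 v hv w hw.1)
  exact ⟨Nat.pair (Nat.pair α a) (Nat.pair β b), x, y, u, w, hl, by simpa using hu,
    by simpa using hw, by simpa using hα, by simpa using hβ⟩

/-- The possible kinds of the object with name `a` at `v`. -/
def kindSet (op : A → Bool) (lab : A → Label) (N : MarkedGraph A) (v a : ℕ) : Set ℕ :=
  {k | (k = 1 ∧ ∃ x, Named op lab N v a (.inl x)) ∨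
    ∃ e, Named op lab N v a (.inr e) ∧ ∃ c, k = c + 2 ∧ EdgeCode op lab N v e c}

theorem kindSet_map (h : MIso M N f g) {v a k : ℕ} (hk : k ∈ kindSet op lab M v a) :
    k ∈ kindSet op lab N (f v) a := by
  rcases hk with ⟨rfl, x, hx⟩ | ⟨e, he, c, rfl, hc⟩
  · exact Or.inl ⟨rfl, f x, (h.named_iff hx.1.1 hx.mem).2 hx⟩
  · exact Or.inr ⟨g e, (h.named_iff he.1.1 he.mem).2 he, c, rfl, hc.map h he.1⟩

/-- One inclusion suffices, applied to the isomorphism and to its inverse. -/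
theorem MIso.kindSet_eq (h : MIso M N f g) {v a : ℕ} (hv : v ∈ M.graph.vertexSet) :
    kindSet op lab N (f v) a = kindSet op lab M v a := by
  refine Subset.antisymm (fun k hk => ?_) fun k hk => kindSet_map h hk
  have := kindSet_map h.symm hk
  rwa [h.vert.invOn_invFunOn.1 hv] at this

/-- The infimum is `0` when nothing has the name, as the set is then empty. Vertices contribute `1`
and edges at least `2`, so the value `1` betrays a vertex. -/
theorem sInf_kindSet_eq_one {v a : ℕ} :
    sInf (kindSet op lab N v a) = 1 ↔ ∃ x, Named op lab N v a (.inl x) := by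
  constructor
  · intro h
    have hne : (kindSet op lab N v a).Nonempty := Nat.nonempty_of_pos_sInf (by omega)
    rcases Nat.sInf_mem hne with ⟨-, hx⟩ | ⟨e, -, c, hk, -⟩
    · exact hx
    · omega
  · intro h
    have h1 : 1 ∈ kindSet op lab N v a := Or.inl ⟨rfl, h⟩
    have h2 := Nat.sInf_le h1
    rcases Nat.sInf_mem ⟨1, h1⟩ with ⟨hk, -⟩ | ⟨e, -, c, hk, -⟩
    · exact hk
    · omega

theorem exists_of_two_le_sInf_kindSet {v a : ℕ} (h : 2 ≤ sInf (kindSet op lab N v a)) :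
    ∃ e, Named op lab N v a (.inr e) ∧
      EdgeCode op lab N v e (sInf (kindSet op lab N v a) - 2) := by
  have hne : (kindSet op lab N v a).Nonempty := Nat.nonempty_of_pos_sInf (by omega)
  rcases Nat.sInf_mem hne with ⟨hk, -⟩ | ⟨e, he, c, hk, hc⟩
  · omega
  · refine ⟨e, he, ?_⟩
    rwa [hk, Nat.add_sub_cancel]

theorem Named.two_le_sInf_kindSet {v a e c : ℕ} (he : Named op lab N v a (.inr e))
    (hc : EdgeCode op lab N v e c) : 2 ≤ sInf (kindSet op lab N v a) := by
  rcases Nat.sInf_mem (s := kindSet op lab N v a) ⟨_, Or.inr ⟨e, he, c, rfl, hc⟩⟩ with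
    ⟨-, x, hx⟩ | ⟨e, -, c, hk, -⟩
  · cases hx.unique he
  · omega

/-- The mark of an object. -/
def objMark (xm : A → X) (N : MarkedGraph A) : ℕ ⊕ ℕ → X :=
  Sum.elim (fun v => xm (N.vmark v)) fun e => xm (N.emark e)

open scoped Classical in
/-- The mark of the object with name `a` at `v`. -/
def namedMark (op : A → Bool) (lab : A → Label) (xm : A → X) (b : X) (N : MarkedGraph A)
    (v a : ℕ) : X :=
  if h : ∃ o, Named op lab N v a o then objMark xm N h.choose else b

variable {xm : A → X} {b : X}

theorem Named.namedMark_eq {v a : ℕ} {o : ℕ ⊕ ℕ} (h : Named op lab N v a o) :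
    namedMark op lab xm b N v a = objMark xm N o := by
  have hex : ∃ o, Named op lab N v a o := ⟨o, h⟩
  rw [namedMark, dif_pos hex, hex.choose_spec.unique h]

theorem MIso.namedMark_eq (h : MIso M N f g) {v a : ℕ} (hv : v ∈ M.graph.vertexSet) :
    namedMark op lab xm b N (f v) a = namedMark op lab xm b M v a := by
  by_cases hex : ∃ o, Named op lab M v a o
  · obtain ⟨o, ho⟩ := hex
    rw [ho.namedMark_eq, ((h.named_iff hv ho.mem).2 ho).namedMark_eq]
    have hm := ho.mem
    rcases o with w | e
    · exact congrArg xm (h.vmark w hm)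
    · exact congrArg xm (h.emark e hm)
  · have hex' : ¬ ∃ o, Named op lab N (f v) a o := by
      rintro ⟨o, ho⟩
      obtain ⟨o, hm, rfl⟩ := h.surjOn_objs ho.mem
      exact hex ⟨o, (h.named_iff hv hm).1 ho⟩
    rw [namedMark, namedMark, dif_neg hex, dif_neg hex']

/-- The recipes by which the graph can be recovered from its open subgraph. -/
def encode (op : A → Bool) (lab : A → Label) (xm : A → X) (b : X) (N : MarkedGraph A) :
    Marks (Recipe X) :=
  Sum.elim (fun v => (lab (N.vmark v), fun a => sInf (kindSet op lab N v a),
    fun a => namedMark op lab xm b N v a)) fun e => (lab (N.emark e), fun _ => 0, fun _ => b)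

theorem MIso.encode_eq (h : MIso M N f g) : ∀ o ∈ objs M.graph,
    encode op lab xm b N (Sum.map f g o) = encode op lab xm b M o := by
  rintro (v | e) ho
  · refine Prod.ext (congrArg lab (h.vmark v ho)) (Prod.ext (funext fun a => ?_)
      (funext fun a => h.namedMark_eq ho))
    exact congrArg sInf (h.kindSet_eq ho)
  · exact Prod.ext (congrArg lab (h.emark e ho)) rfl

/-- The open subgraph marked by the recipes. -/
def encodePre (op : A → Bool) (lab : A → Label) (xm : A → X) (b : X) (N : MarkedGraph A) :
    PreGraph (Recipe X) :=
  openPre (op ∘ Prod.fst) Prod.snd (N.addMarks (encode op lab xm b N))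

theorem MIso.encodePre (h : MIso M N f g) :
    PreIso (encodePre op lab xm b M) (encodePre op lab xm b N) f g :=
  preIso_openPre (h.addMarks h.encode_eq)

/-- The recipe keeps the label as its first component, so addresses in the encoded cluster are those
used when the ends were coded. -/
theorem isAddr_encodePre {v : ℕ} {o o' : ℕ ⊕ ℕ} {α : ℕ} :
    IsAddr Prod.fst ((encodePre op lab xm b N).comp v).toMarkedGraph o α o' ↔
      IsAddr id ((openPre op lab N).comp v).toMarkedGraph o α o' := by
  have : objLabel Prod.fst ((encodePre op lab xm b N).comp v).toMarkedGraph =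
      objLabel id ((openPre op lab N).comp v).toMarkedGraph := by
    funext o
    rcases o with w | e <;> rfl
  rw [IsAddr, IsAddr, this]
  rfl

end

section Measurable

variable [TopologicalSpace A] [PolishSpace A] [MeasurableSpace A] [BorelSpace A]
  [TopologicalSpace X] [PolishSpace X] [MeasurableSpace X] [BorelSpace X]
  {op : A → Bool} (hop : Continuous op) {lab : A → Label} (hlab : Continuous lab)

include hop hlab

theorem measurable_mem_openGraph (v : ℕ) :
    Measurable fun N : MarkedGraph A => v ∈ (openGraph op N).vertexSet :=
  (measurable_mem_vertexSet measurable_id measurable_const).and (measurableSet_setOfPred.1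
    ((hop.measurable.comp (measurable_vmark measurable_id measurable_const))
      (measurableSet_singleton true)))

theorem measurable_named (v a : ℕ) (o : ℕ ⊕ ℕ) :
    Measurable fun N : MarkedGraph A => Named op lab N v a o := by
  have hA : ∀ o α o', Measurable fun N : MarkedGraph A => IsAddr lab N o α o' := fun o α o' =>
    measurable_isAddr measurable_id hlab.measurable o o' α
  refine (measurable_mem_openGraph hop hlab v).and (Measurable.and ?_ ((hA _ _ _).and ?_))
  · refine measurable_apply_countable (F := fun N α => IsAddr lab N o α (.inl v))
      (fun α => hA _ _ _) (measurable_sInf_nat fun α => Measurable.exists fun w =>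
        (measurable_mem_openGraph hop hlab w).and (hA _ _ _))
  · exact (measurable_from_top (f := fun k => k = a)).comp
      (measurable_addrOf measurable_id hlab.measurable (.inl v) o)

theorem measurable_edgeCode (v e c : ℕ) :
    Measurable fun N : MarkedGraph A => EdgeCode op lab N v e c := by
  have hC : Measurable fun N : MarkedGraph A => ((openPre op lab N).comp v).toMarkedGraph :=
    RootedGraph.measurable_toMarkedGraph.comp (measurable_comp
      (clusterT op hop lab hlab).measurable_isLink (clusterT op hop lab hlab).measurable_vmark
      (clusterT op hop lab hlab).measurable_emark measurable_const)
  exact Measurable.exists fun x => Measurable.exists fun y => Measurable.exists fun u =>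
    Measurable.exists fun w => (measurable_isLink measurable_id measurable_const measurable_const
      measurable_const).and ((measurable_named hop hlab _ _ _).and
      ((measurable_named hop hlab _ _ _).and ((measurable_isAddr hC measurable_id _ _ _).and
        (measurable_isAddr hC measurable_id _ _ _))))

theorem measurable_encode {xm : A → X} (hxm : Measurable xm) (b : X) :
    Measurable (encode op lab xm b) := by
  refine measurable_pi_lambda _ fun o => ?_
  rcases o with v | e
  · refine (hlab.measurable.comp (measurable_vmark measurable_id measurable_const)).prodMk
      ((measurable_pi_lambda _ fun a => measurable_sInf_nat fun k => ?_).prodMk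
      (measurable_pi_lambda _ fun a => ?_))
    · exact (measurable_const.and (Measurable.exists fun x => measurable_named hop hlab _ _ _)).or
        (Measurable.exists fun e => (measurable_named hop hlab _ _ _).and
          (Measurable.exists fun c => measurable_const.and (measurable_edgeCode hop hlab _ _ _)))
    · refine measurable_of_cases (S := fun o N => Named op lab N v a o) (measurable_named hop hlab v a)
        (g := fun o N => objMark xm N o) (fun o => ?_) (c := b) (fun o N h => h.namedMark_eq)
        fun N h => dif_neg (not_exists.2 h)
      rcases o with w | e
      · exact hxm.comp (measurable_vmark measurable_id measurable_const)
      · exact hxm.comp (measurable_emark measurable_id measurable_const)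
  · exact (hlab.measurable.comp (measurable_emark measurable_id measurable_const)).prodMk
      measurable_const

theorem measurable_encodePre_comp {xm : A → X} (hxm : Measurable xm) (b : X) (v : ℕ) :
    Measurable fun N : MarkedGraph A => (encodePre op lab xm b N).comp v := by
  have hN : Measurable fun N : MarkedGraph A => N.addMarks (encode op lab xm b N) := by
    rw [measurable_markedGraph_iff]
    have h := measurable_markedGraph_iff.1 (measurable_id (α := MarkedGraph A))
    have hm' := measurable_pi_iff.1 (measurable_encode hop hlab hxm b)
    exact ⟨h.1, h.2.1, fun v => (h.2.2.1 v).prodMk (hm' _), fun v => (h.2.2.2 v).prodMk (hm' _)⟩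
  let T := clusterT (op ∘ Prod.fst) (hop.comp continuous_fst)
    (Prod.snd : A × Recipe X → Recipe X) continuous_snd
  exact measurable_comp (fun e x y => (T.measurable_isLink e x y).comp hN)
    (fun x => (T.measurable_vmark x).comp hN) (fun x => (T.measurable_emark x).comp hN)
    measurable_const

end Measurable

end

section

variable {A B X Y Z : Type}

/-! ### Relabelled graphs -/

/-- The image of a graph under injective relabellings, with given marks. -/
def MarkedGraph.image (N : MarkedGraph A) {f g : ℕ → ℕ} (hf : InjOn f N.graph.vertexSet)
    (hg : InjOn g N.graph.edgeSet) (vm em : ℕ → X) : PreGraph X where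
  graph :=
    { vertexSet := f '' N.graph.vertexSet
      IsLink := fun e x y => ∃ e₀ x₀ y₀, N.graph.IsLink e₀ x₀ y₀ ∧ g e₀ = e ∧ f x₀ = x ∧ f y₀ = y
      isLink_symm := fun _ _ => ⟨fun _ _ ⟨e₀, x₀, y₀, h, he, hx, hy⟩ =>
        ⟨e₀, y₀, x₀, h.symm, he, hy, hx⟩⟩
      eq_or_eq_of_isLink_of_isLink := by
        rintro _ _ _ _ _ ⟨e, x, y, h, rfl, rfl, rfl⟩ ⟨e', x', y', h', he, rfl, rfl⟩
        obtain rfl := hg h'.edge_mem h.edge_mem he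
        exact (h.left_eq_or_eq h').imp (congrArg f) (congrArg f)
      left_mem_of_isLink := by
        rintro _ _ _ ⟨e, x, y, h, -, rfl, -⟩
        exact ⟨x, h.left_mem, rfl⟩ }
  vmark := vm
  emark := em
  locallyFinite := by
    rintro _ ⟨v, hv, rfl⟩
    refine ((N.locallyFinite v hv).image g).subset ?_
    rintro _ ⟨_, e, x, y, h, rfl, hx, rfl⟩
    obtain rfl := hf h.left_mem hv hx
    exact ⟨e, ⟨y, h⟩, rfl⟩

/-- Relabelling by injections gives an isomorphic graph, and by connectedness the component of the
root is everything. With `codeOf` this puts the original graph on the labels of its blow-up. -/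
theorem image_comp_cls (N : RootedGraph A) {f g : ℕ → ℕ} (hf : InjOn f N.graph.vertexSet)
    (hg : InjOn g N.graph.edgeSet) {vm em : ℕ → A}
    (hv : ∀ v ∈ N.graph.vertexSet, vm (f v) = N.vmark v)
    (he : ∀ e ∈ N.graph.edgeSet, em (g e) = N.emark e) :
    ((N.image hf hg vm em).comp (f N.root)).cls = N.cls := by
  let Γ : PreGraph A := ⟨N.graph, N.vmark, N.emark, N.locallyFinite⟩
  have hΓ : PreIso Γ (N.image hf hg vm em) f g := by
    refine ⟨⟨hf.bijOn_image, ⟨?_, hg, ?_⟩, fun hl => ⟨_, _, _, hl, rfl, rfl, rfl⟩⟩, hv, he⟩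
    · intro e he
      obtain ⟨x, y, hl⟩ := Γ.graph.exists_isLink_of_mem_edgeSet he
      exact ⟨f x, f y, e, x, y, hl, rfl, rfl, rfl⟩
    · rintro _ ⟨_, _, e, x, y, hl, rfl, -, -⟩
      exact ⟨e, hl.edge_mem, rfl⟩
  have hall : ∀ v ∈ N.graph.vertexSet, v ∈ reach N.graph N.root :=
    fun v hv => N.connected _ N.root_mem v hv
  have h1 : MIso N.toMarkedGraph (Γ.comp N.root).toMarkedGraph id id := by
    refine ⟨⟨⟨hall, injOn_id _, fun v hv => ⟨v, reach_subset N.root_mem hv, rfl⟩⟩,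
      ⟨fun e he => ?_, injOn_id _, ?_⟩, fun hl => ⟨hl, hall _ hl.left_mem, hall _ hl.right_mem⟩⟩,
      fun _ _ => rfl, fun _ _ => rfl⟩
    · obtain ⟨x, y, hl⟩ := N.graph.exists_isLink_of_mem_edgeSet he
      exact ⟨x, y, hl, hall _ hl.left_mem, hall _ hl.right_mem⟩
    · rintro e ⟨x, y, hl, -⟩
      exact ⟨e, hl.edge_mem, rfl⟩
  exact (RootedGraph.cls_eq_iff.2 ⟨_, _, (hΓ.comp (x := N.root) N.root_mem).comp h1, rfl⟩).symm

/-! ### Recovering a graph from its open subgraph -/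

open scoped Classical in
/-- The descendant that represents `o`. -/
def codeOf (op : A → Bool) (lab : A → Label) (N : MarkedGraph A) (o : ℕ ⊕ ℕ) : ℕ :=
  if h : ∃ x : ℕ × ℕ, Named op lab N x.1 x.2 o then Nat.pair h.choose.1 h.choose.2 else 0

section

variable {op : A → Bool} {lab : A → Label} {xm : A → X} {b : X} {N : MarkedGraph A}

theorem Named.codeOf_eq {v a : ℕ} {o : ℕ ⊕ ℕ} (h : Named op lab N v a o) :
    codeOf op lab N o = Nat.pair v a := by
  have hex : ∃ x : ℕ × ℕ, Named op lab N x.1 x.2 o := ⟨(v, a), h⟩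
  rw [codeOf, dif_pos hex, hex.choose_spec.owner_unique h, hex.choose_spec.name_unique h]

theorem Named.codeOf_unpair {x : ℕ} {o : ℕ ⊕ ℕ} (h : Named op lab N x.unpair.1 x.unpair.2 o) :
    codeOf op lab N o = x := h.codeOf_eq.trans (Nat.pair_unpair x)

/-- An object is recovered from its owner and its name, an address as seen from the owner. -/
theorem injOn_codeOf (hc : OpenConnected op N) (hd : DistinctLabels lab N) :
    InjOn (codeOf op lab N) (objs N.graph) := by
  intro o ho o' ho' heq
  obtain ⟨v, a, h⟩ := exists_named hc hd ho
  obtain ⟨w, c, h'⟩ := exists_named hc hd ho'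
  rw [h.codeOf_eq, h'.codeOf_eq, Nat.pair_eq_pair] at heq
  obtain ⟨rfl, rfl⟩ := heq
  exact h.unique h'

variable {r : ℕ}

/-- Ends in the blow-up and addresses in the open subgraph. -/
theorem isEnd_encodePre_iff {K v s x : ℕ} (hv : v ∈ reach (openGraph op N) r) :
    IsEnd K ((encodePre op lab xm b N).comp r).toMarkedGraph v s x ↔
      s.unpair.1 < K ∧ x.unpair.2 < K ∧ x.unpair.2 = s.unpair.2 ∧
      IsAddr id ((openPre op lab N).comp v).toMarkedGraph (.inl v) s.unpair.1 (.inl x.unpair.1) ∧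
      ∃ x₀, Named op lab N x.unpair.1 x.unpair.2 (.inl x₀) := by
  rw [IsEnd, isAddr_encodePre, PreGraph.comp_toMarkedGraph_eq (Γ := openPre op lab N) (x := r) (y := v) hv]
  exact and_congr_right' (and_congr_right' (and_congr_right' (and_congr_right' sInf_kindSet_eq_one)))

/-- There are no spurious edges, whatever `K`: the kind of `e` codes the ends of the edge that `e`
names, and an address designates a single owner, so the ends in the blow-up represent the true ends.
-/
theorem isLink_of_blowupLink {K e x y : ℕ}
    (h : BlowupLink K ((encodePre op lab xm b N).comp r).toMarkedGraph e x y) :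
    ∃ e₀ x₀ y₀, N.graph.IsLink e₀ x₀ y₀ ∧ codeOf op lab N (.inr e₀) = e ∧
      codeOf op lab N (.inl x₀) = x ∧ codeOf op lab N (.inl y₀) = y := by
  obtain ⟨h1, -, h3, h4⟩ := h
  have hv : e.unpair.1 ∈ reach (openGraph op N) r := h1
  obtain ⟨e₀, he, x₀, y₀, u, w, hl, hu, hw, ha, hb⟩ := exists_of_two_le_sInf_kindSet h3
  have key : ∀ {s u z z₀}, Named op lab N u s.unpair.2 (.inl z₀) →
      IsAddr id ((openPre op lab N).comp e.unpair.1).toMarkedGraph (.inl e.unpair.1) s.unpair.1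
        (.inl u) → IsEnd K ((encodePre op lab xm b N).comp r).toMarkedGraph e.unpair.1 s z →
      codeOf op lab N (.inl z₀) = z := by
    intro s u z z₀ hu ha hz
    obtain ⟨-, -, h5, h6, -⟩ := (isEnd_encodePre_iff hv).1 hz
    have := Sum.inl_injective (ha.unique h6)
    rw [← h5, this] at hu
    exact hu.codeOf_unpair
  rcases h4 with ⟨hx, hy⟩ | ⟨hy, hx⟩
  · exact ⟨e₀, x₀, y₀, hl, he.codeOf_unpair, key hu ha hx, key hw hb hy⟩
  · exact ⟨e₀, y₀, x₀, hl.symm, he.codeOf_unpair, key hw hb hx, key hu ha hy⟩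

/-- Finitely many numbers, namely the name of the edge and the addresses and names used for its
ends, must be less than `K`. -/
theorem eventually_blowupLink (hc : OpenConnected op N) (hd : DistinctLabels lab N)
    (hr : r ∈ (openGraph op N).vertexSet) {e x y : ℕ} (hl : N.graph.IsLink e x y) :
    ∀ᶠ K in atTop, BlowupLink K ((encodePre op lab xm b N).comp r).toMarkedGraph
      (codeOf op lab N (.inr e)) (codeOf op lab N (.inl x)) (codeOf op lab N (.inl y)) := by
  obtain ⟨v, a, he⟩ := exists_named hc hd (o := .inr e) hl.edge_mem
  have hv : v ∈ reach (openGraph op N) r := hc.2 r hr v he.1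
  obtain ⟨c, hcode⟩ := exists_edgeCode hc hd he.1 hl.edge_mem
  have h2 := he.two_le_sInf_kindSet hcode
  -- The stored kind is the least one and may come from a code other than `c`; it belongs to the
  -- same edge, and the ends are read from the stored code.
  obtain ⟨e', he', x₀, y₀, u, w, hl', hu, hw, ha, hb⟩ := exists_of_two_le_sInf_kindSet h2
  cases he'.unique he
  have key : ∀ {s u z₀}, Named op lab N u s.unpair.2 (.inl z₀) →
      IsAddr id ((openPre op lab N).comp v).toMarkedGraph (.inl v) s.unpair.1 (.inl u) →
      ∀ᶠ K in atTop, IsEnd K ((encodePre op lab xm b N).comp r).toMarkedGraph v s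
        (codeOf op lab N (.inl z₀)) := by
    intro s u z₀ hu ha
    filter_upwards [eventually_gt_atTop s.unpair.1, eventually_gt_atTop s.unpair.2] with K h1 h2
    rw [isEnd_encodePre_iff hv, hu.codeOf_eq, Nat.unpair_pair]
    exact ⟨h1, h2, rfl, ha, z₀, hu⟩
  filter_upwards [key hu ha, key hw hb, eventually_gt_atTop a] with K h3 h4 h5
  rw [he.codeOf_eq, BlowupLink, Nat.unpair_pair]
  have hkind : kindAt ((encodePre op lab xm b N).comp r).toMarkedGraph (Nat.pair v a) =
      sInf (kindSet op lab N v a) := by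
    rw [kindAt, Nat.unpair_pair]; rfl
  rw [hkind]
  refine ⟨hv, h5, h2, ?_⟩
  rcases hl'.eq_and_eq_or_eq_and_eq hl with ⟨rfl, rfl⟩ | ⟨rfl, rfl⟩
  · exact Or.inl ⟨h3, h4⟩
  · exact Or.inr ⟨h3, h4⟩

end

variable [TopologicalSpace X] {op : A → Bool} {lab : A → Label} {xm : A → X} {b : X}

/-- The pieces of the blow-up of the encoded open subgraph exhaust the graph. -/
theorem tendsto_blowup_encode {N : RootedGraph A} (hc : OpenConnected op N.toMarkedGraph)
    (hd : DistinctLabels lab N.toMarkedGraph) {v a : ℕ}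
    (h : Named op lab N.toMarkedGraph v a (.inl N.root)) :
    Tendsto (fun K => ((blowupPre K ((encodePre op lab xm b N.toMarkedGraph).comp v).toMarkedGraph).comp
      (Nat.pair v a)).cls) atTop (𝓝 (N.mapMarks xm).cls) := by
  have hinj := injOn_codeOf hc hd
  have hf : InjOn (fun x => codeOf op lab N.toMarkedGraph (.inl x)) N.graph.vertexSet :=
    fun x hx y hy hxy => Sum.inl_injective (hinj hx hy hxy)
  have hg : InjOn (fun x => codeOf op lab N.toMarkedGraph (.inr x)) N.graph.edgeSet :=
    fun x hx y hy hxy => Sum.inr_injective (hinj hx hy hxy)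
  let C := ((encodePre op lab xm b N.toMarkedGraph).comp v).toMarkedGraph
  have hmark : ∀ o ∈ objs N.graph, markAt C (codeOf op lab N.toMarkedGraph o) =
      objMark xm N.toMarkedGraph o := by
    intro o ho
    obtain ⟨w, c, h'⟩ := exists_named hc hd ho
    rw [h'.codeOf_eq, markAt, Nat.unpair_pair]
    exact h'.namedMark_eq
  -- The limit is represented by the original graph carried by `codeOf` to the labels of the
  -- blow-up, so that convergence can be checked label by label.
  have hcls := image_comp_cls (N.mapMarks xm) hf hg (vm := markAt C) (em := markAt C)
    (fun x hx => hmark (.inl x) hx) fun e he => hmark (.inr e) he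
  change RootedGraph.cls (PreGraph.comp _ (codeOf op lab N.toMarkedGraph (.inl N.root))) = _ at hcls
  rw [h.codeOf_eq] at hcls
  rw [← hcls]
  refine Tendsto.comp (nhds_cls _).ge (PreGraph.tendsto_comp (fun y hy => ?_) (fun _ _ => tendsto_const_nhds)
    fun _ _ => tendsto_const_nhds)
  have hy' := reach_subset (G := ((N.mapMarks xm).image hf hg (markAt C) (markAt C)).graph)
    ⟨N.root, N.root_mem, h.codeOf_eq⟩ hy
  obtain ⟨x, hx, rfl⟩ := hy'
  -- There are finitely many edges at `x`, and each appears in the blow-up for all large `K`.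
  have hall : ∀ᶠ K in atTop, ∀ e ∈ {e | N.graph.Inc e x}, ∀ z, N.graph.IsLink e x z →
      BlowupLink K C (codeOf op lab N.toMarkedGraph (.inr e)) (codeOf op lab N.toMarkedGraph (.inl x))
        (codeOf op lab N.toMarkedGraph (.inl z)) := by
    refine (eventually_all_finite (finite_inc N.toMarkedGraph x)).2 fun e ⟨z, hz⟩ => ?_
    filter_upwards [eventually_blowupLink (xm := xm) (b := b) hc hd h.1 hz] with K hK z' hz'
    rwa [hz'.right_unique hz]
  filter_upwards [hall] with K hK e z
  constructor
  · exact isLink_of_blowupLink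
  · rintro ⟨e, x', z, hl, rfl, hxx, rfl⟩
    obtain rfl := hf hl.left_mem hx hxx
    exact hK e ⟨z, hl⟩ z hl

end

section

variable {A B X Y Z : Type}

theorem vsum_finset_sum {N : MarkedGraph A} {ι : Type*} (s : Finset ι) (h : ι → ℕ → ℝ≥0∞) :
    vsum N (fun v => ∑ i ∈ s, h i v) = ∑ i ∈ s, vsum N (h i) := by
  unfold vsum
  rw [← Summable.tsum_finsetSum fun i _ => ENNReal.summable]
  refine tsum_congr fun v => ?_
  by_cases hv : v ∈ N.graph.vertexSet <;> simp [hv]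

theorem vsum_eq_single {N : MarkedGraph A} {u : ℕ} (hu : u ∈ N.graph.vertexSet) {h : ℕ → ℝ≥0∞}
    (h0 : ∀ v, v ≠ u → h v = 0) : vsum N h = h u := by
  rw [vsum, tsum_eq_single u fun v hv => by simp [h0 v hv], indicator_of_mem hu]

/-! ### Transport of mass from the owner -/

section

variable [TopologicalSpace A] [PolishSpace A] [MeasurableSpace A] [BorelSpace A]
  [TopologicalSpace X] [PolishSpace X] [MeasurableSpace X] [BorelSpace X]
  {op : A → Bool} (hop : Continuous op) {lab : A → Label} (hlab : Continuous lab)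
  {xm : A → X} (hxm : Measurable xm) (b : X)

/-- The piece of the blow-up of the encoded cluster of `v`, rooted at the `i`-th descendant. -/
def piece (op : A → Bool) (lab : A → Label) (xm : A → X) (b : X) (K : ℕ) (N : MarkedGraph A) (v : ℕ)
    (i : Fin K) : RootedSpace X :=
  ((blowupT K).rg ((encodePre op lab xm b N).comp v) i).cls

theorem pres_blowupT_iff {K : ℕ} {N : MarkedGraph A} {v : ℕ} {i : Fin K} :
    (blowupT (X := X) K).pres ((encodePre op lab xm b N).comp v).toMarkedGraph v i ↔
      ∃ x, Named op lab N v i (.inl x) := by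
  rw [← sInf_kindSet_eq_one]
  change kindAt _ _ = 1 ↔ _
  rw [kindAt, Nat.unpair_pair]
  rfl

open scoped Classical in
/-- The mass sent by the owner. -/
def ownerMass (op : A → Bool) (lab : A → Label) (xm : A → X) (b : X) (K : ℕ)
    (g : RootedSpace X → ℝ≥0∞) (N : MarkedGraph A) (u v : ℕ) : ℝ≥0∞ :=
  ∑ i : Fin K, if Named op lab N u i (.inl v) then g (piece op lab xm b K N u i) else 0

/-- `ownerMass` as a mass transport. -/
def ownerTransport (op : A → Bool) (lab : A → Label) (xm : A → X) (b : X) (K : ℕ)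
    (g : RootedSpace X → ℝ≥0∞) : BirootedSpace A → ℝ≥0∞ :=
  Quotient.lift (fun D => ownerMass op lab xm b K g D.toMarkedGraph D.root₁ D.root₂) <| by
    intro C D h
    obtain ⟨φ, ψ, hi, hr, hs⟩ := BirootedGraph.cls_eq_iff.1 (Quotient.sound h : C.cls = D.cls)
    refine Finset.sum_congr rfl fun i _ => ?_
    have h1 := hi.named_iff (op := op) (lab := lab) (a := i) C.root₁_mem (o := .inl C.root₂)
      C.root₂_mem
    rw [Sum.map_inl, hr, hs] at h1
    by_cases h2 : Named op lab C.toMarkedGraph C.root₁ i (.inl C.root₂)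
    · rw [if_pos h2, if_pos (h1.2 h2)]
      have h3 := (hi.encodePre (op := op) (lab := lab) (xm := xm) (b := b)).comp (x := C.root₁) h2.1
      have h4 := (blowupT (X := X) K).rg_congr (RootedGraph.cls_eq_iff.2 ⟨φ, ψ, h3, rfl⟩) i
      rw [hr] at h4
      exact congrArg g (h4.2 ((pres_blowupT_iff b).2 ⟨_, h2⟩))
    · rw [if_neg h2, if_neg (h2 ∘ h1.1)]

theorem ownerTransport_bi (K : ℕ) (g : RootedSpace X → ℝ≥0∞) (N : RootedGraph A) {u v : ℕ}
    (hu : u ∈ N.graph.vertexSet) (hv : v ∈ N.graph.vertexSet) :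
    ownerTransport op lab xm b K g (N.bi u v).cls = ownerMass op lab xm b K g N.toMarkedGraph u v := by
  change ownerMass op lab xm b K g (N.bi u v).toMarkedGraph _ _ = _
  rw [RootedGraph.bi_toMarkedGraph, RootedGraph.bi_root₁ hu hv, RootedGraph.bi_root₂ hu hv]

include hop hlab hxm in
theorem measurable_ownerTransport (K : ℕ) {g : RootedSpace X → ℝ≥0∞} (hg : Measurable g) :
    Measurable (ownerTransport op lab xm b K g) := by
  classical
  refine measurable_of_comp_bicls ?_
  refine measurable_apply_countable (F := fun (D : BirootedGraph A) v =>
    ownerMass op lab xm b K g D.toMarkedGraph D.root₁ v) (fun v => ?_) BirootedGraph.measurable_root₂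
  refine measurable_apply_countable (F := fun (D : BirootedGraph A) u =>
    ownerMass op lab xm b K g D.toMarkedGraph u v) (fun u => ?_) BirootedGraph.measurable_root₁
  refine Measurable.comp (g := fun N : MarkedGraph A => ownerMass op lab xm b K g N u v) ?_
    BirootedGraph.measurable_toMarkedGraph
  refine Finset.measurable_sum _ fun i _ => Measurable.ite (measurableSet_setOfPred.2
    (measurable_named hop hlab u i (.inl v))) ?_ measurable_const
  exact hg.comp (RootedGraph.measurable_cls.comp (((blowupT (X := X) K).measurable_rg i).comp
    (measurable_encodePre_comp hop hlab hxm b u)))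

-- A name at the root designates at most one object, so each index that names a vertex contributes
-- one piece. A closed root names nothing and sends nothing.
open scoped Classical in
theorem massOut_ownerTransport (K : ℕ) (g : RootedSpace X → ℝ≥0∞) (N : RootedGraph A) :
    massOut (ownerTransport op lab xm b K g) N.cls =
      ∑ i : Fin K, if ∃ x, Named op lab N.toMarkedGraph N.root i (.inl x) then
        g (piece op lab xm b K N.toMarkedGraph N.root i) else 0 := by
  rw [massOut_cls, vsum_congr (h' := fun v => ownerMass op lab xm b K g N.toMarkedGraph N.root v)
    fun v hv => ownerTransport_bi b K g N N.root_mem hv]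
  unfold ownerMass
  rw [vsum_finset_sum]
  refine Finset.sum_congr rfl fun i _ => ?_
  by_cases h : ∃ x, Named op lab N.toMarkedGraph N.root i (.inl x)
  · obtain ⟨x, hx⟩ := id h
    rw [if_pos h, vsum_eq_single (u := x) hx.mem, if_pos hx]
    intro v hv
    exact if_neg fun h' => hv (Sum.inl_injective (h'.unique hx))
  · rw [if_neg h]
    have h' : ∀ v, ¬ Named op lab N.toMarkedGraph N.root i (.inl v) := fun v hv => h ⟨v, hv⟩
    simp [h', vsum]

/-- The root has a single owner and a single name there, so it receives just the piece rooted at its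
own representative, provided the name is less than `K`. -/
theorem massIn_ownerTransport (K : ℕ) (g : RootedSpace X → ℝ≥0∞) (N : RootedGraph A) {v a : ℕ}
    (h : Named op lab N.toMarkedGraph v a (.inl N.root)) :
    massIn (ownerTransport op lab xm b K g) N.cls =
      if h : a < K then g (piece op lab xm b K N.toMarkedGraph v ⟨a, h⟩) else 0 := by
  classical
  rw [massIn_cls, vsum_congr (h' := fun v => ownerMass op lab xm b K g N.toMarkedGraph v N.root)
    fun v hv => ownerTransport_bi b K g N hv N.root_mem,
    vsum_eq_single (h := fun v => ownerMass op lab xm b K g N.toMarkedGraph v N.root) (u := v)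
      h.1.1 fun w hw => Finset.sum_eq_zero fun i _ =>
      if_neg fun h' => hw (h'.owner_unique h)]
  unfold ownerMass
  split_ifs with haK
  · rw [Finset.sum_eq_single_of_mem (⟨a, haK⟩ : Fin K) (Finset.mem_univ _) fun i _ hi =>
      if_neg fun h' => hi (Fin.ext (h'.name_unique h)), if_pos h]
  · exact Finset.sum_eq_zero fun i _ => if_neg fun h' => haK ((Named.name_unique h' h : (i : ℕ) = a) ▸ i.2)

/-! ### The open subgraph marked by the recipes -/

include hop hlab hxm in
theorem measurable_encode_rooted : Measurable fun N : RootedGraph A =>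
    encode op lab xm b N.toMarkedGraph :=
  (measurable_encode hop hlab hxm b).comp RootedGraph.measurable_toMarkedGraph

variable [Nonempty X]

theorem equivariant_encode :
    Equivariant (detKernel (measurable_encode_rooted hop hlab hxm b)) :=
  equivariant_detKernel _ fun _ _ _ _ h => h.encode_eq

/-- The law of the graph marked by the recipes. -/
def encodeLaw (J : Measure (RootedSpace A)) : Measure (RootedSpace (A × Recipe X)) :=
  addLaw (equivariant_encode hop hlab hxm b).rootEquivariant J

/-- The unnormalized law of the open cluster marked by the recipes. -/
def encodedCluster (J : Measure (RootedSpace A)) : Measure (RootedSpace (Recipe X)) :=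
  (clusterT (op ∘ Prod.fst) (hop.comp continuous_fst) (Prod.snd : A × Recipe X → Recipe X)
    continuous_snd).tr (encodeLaw hop hlab hxm b J)

/-- The blow-up sums `g` over the vertices named by an open root, which is the mass that the root
sends. Mass transport replaces it by what the root receives from its owner, so every vertex of the
graph is counted through its owner. -/
theorem lintegral_blowup_encodedCluster (J : Measure (RootedSpace A)) (hJ : Uni J) (K : ℕ)
    {g : RootedSpace X → ℝ≥0∞} (hg : Measurable g) :
    ∫⁻ p, g p ∂(blowupT K).tr (encodedCluster hop hlab hxm b J) =
      ∫⁻ q, massIn (ownerTransport op lab xm b K g) q ∂J := by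
  classical
  rw [← hJ _ (measurable_ownerTransport hop hlab hxm b K hg), Transform.lintegral_tr _ _ hg,
    encodedCluster, Transform.lintegral_tr _ _ (Transform.measurable_push _ hg), encodeLaw]
  refine lintegral_addLaw_detKernel _ _ J (Transform.measurable_push _ (Transform.measurable_push _ hg))
    (Eventually.of_forall fun q N hN => ?_)
  rw [← hN, push_clusterT _ _ (Transform.measurable_push _ hg), massOut_ownerTransport]
  have hcomp : (openPre (op ∘ Prod.fst) Prod.snd (N.addMarks
      (encode op lab xm b N.toMarkedGraph)).toMarkedGraph).comp (N.addMarks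
      (encode op lab xm b N.toMarkedGraph)).root = (encodePre op lab xm b N.toMarkedGraph).comp N.root := rfl
  rw [hcomp, Transform.push_cls _ hg]
  by_cases hr : op (N.vmark N.root) = true
  · refine (if_pos hr).trans (Finset.sum_congr rfl fun i _ => ?_)
    have := pres_blowupT_iff (op := op) (lab := lab) (xm := xm) b (N := N.toMarkedGraph) (v := N.root) (i := i)
    exact if_congr this rfl rfl
  · refine (if_neg hr).trans (Eq.symm (Finset.sum_eq_zero fun i _ => if_neg ?_))
    rintro ⟨x, hx⟩
    exact hr hx.1.2

/-- Once `K` exceeds the name of the root, the mass received is `g` at the piece representing the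
root, and these pieces converge to the marked graph. The distance from `g` to `0` bounds them, so
dominated convergence applies. -/
theorem tendsto_lintegral_blowup {J : Measure (RootedSpace A)} [IsProbabilityMeasure J] (hJ : Uni J)
    (hc : ∀ᵐ q ∂J, ∀ N : RootedGraph A, N.cls = q → OpenConnected op N.toMarkedGraph)
    (hd : ∀ᵐ q ∂J, ∀ N : RootedGraph A, N.cls = q → DistinctLabels lab N.toMarkedGraph)
    (g : BoundedContinuousFunction (RootedSpace X) NNReal) :
    Tendsto (fun K => ∫⁻ p, (g p : ℝ≥0∞) ∂(blowupT K).tr (encodedCluster hop hlab hxm b J)) atTop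
      (𝓝 (∫⁻ p, (g p : ℝ≥0∞) ∂J.map (mapMarks xm))) := by
  have hgc : Continuous fun p => (g p : ℝ≥0∞) := ENNReal.continuous_coe.comp g.continuous
  rw [lintegral_map hgc.measurable (measurable_mapMarks hxm)]
  simp only [lintegral_blowup_encodedCluster hop hlab hxm b J hJ _ hgc.measurable]
  have hnamed : ∀ᵐ q ∂J, ∃ N : RootedGraph A, N.cls = q ∧ OpenConnected op N.toMarkedGraph ∧
      DistinctLabels lab N.toMarkedGraph ∧ ∃ v a, Named op lab N.toMarkedGraph v a (.inl N.root) := by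
    filter_upwards [hc, hd] with q hcq hdq
    obtain ⟨N, rfl⟩ := RootedGraph.exists_cls_eq q
    exact ⟨N, rfl, hcq N rfl, hdq N rfl, exists_named (hcq N rfl) (hdq N rfl) N.root_mem⟩
  refine tendsto_lintegral_of_dominated_convergence (fun _ => (nndist g 0 : ℝ≥0∞))
    (fun K => measurable_massIn (measurable_ownerTransport hop hlab hxm b K hgc.measurable))
    (fun K => ?_) (by simp) ?_
  · filter_upwards [hnamed] with q hq
    obtain ⟨N, rfl, -, -, v, a, h⟩ := hq
    rw [massIn_ownerTransport b K _ N h]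
    split_ifs
    · exact ENNReal.coe_le_coe.2 (BoundedContinuousFunction.NNReal.upper_bound g _)
    · exact zero_le
  · filter_upwards [hnamed] with q hq
    obtain ⟨N, rfl, h1, h2, v, a, h⟩ := hq
    refine ((hgc.tendsto _).comp (tendsto_blowup_encode (xm := xm) (b := b) h1 h2 h)).congr' ?_
    filter_upwards [eventually_gt_atTop a] with K hK
    rw [massIn_ownerTransport b K _ N h, dif_pos hK]
    rfl

end

end

/-! ### From the open cluster to the graph -/

section

variable {A B X Y Z : Type}

section

variable [TopologicalSpace Y] [PolishSpace Y] [MeasurableSpace Y] [BorelSpace Y]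
  [TopologicalSpace Z] [PolishSpace Z] [MeasurableSpace Z] [BorelSpace Z]

theorem Transform.tr_smul (T : Transform Y Z) (c : ℝ≥0∞) (Q : Measure (RootedSpace Y)) :
    T.tr (c • Q) = c • T.tr Q := by
  refine Measure.ext_of_lintegral _ fun φ hφ => ?_
  rw [lintegral_smul_measure, Transform.lintegral_tr _ _ hφ, Transform.lintegral_tr _ _ hφ,
    lintegral_smul_measure]

end

theorem toMeasure_normalize_eq_smul {Ω : Type*} [MeasurableSpace Ω] [Nonempty Ω] {μ : FiniteMeasure Ω}
    (h : μ ≠ 0) : (μ.normalize : Measure Ω) = ((μ : Measure Ω) univ)⁻¹ • (μ : Measure Ω) := by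
  rw [FiniteMeasure.toMeasure_normalize_eq_of_nonzero _ h]
  change ((μ.mass⁻¹ : NNReal) : ℝ≥0∞) • (μ : Measure Ω) = _
  rw [ENNReal.coe_inv (μ.mass_nonzero_iff.2 h), FiniteMeasure.ennreal_mass]

section

variable [TopologicalSpace A] [PolishSpace A] [MeasurableSpace A] [BorelSpace A]
  [TopologicalSpace X] [PolishSpace X] [MeasurableSpace X] [BorelSpace X] [Nonempty X]
  {op : A → Bool} (hop : Continuous op) {lab : A → Label} (hlab : Continuous lab)
  {xm : A → X} (hxm : Measurable xm) (b : X)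

instance (J : Measure (RootedSpace A)) [IsProbabilityMeasure J] :
    IsProbabilityMeasure (encodeLaw hop hlab hxm b J) := by
  unfold encodeLaw; infer_instance

instance (J : Measure (RootedSpace A)) [IsProbabilityMeasure J] :
    IsFiniteMeasure (encodedCluster hop hlab hxm b J) := by
  unfold encodedCluster; infer_instance

theorem uni_encodedCluster {J : Measure (RootedSpace A)} (hJ : Uni J) :
    Uni (encodedCluster hop hlab hxm b J) :=
  Transform.uni_tr _ (hJ.addLaw (equivariant_encode hop hlab hxm b))

theorem percolationLaw_encodedCluster (J : Measure (RootedSpace A)) :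
    percolationLaw (J.map (mapMarks op)) = (encodedCluster hop hlab hxm b J univ)⁻¹ •
      (encodedCluster hop hlab hxm b J).map forget := by
  have h : (encodeLaw hop hlab hxm b J).map (mapMarks (op ∘ Prod.fst)) = J.map (mapMarks op) := by
    rw [← map_mapMarks_mapMarks _ measurable_fst hop.measurable]
    exact congrArg (fun μ => μ.map (mapMarks op)) (map_fst_addLaw
      (equivariant_encode hop hlab hxm b).rootEquivariant J)
  rw [← h]
  exact percolationLaw_map (hop.comp continuous_fst) continuous_snd _

include hop hlab hxm b in
/-- A graph whose open subgraph is connected and strongly sofic is sofic with any marks. -/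
theorem sofic_of_openSubgraph {J : Measure (RootedSpace A)} [IsProbabilityMeasure J] (hJ : Uni J)
    (hc : ∀ᵐ q ∂J, ∀ N : RootedGraph A, N.cls = q → OpenConnected op N.toMarkedGraph)
    (hd : ∀ᵐ q ∂J, ∀ N : RootedGraph A, N.cls = q → DistinctLabels lab N.toMarkedGraph)
    {H : ProbabilityMeasure UnmarkedSpace}
    (hJH : percolationLaw (J.map (mapMarks op)) = (H : Measure UnmarkedSpace))
    (hH : StronglySofic H) {R : ProbabilityMeasure (RootedSpace X)}
    (hR : (R : Measure (RootedSpace X)) = J.map (mapMarks xm)) : Sofic R := by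
  have : Nonempty (RootedSpace X) := R.nonempty
  let S := encodedCluster hop hlab hxm b J
  have hS : (S univ)⁻¹ • S.map forget = (H : Measure UnmarkedSpace) :=
    (percolationLaw_encodedCluster hop hlab hxm b J).symm.trans hJH
  have hS0 : S univ ≠ 0 := by
    intro h
    have h1 := congrArg (fun μ : Measure _ => μ univ) hS
    simp [Measure.measure_univ_eq_zero.1 h] at h1
  let c := (S univ)⁻¹
  have hc0 : c ≠ 0 := ENNReal.inv_ne_zero.2 (measure_ne_top S univ)
  have hct : c ≠ ⊤ := ENNReal.inv_ne_top.2 hS0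
  let S₀ : ProbabilityMeasure (RootedSpace (Recipe X)) :=
    ⟨c • S, ⟨by rw [Measure.smul_apply, smul_eq_mul, ENNReal.inv_mul_cancel hS0 (measure_ne_top S univ)]⟩⟩
  -- The normalised encoded cluster is a marking of `H` by recipes, which form a Polish space, so
  -- strong soficity of `H` applies.
  have hS₀ : Sofic S₀ := by
    refine hH (Recipe X) S₀ ⟨fun f hf => ?_, ?_⟩
    · change ∫⁻ q, massOut f q ∂(c • S) = ∫⁻ q, massIn f q ∂(c • S)
      rw [lintegral_smul_measure, lintegral_smul_measure, uni_encodedCluster hop hlab hxm b hJ f hf]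
    · change (c • S).map forget = _
      rw [Measure.map_smul, hS]
  -- The blow-up laws need not have mass one. They converge to `R` as finite measures, hence their
  -- normalisations converge to `R` as well.
  let G : ℕ → FiniteMeasure (RootedSpace X) := fun K => ⟨(blowupT K).tr S, inferInstance⟩
  have hG : Tendsto G atTop (𝓝 R.toFiniteMeasure) := by
    rw [FiniteMeasure.tendsto_iff_forall_lintegral_tendsto]
    intro g
    have := tendsto_lintegral_blowup hop hlab hxm b hJ hc hd g
    rw [← hR] at this
    exact this
  have hR0 : R.toFiniteMeasure ≠ 0 := by
    rw [← FiniteMeasure.mass_nonzero_iff, ProbabilityMeasure.mass_toFiniteMeasure]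
    exact one_ne_zero
  have ht := FiniteMeasure.tendsto_normalize_of_tendsto hG hR0
  rw [ProbabilityMeasure.toFiniteMeasure_normalize_eq_self] at ht
  refine sofic_of_tendsto ((hG.eventually_ne hR0).mono fun K hK => ?_) ht
  refine (blowupT K).sofic_tr hS₀ ?_
  rw [toMeasure_normalize_eq_smul hK]
  change ((blowupT K).tr S univ)⁻¹ • (blowupT K).tr S =
    ((blowupT K).tr (c • S) univ)⁻¹ • (blowupT K).tr (c • S)
  -- The factor `c` cancels in the normalisation.
  rw [Transform.tr_smul, Measure.smul_apply, smul_eq_mul, smul_smul,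
    ENNReal.mul_inv (.inl hc0) (.inl hct), mul_right_comm, ENNReal.inv_mul_cancel hc0 hct, one_mul]

end

/-- Strong soficity of the open cluster of a connected percolation gives that of the graph. -/
theorem StronglySofic.of_percolation {P H : ProbabilityMeasure UnmarkedSpace}
    {Q : ProbabilityMeasure (RootedSpace Bool)} (hQ : IsConnectedPercolationOn Q P)
    (hH : percolationLaw (Q : Measure (RootedSpace Bool)) = (H : Measure UnmarkedSpace))
    (hS : StronglySofic H) : StronglySofic P := by
  intro X _ _ R hR
  let _ : MeasurableSpace X := borel X
  have : BorelSpace X := ⟨rfl⟩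
  have : Nonempty X := ProbabilityMeasure.nonempty_marks R
  obtain ⟨b⟩ := id this
  have hQU : Uni (Q : Measure (RootedSpace Bool)) := hQ.1.1
  obtain ⟨K, hKm, hK, hKR⟩ := exists_equivariant_labelled (R := (R : Measure (RootedSpace X))) hR.1
  have hK₁ := hK.comapMarks (A := Bool × Label) measurable_snd
  -- The marks of `R` are resampled on the labelled graph that carries the percolation. The kernel
  -- reads labels only, so marks and percolation are conditionally independent given the labelled
  -- graph.
  let J := addLaw hK₁.rootEquivariant (labelled (Q : Measure (RootedSpace Bool)))
  have hJU : Uni J := hQU.labelled.addLaw hK₁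
  have hJ1 : J.map (mapMarks Prod.fst) = labelled (Q : Measure (RootedSpace Bool)) :=
    map_fst_addLaw _ _
  have hop : Continuous ((Prod.fst : Bool × Label → Bool) ∘ Prod.fst (β := X)) :=
    continuous_fst.comp continuous_fst
  have hlab : Continuous ((Prod.snd : Bool × Label → Label) ∘ Prod.fst (β := X)) :=
    continuous_snd.comp continuous_fst
  have hJQ : J.map (mapMarks ((Prod.fst : Bool × Label → Bool) ∘ Prod.fst (β := X))) =
      (Q : Measure (RootedSpace Bool)) := by
    rw [← map_mapMarks_mapMarks J measurable_fst measurable_fst, hJ1]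
    exact map_fst_labelled _
  -- `Q` and `R` have the same underlying unmarked law, so their labelled graphs agree in law and
  -- `K` reproduces `R`.
  have hJR : J.map (mapMarks Prod.snd) = (R : Measure (RootedSpace X)) := by
    have h2 := map_addLaw_comapMarks hK.rootEquivariant (measurable_snd (α := Bool) (β := Label))
      (labelled (Q : Measure (RootedSpace Bool)))
    rw [map_snd_labelled, hQ.1.2, ← hR.2, ← map_snd_labelled, hKR] at h2
    have h3 := congrArg (fun μ => μ.map (mapMarks Prod.snd)) h2
    simp only [map_mapMarks_mapMarks _ (measurable_snd.prodMap measurable_id) measurable_snd,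
      map_mapMarks_mapMarks _ measurable_swap measurable_snd] at h3
    exact h3.trans (map_fst_labelled (R : Measure (RootedSpace X)))
  refine sofic_of_openSubgraph hop hlab measurable_snd b hJU
    (ae_openConnected hop (hJQ.symm ▸ hQ.2)) ?_ (hJQ.symm ▸ hH) hS hJR.symm
  have hd := ae_distinctLabels (Q : Measure (RootedSpace Bool))
  rw [← hJ1] at hd
  filter_upwards [ae_of_ae_map (measurable_mapMarks measurable_fst).aemeasurable hd] with q hq N hN
  exact hq (N.mapMarks Prod.fst) (by rw [← hN, mapMarks_cls])

/-- Strong soficity is preserved by passing to or from a connected percolation. -/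
theorem IsConnectedPercolationOn.stronglySofic_iff {P H : ProbabilityMeasure UnmarkedSpace}
    {Q : ProbabilityMeasure (RootedSpace Bool)} (hQ : IsConnectedPercolationOn Q P)
    (hH : percolationLaw (Q : Measure (RootedSpace Bool)) = (H : Measure UnmarkedSpace)) :
    StronglySofic P ↔ StronglySofic H :=
  ⟨StronglySofic.percolation hQ hH, StronglySofic.of_percolation hQ hH⟩

/-- Forgetting all marks but one percolation leaves a connected percolation on the graph that
carries the coupling. -/
theorem isConnectedPercolationOn_map {A : Type} [TopologicalSpace A] [PolishSpace A]
    [MeasurableSpace A] [BorelSpace A] {Q : ProbabilityMeasure (RootedSpace A)} (hQ : Unimodular Q)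
    {op : A → Bool} (hop : Measurable op)
    (hc : AlmostSurelyConnected ((Q : Measure (RootedSpace A)).map (mapMarks op))) :
    IsConnectedPercolationOn (Q.map (measurable_mapMarks hop).aemeasurable)
      (Q.map (measurable_mapMarks (X := A) (g := fun _ => ()) measurable_const).aemeasurable) :=
  ⟨⟨Uni.map_mapMarks hQ hop, map_forget_mapMarks _ hop⟩, hc⟩

end

end UnimodularGraph

end

theorem mainTheorem12 :
    (∀ P₁ P₂ : MeasureTheory.ProbabilityMeasure UnimodularGraph.UnmarkedSpace,
      UnimodularGraph.Unimodular P₁ → UnimodularGraph.Unimodular P₂ →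
      UnimodularGraph.CouplingEquivalent P₁ P₂ →
      (UnimodularGraph.StronglySofic P₁ ↔ UnimodularGraph.StronglySofic P₂)) ∧
    (∀ (P H : MeasureTheory.ProbabilityMeasure UnimodularGraph.UnmarkedSpace)
      (Q : MeasureTheory.ProbabilityMeasure (UnimodularGraph.RootedSpace Bool)),
      UnimodularGraph.Unimodular P →
      UnimodularGraph.IsConnectedPercolationOn Q P →
      UnimodularGraph.percolationLaw (Q : MeasureTheory.Measure _) =
        (H : MeasureTheory.Measure UnimodularGraph.UnmarkedSpace) →
      (UnimodularGraph.StronglySofic P ↔ UnimodularGraph.StronglySofic H)) := by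
  refine ⟨fun P₁ P₂ _ _ ⟨Q, hQ, hc₁, hc₂, h₁, h₂⟩ => ?_, fun P H Q _ hQ hH => hQ.stronglySofic_iff hH⟩
  -- Both equivalences pass through the same law, that of the unmarked graph carrying the coupling.
  have h₁' := (UnimodularGraph.isConnectedPercolationOn_map hQ measurable_fst hc₁).stronglySofic_iff h₁
  have h₂' := (UnimodularGraph.isConnectedPercolationOn_map hQ measurable_snd hc₂).stronglySofic_iff h₂
  exact h₁'.symm.trans h₂'
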